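/- Let $(M^{n},g)$, $n\ge 2$, be a smooth Riemannian manifold with boundary and let $f:\Sigma^{n-1}\to M$ be a smooth immersed hypersurface with boundary such that $f(\partial\Sigma)\subset\partial M$, with a smooth unit normal field $\nu$. Assume that $\Sigma$ is a free boundary minimal hypersurface, i.e. the first variation of volume vanishes along every compactly supported smooth variation of $\Sigma$ through hypersurfaces in $M$ whose boundary lies on $\partial M$ (variations $F_t$ with $t\in[0,\varepsilon)$ are used, so that interior points of $\Sigma$ lying on $\partial M$ may be moved into $M$). Let $F:(-\varepsilon,\varepsilon)\times\Sigma\to M$ be a smooth variation with $F_0=f$ and $F_t=f$ outside a compact set $K\subset\Sigma$, let $X=\partial_tF|_{t=0}$ be its variation field and $Z=\nabla_XX=\nabla_{\partial_t}\partial_tF|_{t=0}$, and write $V(t)$ for the volume of $K$ in the metric $F_t^*g$. Conventions: $X=\varphi\nu+T$ with $\varphi=\langle X,\nu\rangle$ and $T$ tangent to $\Sigma$; $\hat Z$ is the component of $Z$ tangent to $\Sigma$; $\nabla$ is the Levi-Civita connection of $M$ (on functions, $\nabla\varphi$ is the gradient on $\Sigma$); $\operatorname{div}Y=\sum_i\langle\nabla_{e_i}Y,e_i\rangle$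 for an orthonormal frame $e_i$ of $T\Sigma$; $B(Y,W)=\langle\nabla_Y\nu,W\rangle$ for $Y,W\in T\Sigma$; $\mathrm{Ric}(\nu)=\mathrm{Ric}(\nu,\nu)$; $(\varphi B_{ij}T_i)_{;j}$ is the divergence on $\Sigma$ of the tangent field $\varphi\nabla_T\nu$; $\eta$ is the outward unit normal of $\partial M$ and $A(Y,W)=\langle\nabla_Y\eta,W\rangle$ for $Y,W\in T\partial M$. (a) If $X$ is tangent to $\partial M$ along $\partial\Sigma$, then $V$ is differentiable near $0$ and twice differentiable at $0$, the function $F_X$ below is integrable, and $$\delta^2\Sigma(X):=V''(0)=\int_\Sigma F_X\,d\mathrm{vol}_\Sigma,$$ $$F_X=-\varphi^2\,\mathrm{Ric}(\nu)-\varphi^2|B|^2+|\nabla\varphi|^2+\operatorname{div}\bigl(T\operatorname{div}T-\nabla_TT\bigr)+\operatorname{div}\hat Z-2(\varphi B_{ij}T_i)_{;j}.$$ (b) If $F_t(\partial\Sigma)\subset\partial M$ for all $t$ and the variation is normal, $X=\varphi\nu$ (so $\varphi$ is smooth with compact support), then $V$ is differentiable near $0$ and twice differentiable at $0$, both integrands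 below are integrable, and $$\delta^2\Sigma(\varphi\nu)=V''(0)=\int_\Sigma\Bigl(|\nabla\varphi|^2-\bigl(\mathrm{Ric}(\nu)+|B|^2\bigr)\varphi^2\Bigr)d\mathrm{vol}_\Sigma-\int_{\partial\Sigma}\varphi^2A(\nu,\nu)\,d\mathrm{vol}_{\partial\Sigma}.$$ -/

import Mathlib

open Set Filter Topology MeasureTheory Bundle
open scoped Manifold ContDiff

noncomputable section

namespace FreeBoundary

/-- `n`-dimensional coordinate space. -/
abbrev Coord (n : ℕ) : Type := EuclideanSpace ℝ (Fin n)

/-- Smooth Riemannian metrics on an `n`-dimensional manifold with boundary. -/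
abbrev RMetric (n : ℕ) [NeZero n] (M : Type*) [TopologicalSpace M]
    [ChartedSpace (EuclideanHalfSpace n) M] [IsManifold (𝓡∂ n) ∞ M] : Type _ :=
  ContMDiffRiemannianMetric (𝓡∂ n) ∞ (Coord n) (fun x : M => TangentSpace (𝓡∂ n) x)

/-- The `i`-th standard basis vector. -/
abbrev stdVec {n : ℕ} (i : Fin n) : Coord n := EuclideanSpace.single i (1 : ℝ)

section Coordinates

variable {n : ℕ} [NeZero n] {M : Type*} [TopologicalSpace M]
  [ChartedSpace (EuclideanHalfSpace n) M] [IsManifold (𝓡∂ n) ∞ M]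

/-- The tangent vector at `q` whose components in the preferred chart at `x` are `v`
(for `q` in the domain of that chart). For `q = x` this is `v` itself, since Mathlib
identifies `T_x M` with `ℝⁿ` through the preferred chart at `x`. -/
def coordVec (x q : M) (v : Coord n) : TangentSpace (𝓡∂ n) q :=
  (trivializationAt (Coord n) (fun y : M => TangentSpace (𝓡∂ n) y) x).symm q v

/-- Partial derivative `∂_i u` of a function on the half-space (one-sided at its boundary). -/
def partialDeriv (u : Coord n → ℝ) (y : Coord n) (i : Fin n) : ℝ :=
  fderivWithin ℝ u (range (𝓡∂ n)) y (stdVec i)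

/-- The matrix `g_{ij}(y)` of the metric in the preferred chart at `x`, `y` a coordinate. -/
def metricMatrix (g : RMetric n M) (x : M) (y : Coord n) : Matrix (Fin n) (Fin n) ℝ :=
  Matrix.of fun i j =>
    g.inner ((extChartAt (𝓡∂ n) x).symm y)
      (coordVec x ((extChartAt (𝓡∂ n) x).symm y) (stdVec i))
      (coordVec x ((extChartAt (𝓡∂ n) x).symm y) (stdVec j))

/-- Christoffel symbol `Γ^k_{ij}(y)` of the Levi-Civita connection in the preferred chart
at `x`. -/
def christoffel (g : RMetric n M) (x : M) (y : Coord n) (k i j : Fin n) : ℝ :=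
  (1 / 2 : ℝ) * ∑ l, (metricMatrix g x y)⁻¹ k l *
    (partialDeriv (fun z => metricMatrix g x z j l) y i
      + partialDeriv (fun z => metricMatrix g x z i l) y j
      - partialDeriv (fun z => metricMatrix g x z i j) y l)

/-- The vector `Γ(v, w)^k = Γ^k_{ij} v^i w^j` at `x`, in the preferred chart at `x`. -/
def christoffelVec (g : RMetric n M) (x : M) (v w : Coord n) : Coord n :=
  WithLp.toLp 2 fun k =>
    ∑ i, ∑ j, christoffel g x (extChartAt (𝓡∂ n) x x) k i j * v i * w j

/-- Components of the curvature tensor, `R(∂_i, ∂_j) ∂_k = R^l_{kij} ∂_l`, where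
`R(X, Y) Z = ∇_X ∇_Y Z - ∇_Y ∇_X Z - ∇_{[X,Y]} Z`, in the preferred chart at `x`. -/
def riemann (g : RMetric n M) (x : M) (y : Coord n) (l k i j : Fin n) : ℝ :=
  partialDeriv (fun z => christoffel g x z l j k) y i
    - partialDeriv (fun z => christoffel g x z l i k) y j
    + ∑ p, (christoffel g x y l i p * christoffel g x y p j k
      - christoffel g x y l j p * christoffel g x y p i k)

/-- The Ricci form `Ric(v, w) = tr (u ↦ R(u, v) w)` at `x`. -/
def ricci (g : RMetric n M) (x : M) (v w : TangentSpace (𝓡∂ n) x) : ℝ :=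
  let v' : Coord n := v
  let w' : Coord n := w
  ∑ j, ∑ k, (∑ l, riemann g x (extChartAt (𝓡∂ n) x x) l k l j) * v' j * w' k

/-- The Levi-Civita covariant derivative `∇_w V` of a vector field `V` along a map `c : N → M`
in the direction `w ∈ T_p N`. In coordinates it is `dV(w) + Γ(dc(w), V)`. -/
def covDerivAlong (g : RMetric n M)
    {EN : Type*} [NormedAddCommGroup EN] [NormedSpace ℝ EN] {HN : Type*} [TopologicalSpace HN]
    (J : ModelWithCorners ℝ EN HN) {N : Type*} [TopologicalSpace N] [ChartedSpace HN N]
    (c : N → M) (V : ∀ p, TangentSpace (𝓡∂ n) (c p)) (p : N) (w : TangentSpace J p) :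
    TangentSpace (𝓡∂ n) (c p) :=
  let dV : Coord n := mfderiv J 𝓘(ℝ, Coord n)
    (fun q => (trivializationAt (Coord n) (fun y : M => TangentSpace (𝓡∂ n) y) (c p)
      (TotalSpace.mk' (Coord n) (c q) (V q))).2) p w
  let dc : Coord n := mfderiv J (𝓡∂ n) c p w
  dV + christoffelVec g (c p) dc (V p)

/-- A tangent vector at a boundary point is tangent to the boundary: its component along the
boundary defining coordinate `x_0` of the preferred chart vanishes. -/
def IsTangentToBoundary {x : M} (v : TangentSpace (𝓡∂ n) x) : Prop :=
  let v' : Coord n := v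
  v' 0 = 0

/-- The vector field `-grad x_0 / |grad x_0|`, in components of the preferred chart at `x`. Along
`{x_0 = 0}` it is the outward unit normal `η` of the boundary. -/
def outwardNormal (g : RMetric n M) (x : M) (y : Coord n) : Coord n :=
  WithLp.toLp 2 fun a =>
    -((metricMatrix g x y)⁻¹ a 0) / Real.sqrt ((metricMatrix g x y)⁻¹ 0 0)

/-- The second fundamental form `A(v, w) = ⟨∇_v η, w⟩` of the boundary at a boundary point `x`,
with respect to the outward unit normal `η`; `v` and `w` tangent to the boundary. -/
def boundaryForm (g : RMetric n M) (x : M) (v w : TangentSpace (𝓡∂ n) x) : ℝ :=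
  let v' : Coord n := v
  let y := extChartAt (𝓡∂ n) x x
  let dη : Coord n := fderivWithin ℝ (outwardNormal g x) (range (𝓡∂ n)) y v'
  let u : Coord n := dη + christoffelVec g x v' (outwardNormal g x y)
  g.inner x u w

end Coordinates

section Hypersurface

variable {n : ℕ} (m : ℕ) [NeZero n] [NeZero m] {M : Type*} [TopologicalSpace M]
  [ChartedSpace (EuclideanHalfSpace n) M] [IsManifold (𝓡∂ n) ∞ M]
  {S : Type*} [TopologicalSpace S] [ChartedSpace (EuclideanHalfSpace m) S]
  [IsManifold (𝓡∂ m) ∞ S]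

/-- `df(∂_i)` at `p`, where `∂_i` is the coordinate field of the preferred chart at `x`. -/
def frameVec (f : S → M) (x p : S) (i : Fin m) : TangentSpace (𝓡∂ n) (f p) :=
  mfderiv (𝓡∂ m) (𝓡∂ n) f p (coordVec x p (stdVec i))

/-- The matrix `h_{ij} = ⟨df(∂_i), df(∂_j)⟩` of the induced metric `f^* g` at `p`, in the preferred
chart at `x`. -/
def inducedMatrix (g : RMetric n M) (f : S → M) (x p : S) : Matrix (Fin m) (Fin m) ℝ :=
  Matrix.of fun i j => g.inner (f p) (frameVec m f x p i) (frameVec m f x p j)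

/-- The vector `u ∈ T_p S` such that `df(u)` is the orthogonal projection of `V` to `df(T_p S)`. -/
def tangentPart (g : RMetric n M) (f : S → M) (p : S) (V : TangentSpace (𝓡∂ n) (f p)) :
    TangentSpace (𝓡∂ m) p :=
  ∑ i, (∑ j, (inducedMatrix m g f p p)⁻¹ i j * g.inner (f p) V (frameVec m f p p j)) •
    coordVec p p (stdVec i)

/-- The divergence along `S` of a vector field `Y` along `f`,
`div Y = ∑_i ⟨∇_{e_i} Y, e_i⟩ = h^{ij} ⟨∇_{∂_i} Y, ∂_j⟩`. -/
def divAlong (g : RMetric n M) (f : S → M) (Y : ∀ p, TangentSpace (𝓡∂ n) (f p)) (p : S) : ℝ :=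
  ∑ i, ∑ j, (inducedMatrix m g f p p)⁻¹ i j *
    g.inner (f p) (covDerivAlong g (𝓡∂ m) f Y p (coordVec p p (stdVec i))) (frameVec m f p p j)

/-- `|∇φ|²`, the squared length of the gradient of `φ` in the induced metric. -/
def gradNormSq (g : RMetric n M) (f : S → M) (φ : S → ℝ) (p : S) : ℝ :=
  let dφ : Fin m → ℝ := fun i => mfderiv (𝓡∂ m) 𝓘(ℝ, ℝ) φ p (coordVec p p (stdVec i))
  ∑ i, ∑ j, (inducedMatrix m g f p p)⁻¹ i j * dφ i * dφ j

/-- The second fundamental form in coordinates, `B_{ij} = ⟨∇_{∂_i} ν, ∂_j⟩`. -/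
def secondForm (g : RMetric n M) (f : S → M) (ν : ∀ p, TangentSpace (𝓡∂ n) (f p)) (p : S) :
    Matrix (Fin m) (Fin m) ℝ :=
  Matrix.of fun i j =>
    g.inner (f p) (covDerivAlong g (𝓡∂ m) f ν p (coordVec p p (stdVec i))) (frameVec m f p p j)

/-- `|B|² = h^{ik} h^{jl} B_{ij} B_{kl}`. -/
def secondFormNormSq (g : RMetric n M) (f : S → M) (ν : ∀ p, TangentSpace (𝓡∂ n) (f p))
    (p : S) : ℝ :=
  ∑ i, ∑ j, ∑ k, ∑ l, (inducedMatrix m g f p p)⁻¹ i k * (inducedMatrix m g f p p)⁻¹ j l *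
    secondForm m g f ν p i j * secondForm m g f ν p k l

/-- The density `F_X` of the second variation, for the variation field `X` and the acceleration
`Z = ∇_X X` along `f`, and the unit normal `ν`. Here `φ = ⟨X, ν⟩`, `T` is the tangential part of
`X`, `Zhat` the tangential part of `Z`, and the vector field `φ B_{ij} T_i` is `φ ∇_T ν`. -/
def secondVariationDensity (g : RMetric n M) (f : S → M)
    (ν X Z : ∀ p, TangentSpace (𝓡∂ n) (f p)) (p : S) : ℝ :=
  let φ : S → ℝ := fun q => g.inner (f q) (X q) (ν q)
  let τ : ∀ q, TangentSpace (𝓡∂ m) q := fun q => tangentPart m g f q (X q)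
  let T : ∀ q, TangentSpace (𝓡∂ n) (f q) := fun q => mfderiv (𝓡∂ m) (𝓡∂ n) f q (τ q)
  let Zhat : ∀ q, TangentSpace (𝓡∂ n) (f q) :=
    fun q => mfderiv (𝓡∂ m) (𝓡∂ n) f q (tangentPart m g f q (Z q))
  gradNormSq m g f φ p
    - (φ p) ^ 2 * ricci g (f p) (ν p) (ν p) - (φ p) ^ 2 * secondFormNormSq m g f ν p
    + divAlong m g f (fun q => divAlong m g f T q • T q - covDerivAlong g (𝓡∂ m) f T q (τ q)) p
    + divAlong m g f Zhat p
    - 2 * divAlong m g f (fun q => φ q • covDerivAlong g (𝓡∂ m) f ν q (τ q)) p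

end Hypersurface

section Volume

variable {n : ℕ} (k : ℕ) [NeZero n] {M : Type*} [TopologicalSpace M]
  [ChartedSpace (EuclideanHalfSpace n) M] [IsManifold (𝓡∂ n) ∞ M]
  {S : Type*} [TopologicalSpace S] [T2Space S] [SigmaCompactSpace S]
  [ChartedSpace (EuclideanHalfSpace (k + 1)) S] [IsManifold (𝓡∂ (k + 1)) ∞ S]
  [MeasurableSpace S] [BorelSpace S]

variable (S) in
/-- A smooth partition of unity subordinate to the preferred charts of `S`. -/
def chartPartition : SmoothPartitionOfUnity S (𝓡∂ (k + 1)) S univ :=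
  (SmoothPartitionOfUnity.exists_isSubordinate_chartAt_source (𝓡∂ (k + 1)) S).choose

/-- The measure `√(det h) dy` in the preferred chart at `x`, transported to `S`, where `h` is the
metric induced by `f`. -/
def chartVolume (g : RMetric n M) (f : S → M) (x : S) : Measure S :=
  ((volume.restrict (extChartAt (𝓡∂ (k + 1)) x).target).withDensity fun y : Coord (k + 1) =>
    ENNReal.ofReal (Real.sqrt
      (inducedMatrix (k + 1) g f x ((extChartAt (𝓡∂ (k + 1)) x).symm y)).det)).map
    (extChartAt (𝓡∂ (k + 1)) x).symm

/-- The volume measure of the induced metric `f^* g` on `S`, glued from the charts. -/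
def inducedVolume (g : RMetric n M) (f : S → M) : Measure S :=
  Measure.sum fun x : S =>
    (chartVolume k g f x).withDensity fun p => ENNReal.ofReal (chartPartition k S x p)

/-- The inclusion `z ↦ (0, z)` of the boundary of the half-space. -/
def boundaryIncl (z : Coord k) : Coord (k + 1) :=
  WithLp.toLp 2 (Fin.cons (0 : ℝ) fun i => z i)

/-- The measure on the boundary of `S` in the preferred chart at `x`: `√(det h') dz`, where `h'` is
the metric induced on the boundary `{y_0 = 0}`. -/
def chartBoundaryVolume (g : RMetric n M) (f : S → M) (x : S) : Measure S :=
  ((volume.restrict (boundaryIncl k ⁻¹' (extChartAt (𝓡∂ (k + 1)) x).target)).withDensity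
    fun z : Coord k => ENNReal.ofReal (Real.sqrt
      ((inducedMatrix (k + 1) g f x ((extChartAt (𝓡∂ (k + 1)) x).symm (boundaryIncl k z))).submatrix
        Fin.succ Fin.succ).det)).map
    (fun z => (extChartAt (𝓡∂ (k + 1)) x).symm (boundaryIncl k z))

/-- The `k`-dimensional volume measure of `∂S` for the induced metric, as a measure on `S`
concentrated on `∂S`. -/
def boundaryVolume (g : RMetric n M) (f : S → M) : Measure S :=
  Measure.sum fun x : S =>
    (chartBoundaryVolume k g f x).withDensity fun p => ENNReal.ofReal (chartPartition k S x p)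

variable (n) in
/-- `F` is a smooth variation of `f`, with times in the interval `J`, supported in the compact
set `K`. -/
structure IsVariation (f : S → M) (F : ℝ → S → M) (J : Set ℝ) (K : Set S) : Prop where
  zero : ∀ p, F 0 p = f p
  smooth : ContMDiffOn (𝓘(ℝ, ℝ).prod (𝓡∂ (k + 1))) (𝓡∂ n) ∞ (fun q : ℝ × S => F q.1 q.2)
    (J ×ˢ univ)
  isCompact : IsCompact K
  eq_off : ∀ t ∈ J, ∀ p, p ∉ K → F t p = f p

variable (n) in
/-- The surfaces `F t`, `t ∈ J`, have their boundary on `∂M`. -/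
def KeepsBoundary (F : ℝ → S → M) (J : Set ℝ) : Prop :=
  ∀ t ∈ J, ∀ p ∈ (𝓡∂ (k + 1)).boundary S, F t p ∈ (𝓡∂ n).boundary M

/-- The volume of (the part over `K` of) the surfaces `F t`. -/
def volumeFunction (g : RMetric n M) (F : ℝ → S → M) (K : Set S) (t : ℝ) : ℝ :=
  (inducedVolume k g (F t)).real K

/-- `f` is a critical point of the volume among all surfaces whose boundary lies on `∂M`: the first
variation of volume vanishes along every compactly supported variation through such surfaces.
The variations are only required for times `t ≥ 0` (every variation with two-sided times restricts
to such a one), so that a point of the interior of `S` lying on `∂M` can be moved into `M`. -/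
def IsFreeBoundaryMinimal (g : RMetric n M) (f : S → M) : Prop :=
  ∀ (ε : ℝ) (F : ℝ → S → M) (K : Set S), 0 < ε → IsVariation n k f F (Ico 0 ε) K →
    KeepsBoundary n k F (Ico 0 ε) → HasDerivWithinAt (volumeFunction k g F K) 0 (Ici 0) 0

variable (n) in
/-- The variation field `X = ∂F/∂t` at `t = 0`. -/
def variationField (f : S → M) (F : ℝ → S → M) (p : S) : TangentSpace (𝓡∂ n) (f p) :=
  let X : Coord n := mfderiv 𝓘(ℝ, ℝ) (𝓡∂ n) (fun t : ℝ => F t p) 0 (1 : ℝ)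
  X

/-- The acceleration `∇_X X = ∇_{∂/∂t} (∂F/∂t)` at `t = 0`. If `F` moves points along the
integral curves of a vector field `X` on `M`, this is the covariant derivative of `X` along `X`. -/
def variationAcceleration (g : RMetric n M) (f : S → M) (F : ℝ → S → M) (p : S) :
    TangentSpace (𝓡∂ n) (f p) :=
  let Z : Coord n := covDerivAlong g 𝓘(ℝ, ℝ) (fun t : ℝ => F t p)
    (fun s => mfderiv 𝓘(ℝ, ℝ) (𝓡∂ n) (fun t : ℝ => F t p) s (1 : ℝ)) 0 (1 : ℝ)
  Z

end Volume

/-- `V` is differentiable near `0` and `V''(0) = a`. -/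
def HasSecondDerivAtZero (V : ℝ → ℝ) (a : ℝ) : Prop :=
  (∀ᶠ t in 𝓝 (0 : ℝ), DifferentiableAt ℝ V t) ∧ HasDerivAt (deriv V) a 0

end FreeBoundary

end

open Set Filter Topology MeasureTheory Bundle
open scoped Manifold ContDiff

set_option linter.unusedSectionVars false

/-! The volume of `F t` over `K` is the integral, against the fixed measure of `f`, of the square
root of the ratio of the Gram determinants of `F t` and `f`. This ratio (`relDet`) does not depend
on the chart, is smooth up to the boundary and equals one off `K`. Hence `V` may be differentiated
twice under the integral sign, and everything reduces to the second time derivative of the volume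
element at a point.

The boundary of `S` is a null set, so interior points suffice. There one works in a chart, with a
frame that is orthonormal at the point. Jacobi's formula and the commutation of covariant
derivatives along `F` give that second derivative as `(tr P)² - tr P² + Σ ⟨∇_i X, ν⟩² + Σ ⟨R(X, e_i)
X, e_i⟩ + div Z` with `P_ij = ⟨∇_i X, e_j⟩` (`LocalHypersurface.secondDeriv_volumeElement`). Now
insert `X = φν + T`. The terms quadratic in `T` form a divergence by the Ricci identity
(`sdiv_tangential`), the mixed terms form a divergence by the contracted Codazzi equation
(`sdiv_normal_tangential`), and those quadratic in `φ` are `|∇φ|² - φ²(Ric(ν) + |B|²)`. Since the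
mean curvature vanishes, `div Z = div Ẑ`. The sum is the density `F_X` (`localDensity_eq`), and (a)
follows with no integration by parts.

That the mean curvature vanishes comes from criticality. Pushing `f` along a field `ξ` in a chart
changes the volume at the rate `∫ div ξ`; a cut-off multiple of `ν` is then a test field. Where an
interior point of `S` lies on `∂M`, the surface is tangent to `∂M` and can be pushed to one side
only, which is enough because one-sided derivatives vanish too (`divAlong_normal_eq_zero`). Cut-off
constant fields tangent to `∂M`, together with the divergence theorem, show that the conormal of
`∂Σ` is orthogonal to `∂M` (`conormal_orthogonal`).

In (b) `T = 0`, and only `∫ div Ẑ = ∫_{∂Σ} ⟨Z, η⟩` remains to be computed, the conormal being `η`.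
Points of `∂Σ` move within `∂M`, so the zeroth coordinate of their position has no second derivative
and the zeroth component of `Z` is that of `Γ(X, X)`; this means `⟨Z, η⟩ = -φ² A(ν, ν)`
(`variationAcceleration_boundary`, `boundaryForm_eq`). -/

namespace FreeBoundary

/-! ### Bounded bilinear maps and their product rule. -/

section Bilinear

/-- Bounded bilinear maps, as a normed space of its own. -/
def Bil (E F : Type*) [NormedAddCommGroup E] [NormedSpace ℝ E] [NormedAddCommGroup F]
    [NormedSpace ℝ F] : Type _ := E →L[ℝ] E →L[ℝ] F

variable {E F : Type*} [NormedAddCommGroup E] [NormedSpace ℝ E] [NormedAddCommGroup F]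
  [NormedSpace ℝ F]

noncomputable instance : NormedAddCommGroup (Bil E F) :=
  inferInstanceAs (NormedAddCommGroup (E →L[ℝ] E →L[ℝ] F))

noncomputable instance : NormedSpace ℝ (Bil E F) :=
  inferInstanceAs (NormedSpace ℝ (E →L[ℝ] E →L[ℝ] F))

namespace Bil

/-- The bounded bilinear map given by a curried continuous linear map. -/
noncomputable def mk (B : E →L[ℝ] E →L[ℝ] F) : Bil E F := B

/-- The curried continuous linear map of a bounded bilinear map. -/
noncomputable def curry : Bil E F →L[ℝ] E →L[ℝ] E →L[ℝ] F :=
  ContinuousLinearMap.id ℝ (E →L[ℝ] E →L[ℝ] F)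

/-- Evaluation of a bilinear map. -/
noncomputable def app (B : Bil E F) (v w : E) : F := curry B v w

noncomputable instance : CoeFun (Bil E F) fun _ => E → E → F := ⟨app⟩

variable (B B' : Bil E F) (u v w : E) (r : ℝ)

@[simp] theorem mk_apply (b : E →L[ℝ] E →L[ℝ] F) : mk b v w = b v w := rfl
@[simp] theorem zero_apply : (0 : Bil E F) v w = 0 := rfl
@[simp] theorem add_apply : (B + B') v w = B v w + B' v w := rfl
@[simp] theorem smul_apply : (r • B) v w = r • B v w := rfl
@[simp] theorem add_left : B (u + v) w = B u w + B v w := by simp [app]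
@[simp] theorem add_right : B u (v + w) = B u v + B u w := by simp [app]
@[simp] theorem sub_left : B (u - v) w = B u w - B v w := by simp [app]
@[simp] theorem sub_right : B u (v - w) = B u v - B u w := by simp [app]
@[simp] theorem neg_left : B (-v) w = - B v w := by simp [app]
@[simp] theorem smul_left : B (r • v) w = r • B v w := by simp [app]
@[simp] theorem smul_right : B v (r • w) = r • B v w := by simp [app]
@[simp] theorem zero_left : B 0 w = 0 := by simp [app]
@[simp] theorem zero_right : B v 0 = 0 := by simp [app]

theorem sum_left {ι : Type*} (s : Finset ι) (v : ι → E) : B (∑ i ∈ s, v i) w = ∑ i ∈ s, B (v i) w := by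
  simp [app]

theorem sum_right {ι : Type*} (s : Finset ι) (w : ι → E) : B v (∑ i ∈ s, w i) = ∑ i ∈ s, B v (w i) := by
  simp [app]

theorem sum_apply {ι : Type*} (s : Finset ι) (B : ι → Bil E F) :
    (∑ i ∈ s, B i) v w = ∑ i ∈ s, B i v w := by
  classical
  induction s using Finset.induction_on with
  | empty => simp
  | insert a s ha ih => rw [Finset.sum_insert ha, Finset.sum_insert ha, add_apply, ih]

variable {D : Type*} [NormedAddCommGroup D] [NormedSpace ℝ D]

set_option synthInstance.maxHeartbeats 400000 in
/-- The derivative of `q ↦ B q (v q) (w q)`. -/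
noncomputable def derivApply (B : Bil E F) (v w : E) (B' : D →L[ℝ] Bil E F) (v' w' : D →L[ℝ] E) : D →L[ℝ] F :=
  ((curry.comp B').flip v).flip w + (((curry B).flip w).comp v' + (curry B v).comp w')

set_option synthInstance.maxHeartbeats 400000 in
@[simp] theorem derivApply_apply (B : Bil E F) (v w : E) (B' : D →L[ℝ] Bil E F) (v' w' : D →L[ℝ] E)
    (u : D) : derivApply B v w B' v' w' u = B' u v w + B (v' u) w + B v (w' u) := by
  simp [derivApply, add_assoc, app]

end Bil

variable {D : Type*} [NormedAddCommGroup D] [NormedSpace ℝ D] {B : D → Bil E F} {v w : D → E}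
  {B' : D →L[ℝ] Bil E F} {v' w' : D →L[ℝ] E} {s : Set D} {p : D} {n : WithTop ℕ∞}

-- The product rule for the evaluation of a linear map, used once for each argument.
set_option synthInstance.maxHeartbeats 400000 in
set_option maxHeartbeats 1000000 in
theorem _root_.HasFDerivWithinAt.bil_apply (hB : HasFDerivWithinAt B B' s p)
    (hv : HasFDerivWithinAt v v' s p) (hw : HasFDerivWithinAt w w' s p) :
    HasFDerivWithinAt (fun q => B q (v q) (w q)) (Bil.derivApply (B p) (v p) (w p) B' v' w') s p := by
  have hc : HasFDerivWithinAt (F := E →L[ℝ] E →L[ℝ] F) (fun q => B q) (Bil.curry.comp B') s p := hB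
  have hc2 := hc.clm_apply hv
  have hc3 := hc2.clm_apply hw
  refine HasFDerivWithinAt.congr_fderiv hc3 ?_
  ext u
  rw [Bil.derivApply_apply]
  change (B p) (v p) (w' u) + ((B p) (v' u) (w p) + (B' u) (v p) (w p)) = _
  abel

theorem _root_.HasFDerivAt.bil_apply (hB : HasFDerivAt B B' p)
    (hv : HasFDerivAt v v' p) (hw : HasFDerivAt w w' p) :
    HasFDerivAt (fun q => B q (v q) (w q)) (Bil.derivApply (B p) (v p) (w p) B' v' w') p := by
  rw [← hasFDerivWithinAt_univ] at *
  exact HasFDerivWithinAt.bil_apply hB hv hw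

set_option synthInstance.maxHeartbeats 400000 in
set_option maxHeartbeats 1000000 in
theorem _root_.ContDiffOn.bil_apply (hB : ContDiffOn ℝ n B s) (hv : ContDiffOn ℝ n v s)
    (hw : ContDiffOn ℝ n w s) : ContDiffOn ℝ n (fun q => B q (v q) (w q)) s := by
  have hc : ContDiffOn (F := E →L[ℝ] E →L[ℝ] F) ℝ n (fun q => B q) s := hB
  exact (hc.clm_apply hv).clm_apply hw

end Bilinear

/-! ### Riemannian geometry in one chart: curvature and covariant derivatives along maps. -/

section LocalMetric

variable {E : Type*} [NormedAddCommGroup E] [NormedSpace ℝ E]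

/-- A smooth Riemannian metric `G` on a (relatively open) subset `Ω` of a half-space, together with
its Levi-Civita connection `Γ`, a smooth family of symmetric bilinear maps. -/
structure LocalMetric (Ω : Set E) (G : E → Bil E ℝ) (Γ : E → Bil E E) :
    Prop where
  uniq : UniqueDiffOn ℝ Ω
  -- Second derivatives within `Ω` are symmetric at limits of interior points; this is what makes
  -- boundary points of the half-space harmless.
  accum : Ω ⊆ closure (interior Ω)
  smoothG : ContDiffOn ℝ ∞ G Ω
  smoothΓ : ContDiffOn ℝ ∞ Γ Ω
  symm : ∀ z ∈ Ω, ∀ v w, G z v w = G z w v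
  pos : ∀ z ∈ Ω, ∀ v, v ≠ 0 → 0 < G z v v
  torsion : ∀ z ∈ Ω, ∀ v w, Γ z v w = Γ z w v
  compat : ∀ z ∈ Ω, ∀ u v w,
    fderivWithin ℝ G Ω z u v w = G z (Γ z u v) w + G z v (Γ z u w)

/-- The curvature tensor of the connection `Γ`. -/
noncomputable def curv (Ω : Set E) (Γ : E → Bil E E) (z a b c : E) : E :=
  fderivWithin ℝ Γ Ω z a b c - fderivWithin ℝ Γ Ω z b a c + (Γ z a (Γ z b c) - Γ z b (Γ z a c))

variable {Ω : Set E} {G : E → Bil E ℝ} {Γ : E → Bil E E}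

theorem curv_antisymm (z a b c : E) : curv Ω Γ z a b c = - curv Ω Γ z b a c := by
  simp only [curv]; abel

theorem curv_self (z a c : E) : curv Ω Γ z a a c = 0 := by
  simp [curv]

theorem curv_add_left (z a a' b c : E) :
    curv Ω Γ z (a + a') b c = curv Ω Γ z a b c + curv Ω Γ z a' b c := by
  simp only [curv, map_add, Bil.add_apply, Bil.add_left, Bil.add_right]; abel

theorem curv_smul_left (r : ℝ) (z a b c : E) :
    curv Ω Γ z (r • a) b c = r • curv Ω Γ z a b c := by
  simp only [curv, map_smul, Bil.smul_apply, Bil.smul_left, Bil.smul_right, smul_sub, smul_add]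

theorem curv_add_right (z a b c c' : E) :
    curv Ω Γ z a b (c + c') = curv Ω Γ z a b c + curv Ω Γ z a b c' := by
  simp only [curv, Bil.add_right]; abel

theorem curv_smul_right (r : ℝ) (z a b c : E) :
    curv Ω Γ z a b (r • c) = r • curv Ω Γ z a b c := by
  simp only [curv, Bil.smul_right, smul_sub, smul_add]

namespace LocalMetric

variable (h : LocalMetric Ω G Γ)
include h

theorem differentiableΓ {z : E} (hz : z ∈ Ω) : DifferentiableWithinAt ℝ Γ Ω z :=
  (h.smoothΓ z hz).differentiableWithinAt (by simp)

theorem differentiableG {z : E} (hz : z ∈ Ω) : DifferentiableWithinAt ℝ G Ω z :=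
  (h.smoothG z hz).differentiableWithinAt (by simp)

/-- Differentiate `torsion`; derivatives within `Ω` are unique. -/
theorem fderivΓ_symm {z : E} (hz : z ∈ Ω) (a b c : E) :
    fderivWithin ℝ Γ Ω z a b c = fderivWithin ℝ Γ Ω z a c b := by
  have h1 := (h.differentiableΓ hz).hasFDerivWithinAt.bil_apply
    (hasFDerivWithinAt_const b z Ω) (hasFDerivWithinAt_const c z Ω)
  have h2 := (h.differentiableΓ hz).hasFDerivWithinAt.bil_apply
    (hasFDerivWithinAt_const c z Ω) (hasFDerivWithinAt_const b z Ω)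
  have h3 := h2.congr (f₁ := fun y => Γ y b c) (fun y hy => h.torsion y hy b c)
    (h.torsion z hz b c)
  have := UniqueDiffWithinAt.eq (h.uniq z hz) h1 h3
  simpa using congrArg (fun L : E →L[ℝ] E => (L a : E)) this

/-- For a symmetric `Γ` the derivative terms and the quadratic terms of the cyclic sum cancel in
pairs. -/
theorem bianchi {z : E} (hz : z ∈ Ω) (a b c : E) :
    curv Ω Γ z a b c + curv Ω Γ z b c a + curv Ω Γ z c a b = 0 := by
  simp only [curv]
  rw [h.fderivΓ_symm hz a b c, h.fderivΓ_symm hz b a c, h.fderivΓ_symm hz c a b,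
    h.torsion z hz b c, h.torsion z hz a c, h.torsion z hz b a]
  abel

/-- The second derivative of `G` is symmetric in its two directions. Expressing it by applying
`compat` twice and exchanging the directions leaves exactly the curvature terms: the terms in which
each slot carries one `Γ` are symmetric and drop out. -/
theorem curv_skew {z : E} (hz : z ∈ Ω) (a b c d : E) :
    G z (curv Ω Γ z a b c) d + G z c (curv Ω Γ z a b d) = 0 := by
  have key : ∀ u v w : E, HasFDerivWithinAt (fun y => fderivWithin ℝ G Ω y u v w)
      (fderivWithin ℝ (fun y => fderivWithin ℝ G Ω y u v w) Ω z) Ω z ∧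
      ∀ s, fderivWithin ℝ (fun y => fderivWithin ℝ G Ω y u v w) Ω z s =
        fderivWithin ℝ (fderivWithin ℝ G Ω) Ω z s u v w := by
    intro u v w
    have hd : DifferentiableWithinAt ℝ (fderivWithin ℝ G Ω) Ω z :=
      ((h.smoothG.fderivWithin h.uniq (m := 1) (by norm_cast)) z hz).differentiableWithinAt
        (by simp)
    have h1 := (hd.hasFDerivWithinAt.clm_apply (hasFDerivWithinAt_const u z Ω)).bil_apply
      (hasFDerivWithinAt_const v z Ω) (hasFDerivWithinAt_const w z Ω)
    refine ⟨h1.differentiableWithinAt.hasFDerivWithinAt, fun s => ?_⟩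
    rw [h1.fderivWithin (h.uniq z hz)]
    simp
  have key2 : ∀ u v w s : E, fderivWithin ℝ (fderivWithin ℝ G Ω) Ω z s u v w =
      G z (Γ z s (Γ z u v)) w + G z (Γ z u v) (Γ z s w) + G z (fderivWithin ℝ Γ Ω z s u v) w
      + (G z (Γ z s v) (Γ z u w) + G z v (Γ z s (Γ z u w)) + G z v (fderivWithin ℝ Γ Ω z s u w)) := by
    intro u v w s
    rw [← (key u v w).2 s]
    have hG := (h.differentiableG hz).hasFDerivWithinAt
    have hΓ := (h.differentiableΓ hz).hasFDerivWithinAt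
    have hu := hasFDerivWithinAt_const (𝕜 := ℝ) u z Ω
    have hv := hΓ.bil_apply hu (hasFDerivWithinAt_const v z Ω)
    have hw := hΓ.bil_apply hu (hasFDerivWithinAt_const w z Ω)
    have h1 := hG.bil_apply hv (hasFDerivWithinAt_const w z Ω)
    have h2 := hG.bil_apply (hasFDerivWithinAt_const v z Ω) hw
    have h3 := (h1.add h2).congr (f₁ := fun y => fderivWithin ℝ G Ω y u v w)
      (fun y hy => h.compat y hy u v w) (h.compat z hz u v w)
    rw [h3.fderivWithin (h.uniq z hz)]
    simp
    try rw [h.compat z hz]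
    try rw [h.compat z hz]
  have hs : fderivWithin ℝ (fderivWithin ℝ G Ω) Ω z a b = fderivWithin ℝ (fderivWithin ℝ G Ω) Ω z b a :=
    (h.smoothG z hz).isSymmSndFDerivWithinAt (by simp; norm_cast)
      h.uniq (h.accum hz) hz a b
  have e1 := key2 b c d a
  have e2 := key2 a c d b
  rw [hs] at e1
  simp only [curv, Bil.add_left, Bil.add_right, Bil.sub_left, Bil.sub_right]
  linarith

/-- The octahedron argument: four cyclic identities are combined by means of the two
skew-symmetries. -/
theorem curv_pair {z : E} (hz : z ∈ Ω) (a b c d : E) :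
    G z (curv Ω Γ z a b c) d = G z (curv Ω Γ z c d a) b := by
  have B : ∀ a b c d, G z (curv Ω Γ z a b c) d + G z (curv Ω Γ z b c a) d
      + G z (curv Ω Γ z c a b) d = 0 := by
    intro a b c d
    have := congrArg (fun x => G z x d) (h.bianchi hz a b c)
    simpa using this
  have S : ∀ a b c d, G z (curv Ω Γ z a b c) d = - G z (curv Ω Γ z a b d) c := by
    intro a b c d
    have := h.curv_skew hz a b c d
    rw [h.symm z hz c] at this
    linarith
  have A : ∀ a b c d, G z (curv Ω Γ z a b c) d = - G z (curv Ω Γ z b a c) d := by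
    intro a b c d
    rw [curv_antisymm]; simp
  have b1 := B a b c d
  have b2 := B b c d a
  have b3 := B c d a b
  have b4 := B d a b c
  linarith [S a b c d, S b c a d, S c a b d, S b c d a, S c d b a, S d b c a, S c d a b, S d a c b,
    S a c d b, S d a b c, S a b d c, S b d a c, A a b c d, A b c a d, A c a b d, A c d a b,
    A d a c b, A b d a c, A a c d b, A d b c a]

end LocalMetric

variable {D : Type*} [NormedAddCommGroup D] [NormedSpace ℝ D]

/-- The covariant derivative along `F` of the vector field `V` along `F` in the direction `u`. -/
noncomputable def cov (Γ : E → Bil E E) (F V : D → E) (u p : D) : E :=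
  fderiv ℝ V p u + Γ (F p) (fderiv ℝ F p u) (V p)

section Cov

variable {F V W : D → E} {u v p : D}

theorem cov_add (hV : DifferentiableAt ℝ V p) (hW : DifferentiableAt ℝ W p) :
    cov Γ F (fun q => V q + W q) u p = cov Γ F V u p + cov Γ F W u p := by
  have : fderiv ℝ (fun q => V q + W q) p = fderiv ℝ V p + fderiv ℝ W p := fderiv_add hV hW
  simp only [cov, this, _root_.add_apply, Bil.add_right]; abel

theorem cov_smul {φ : D → ℝ} (hφ : DifferentiableAt ℝ φ p) (hV : DifferentiableAt ℝ V p) :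
    cov Γ F (fun q => φ q • V q) u p = fderiv ℝ φ p u • V p + φ p • cov Γ F V u p := by
  have : fderiv ℝ (fun q => φ q • V q) p = _ := fderiv_smul hφ hV
  simp only [cov, this, _root_.add_apply, _root_.smul_apply,
    ContinuousLinearMap.smulRight_apply, Bil.smul_right, smul_add]
  abel

theorem cov_sum {ι : Type*} (s : Finset ι) {V : ι → D → E}
    (hV : ∀ i ∈ s, DifferentiableAt ℝ (V i) p) :
    cov Γ F (fun q => ∑ i ∈ s, V i q) u p = ∑ i ∈ s, cov Γ F (V i) u p := by
  have : fderiv ℝ (fun q => ∑ i ∈ s, V i q) p = _ := fderiv_fun_sum hV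
  simp only [cov, this, _root_.sum_apply, Bil.sum_right, Finset.sum_add_distrib]

theorem cov_congr (hV : V =ᶠ[𝓝 p] W) : cov Γ F V u p = cov Γ F W u p := by
  simp only [cov, hV.fderiv_eq, hV.eq_of_nhds]

theorem cov_sum_dir {ι : Type*} (s : Finset ι) (r : ι → ℝ) (u : ι → D) :
    cov Γ F V (∑ i ∈ s, r i • u i) p = ∑ i ∈ s, r i • cov Γ F V (u i) p := by
  simp only [cov, map_sum, map_smul, Bil.sum_left, Bil.smul_left,
    smul_add, Finset.sum_add_distrib]

end Cov

namespace LocalMetric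

variable (h : LocalMetric Ω G Γ) {U : Set D} (hU : IsOpen U) {F V W : D → E}
  (hF : ContDiffOn ℝ ∞ F U) (hFΩ : MapsTo F U Ω) {p : D} (hp : p ∈ U)

include h hF hFΩ

theorem contDiffOn_Γ : ContDiffOn ℝ ∞ (fun q => Γ (F q)) U := h.smoothΓ.comp hF hFΩ

theorem contDiffOn_G : ContDiffOn ℝ ∞ (fun q => G (F q)) U := h.smoothG.comp hF hFΩ

theorem contDiffOn_inner (hV : ContDiffOn ℝ ∞ V U) (hW : ContDiffOn ℝ ∞ W U) :
    ContDiffOn ℝ ∞ (fun q => G (F q) (V q) (W q)) U :=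
  (h.contDiffOn_G hF hFΩ).bil_apply hV hW

include hU

theorem contDiffOn_cov (hV : ContDiffOn ℝ ∞ V U) (u : D) : ContDiffOn ℝ ∞ (cov Γ F V u) U := by
  have h1 : ContDiffOn ℝ ∞ (fun q => fderiv ℝ V q u) U :=
    (hV.fderiv_of_isOpen hU (by simp)).clm_apply contDiffOn_const
  have h2 : ContDiffOn ℝ ∞ (fun q => fderiv ℝ F q u) U :=
    (hF.fderiv_of_isOpen hU (by simp)).clm_apply contDiffOn_const
  exact h1.add ((h.contDiffOn_Γ hF hFΩ).bil_apply h2 hV)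

include hp

/-- `Γ` is differentiable only within `Ω`, which may contain boundary points. Since `F` maps the
open set `U` into `Ω`, the composite still has a full derivative, so interior points of the
hypersurface that lie on `∂M` need no separate treatment. -/
theorem hasFDerivAt_Γ : HasFDerivAt (fun q => Γ (F q))
    ((fderivWithin ℝ Γ Ω (F p)).comp (fderiv ℝ F p)) p := by
  have hd : DifferentiableAt ℝ F p := (hF.contDiffAt (hU.mem_nhds hp)).differentiableAt (by simp)
  have h1 : HasFDerivWithinAt (fun q => Γ (F q)) _ U p :=
    (h.differentiableΓ (hFΩ hp)).hasFDerivWithinAt.comp p hd.hasFDerivAt.hasFDerivWithinAt hFΩ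
  exact h1.hasFDerivAt (hU.mem_nhds hp)

theorem hasFDerivAt_G : HasFDerivAt (fun q => G (F q))
    ((fderivWithin ℝ G Ω (F p)).comp (fderiv ℝ F p)) p := by
  have hd : DifferentiableAt ℝ F p := (hF.contDiffAt (hU.mem_nhds hp)).differentiableAt (by simp)
  have h1 : HasFDerivWithinAt (fun q => G (F q)) _ U p :=
    (h.differentiableG (hFΩ hp)).hasFDerivWithinAt.comp p hd.hasFDerivAt.hasFDerivWithinAt hFΩ
  exact h1.hasFDerivAt (hU.mem_nhds hp)

theorem fderiv_inner (hV : DifferentiableAt ℝ V p) (hW : DifferentiableAt ℝ W p) (u : D) :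
    fderiv ℝ (fun q => G (F q) (V q) (W q)) p u
      = G (F p) (cov Γ F V u p) (W p) + G (F p) (V p) (cov Γ F W u p) := by
  have h1 := (h.hasFDerivAt_G hU hF hFΩ hp).bil_apply hV.hasFDerivAt hW.hasFDerivAt
  rw [h1.fderiv]
  simp [cov, h.compat _ (hFΩ hp)]
  ring

/-- Second derivatives of `F` commute and `Γ` is symmetric. No bracket appears because `u` and `v`
are constant fields on `D`. -/
theorem cov_fderiv_comm (u v : D) :
    cov Γ F (fun q => fderiv ℝ F q v) u p = cov Γ F (fun q => fderiv ℝ F q u) v p := by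
  have hc := hF.contDiffAt (hU.mem_nhds hp)
  have hd : DifferentiableAt ℝ (fderiv ℝ F) p :=
    (hc.fderiv_right (m := 1) (by norm_cast)).differentiableAt (by simp)
  have e : ∀ w : D, fderiv ℝ (fun q => fderiv ℝ F q w) p = (fderiv ℝ (fderiv ℝ F) p).flip w := by
    intro w
    rw [(hd.hasFDerivAt.clm_apply (hasFDerivAt_const w p)).fderiv]
    ext; simp
  have hs : fderiv ℝ (fderiv ℝ F) p u v = fderiv ℝ (fderiv ℝ F) p v u :=
    hc.isSymmSndFDerivAt (by simp; norm_cast) u v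
  simp only [cov, e, ContinuousLinearMap.flip_apply, hs]
  rw [h.torsion _ (hFΩ hp)]

/-- The Ricci identity along a map: the second derivatives of `V` and of `F` cancel, and what is
left are the derivatives and products of `Γ` that make up the curvature. -/
theorem cov_comm (hV : ContDiffOn ℝ ∞ V U) (u v : D) :
    cov Γ F (cov Γ F V v) u p = cov Γ F (cov Γ F V u) v p
      + curv Ω Γ (F p) (fderiv ℝ F p u) (fderiv ℝ F p v) (V p) := by
  have sym : ∀ {X : D → E}, ContDiffOn ℝ ∞ X U → ∀ a b : D, DifferentiableAt ℝ (fun q => fderiv ℝ X q b) p ∧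
      fderiv ℝ (fun q => fderiv ℝ X q b) p a = fderiv ℝ (fun q => fderiv ℝ X q a) p b := by
    intro X hX a b
    have hc := hX.contDiffAt (hU.mem_nhds hp)
    have hd : DifferentiableAt ℝ (fderiv ℝ X) p :=
      (hc.fderiv_right (m := 1) (by norm_cast)).differentiableAt (by simp)
    have e : ∀ w : D, fderiv ℝ (fun q => fderiv ℝ X q w) p = (fderiv ℝ (fderiv ℝ X) p).flip w := by
      intro w
      rw [(hd.hasFDerivAt.clm_apply (hasFDerivAt_const w p)).fderiv]
      ext; simp
    have hs : fderiv ℝ (fderiv ℝ X) p a b = fderiv ℝ (fderiv ℝ X) p b a :=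
      hc.isSymmSndFDerivAt (by simp; norm_cast) a b
    refine ⟨(hd.hasFDerivAt.clm_apply (hasFDerivAt_const b p)).differentiableAt, ?_⟩
    simp only [e, ContinuousLinearMap.flip_apply, hs]
  have hdV : DifferentiableAt ℝ V p := (hV.contDiffAt (hU.mem_nhds hp)).differentiableAt (by simp)
  have exp : ∀ a b : D, fderiv ℝ (cov Γ F V b) p a = fderiv ℝ (fun q => fderiv ℝ V q b) p a
      + (fderivWithin ℝ Γ Ω (F p) (fderiv ℝ F p a) (fderiv ℝ F p b) (V p)
        + Γ (F p) (fderiv ℝ (fun q => fderiv ℝ F q b) p a) (V p)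
        + Γ (F p) (fderiv ℝ F p b) (fderiv ℝ V p a)) := by
    intro a b
    have h2 := (h.hasFDerivAt_Γ hU hF hFΩ hp).bil_apply (sym hF a b).1.hasFDerivAt
      hdV.hasFDerivAt
    have h1 := ((sym hV a b).1.hasFDerivAt.add h2).fderiv
    have h3 : fderiv ℝ (cov Γ F V b) p = _ := h1
    rw [h3]
    simp
  rw [show cov Γ F (cov Γ F V v) u p = fderiv ℝ (cov Γ F V v) p u
      + Γ (F p) (fderiv ℝ F p u) (cov Γ F V v p) from rfl,
    show cov Γ F (cov Γ F V u) v p = fderiv ℝ (cov Γ F V u) p v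
      + Γ (F p) (fderiv ℝ F p v) (cov Γ F V u p) from rfl, exp, exp, (sym hV u v).2, (sym hF u v).2]
  simp only [cov, curv, Bil.add_right]
  abel

end LocalMetric

end LocalMetric

/-! ### Determinants, inverses and contractions of Gram matrices. -/

section MatrixCalculus

variable {m : ℕ}

/-- The contraction `h^{ij} a_{ij}`. -/
noncomputable def contract (h a : Matrix (Fin m) (Fin m) ℝ) : ℝ := ∑ i, ∑ j, h⁻¹ i j * a i j

theorem contract_eq_trace (h a : Matrix (Fin m) (Fin m) ℝ) :
    contract h a = (h⁻¹ * a.transpose).trace := by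
  simp [contract, Matrix.trace, Matrix.mul_apply]

/-- A change of frame conjugates the Gram matrix and the contracted form alike, so contractions do
not depend on the frame. Pointwise identities may therefore be checked in a frame that is
orthonormal at the point. -/
theorem contract_conj {P : Matrix (Fin m) (Fin m) ℝ} (hP : IsUnit P.det)
    (h a : Matrix (Fin m) (Fin m) ℝ) :
    contract (P * h * P.transpose) (P * a * P.transpose) = contract h a := by
  have hPt : IsUnit P.transpose.det := by rwa [Matrix.det_transpose]
  rw [contract_eq_trace, contract_eq_trace, Matrix.mul_inv_rev, Matrix.mul_inv_rev,
    Matrix.transpose_mul, Matrix.transpose_mul, Matrix.transpose_transpose]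
  rw [show P.transpose⁻¹ * (h⁻¹ * P⁻¹) * (P * (a.transpose * P.transpose)) =
    P.transpose⁻¹ * (h⁻¹ * ((P⁻¹ * P) * a.transpose) * P.transpose) by simp only [Matrix.mul_assoc],
    Matrix.nonsing_inv_mul _ hP, Matrix.one_mul, Matrix.trace_mul_comm, Matrix.mul_assoc,
    Matrix.mul_nonsing_inv _ hPt, Matrix.mul_one]

theorem contract_one (a : Matrix (Fin m) (Fin m) ℝ) : contract 1 a = ∑ i, a i i := by
  simp [contract, Matrix.one_apply]

/-- `|b|² = h^{ik} h^{jl} b_{ij} b_{kl}`. -/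
noncomputable def contractSq (h b : Matrix (Fin m) (Fin m) ℝ) : ℝ :=
  contract h (b * h⁻¹ * b.transpose)

theorem contractSq_eq (h b : Matrix (Fin m) (Fin m) ℝ) :
    contractSq h b = ∑ i, ∑ j, ∑ k, ∑ l, h⁻¹ i k * h⁻¹ j l * b i j * b k l := by
  simp only [contractSq, contract, Matrix.mul_apply, Matrix.transpose_apply, Finset.sum_mul,
    Finset.mul_sum]
  refine Finset.sum_congr rfl fun i _ => ?_
  rw [Finset.sum_congr rfl fun k _ => Finset.sum_comm, Finset.sum_comm]
  refine Finset.sum_congr rfl fun j _ => Finset.sum_congr rfl fun k _ =>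
    Finset.sum_congr rfl fun l _ => by ring

theorem contractSq_conj {P : Matrix (Fin m) (Fin m) ℝ} (hP : IsUnit P.det)
    (h b : Matrix (Fin m) (Fin m) ℝ) :
    contractSq (P * h * P.transpose) (P * b * P.transpose) = contractSq h b := by
  have hPt : IsUnit P.transpose.det := by rwa [Matrix.det_transpose]
  rw [contractSq, contractSq, ← contract_conj hP h]
  congr 1
  rw [Matrix.mul_inv_rev, Matrix.mul_inv_rev, Matrix.transpose_mul, Matrix.transpose_mul,
    Matrix.transpose_transpose]
  rw [show P * b * P.transpose * (P.transpose⁻¹ * (h⁻¹ * P⁻¹)) * (P * (b.transpose * P.transpose)) =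
    P * (b * ((P.transpose * P.transpose⁻¹) * (h⁻¹ * ((P⁻¹ * P) * (b.transpose * P.transpose))))) by
    simp only [Matrix.mul_assoc], Matrix.mul_nonsing_inv _ hPt, Matrix.nonsing_inv_mul _ hP]
  simp only [Matrix.mul_assoc, Matrix.one_mul]

/-- Jacobi's formula. Differentiating the Leibniz expansion column by column gives determinants with
one column taken from `M'`; by Cramer's rule these are the diagonal entries of `adj M * M'`. -/
theorem hasDerivWithinAt_det {M : ℝ → Matrix (Fin m) (Fin m) ℝ} {M' : Matrix (Fin m) (Fin m) ℝ}
    {s : Set ℝ} {t : ℝ} (hM : ∀ i j, HasDerivWithinAt (fun t => M t i j) (M' i j) s t) :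
    HasDerivWithinAt (fun t => (M t).det) ((M t).adjugate * M').trace s t := by
  have e : ((M t).adjugate * M').trace = ∑ σ : Equiv.Perm (Fin m), (Equiv.Perm.sign σ : ℝ) *
      ∑ k, (∏ i ∈ Finset.univ.erase k, M t (σ i) i) • M' (σ k) k := by
    have : ((M t).adjugate * M').trace = ∑ k, ((M t).updateCol k (fun i => M' i k)).det := by
      simp only [Matrix.trace, Matrix.diag]
      refine Finset.sum_congr rfl fun k _ => ?_
      rw [← Matrix.cramer_apply, Matrix.cramer_eq_adjugate_mulVec]
      simp [Matrix.mul_apply, Matrix.mulVec, dotProduct]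
    rw [this]
    simp only [Matrix.det_apply', Finset.mul_sum]
    rw [Finset.sum_comm]
    refine Finset.sum_congr rfl fun σ _ => Finset.sum_congr rfl fun k _ => ?_
    rw [← Finset.mul_prod_erase _ _ (Finset.mem_univ k)]
    rw [Finset.prod_congr rfl (g := fun i => M t (σ i) i)]
    · simp; ring
    · intro i hi
      rw [Matrix.updateCol_ne (Finset.ne_of_mem_erase hi)]
  rw [e]
  simp only [Matrix.det_apply']
  refine HasDerivWithinAt.fun_sum fun σ _ => HasDerivWithinAt.const_mul _ ?_
  exact HasDerivWithinAt.fun_finsetProd fun i _ => hM (σ i) i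

theorem hasDerivWithinAt_sqrt_det {M : ℝ → Matrix (Fin m) (Fin m) ℝ}
    {M' : Matrix (Fin m) (Fin m) ℝ} {s : Set ℝ} {t : ℝ}
    (hM : ∀ i j, HasDerivWithinAt (fun t => M t i j) (M' i j) s t) (hpos : 0 < (M t).det) :
    HasDerivWithinAt (fun t => √(M t).det) (√(M t).det * ((M t)⁻¹ * M').trace / 2) s t := by
  have h1 := (hasDerivWithinAt_det hM).sqrt hpos.ne'
  refine h1.congr_deriv ?_
  rw [Matrix.inv_def, Ring.inverse_eq_inv', Matrix.smul_mul, Matrix.trace_smul, smul_eq_mul]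
  have h2 : √(M t).det ≠ 0 := (Real.sqrt_pos.2 hpos).ne'
  have h3 : (M t).det = √(M t).det * √(M t).det := (Real.mul_self_sqrt hpos.le).symm
  generalize √(M t).det = r at *
  rw [h3]
  field_simp

/-- For `d = det M` with `d 0 = 1` one has `(√d)'' = d''/2 - d'²/4` at `0`. Jacobi's formula gives
`d' = tr (adj M * M')`, so one more derivative requires that of the adjugate. -/
theorem secondDeriv_sqrt_det {M M' : ℝ → Matrix (Fin m) (Fin m) ℝ}
    {M'' : Matrix (Fin m) (Fin m) ℝ}
    (hM : ∀ᶠ t in 𝓝 (0 : ℝ), ∀ i j, HasDerivAt (fun t => M t i j) (M' t i j) t)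
    (hM' : ∀ i j, HasDerivAt (fun t => M' t i j) (M'' i j) 0) (h0 : M 0 = 1) :
    HasDerivAt (deriv fun t => √(M t).det)
      ((M''.trace - (M' 0 * M' 0).trace) / 2 + (M' 0).trace ^ 2 / 4) 0 := by
  have hM0 := hM.self_of_nhds
  have hdet : ∀ᶠ t in 𝓝 (0 : ℝ), HasDerivAt (fun t => (M t).det) ((M t).adjugate * M' t).trace t := by
    filter_upwards [hM] with t ht
    rw [← hasDerivWithinAt_univ]
    exact hasDerivWithinAt_det fun i j => (ht i j).hasDerivWithinAt
  have hd0 := hdet.self_of_nhds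
  have hpos : ∀ᶠ t in 𝓝 (0 : ℝ), 0 < (M t).det :=
    hd0.continuousAt.tendsto.eventually_const_lt (by simp [h0])
  have hadj : ∀ i j, DifferentiableAt ℝ (fun t => (M t).adjugate i j) 0 := by
    intro i j
    simp only [Matrix.adjugate_apply]
    have := hasDerivWithinAt_det (M := fun t => (M t).updateRow j (Pi.single i 1)) (s := univ)
      (t := 0) (M' := (M' 0).updateRow j 0) (fun a b => by
        by_cases hab : a = j
        · subst hab
          simp only [Matrix.updateRow_self]
          exact hasDerivWithinAt_const _ _ _
        · simp only [Matrix.updateRow_ne hab]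
          exact (hM0 a b).hasDerivWithinAt)
    exact (hasDerivWithinAt_univ.1 this).differentiableAt
  -- Differentiating `adj M * M = det M • 1` at the identity gives `adj' = tr M' • 1 - M'`.
  have hadj' : ∀ i j, deriv (fun t => (M t).adjugate i j) 0 =
      (M' 0).trace * (1 : Matrix (Fin m) (Fin m) ℝ) i j - M' 0 i j := by
    intro i j
    have h1 : HasDerivAt (fun t => ((M t).adjugate * M t) i j)
        (∑ k, (deriv (fun t => (M t).adjugate i k) 0 * M 0 k j + (M 0).adjugate i k * M' 0 k j)) 0 := by
      simp only [Matrix.mul_apply]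
      exact HasDerivAt.fun_sum fun k _ => (hadj i k).hasDerivAt.mul (hM0 k j)
    have h2 : HasDerivAt (fun t => ((M t).adjugate * M t) i j)
        (((M 0).adjugate * M' 0).trace * (1 : Matrix (Fin m) (Fin m) ℝ) i j) 0 := by
      have := hd0.mul_const ((1 : Matrix (Fin m) (Fin m) ℝ) i j)
      simpa only [Matrix.adjugate_mul, Matrix.smul_apply, smul_eq_mul] using this
    have := h1.unique h2
    simp [h0, Finset.sum_add_distrib, Matrix.one_apply] at this
    simp [Matrix.one_apply]
    linarith
  have htr : HasDerivAt (fun t => ((M t).adjugate * M' t).trace)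
      ((M' 0).trace ^ 2 - (M' 0 * M' 0).trace + M''.trace) 0 := by
    have h1 : HasDerivAt (fun t => ((M t).adjugate * M' t).trace)
        (∑ i, ∑ k, (deriv (fun t => (M t).adjugate i k) 0 * M' 0 k i + (M 0).adjugate i k * M'' k i)) 0 := by
      simp only [Matrix.trace, Matrix.diag, Matrix.mul_apply]
      exact HasDerivAt.fun_sum fun i _ => HasDerivAt.fun_sum fun k _ =>
        (hadj i k).hasDerivAt.mul (hM' k i)
    refine h1.congr_deriv ?_
    simp only [hadj', h0, Matrix.adjugate_one, Matrix.trace, Matrix.diag, Matrix.mul_apply,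
      Finset.sum_add_distrib, sub_mul, Finset.sum_sub_distrib, Matrix.one_apply]
    simp [sq, Finset.mul_sum]
  have hderiv : (deriv fun t => √(M t).det) =ᶠ[𝓝 0]
      fun t => ((M t).adjugate * M' t).trace / (2 * √(M t).det) := by
    filter_upwards [hdet, hpos] with t ht hp
    exact (ht.sqrt hp.ne').deriv
  refine HasDerivAt.congr_of_eventuallyEq ?_ hderiv
  have hs := (hd0.sqrt (by simp [h0])).const_mul 2
  refine (htr.div hs (by simp [h0])).congr_deriv ?_
  simp [h0]
  ring

-- A positive matrix is `Bᵀ B`, and `P = (Bᵀ)⁻¹` works. The rows of `P` are the coefficients of an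
-- orthonormal frame.
open scoped MatrixOrder Matrix.Norms.L2Operator in
theorem exists_conj_eq_one {h : Matrix (Fin m) (Fin m) ℝ} (hh : h.PosDef) :
    ∃ P : Matrix (Fin m) (Fin m) ℝ, IsUnit P.det ∧ P * h * P.transpose = 1 := by
  obtain ⟨B, hB⟩ := CStarAlgebra.nonneg_iff_eq_star_mul_self.mp hh.posSemidef.nonneg
  rw [Matrix.star_eq_conjTranspose] at hB
  have hBt : B.conjTranspose = B.transpose := by ext i j; simp
  rw [hBt] at hB
  have hu : IsUnit B.det := by
    have := hh.det_pos
    rw [hB, Matrix.det_mul, Matrix.det_transpose] at this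
    exact isUnit_iff_ne_zero.2 fun h0 => by simp [h0] at this
  have hut : IsUnit B.transpose.det := by rwa [Matrix.det_transpose]
  refine ⟨B.transpose⁻¹, ?_, ?_⟩
  · rw [Matrix.det_nonsing_inv]
    exact isUnit_ringInverse.2 hut
  · rw [hB, Matrix.transpose_nonsing_inv, Matrix.transpose_transpose, ← Matrix.mul_assoc,
      Matrix.nonsing_inv_mul _ hut, Matrix.one_mul, Matrix.mul_nonsing_inv _ hu]

end MatrixCalculus

section InverseEntries

variable {D : Type*} [NormedAddCommGroup D] [NormedSpace ℝ D] {m : ℕ} {s : Set D}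
  {M : D → Matrix (Fin m) (Fin m) ℝ} {n : WithTop ℕ∞}

theorem contDiffOn_det (hM : ∀ i j, ContDiffOn ℝ n (fun y => M y i j) s) :
    ContDiffOn ℝ n (fun y => (M y).det) s := by
  simp only [Matrix.det_apply']
  exact ContDiffOn.sum fun σ _ => contDiffOn_const.mul (contDiffOn_prod fun i _ => hM _ _)

theorem contDiffOn_inv (hM : ∀ i j, ContDiffOn ℝ n (fun y => M y i j) s)
    (hdet : ∀ y ∈ s, (M y).det ≠ 0) (i j : Fin m) :
    ContDiffOn ℝ n (fun y => (M y)⁻¹ i j) s := by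
  simp only [Matrix.inv_def, Ring.inverse_eq_inv', Matrix.smul_apply, smul_eq_mul,
    Matrix.adjugate_apply]
  refine ((contDiffOn_det hM).inv hdet).mul (contDiffOn_det fun a b => ?_)
  by_cases hab : a = j
  · subst hab
    simp only [Matrix.updateRow_self]
    exact contDiffOn_const
  · simp only [Matrix.updateRow_ne hab]
    exact hM a b

/-- Differentiate `M⁻¹ M = 1` at a point where both factors are the identity. -/
theorem fderiv_inv_of_eq_one {U : Set D} (hU : IsOpen U) {p : D} (hp : p ∈ U)
    (hM : ∀ i j, ContDiffOn ℝ ∞ (fun y => M y i j) U) (hdet : ∀ y ∈ U, (M y).det ≠ 0)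
    (h1 : M p = 1) (i j : Fin m) (u : D) :
    fderiv ℝ (fun y => (M y)⁻¹ i j) p u = - fderiv ℝ (fun y => M y i j) p u := by
  have hdM : ∀ i j, DifferentiableAt ℝ (fun y => M y i j) p := fun i j =>
    ((hM i j).contDiffAt (hU.mem_nhds hp)).differentiableAt (by simp)
  have hdI : ∀ i j, DifferentiableAt ℝ (fun y => (M y)⁻¹ i j) p := fun i j =>
    ((contDiffOn_inv hM hdet i j).contDiffAt (hU.mem_nhds hp)).differentiableAt (by simp)
  have e1 : HasFDerivAt (fun y => ∑ k, (M y)⁻¹ i k * M y k j)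
      (∑ k, ((M p)⁻¹ i k • fderiv ℝ (fun y => M y k j) p
        + M p k j • fderiv ℝ (fun y => (M y)⁻¹ i k) p)) p :=
    HasFDerivAt.fun_sum fun k _ => (hdI i k).hasFDerivAt.mul (hdM k j).hasFDerivAt
  have e2 : (fun y => ∑ k, (M y)⁻¹ i k * M y k j) =ᶠ[𝓝 p]
      fun _ => (1 : Matrix (Fin m) (Fin m) ℝ) i j := by
    filter_upwards [hU.mem_nhds hp] with y hy
    rw [← Matrix.mul_apply, Matrix.nonsing_inv_mul _ (isUnit_iff_ne_zero.2 (hdet y hy))]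
  have e3 := e2.fderiv_eq (𝕜 := ℝ)
  rw [e1.fderiv] at e3
  have e4 := congrArg (fun L : D →L[ℝ] ℝ => L u) e3
  simp [h1, Matrix.one_apply, Finset.sum_add_distrib] at e4
  linarith

end InverseEntries

/-! ### Hypersurfaces in a local metric: tangential projection and divergence. -/

section Hypersurfaces

variable {E D : Type*} [NormedAddCommGroup E] [NormedSpace ℝ E] [NormedAddCommGroup D]
  [NormedSpace ℝ D] {m : ℕ}

/-- The `m` vectors `a i`, independent because their Gram determinant is nonzero, form a basis
together with the orthogonal unit vector `n`, by dimension. A vector orthogonal to a basis is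
orthogonal to itself. -/
theorem Bil.eq_zero_of_orthogonal {B : Bil E ℝ} (hpos : ∀ v, v ≠ 0 → 0 < B v v) (hE : Module.finrank ℝ E = m + 1) {a : Fin m → E} {n : E}
    (hdet : (Matrix.of fun i j => B (a i) (a j)).det ≠ 0) (hn : B n n = 1)
    (hna : ∀ i, B n (a i) = 0) {d : E} (hda : ∀ i, B d (a i) = 0) (hdn : B d n = 0) : d = 0 := by
  have hli : LinearIndependent ℝ (fun o : Option (Fin m) => o.elim n a) := by
    rw [Fintype.linearIndependent_iff]
    intro c hc
    rw [Fintype.sum_option] at hc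
    simp only [Option.elim] at hc
    have h0 : c none = 0 := by
      have := congrArg (fun x => B n x) hc
      simpa [Bil.sum_right, hna, hn] using this
    have h1 : Matrix.vecMul (fun i => c (some i)) (Matrix.of fun i j => B (a i) (a j)) = 0 := by
      ext j
      have := congrArg (fun x => B x (a j)) hc
      simpa [Bil.sum_left, hna, Matrix.vecMul, dotProduct] using this
    have h2 := Matrix.eq_zero_of_vecMul_eq_zero hdet h1
    intro o
    cases o with
    | none => exact h0
    | some i => exact congrFun h2 i
  have hspan := hli.span_eq_top_of_card_eq_finrank (by simp [hE])
  have hd : d ∈ Submodule.span ℝ (range fun o : Option (Fin m) => o.elim n a) := by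
    rw [hspan]; trivial
  have : ∀ x ∈ Submodule.span ℝ (range fun o : Option (Fin m) => o.elim n a), B d x = 0 := by
    intro x hx
    induction hx using Submodule.span_induction with
    | mem x hx =>
      obtain ⟨o, rfl⟩ := hx
      cases o with
      | none => exact hdn
      | some i => exact hda i
    | zero => simp
    | add x y _ _ hx hy => simp [hx, hy]
    | smul r x _ hx => simp [hx]
  by_contra h
  exact (hpos d h).ne' (this d hd)

/-- The coordinate vector field `∂_i f` in the direction `e i`. -/
noncomputable def frame (f : D → E) (e : Fin m → D) (i : Fin m) (y : D) : E := fderiv ℝ f y (e i)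

/-- The Gram matrix of the coordinate vector fields. -/
noncomputable def gram (G : E → Bil E ℝ) (f : D → E) (e : Fin m → D) (y : D) :
    Matrix (Fin m) (Fin m) ℝ :=
  Matrix.of fun i j => G (f y) (frame f e i y) (frame f e j y)

/-- The matrix `⟨∇_i Y, ∂_j f⟩`. -/
noncomputable def covMat (G : E → Bil E ℝ) (Γ : E → Bil E E) (f : D → E) (e : Fin m → D)
    (Y : D → E) (y : D) : Matrix (Fin m) (Fin m) ℝ :=
  Matrix.of fun i j => G (f y) (cov Γ f Y (e i) y) (frame f e j y)

/-- The divergence along `f`. -/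
noncomputable def sdiv (G : E → Bil E ℝ) (Γ : E → Bil E E) (f : D → E) (e : Fin m → D)
    (Y : D → E) (y : D) : ℝ :=
  contract (gram G f e y) (covMat G Γ f e Y y)

/-- The components of the tangential part. -/
noncomputable def tcomp (G : E → Bil E ℝ) (f : D → E) (e : Fin m → D) (V : D → E) (i : Fin m)
    (y : D) : ℝ :=
  ∑ j, (gram G f e y)⁻¹ i j * G (f y) (V y) (frame f e j y)

/-- The tangential part, as a vector in the domain. -/
noncomputable def tvec (G : E → Bil E ℝ) (f : D → E) (e : Fin m → D) (V : D → E) (y : D) : D :=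
  ∑ i, tcomp G f e V i y • e i

/-- The tangential part, as a vector in the target. -/
noncomputable def tfield (G : E → Bil E ℝ) (f : D → E) (e : Fin m → D) (V : D → E) (y : D) : E :=
  fderiv ℝ f y (tvec G f e V y)

variable {Ω : Set E} {G : E → Bil E ℝ} {Γ : E → Bil E E}

theorem tfield_eq (f : D → E) (e : Fin m → D) (V : D → E) (y : D) :
    tfield G f e V y = ∑ i, tcomp G f e V i y • frame f e i y := by
  simp [tfield, tvec, frame]

/-- A hypersurface immersed in a local metric, with unit normal field. -/
structure LocalHypersurface (Ω : Set E) (G : E → Bil E ℝ) (Γ : E → Bil E E) (U : Set D)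
    (f ν : D → E) (e : Fin m → D) : Prop where
  metric : LocalMetric Ω G Γ
  isOpen : IsOpen U
  smooth : ContDiffOn ℝ ∞ f U
  mapsTo : MapsTo f U Ω
  finrank : Module.finrank ℝ E = m + 1
  smoothν : ContDiffOn ℝ ∞ ν U
  unit : ∀ y ∈ U, G (f y) (ν y) (ν y) = 1
  normal : ∀ y ∈ U, ∀ i, G (f y) (ν y) (frame f e i y) = 0
  det_ne : ∀ y ∈ U, (gram G f e y).det ≠ 0

namespace LocalHypersurface

variable {U : Set D} {f ν : D → E} {e : Fin m → D} (h : LocalHypersurface Ω G Γ U f ν e)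
  {X Y V W : D → E} {p : D}

include h

theorem contDiffOn_frame (i : Fin m) : ContDiffOn ℝ ∞ (frame f e i) U :=
  (h.smooth.fderiv_of_isOpen h.isOpen (by simp)).clm_apply contDiffOn_const

theorem contDiffOn_inner (hV : ContDiffOn ℝ ∞ V U) (hW : ContDiffOn ℝ ∞ W U) :
    ContDiffOn ℝ ∞ (fun q => G (f q) (V q) (W q)) U :=
  h.metric.contDiffOn_inner h.smooth h.mapsTo hV hW

theorem contDiffOn_gram (i j : Fin m) : ContDiffOn ℝ ∞ (fun y => gram G f e y i j) U :=
  h.contDiffOn_inner (h.contDiffOn_frame i) (h.contDiffOn_frame j)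

theorem contDiffOn_gram_inv (i j : Fin m) : ContDiffOn ℝ ∞ (fun y => (gram G f e y)⁻¹ i j) U :=
  contDiffOn_inv h.contDiffOn_gram h.det_ne i j

theorem contDiffOn_cov (hV : ContDiffOn ℝ ∞ V U) (u : D) : ContDiffOn ℝ ∞ (cov Γ f V u) U :=
  h.metric.contDiffOn_cov h.isOpen h.smooth h.mapsTo hV u

theorem contDiffOn_tcomp (hV : ContDiffOn ℝ ∞ V U) (i : Fin m) :
    ContDiffOn ℝ ∞ (tcomp G f e V i) U :=
  ContDiffOn.sum fun j _ => (h.contDiffOn_gram_inv i j).mul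
    (h.contDiffOn_inner hV (h.contDiffOn_frame j))

theorem contDiffOn_tfield (hV : ContDiffOn ℝ ∞ V U) : ContDiffOn ℝ ∞ (tfield G f e V) U := by
  rw [funext (tfield_eq f e V)]
  exact ContDiffOn.sum fun i _ => (h.contDiffOn_tcomp hV i).smul (h.contDiffOn_frame i)

theorem contDiffOn_sdiv (hV : ContDiffOn ℝ ∞ V U) : ContDiffOn ℝ ∞ (sdiv G Γ f e V) U := by
  change ContDiffOn ℝ ∞ (fun y => ∑ i, ∑ j, (gram G f e y)⁻¹ i j *
    G (f y) (cov Γ f V (e i) y) (frame f e j y)) U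
  exact ContDiffOn.sum fun i _ => ContDiffOn.sum fun j _ => (h.contDiffOn_gram_inv i j).mul
    (h.contDiffOn_inner (h.contDiffOn_cov hV (e i)) (h.contDiffOn_frame j))

omit h in
theorem differentiableAt_of_contDiffOn {F : Type*} [NormedAddCommGroup F] [NormedSpace ℝ F]
    {V : D → F} (hU : IsOpen U) (hp : p ∈ U)
    (hV : ContDiffOn ℝ ∞ V U) : DifferentiableAt ℝ V p :=
  (hV.contDiffAt (hU.mem_nhds hp)).differentiableAt (by simp)

theorem decomp (hp : p ∈ U) (V : D → E) :
    V p = G (f p) (V p) (ν p) • ν p + tfield G f e V p := by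
  have hz := h.mapsTo hp
  have hs := h.metric.symm _ hz
  rw [← sub_eq_zero]
  -- `tcomp` inverts the Gram matrix, so the projection has the same inner products with the frame
  -- as `V`. The difference of the two sides is then orthogonal to the frame and to the normal.
  have key : ∀ j, G (f p) (tfield G f e V p) (frame f e j p) = G (f p) (V p) (frame f e j p) := by
    intro j
    have h1 : (gram G f e p)⁻¹ * gram G f e p = 1 :=
      Matrix.nonsing_inv_mul _ (isUnit_iff_ne_zero.2 (h.det_ne p hp))
    have hst : (gram G f e p)⁻¹.transpose = (gram G f e p)⁻¹ := by
      rw [Matrix.transpose_nonsing_inv]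
      congr 1
      ext i j; exact hs _ _
    rw [tfield_eq, Bil.sum_left]
    simp only [Bil.smul_left, tcomp, smul_eq_mul, Finset.sum_mul]
    rw [Finset.sum_comm]
    have : ∀ k, ∑ i, (gram G f e p)⁻¹ i k * G (f p) (V p) (frame f e k p) *
        G (f p) (frame f e i p) (frame f e j p) =
        G (f p) (V p) (frame f e k p) * (1 : Matrix (Fin m) (Fin m) ℝ) k j := by
      intro k
      rw [← h1, Matrix.mul_apply, Finset.mul_sum]
      refine Finset.sum_congr rfl fun i _ => ?_
      rw [← congrFun (congrFun hst k) i, Matrix.transpose_apply]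
      simp only [gram, Matrix.of_apply]
      ring
    simp [this, Matrix.one_apply]
  have hn : G (f p) (tfield G f e V p) (ν p) = 0 := by
    rw [tfield_eq, Bil.sum_left]
    refine Finset.sum_eq_zero fun i _ => ?_
    rw [Bil.smul_left, hs, h.normal p hp]; simp
  refine Bil.eq_zero_of_orthogonal (B := G (f p)) (h.metric.pos _ hz) h.finrank
    (h.det_ne p hp) (h.unit p hp) (h.normal p hp) (fun i => ?_) ?_
  · simp [key, h.normal p hp]
  · simp [hn, h.unit p hp]

/-- Parseval's identity for the orthonormal basis made of the frame and the normal. -/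
theorem inner_eq (hp : p ∈ U) (h1 : gram G f e p = 1) (v w : E) :
    G (f p) v w = ∑ i, G (f p) v (frame f e i p) * G (f p) w (frame f e i p)
      + G (f p) v (ν p) * G (f p) w (ν p) := by
  have hs := h.metric.symm _ (h.mapsTo hp)
  have := h.decomp hp (fun _ => w)
  conv_lhs => rw [this]
  rw [Bil.add_right, Bil.smul_right, tfield_eq, Bil.sum_right, add_comm]
  congr 1
  · refine Finset.sum_congr rfl fun i _ => ?_
    rw [Bil.smul_right, smul_eq_mul, mul_comm]
    congr 1
    simp [tcomp, h1, Matrix.one_apply]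
  · rw [smul_eq_mul, mul_comm]

theorem cov_frame_symm (hp : p ∈ U) (i k : Fin m) :
    cov Γ f (frame f e i) (e k) p = cov Γ f (frame f e k) (e i) p :=
  h.metric.cov_fderiv_comm h.isOpen h.smooth h.mapsTo hp (e k) (e i)

theorem fderiv_inner (hp : p ∈ U) (hV : ContDiffOn ℝ ∞ V U) (hW : ContDiffOn ℝ ∞ W U) (u : D) :
    fderiv ℝ (fun q => G (f q) (V q) (W q)) p u
      = G (f p) (cov Γ f V u p) (W p) + G (f p) (V p) (cov Γ f W u p) :=
  h.metric.fderiv_inner h.isOpen h.smooth h.mapsTo hp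
    (differentiableAt_of_contDiffOn h.isOpen hp hV) (differentiableAt_of_contDiffOn h.isOpen hp hW) u

omit h in
theorem sdiv_eq (h1 : gram G f e p = 1) (Y : D → E) :
    sdiv G Γ f e Y p = ∑ i, G (f p) (cov Γ f Y (e i) p) (frame f e i p) := by
  rw [sdiv, h1, contract_one]; rfl

omit h in
theorem tcomp_eq (h1 : gram G f e p = 1) (Y : D → E) (i : Fin m) :
    tcomp G f e Y i p = G (f p) (Y p) (frame f e i p) := by
  simp [tcomp, h1, Matrix.one_apply]

/-- The frame is orthonormal at `p` only, so the inverse Gram matrix contributes its derivative,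
which is minus that of the Gram matrix. This is the subtracted double sum. -/
theorem fderiv_sdiv (hp : p ∈ U) (h1 : gram G f e p = 1) (hY : ContDiffOn ℝ ∞ Y U) (u : D) :
    fderiv ℝ (sdiv G Γ f e Y) p u =
      ∑ i, (G (f p) (cov Γ f (cov Γ f Y (e i)) u p) (frame f e i p)
        + G (f p) (cov Γ f Y (e i) p) (cov Γ f (frame f e i) u p))
      - ∑ i, ∑ j, (G (f p) (cov Γ f (frame f e i) u p) (frame f e j p)
        + G (f p) (cov Γ f (frame f e j) u p) (frame f e i p)) *
          G (f p) (cov Γ f Y (e i) p) (frame f e j p) := by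
  have hs := h.metric.symm _ (h.mapsTo hp)
  have dI : ∀ i j, DifferentiableAt ℝ (fun y => (gram G f e y)⁻¹ i j) p := fun i j =>
    differentiableAt_of_contDiffOn h.isOpen hp (h.contDiffOn_gram_inv i j)
  have dC : ∀ i j, DifferentiableAt ℝ (fun y => covMat G Γ f e Y y i j) p := fun i j =>
    differentiableAt_of_contDiffOn h.isOpen hp
      (h.contDiffOn_inner (h.contDiffOn_cov hY (e i)) (h.contDiffOn_frame j))
  have e1 : HasFDerivAt (sdiv G Γ f e Y) (∑ i, ∑ j,
      ((gram G f e p)⁻¹ i j • fderiv ℝ (fun y => covMat G Γ f e Y y i j) p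
        + covMat G Γ f e Y p i j • fderiv ℝ (fun y => (gram G f e y)⁻¹ i j) p)) p := by
    change HasFDerivAt (fun y => ∑ i, ∑ j, (gram G f e y)⁻¹ i j * covMat G Γ f e Y y i j) _ p
    exact HasFDerivAt.fun_sum fun i _ => HasFDerivAt.fun_sum fun j _ =>
      (dI i j).hasFDerivAt.mul (dC i j).hasFDerivAt
  rw [e1.fderiv]
  have e2 : ∀ i j, fderiv ℝ (fun y => (gram G f e y)⁻¹ i j) p u =
      -(G (f p) (cov Γ f (frame f e i) u p) (frame f e j p)
        + G (f p) (cov Γ f (frame f e j) u p) (frame f e i p)) := by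
    intro i j
    rw [fderiv_inv_of_eq_one h.isOpen hp h.contDiffOn_gram h.det_ne h1]
    congr 1
    rw [hs (cov Γ f (frame f e j) u p)]
    exact h.fderiv_inner hp (h.contDiffOn_frame i) (h.contDiffOn_frame j) u
  have e3 : ∀ i j, fderiv ℝ (fun y => covMat G Γ f e Y y i j) p u =
      G (f p) (cov Γ f (cov Γ f Y (e i)) u p) (frame f e j p)
        + G (f p) (cov Γ f Y (e i) p) (cov Γ f (frame f e j) u p) := fun i j =>
    h.fderiv_inner hp (h.contDiffOn_cov hY (e i)) (h.contDiffOn_frame j) u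
  simp only [_root_.sum_apply, _root_.add_apply, _root_.smul_apply, smul_eq_mul, e2, e3, h1,
    inv_one, Finset.sum_add_distrib, Matrix.one_apply]
  simp only [ite_mul, one_mul, zero_mul, Finset.sum_ite_eq, Finset.mem_univ, if_true]
  rw [← Finset.sum_add_distrib, ← Finset.sum_add_distrib, sub_eq_add_neg, ← Finset.sum_neg_distrib,
    ← Finset.sum_add_distrib]
  refine Finset.sum_congr rfl fun i _ => ?_
  rw [← Finset.sum_neg_distrib]
  congr 1
  refine Finset.sum_congr rfl fun j _ => ?_
  simp only [covMat, Matrix.of_apply]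
  ring

theorem sdiv_smul (hp : p ∈ U) (h1 : gram G f e p = 1) {φ : D → ℝ} (hφ : ContDiffOn ℝ ∞ φ U)
    (hY : ContDiffOn ℝ ∞ Y U) :
    sdiv G Γ f e (fun q => φ q • Y q) p = ∑ i, fderiv ℝ φ p (e i) * G (f p) (Y p) (frame f e i p)
      + φ p * sdiv G Γ f e Y p := by
  rw [sdiv_eq h1, sdiv_eq h1, Finset.mul_sum, ← Finset.sum_add_distrib]
  refine Finset.sum_congr rfl fun i _ => ?_
  rw [cov_smul (differentiableAt_of_contDiffOn h.isOpen hp hφ)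
    (differentiableAt_of_contDiffOn h.isOpen hp hY)]
  simp

theorem sdiv_add (hp : p ∈ U) (hX : ContDiffOn ℝ ∞ X U) (hY : ContDiffOn ℝ ∞ Y U) :
    sdiv G Γ f e (fun q => X q + Y q) p = sdiv G Γ f e X p + sdiv G Γ f e Y p := by
  simp only [sdiv, contract, covMat, Matrix.of_apply, cov_add
    (differentiableAt_of_contDiffOn h.isOpen hp hX) (differentiableAt_of_contDiffOn h.isOpen hp hY),
    Bil.add_left, mul_add, Finset.sum_add_distrib]

omit h in
theorem sdiv_congr (hXY : X =ᶠ[𝓝 p] Y) : sdiv G Γ f e X p = sdiv G Γ f e Y p := by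
  simp only [sdiv, contract, covMat, cov_congr hXY]

/-- The variable direction is expanded in the constant directions `e k` before it is differentiated;
the second covariant derivatives that appear can then be commuted by `cov_comm`. -/
theorem sdiv_cov_tvec (hp : p ∈ U) (h1 : gram G f e p = 1) (hV : ContDiffOn ℝ ∞ V U)
    (hY : ContDiffOn ℝ ∞ Y U) :
    sdiv G Γ f e (fun q => cov Γ f Y (tvec G f e V q) q) p =
      ∑ i, ∑ k, (fderiv ℝ (tcomp G f e V k) p (e i) * G (f p) (cov Γ f Y (e k) p) (frame f e i p)
        + tcomp G f e V k p * G (f p) (cov Γ f (cov Γ f Y (e k)) (e i) p) (frame f e i p)) := by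
  have e1 : (fun q => cov Γ f Y (tvec G f e V q) q) =
      fun q => ∑ k, tcomp G f e V k q • cov Γ f Y (e k) q := by
    funext q
    rw [tvec, cov_sum_dir]
  have dt := fun k => differentiableAt_of_contDiffOn h.isOpen hp (h.contDiffOn_tcomp hV k)
  have dY := fun k => differentiableAt_of_contDiffOn h.isOpen hp (h.contDiffOn_cov hY (e k))
  rw [e1, sdiv_eq h1]
  refine Finset.sum_congr rfl fun i _ => ?_
  rw [cov_sum (V := fun k q => tcomp G f e V k q • cov Γ f Y (e k) q) _
    fun k _ => (dt k).fun_smul (dY k), Bil.sum_left]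
  refine Finset.sum_congr rfl fun k _ => ?_
  rw [cov_smul (dt k) (dY k)]
  simp

end LocalHypersurface

end Hypersurfaces

/-! ### The Ricci and Codazzi identities along a hypersurface. -/

section SecondVariation

variable {E D : Type*} [NormedAddCommGroup E] [NormedSpace ℝ E] [NormedAddCommGroup D]
  [NormedSpace ℝ D] {m : ℕ} {Ω : Set E} {G : E → Bil E ℝ} {Γ : E → Bil E E}

/-- The coordinate expression of the density of the second variation. -/
noncomputable def localDensity (G : E → Bil E ℝ) (Γ : E → Bil E E) (f : D → E)
    (e : Fin m → D) (ric : ℝ) (φ : D → ℝ) (ν T Zhat : D → E) (τ : D → D) (y : D) : ℝ :=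
  contract (gram G f e y) (Matrix.of fun i j => fderiv ℝ φ y (e i) * fderiv ℝ φ y (e j))
    - φ y ^ 2 * ric - φ y ^ 2 * contractSq (gram G f e y) (covMat G Γ f e ν y)
    + sdiv G Γ f e (fun q => sdiv G Γ f e T q • T q - cov Γ f T (τ q) q) y
    + sdiv G Γ f e Zhat y
    - 2 * sdiv G Γ f e (fun q => φ q • cov Γ f ν (τ q) q) y

namespace LocalHypersurface

variable {U : Set D} {f ν : D → E} {e : Fin m → D} (h : LocalHypersurface Ω G Γ U f ν e)
  {X Y V W T Z : D → E} {p : D}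

include h

/-- Differentiate `⟨ν, ν⟩ = 1`. -/
theorem inner_cov_normal (hp : p ∈ U) (u : D) : G (f p) (cov Γ f ν u p) (ν p) = 0 := by
  have h1 := h.fderiv_inner hp h.smoothν h.smoothν u
  have h2 : (fun q => G (f q) (ν q) (ν q)) =ᶠ[𝓝 p] fun _ => (1 : ℝ) := by
    filter_upwards [h.isOpen.mem_nhds hp] with y hy using h.unit y hy
  rw [h2.fderiv_eq, h.metric.symm _ (h.mapsTo hp) (ν p)] at h1
  simp at h1
  linarith

theorem inner_cov_eq_neg (hp : p ∈ U) (hV : ContDiffOn ℝ ∞ V U)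
    (hn : ∀ q ∈ U, G (f q) (V q) (ν q) = 0) (u : D) :
    G (f p) (cov Γ f V u p) (ν p) = - G (f p) (V p) (cov Γ f ν u p) := by
  have h1 := h.fderiv_inner hp hV h.smoothν u
  have h2 : (fun q => G (f q) (V q) (ν q)) =ᶠ[𝓝 p] fun _ => (0 : ℝ) := by
    filter_upwards [h.isOpen.mem_nhds hp] with y hy using hn y hy
  rw [h2.fderiv_eq] at h1
  simp at h1
  linarith

/-- Differentiate `⟨∂_j f, ν⟩ = 0`. In this form the symmetry of the second fundamental form is that
of `∇_i ∂_j f`. -/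
theorem covMat_normal (hp : p ∈ U) (i j : Fin m) :
    covMat G Γ f e ν p i j = - G (f p) (cov Γ f (frame f e j) (e i) p) (ν p) := by
  rw [h.inner_cov_eq_neg hp (h.contDiffOn_frame j) (fun q hq => by
    rw [h.metric.symm _ (h.mapsTo hq)]; exact h.normal q hq j), h.metric.symm _ (h.mapsTo hp)]
  simp [covMat]

theorem covMat_normal_symm (hp : p ∈ U) (i j : Fin m) :
    covMat G Γ f e ν p i j = covMat G Γ f e ν p j i := by
  rw [h.covMat_normal hp, h.covMat_normal hp, h.cov_frame_symm hp]

theorem cov_tfield (hp : p ∈ U) (hV : ContDiffOn ℝ ∞ V U) (u : D) :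
    cov Γ f (tfield G f e V) u p = ∑ k, (fderiv ℝ (tcomp G f e V k) p u • frame f e k p
      + tcomp G f e V k p • cov Γ f (frame f e k) u p) := by
  have dt := fun k => differentiableAt_of_contDiffOn h.isOpen hp (h.contDiffOn_tcomp hV k)
  have df := fun k => differentiableAt_of_contDiffOn h.isOpen hp (h.contDiffOn_frame k)
  rw [funext (tfield_eq f e V), cov_sum (V := fun k q => tcomp G f e V k q • frame f e k q) _
    fun k _ => (dt k).fun_smul (df k)]
  exact Finset.sum_congr rfl fun k _ => cov_smul (dt k) (df k)

theorem covMat_tfield (hp : p ∈ U) (h1 : gram G f e p = 1) (hV : ContDiffOn ℝ ∞ V U)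
    (i j : Fin m) : covMat G Γ f e (tfield G f e V) p i j = fderiv ℝ (tcomp G f e V j) p (e i)
      + ∑ k, tcomp G f e V k p * G (f p) (cov Γ f (frame f e k) (e i) p) (frame f e j p) := by
  have hg : ∀ k, G (f p) (frame f e k p) (frame f e j p) = (1 : Matrix (Fin m) (Fin m) ℝ) k j := by
    intro k; rw [← h1]; rfl
  simp only [covMat, Matrix.of_apply, h.cov_tfield hp hV, Bil.sum_left, Bil.add_left, Bil.smul_left,
    hg, Finset.sum_add_distrib, Matrix.one_apply, smul_eq_mul]
  simp

theorem inner_cov_tfield_normal (hp : p ∈ U) (hV : ContDiffOn ℝ ∞ V U)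
    (i : Fin m) : G (f p) (cov Γ f (tfield G f e V) (e i) p) (ν p) =
      ∑ k, tcomp G f e V k p * G (f p) (cov Γ f (frame f e k) (e i) p) (ν p) := by
  have hg : ∀ k, G (f p) (frame f e k p) (ν p) = 0 := by
    intro k; rw [h.metric.symm _ (h.mapsTo hp)]; exact h.normal p hp k
  simp only [h.cov_tfield hp hV, Bil.sum_left, Bil.add_left, Bil.smul_left,
    hg, Finset.sum_add_distrib, smul_eq_mul]
  simp

/-- The tangential part of the second variation is a divergence. -/
theorem sdiv_tangential (hp : p ∈ U) (h1 : gram G f e p = 1) (hV : ContDiffOn ℝ ∞ V U)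
    (hT : T = tfield G f e V) :
    sdiv G Γ f e (fun q => sdiv G Γ f e T q • T q - cov Γ f T (tvec G f e V q) q) p =
      (∑ i, covMat G Γ f e T p i i) ^ 2
      - ∑ i, ∑ j, covMat G Γ f e T p i j * covMat G Γ f e T p j i
      + ∑ i, G (f p) (cov Γ f T (e i) p) (ν p) ^ 2
      + ∑ i, G (f p) (curv Ω Γ (f p) (T p) (frame f e i p) (T p)) (frame f e i p) := by
  have hTs : ContDiffOn ℝ ∞ T U := hT ▸ h.contDiffOn_tfield hV
  have hs := h.metric.symm _ (h.mapsTo hp)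
  -- Here `t` holds the components of `T`, `C` and `N` the tangential and normal components of `∇_k
  -- ∂_i f`, and `P` those of `∇T`. The left side of the goal is `(div T)² + T(div T) - div (∇_T
  -- T)`.
  set t : Fin m → ℝ := fun k => tcomp G f e V k p with ht
  set C : Fin m → Fin m → Fin m → ℝ := fun k i j =>
    G (f p) (cov Γ f (frame f e i) (e k) p) (frame f e j p) with hC
  set N : Fin m → Fin m → ℝ := fun k i => G (f p) (cov Γ f (frame f e i) (e k) p) (ν p) with hN
  have Csymm : ∀ k i j, C k i j = C i k j := fun k i j => by
    simp only [hC, h.cov_frame_symm hp]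
  have Nsymm : ∀ k i, N k i = N i k := fun k i => by simp only [hN, h.cov_frame_symm hp]
  set P : Fin m → Fin m → ℝ := fun i j => covMat G Γ f e T p i j with hP
  have hPe : ∀ i j, fderiv ℝ (tcomp G f e V j) p (e i) = P i j - ∑ k, t k * C i k j := by
    intro i j
    simp only [hP, hT, h.covMat_tfield hp h1 hV]
    ring
  have hNe : ∀ i, G (f p) (cov Γ f T (e i) p) (ν p) = ∑ k, t k * N i k := by
    intro i
    rw [hT, h.inner_cov_tfield_normal hp hV]
  have hTt : ∀ i, G (f p) (T p) (frame f e i p) = t i := by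
    intro i
    rw [hT, tfield_eq, Bil.sum_left]
    have hg : ∀ k, G (f p) (frame f e k p) (frame f e i p) = (1 : Matrix (Fin m) (Fin m) ℝ) k i := by
      intro k; rw [← h1]; rfl
    simp [hg, Matrix.one_apply, ht]
  have hdir : ∀ u : D, (fun q => -(cov Γ f T (tvec G f e V q) q)) =
      fun q => (-1 : ℝ) • cov Γ f T (tvec G f e V q) q := by
    intro u; funext q; simp
  have hcovs : ContDiffOn ℝ ∞ (fun q => cov Γ f T (tvec G f e V q) q) U := by
    have : (fun q => cov Γ f T (tvec G f e V q) q) =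
        fun q => ∑ k, tcomp G f e V k q • cov Γ f T (e k) q := by
      funext q; rw [tvec, cov_sum_dir]
    rw [this]
    exact ContDiffOn.sum fun k _ => (h.contDiffOn_tcomp hV k).smul (h.contDiffOn_cov hTs (e k))
  have e1 : sdiv G Γ f e (fun q => sdiv G Γ f e T q • T q - cov Γ f T (tvec G f e V q) q) p =
      sdiv G Γ f e (fun q => sdiv G Γ f e T q • T q) p
        - sdiv G Γ f e (fun q => cov Γ f T (tvec G f e V q) q) p := by
    have := h.sdiv_add hp ((h.contDiffOn_sdiv hTs).smul hTs) hcovs.neg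
    simp only [sub_eq_add_neg]
    refine this.trans ?_
    congr 1
    have := h.sdiv_smul hp h1 (φ := fun _ => (-1 : ℝ)) contDiffOn_const hcovs
    simp only [fderiv_fun_const, Pi.zero_apply, _root_.zero_apply, zero_mul, Finset.sum_const_zero, zero_add,
      neg_one_smul, neg_one_mul] at this
    exact this
  -- The second derivatives in `T(div T)` are reordered to match those in `div (∇_T T)`; the price
  -- is the curvature term of the result.
  have hcomm : ∀ k i, G (f p) (cov Γ f (cov Γ f T (e i)) (e k) p) (frame f e i p) =
      G (f p) (cov Γ f (cov Γ f T (e k)) (e i) p) (frame f e i p)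
      + G (f p) (curv Ω Γ (f p) (frame f e k p) (frame f e i p) (T p)) (frame f e i p) := by
    intro k i
    rw [h.metric.cov_comm h.isOpen h.smooth h.mapsTo hp hTs (e k) (e i), Bil.add_left]
    rfl
  -- Parseval separates the normal parts. By the symmetry of `N` they sum to the squares `⟨∇_i T,
  -- ν⟩²` (see `s3`).
  have hin : ∀ k i, G (f p) (cov Γ f T (e i) p) (cov Γ f (frame f e i) (e k) p) =
      ∑ j, P i j * C k i j + (∑ l, t l * N i l) * N k i := by
    intro k i
    rw [h.inner_eq hp h1, hNe]
    rfl
  have hR : ∀ i, G (f p) (curv Ω Γ (f p) (T p) (frame f e i p) (T p)) (frame f e i p) =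
      ∑ k, t k * G (f p) (curv Ω Γ (f p) (frame f e k p) (frame f e i p) (T p)) (frame f e i p) := by
    intro i
    have : ∀ s : Finset (Fin m), curv Ω Γ (f p) (∑ k ∈ s, t k • frame f e k p) (frame f e i p) (T p)
        = ∑ k ∈ s, t k • curv Ω Γ (f p) (frame f e k p) (frame f e i p) (T p) := by
      intro s
      induction s using Finset.induction_on with
      | empty => simp [curv]
      | insert a s ha ih => rw [Finset.sum_insert ha, Finset.sum_insert ha, curv_add_left,
          curv_smul_left, ih]
    have hTp : T p = ∑ k, t k • frame f e k p := by rw [hT, tfield_eq]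
    conv_lhs => rw [show curv Ω Γ (f p) (T p) (frame f e i p) (T p) =
      curv Ω Γ (f p) (∑ k, t k • frame f e k p) (frame f e i p) (T p) by rw [← hTp]]
    rw [this, Bil.sum_left]
    simp
  rw [e1, h.sdiv_smul hp h1 (h.contDiffOn_sdiv hTs) hTs, h.sdiv_cov_tvec hp h1 hV hTs,
    sdiv_eq h1]
  simp only [h.fderiv_sdiv hp h1 hTs, hTt, hPe, hcomm, hin, hR, hNe]
  change ∑ k, (∑ i, (_ + _ + (∑ j, P i j * C k i j + (∑ l, t l * N i l) * N k i))
    - ∑ i, ∑ j, (C k i j + C k j i) * P i j) * t k + (∑ i, P i i) * (∑ i, P i i)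
    - ∑ i, ∑ k, ((P i k - ∑ l, t l * C i l k) * P k i + t k * _) = _
  set R1 : Fin m → Fin m → ℝ := fun k i =>
    G (f p) (cov Γ f (cov Γ f T (e k)) (e i) p) (frame f e i p)
  set R2 : Fin m → Fin m → ℝ := fun k i =>
    G (f p) (curv Ω Γ (f p) (frame f e k p) (frame f e i p) (T p)) (frame f e i p)
  change ∑ k, (∑ i, (R1 k i + R2 k i + (∑ j, P i j * C k i j + (∑ l, t l * N i l) * N k i))
    - ∑ i, ∑ j, (C k i j + C k j i) * P i j) * t k + (∑ i, P i i) * (∑ i, P i i)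
    - ∑ i, ∑ k, ((P i k - ∑ l, t l * C i l k) * P k i + t k * R1 k i) =
    (∑ i, P i i) ^ 2 - ∑ i, ∑ j, P i j * P j i + ∑ i, (∑ k, t k * N i k) ^ 2
      + ∑ i, ∑ k, t k * R2 k i
  -- The second derivatives `R1` occur in both divergences and cancel by `s1`. All terms with `C`
  -- cancel by `s4` and `s5`, the latter using the symmetry of `C` in its first two indices.
  have s1 : ∑ k, (∑ i, R1 k i) * t k = ∑ i, ∑ k, t k * R1 k i := by
    rw [Finset.sum_comm]
    exact Finset.sum_congr rfl fun k _ => by rw [Finset.sum_mul]; exact Finset.sum_congr rfl fun i _ => mul_comm _ _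
  have s2 : ∑ k, (∑ i, R2 k i) * t k = ∑ i, ∑ k, t k * R2 k i := by
    rw [Finset.sum_comm]
    exact Finset.sum_congr rfl fun k _ => by rw [Finset.sum_mul]; exact Finset.sum_congr rfl fun i _ => mul_comm _ _
  have s3 : ∑ k, (∑ i, (∑ l, t l * N i l) * N k i) * t k = ∑ i, (∑ k, t k * N i k) ^ 2 := by
    simp only [Finset.sum_mul]
    rw [Finset.sum_comm]
    refine Finset.sum_congr rfl fun i _ => ?_
    rw [sq, Finset.mul_sum]
    simp only [← Finset.sum_mul]
    refine Finset.sum_congr rfl fun k _ => ?_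
    rw [Nsymm k i]; ring
  have s4 : ∑ k, (∑ i, ∑ j, P i j * C k i j) * t k =
      ∑ k, (∑ i, ∑ j, C k i j * P i j) * t k := by
    simp only [mul_comm (P _ _)]
  have s5 : ∑ i, ∑ k, (∑ l, t l * C i l k) * P k i = ∑ k, (∑ i, ∑ j, C k j i * P i j) * t k := by
    have e : ∀ i k, (∑ l, t l * C i l k) * P k i = ∑ l, C l i k * P k i * t l := by
      intro i k
      rw [Finset.sum_mul]
      exact Finset.sum_congr rfl fun l _ => by rw [Csymm i l k]; ring
    simp only [e, Finset.sum_mul]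
    rw [Finset.sum_congr rfl fun i _ => Finset.sum_comm, Finset.sum_comm]
    exact Finset.sum_congr rfl fun l _ => Finset.sum_comm
  simp only [Finset.sum_add_distrib, add_mul, sub_mul, Finset.sum_sub_distrib] at *
  rw [s1, s2, s3, s4, s5]
  have s6 : ∑ i, ∑ k, P i k * P k i = ∑ i, ∑ j, P i j * P j i := rfl
  ring

/-- Codazzi's equation, contracted with the tangential part of a vector field. -/
theorem sdiv_normal_tangential (hp : p ∈ U) (h1 : gram G f e p = 1) (hV : ContDiffOn ℝ ∞ V U)
    (hT : T = tfield G f e V) {φ : D → ℝ} (hφ : ContDiffOn ℝ ∞ φ U)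
    (hH : ∀ y ∈ U, sdiv G Γ f e ν y = 0) :
    sdiv G Γ f e (fun q => φ q • cov Γ f ν (tvec G f e V q) q) p =
      - ∑ i, fderiv ℝ φ p (e i) * G (f p) (cov Γ f T (e i) p) (ν p)
      + φ p * (∑ i, ∑ j, covMat G Γ f e T p i j * covMat G Γ f e ν p j i
        - ∑ i, G (f p) (curv Ω Γ (f p) (T p) (frame f e i p) (ν p)) (frame f e i p)) := by
  have hTs : ContDiffOn ℝ ∞ T U := hT ▸ h.contDiffOn_tfield hV
  set t : Fin m → ℝ := fun k => tcomp G f e V k p with ht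
  set C : Fin m → Fin m → Fin m → ℝ := fun k i j =>
    G (f p) (cov Γ f (frame f e i) (e k) p) (frame f e j p) with hC
  set B : Fin m → Fin m → ℝ := fun i j => covMat G Γ f e ν p i j with hB
  have Bsymm : ∀ i j, B i j = B j i := h.covMat_normal_symm hp
  have Csymm : ∀ k i j, C k i j = C i k j := fun k i j => by
    simp only [hC, h.cov_frame_symm hp]
  set P : Fin m → Fin m → ℝ := fun i j => covMat G Γ f e T p i j with hP
  have hPe : ∀ i j, fderiv ℝ (tcomp G f e V j) p (e i) = P i j - ∑ k, t k * C i k j := by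
    intro i j
    simp only [hP, hT, h.covMat_tfield hp h1 hV]
    ring
  -- The normal part of `∇_i T` is `-B(T, e_i)`.
  have hNe : ∀ i, G (f p) (cov Γ f T (e i) p) (ν p) = - ∑ k, t k * B k i := by
    intro i
    rw [hT, h.inner_cov_tfield_normal hp hV, ← Finset.sum_neg_distrib]
    refine Finset.sum_congr rfl fun k _ => ?_
    simp only [hB]
    rw [h.covMat_normal hp, h.cov_frame_symm hp]
    ring
  have hcovs : ContDiffOn ℝ ∞ (fun q => cov Γ f ν (tvec G f e V q) q) U := by
    have : (fun q => cov Γ f ν (tvec G f e V q) q) =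
        fun q => ∑ k, tcomp G f e V k q • cov Γ f ν (e k) q := by
      funext q; rw [tvec, cov_sum_dir]
    rw [this]
    exact ContDiffOn.sum fun k _ => (h.contDiffOn_tcomp hV k).smul (h.contDiffOn_cov h.smoothν (e k))
  have hcomm : ∀ k i, G (f p) (cov Γ f (cov Γ f ν (e k)) (e i) p) (frame f e i p) =
      G (f p) (cov Γ f (cov Γ f ν (e i)) (e k) p) (frame f e i p)
      - G (f p) (curv Ω Γ (f p) (frame f e k p) (frame f e i p) (ν p)) (frame f e i p) := by
    intro k i
    rw [h.metric.cov_comm h.isOpen h.smooth h.mapsTo hp h.smoothν (e k) (e i), Bil.add_left]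
    simp [frame]
  have hin : ∀ k i, G (f p) (cov Γ f ν (e i) p) (cov Γ f (frame f e i) (e k) p) =
      ∑ j, B i j * C k i j := by
    intro k i
    rw [h.inner_eq hp h1, h.inner_cov_normal hp, zero_mul, add_zero]
    rfl
  -- The mean curvature vanishes on all of `U`, hence so does its derivative in the direction `e k`.
  -- With the commutation `hcomm` this is the traced Codazzi equation.
  have hCod : ∀ k, ∑ i, G (f p) (cov Γ f (cov Γ f ν (e i)) (e k) p) (frame f e i p) =
      ∑ i, ∑ j, C k j i * B i j := by
    intro k
    have e1 := h.fderiv_sdiv hp h1 h.smoothν (e k)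
    have e2 : sdiv G Γ f e ν =ᶠ[𝓝 p] fun _ => (0 : ℝ) := by
      filter_upwards [h.isOpen.mem_nhds hp] with y hy using hH y hy
    rw [e2.fderiv_eq] at e1
    simp only [hin, fderiv_fun_const, Pi.zero_apply, _root_.zero_apply] at e1
    change 0 = ∑ i, (_ + _) - ∑ i, ∑ j, (C k i j + C k j i) * B i j at e1
    simp only [Finset.sum_add_distrib, add_mul] at e1
    simp only [mul_comm (B _ _)] at e1
    linarith
  have hR : ∀ i, G (f p) (curv Ω Γ (f p) (T p) (frame f e i p) (ν p)) (frame f e i p) =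
      ∑ k, t k * G (f p) (curv Ω Γ (f p) (frame f e k p) (frame f e i p) (ν p)) (frame f e i p) := by
    intro i
    have : ∀ s : Finset (Fin m), curv Ω Γ (f p) (∑ k ∈ s, t k • frame f e k p) (frame f e i p) (ν p)
        = ∑ k ∈ s, t k • curv Ω Γ (f p) (frame f e k p) (frame f e i p) (ν p) := by
      intro s
      induction s using Finset.induction_on with
      | empty => simp [curv]
      | insert a s ha ih => rw [Finset.sum_insert ha, Finset.sum_insert ha, curv_add_left,
          curv_smul_left, ih]
    have hTp : T p = ∑ k, t k • frame f e k p := by rw [hT, tfield_eq]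
    rw [hTp, this, Bil.sum_left]
    simp
  have hX : ∀ i, G (f p) (cov Γ f ν (tvec G f e V p) p) (frame f e i p) = ∑ k, t k * B k i := by
    intro i
    rw [tvec, cov_sum_dir, Bil.sum_left]
    simp only [Bil.smul_left, smul_eq_mul]
    rfl
  rw [h.sdiv_smul hp h1 hφ hcovs, h.sdiv_cov_tvec hp h1 hV h.smoothν]
  simp only [hX, hPe, hcomm, hR, hNe]
  set R2 : Fin m → Fin m → ℝ := fun k i =>
    G (f p) (curv Ω Γ (f p) (frame f e k p) (frame f e i p) (ν p)) (frame f e i p)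
  set R1 : Fin m → Fin m → ℝ := fun k i =>
    G (f p) (cov Γ f (cov Γ f ν (e i)) (e k) p) (frame f e i p)
  change _ + φ p * ∑ i, ∑ k, ((P i k - ∑ l, t l * C i l k) * B k i + t k * (R1 k i - R2 k i)) =
    _ + φ p * (∑ i, ∑ j, P i j * B j i - ∑ i, ∑ k, t k * R2 k i)
  have hCod' : ∀ k, ∑ i, R1 k i = ∑ i, ∑ j, C k j i * B i j := hCod
  have s1 : ∑ i, ∑ k, t k * R1 k i = ∑ k, (∑ i, ∑ j, C k j i * B i j) * t k := by
    rw [Finset.sum_comm]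
    refine Finset.sum_congr rfl fun k _ => ?_
    rw [← Finset.mul_sum, hCod', mul_comm]
  have s5 : ∑ i, ∑ k, (∑ l, t l * C i l k) * B k i = ∑ k, (∑ i, ∑ j, C k j i * B i j) * t k := by
    have e : ∀ i k, (∑ l, t l * C i l k) * B k i = ∑ l, C l i k * B k i * t l := by
      intro i k
      rw [Finset.sum_mul]
      exact Finset.sum_congr rfl fun l _ => by rw [Csymm i l k]; ring
    simp only [e, Finset.sum_mul]
    rw [Finset.sum_congr rfl fun i _ => Finset.sum_comm, Finset.sum_comm]
    exact Finset.sum_congr rfl fun l _ => Finset.sum_comm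
  congr 1
  · simp
  congr 1
  simp only [Finset.sum_add_distrib, sub_mul, mul_sub, Finset.sum_sub_distrib]
  rw [s1, s5]
  ring

end LocalHypersurface

end SecondVariation

/-! ### The pointwise second variation formula. -/

section SecondVariationFormula

variable {E D : Type*} [NormedAddCommGroup E] [NormedSpace ℝ E] [NormedAddCommGroup D]
  [NormedSpace ℝ D] {m : ℕ} {Ω : Set E} {G : E → Bil E ℝ} {Γ : E → Bil E E}

/-- The second derivative of the volume element along a variation with variation field `X` and
acceleration `Z`. -/
noncomputable def secondVariationForm (Ω : Set E) (G : E → Bil E ℝ) (Γ : E → Bil E E) (f ν : D → E)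
    (e : Fin m → D) (X Z : D → E) (p : D) : ℝ :=
  (∑ i, covMat G Γ f e X p i i) ^ 2 - ∑ i, ∑ j, covMat G Γ f e X p i j * covMat G Γ f e X p j i
    + ∑ i, G (f p) (cov Γ f X (e i) p) (ν p) ^ 2
    + ∑ i, G (f p) (curv Ω Γ (f p) (X p) (frame f e i p) (X p)) (frame f e i p)
    + ∑ i, G (f p) (cov Γ f Z (e i) p) (frame f e i p)

namespace LocalHypersurface

variable {U : Set D} {f ν : D → E} {e : Fin m → D} (h : LocalHypersurface Ω G Γ U f ν e)
  {X Z : D → E} {p : D}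

include h

/-- The normal part of `Z` contributes `⟨Z, ν⟩` times the mean curvature, which is zero. -/
theorem sdiv_tfield (hp : p ∈ U) (h1 : gram G f e p = 1) (hZ : ContDiffOn ℝ ∞ Z U)
    (hH : sdiv G Γ f e ν p = 0) : sdiv G Γ f e (tfield G f e Z) p = sdiv G Γ f e Z p := by
  have e1 : Z =ᶠ[𝓝 p] fun q => G (f q) (Z q) (ν q) • ν q + tfield G f e Z q := by
    filter_upwards [h.isOpen.mem_nhds hp] with q hq using h.decomp hq Z
  have hφ := h.contDiffOn_inner hZ h.smoothν
  rw [sdiv_congr e1, h.sdiv_add (X := fun q => G (f q) (Z q) (ν q) • ν q) hp (hφ.smul h.smoothν) (h.contDiffOn_tfield hZ),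
    h.sdiv_smul hp h1 hφ h.smoothν, hH]
  simp [h.normal p hp]

/-- Insert `X = φν + T`, so that `P` becomes `φB + P_T` and the normal components become `dφ + N_T`.
The terms quadratic in `φ` are `|∇φ|² - φ²(Ric(ν) + |B|²)`, those quadratic in `T` are supplied by
`sdiv_tangential`, and the mixed ones are `-2` times `sdiv_normal_tangential`. -/
theorem localDensity_eq (hp : p ∈ U) (h1 : gram G f e p = 1) (hX : ContDiffOn ℝ ∞ X U)
    (hZ : ContDiffOn ℝ ∞ Z U) (hH : ∀ y ∈ U, sdiv G Γ f e ν y = 0) {ric : ℝ}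
    (hric : ric = - ∑ i, G (f p) (curv Ω Γ (f p) (ν p) (frame f e i p) (ν p)) (frame f e i p)) :
    localDensity G Γ f e ric (fun q => G (f q) (X q) (ν q)) ν (tfield G f e X) (tfield G f e Z)
      (tvec G f e X) p = secondVariationForm Ω G Γ f ν e X Z p := by
  have hs := h.metric.symm _ (h.mapsTo hp)
  have hφ := h.contDiffOn_inner hX h.smoothν
  have hTs := h.contDiffOn_tfield hX
  have dφ := differentiableAt_of_contDiffOn h.isOpen hp hφ
  have dν := differentiableAt_of_contDiffOn h.isOpen hp h.smoothν
  have dT := differentiableAt_of_contDiffOn h.isOpen hp hTs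
  have e1 : X =ᶠ[𝓝 p] fun q => G (f q) (X q) (ν q) • ν q + tfield G f e X q := by
    filter_upwards [h.isOpen.mem_nhds hp] with q hq using h.decomp hq X
  set φ : D → ℝ := fun q => G (f q) (X q) (ν q) with hφdef
  set T := tfield G f e X with hTdef
  have hDX : ∀ i, cov Γ f X (e i) p = fderiv ℝ φ p (e i) • ν p + φ p • cov Γ f ν (e i) p
      + cov Γ f T (e i) p := by
    intro i
    rw [cov_congr e1, cov_add (dφ.fun_smul dν) dT, cov_smul dφ dν]
  have hP : ∀ i j, covMat G Γ f e X p i j =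
      φ p * covMat G Γ f e ν p i j + covMat G Γ f e T p i j := by
    intro i j
    simp [covMat, hDX, h.normal p hp]
  have hN : ∀ i, G (f p) (cov Γ f X (e i) p) (ν p) =
      fderiv ℝ φ p (e i) + G (f p) (cov Γ f T (e i) p) (ν p) := by
    intro i
    simp [hDX, h.unit p hp, h.inner_cov_normal hp]
  have hXp : X p = φ p • ν p + T p := h.decomp hp X
  -- The two mixed curvature terms agree by pair symmetry, whence the factor two.
  have hR : ∀ i, G (f p) (curv Ω Γ (f p) (X p) (frame f e i p) (X p)) (frame f e i p) =
      φ p ^ 2 * G (f p) (curv Ω Γ (f p) (ν p) (frame f e i p) (ν p)) (frame f e i p)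
      + 2 * φ p * G (f p) (curv Ω Γ (f p) (T p) (frame f e i p) (ν p)) (frame f e i p)
      + G (f p) (curv Ω Γ (f p) (T p) (frame f e i p) (T p)) (frame f e i p) := by
    intro i
    have hpair := h.metric.curv_pair (h.mapsTo hp) (ν p) (frame f e i p) (T p) (frame f e i p)
    rw [hXp]
    simp only [curv_add_left, curv_add_right, curv_smul_left, curv_smul_right, Bil.add_left,
      Bil.smul_left, smul_eq_mul, hpair]
    ring
  have hBsq : contractSq (gram G f e p) (covMat G Γ f e ν p) =
      ∑ i, ∑ j, covMat G Γ f e ν p i j * covMat G Γ f e ν p j i := by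
    rw [contractSq, h1, contract_one]
    refine Finset.sum_congr rfl fun i _ => ?_
    simp only [inv_one, Matrix.mul_one, Matrix.mul_apply, Matrix.transpose_apply]
    exact Finset.sum_congr rfl fun j _ => by rw [h.covMat_normal_symm hp j i]
  have hH' : ∑ i, covMat G Γ f e ν p i i = 0 := by
    have := hH p hp
    rw [sdiv_eq h1] at this
    exact this
  rw [localDensity, h.sdiv_tangential hp h1 hX rfl,
    h.sdiv_normal_tangential hp h1 hX rfl hφ hH, h.sdiv_tfield hp h1 hZ (hH p hp), sdiv_eq h1, hBsq,
    h1, contract_one, hric, secondVariationForm]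
  simp only [Matrix.of_apply, hP, hN, hR, Finset.sum_add_distrib, ← Finset.mul_sum, hH']
  have sq1 : ∑ i, (fderiv ℝ φ p (e i) + G (f p) (cov Γ f T (e i) p) (ν p)) ^ 2 =
      ∑ i, fderiv ℝ φ p (e i) * fderiv ℝ φ p (e i)
      + 2 * ∑ i, fderiv ℝ φ p (e i) * G (f p) (cov Γ f T (e i) p) (ν p)
      + ∑ i, G (f p) (cov Γ f T (e i) p) (ν p) ^ 2 := by
    rw [Finset.mul_sum, ← Finset.sum_add_distrib, ← Finset.sum_add_distrib]
    exact Finset.sum_congr rfl fun i _ => by ring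
  have sq2 : ∑ i, ∑ j, (φ p * covMat G Γ f e ν p i j + covMat G Γ f e T p i j) *
      (φ p * covMat G Γ f e ν p j i + covMat G Γ f e T p j i) =
      φ p ^ 2 * (∑ i, ∑ j, covMat G Γ f e ν p i j * covMat G Γ f e ν p j i)
      + 2 * φ p * (∑ i, ∑ j, covMat G Γ f e T p i j * covMat G Γ f e ν p j i)
      + ∑ i, ∑ j, covMat G Γ f e T p i j * covMat G Γ f e T p j i := by
    have a1 : ∑ i, ∑ j, covMat G Γ f e ν p i j * covMat G Γ f e T p j i =
        ∑ i, ∑ j, covMat G Γ f e T p i j * covMat G Γ f e ν p j i := by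
      rw [Finset.sum_comm]
      exact Finset.sum_congr rfl fun i _ => Finset.sum_congr rfl fun j _ => mul_comm _ _
    have a2 : ∀ i j, (φ p * covMat G Γ f e ν p i j + covMat G Γ f e T p i j) *
      (φ p * covMat G Γ f e ν p j i + covMat G Γ f e T p j i) =
      φ p ^ 2 * (covMat G Γ f e ν p i j * covMat G Γ f e ν p j i)
      + φ p * (covMat G Γ f e ν p i j * covMat G Γ f e T p j i)
      + φ p * (covMat G Γ f e T p i j * covMat G Γ f e ν p j i)
      + covMat G Γ f e T p i j * covMat G Γ f e T p j i := fun i j => by ring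
    simp only [a2, Finset.sum_add_distrib, ← Finset.mul_sum, a1]
    ring
  rw [sq1, sq2]
  ring

end LocalHypersurface

/-- The second derivative of the volume element. `F` is the variation, depending on time and a
point. -/
theorem LocalHypersurface.secondDeriv_volumeElement {U : Set D} {f ν : D → E} {e : Fin m → D}
    (h : LocalHypersurface Ω G Γ U f ν e) {p : D} (hp : p ∈ U) (h1 : gram G f e p = 1)
    {F : ℝ × D → E} {W : Set (ℝ × D)} (hW : IsOpen W) (hF : ContDiffOn ℝ ∞ F W)
    (hFΩ : MapsTo F W Ω) (hpW : ((0 : ℝ), p) ∈ W) (hf : ∀ᶠ y in 𝓝 p, F (0, y) = f y) :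
    HasDerivAt (deriv fun t : ℝ => √(gram G F (fun i => ((0 : ℝ), e i)) (t, p)).det)
      (secondVariationForm Ω G Γ f ν e (fun y => fderiv ℝ F (0, y) (1, 0))
        (fun y => cov Γ F (fun q => fderiv ℝ F q (1, 0)) (1, 0) (0, y)) p) 0 := by
  set e' : Fin m → ℝ × D := fun i => ((0 : ℝ), e i) with he'
  set u : ℝ × D := (1, 0) with hu
  set X : ℝ × D → E := fun q => fderiv ℝ F q u with hX
  have hLM := h.metric
  have sF : ∀ v, ContDiffOn ℝ ∞ (fun q => fderiv ℝ F q v) W := fun v =>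
    (hF.fderiv_of_isOpen hW (by simp)).clm_apply contDiffOn_const
  have sfr : ∀ i, ContDiffOn ℝ ∞ (frame F e' i) W := fun i => sF (e' i)
  have sD : ∀ i, ContDiffOn ℝ ∞ (cov Γ F (frame F e' i) u) W := fun i =>
    hLM.contDiffOn_cov hW hF hFΩ (sfr i) u
  have sX : ContDiffOn ℝ ∞ X W := sF u
  have curve : ∀ (φ : ℝ × D → ℝ) (t : ℝ), DifferentiableAt ℝ φ (t, p) →
      HasDerivAt (fun t => φ (t, p)) (fderiv ℝ φ (t, p) u) t := by
    intro φ t hφ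
    have : HasDerivAt (fun t : ℝ => (t, p)) u t := (hasDerivAt_id t).prodMk (hasDerivAt_const t p)
    exact hφ.hasFDerivAt.comp_hasDerivAt t this
  have near : ∀ᶠ t in 𝓝 (0 : ℝ), (t, p) ∈ W :=
    (Continuous.tendsto' (by fun_prop : Continuous fun t : ℝ => (t, p)) 0 (0, p) rfl).eventually
      (hW.mem_nhds hpW)
  have dI : ∀ {V V' : ℝ × D → E} {q : ℝ × D}, q ∈ W → ContDiffOn ℝ ∞ V W → ContDiffOn ℝ ∞ V' W →
      DifferentiableAt ℝ (fun q => G (F q) (V q) (V' q)) q ∧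
      fderiv ℝ (fun q => G (F q) (V q) (V' q)) q u =
      G (F q) (cov Γ F V u q) (V' q) + G (F q) (V q) (cov Γ F V' u q) := by
    intro V V' q hq hV hV'
    exact ⟨differentiableAt_of_contDiffOn hW hq (hLM.contDiffOn_inner hF hFΩ hV hV'),
      hLM.fderiv_inner hW hF hFΩ hq (differentiableAt_of_contDiffOn hW hq hV)
      (differentiableAt_of_contDiffOn hW hq hV') u⟩
  set M' : ℝ × D → Matrix (Fin m) (Fin m) ℝ := fun q => Matrix.of fun i j =>
    G (F q) (cov Γ F (frame F e' i) u q) (frame F e' j q)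
      + G (F q) (frame F e' i q) (cov Γ F (frame F e' j) u q) with hM'
  set M'' : Matrix (Fin m) (Fin m) ℝ := Matrix.of fun i j =>
    G (F (0, p)) (cov Γ F (cov Γ F (frame F e' i) u) u (0, p)) (frame F e' j (0, p))
      + G (F (0, p)) (cov Γ F (frame F e' i) u (0, p)) (cov Γ F (frame F e' j) u (0, p))
      + (G (F (0, p)) (cov Γ F (frame F e' i) u (0, p)) (cov Γ F (frame F e' j) u (0, p))
      + G (F (0, p)) (frame F e' i (0, p)) (cov Γ F (cov Γ F (frame F e' j) u) u (0, p))) with hM''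
  have hFf : F (0, p) = f p := hf.self_of_nhds
  have embed : HasFDerivAt (fun y : D => ((0 : ℝ), y)) (ContinuousLinearMap.inr ℝ ℝ D) p :=
    hasFDerivAt_prodMk_right 0 p
  have restrict : ∀ {V : ℝ × D → E}, DifferentiableAt ℝ V (0, p) → ∀ v,
      fderiv ℝ (fun y => V (0, y)) p v = fderiv ℝ V (0, p) (0, v) := by
    intro V hV v
    have := (hV.hasFDerivAt.comp p embed).fderiv
    change fderiv ℝ (fun y => V (0, y)) p = _ at this
    rw [this]; simp
  have hfr : ∀ i, frame F e' i (0, p) = frame f e i p := by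
    intro i
    have hf' : f =ᶠ[𝓝 p] fun y => F (0, y) := by
      filter_upwards [hf] with y hy using hy.symm
    rw [frame, frame, hf'.fderiv_eq, restrict (differentiableAt_of_contDiffOn hW hpW hF)]
  have hcovr : ∀ {V : ℝ × D → E}, ContDiffOn ℝ ∞ V W → ∀ i,
      cov Γ F V (e' i) (0, p) = cov Γ f (fun y => V (0, y)) (e i) p := by
    intro V hV i
    rw [cov, cov, restrict (differentiableAt_of_contDiffOn hW hpW hV), hFf]
    congr 2
    exact hfr i
  have hg0 : gram G F e' (0, p) = 1 := by
    rw [← h1]; ext i j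
    simp only [gram, Matrix.of_apply, hfr, hFf]
  have hmain := secondDeriv_sqrt_det (M := fun t => gram G F e' (t, p)) (M' := fun t => M' (t, p))
    (M'' := M'') ?_ ?_ hg0
  · refine hmain.congr_deriv ?_
    have hs := hLM.symm _ (h.mapsTo hp)
    have hDX : ∀ i, cov Γ F (frame F e' i) u (0, p) = cov Γ f (fun y => X (0, y)) (e i) p := by
      intro i
      rw [← hcovr sX]
      exact hLM.cov_fderiv_comm hW hF hFΩ hpW u (e' i)
    -- `∇_t ∇_t ∂_i F = ∇_t ∇_i X = ∇_i ∇_t X + R(X, ∂_i f) X`. The first equality is needed in a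
    -- neighbourhood, since it gets differentiated.
    have hDDX : ∀ i, cov Γ F (cov Γ F (frame F e' i) u) u (0, p) =
        cov Γ f (fun y => cov Γ F X u (0, y)) (e i) p
        + curv Ω Γ (f p) (X (0, p)) (frame f e i p) (X (0, p)) := by
      intro i
      have e1 : cov Γ F (frame F e' i) u =ᶠ[𝓝 (0, p)] cov Γ F X (e' i) := by
        filter_upwards [hW.mem_nhds hpW] with q hq
        exact hLM.cov_fderiv_comm hW hF hFΩ hq u (e' i)
      rw [cov_congr e1, hLM.cov_comm hW hF hFΩ hpW sX, hFf,
        hcovr (hLM.contDiffOn_cov hW hF hFΩ sX u)]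
      congr 2
      exact hfr i
    -- The tangential squares `Σ P_ij²` cancel against those in `tr M'² = 2 Σ P_ij² + 2 tr P²`,
    -- where `M' = P + Pᵀ`. Of `|∇_i X|²` only the normal part survives.
    have hcov2 : ∀ i, G (f p) (cov Γ f (fun y => X (0, y)) (e i) p)
        (cov Γ f (fun y => X (0, y)) (e i) p) =
        ∑ j, covMat G Γ f e (fun y => X (0, y)) p i j * covMat G Γ f e (fun y => X (0, y)) p i j
        + G (f p) (cov Γ f (fun y => X (0, y)) (e i) p) (ν p) ^ 2 := by
      intro i
      rw [h.inner_eq hp h1, sq]; rfl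
    have hM'0 : ∀ i j, M' (0, p) i j = covMat G Γ f e (fun y => X (0, y)) p i j
        + covMat G Γ f e (fun y => X (0, y)) p j i := by
      intro i j
      simp only [hM', Matrix.of_apply, hDX, hfr, hFf, covMat]
      rw [hs (frame f e i p)]
    have hM''0 : ∀ i, M'' i i = 2 * (G (f p) (cov Γ f (fun y => cov Γ F X u (0, y)) (e i) p)
          (frame f e i p)
        + G (f p) (curv Ω Γ (f p) (X (0, p)) (frame f e i p) (X (0, p))) (frame f e i p)
        + (∑ j, covMat G Γ f e (fun y => X (0, y)) p i j * covMat G Γ f e (fun y => X (0, y)) p i j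
        + G (f p) (cov Γ f (fun y => X (0, y)) (e i) p) (ν p) ^ 2)) := by
      intro i
      simp only [hM'', Matrix.of_apply, hDX, hDDX, hfr, hFf, hcov2]
      rw [hs (frame f e i p)]
      simp only [Bil.add_left]
      ring
    set P := covMat G Γ f e (fun y => X (0, y)) p with hP
    have htr : (M' (0, p)).trace = 2 * ∑ i, P i i := by
      simp only [Matrix.trace, Matrix.diag, hM'0, Finset.sum_add_distrib]
      ring
    have htr2 : (M' (0, p) * M' (0, p)).trace =
        2 * ∑ i, ∑ j, P i j * P i j + 2 * ∑ i, ∑ j, P i j * P j i := by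
      simp only [Matrix.trace, Matrix.diag, Matrix.mul_apply, hM'0]
      have a1 : ∑ i, ∑ j, P j i * P j i = ∑ i, ∑ j, P i j * P i j := Finset.sum_comm
      have a2 : ∀ i j, (P i j + P j i) * (P j i + P i j) =
        P i j * P i j + 2 * (P i j * P j i) + P j i * P j i := fun i j => by ring
      simp only [a2, Finset.sum_add_distrib, ← Finset.mul_sum, a1]
      ring
    have htr3 : M''.trace = ∑ i, M'' i i := rfl
    rw [htr, htr2, htr3, secondVariationForm]
    simp only [hM''0, ← Finset.mul_sum, Finset.sum_add_distrib]
    ring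
  · filter_upwards [near] with t ht i j
    refine (curve (fun q => gram G F e' q i j) t (dI ht (sfr i) (sfr j)).1).congr_deriv ?_
    exact (dI ht (sfr i) (sfr j)).2
  · intro i j
    have a := dI hpW (sD i) (sfr j)
    have b := dI hpW (sfr i) (sD j)
    refine ((curve _ 0 a.1).add (curve _ 0 b.1)).congr_deriv ?_
    rw [a.2, b.2]
    rfl

end SecondVariationFormula

/-! ### Charts of the ambient manifold: metric, Christoffel symbols, coordinate changes. -/

section Transformation

variable {E : Type*} [NormedAddCommGroup E] [NormedSpace ℝ E]
  {Ωa Ωb : Set E} {Ga Gb : E → Bil E ℝ} {Γa Γb : E → Bil E E}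

/-- The transformation law of the Levi-Civita connection under a local isometry `ψ`. -/
theorem LocalMetric.transform (ha : LocalMetric Ωa Ga Γa) (hb : LocalMetric Ωb Gb Γb)
    {ψ : E → E} {z : E} (hz : z ∈ Ωb) (hψ : ContDiffWithinAt ℝ ∞ ψ Ωb z)
    (hmaps : ∀ᶠ y in 𝓝[Ωb] z, ψ y ∈ Ωa)
    (hiso : ∀ᶠ y in 𝓝[Ωb] z, ∀ v w, Gb y v w =
      Ga (ψ y) (fderivWithin ℝ ψ Ωb y v) (fderivWithin ℝ ψ Ωb y w))
    (hsurj : Function.Surjective (fderivWithin ℝ ψ Ωb z)) (v w : E) :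
    fderivWithin ℝ ψ Ωb z (Γb z v w) = fderivWithin ℝ (fderivWithin ℝ ψ Ωb) Ωb z v w
      + Γa (ψ z) (fderivWithin ℝ ψ Ωb z v) (fderivWithin ℝ ψ Ωb z w) := by
  set L := fderivWithin ℝ ψ Ωb z with hL
  set L2 := fderivWithin ℝ (fderivWithin ℝ ψ Ωb) Ωb z with hL2
  have hψz : ψ z ∈ Ωa := hmaps.self_of_nhdsWithin hz
  have huniq := hb.uniq z hz
  have hs2 : ∀ a b, L2 a b = L2 b a := fun a b =>
    hψ.isSymmSndFDerivWithinAt (by simp; norm_cast) hb.uniq (hb.accum hz) hz a b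
  have hd2 : HasFDerivWithinAt (fderivWithin ℝ ψ Ωb) L2 Ωb z :=
    ((hψ.fderivWithin_right (m := 1) hb.uniq (by norm_cast) hz).differentiableWithinAt
      (by simp)).hasFDerivWithinAt
  have hd1 : HasFDerivWithinAt ψ L Ωb z := (hψ.differentiableWithinAt (by simp)).hasFDerivWithinAt
  have hGψ : HasFDerivWithinAt (fun y => Ga (ψ y)) ((fderivWithin ℝ Ga Ωa (ψ z)).comp L) Ωb z := by
    have h1 : HasFDerivWithinAt Ga (fderivWithin ℝ Ga Ωa (ψ z)) Ωa (ψ z) :=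
      (ha.differentiableG hψz).hasFDerivWithinAt
    -- `ψ` maps into `Ωa` only near `z`. Intersecting with a relative neighbourhood does not change
    -- the derivative.
    set N := {y | ψ y ∈ Ωa} with hN
    have h2 : HasFDerivWithinAt (fun y => Ga (ψ y)) ((fderivWithin ℝ Ga Ωa (ψ z)).comp L)
        (Ωb ∩ N) z := h1.comp z (hd1.mono inter_subset_left) fun y hy => hy.2
    exact (hasFDerivWithinAt_inter' (show N ∈ 𝓝[Ωb] z from hmaps)).1 h2
  -- `S` is the defect in the transformation law. It is symmetric because both connections are
  -- torsion-free, and differentiating the isometry relation shows that `⟨S(u, a), L b⟩` is skew in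
  -- `a` and `b`. A trilinear form that is symmetric in the first two slots and skew in the last two
  -- vanishes; this is Koszul's argument.
  set S : E → E → E := fun a b => L2 a b + Γa (ψ z) (L a) (L b) - L (Γb z a b) with hS
  have hSsymm : ∀ a b, S a b = S b a := by
    intro a b
    simp only [hS]
    rw [hs2 a b, ha.torsion _ hψz, hb.torsion _ hz]
  have key : ∀ u a b, Ga (ψ z) (S u a) (L b) + Ga (ψ z) (L a) (S u b) = 0 := by
    intro u a b
    have e1 := hGψ.bil_apply (hd2.clm_apply (hasFDerivWithinAt_const a z Ωb))
      (hd2.clm_apply (hasFDerivWithinAt_const b z Ωb))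
    have e2 := (hb.differentiableG hz).hasFDerivWithinAt.bil_apply
      (hasFDerivWithinAt_const a z Ωb) (hasFDerivWithinAt_const b z Ωb)
    have e3 := e1.congr_of_eventuallyEq (f₁ := fun y => Gb y a b)
      (by filter_upwards [hiso] with y hy using hy a b) (hiso.self_of_nhdsWithin hz a b)
    have e4 := UniqueDiffWithinAt.eq huniq e2 e3
    have e5 := congrArg (fun T : E →L[ℝ] ℝ => T u) e4
    have hiz := hiso.self_of_nhdsWithin hz
    simp [hb.compat z hz, ha.compat _ hψz, hiz] at e5
    simp only [hS, Bil.add_left, Bil.sub_left, Bil.add_right, Bil.sub_right]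
    linarith
  have hzero : ∀ a b c, Ga (ψ z) (S a b) (L c) = 0 := by
    intro a b c
    have k1 := key a b c
    have k2 := key b c a
    have k3 := key c a b
    have sy : ∀ x y, Ga (ψ z) x y = Ga (ψ z) y x := ha.symm _ hψz
    rw [sy (L b)] at k1
    rw [sy (L c)] at k2
    rw [sy (L a)] at k3
    rw [hSsymm a c] at k1
    rw [hSsymm b a] at k2
    rw [hSsymm c b] at k3
    linarith
  have : S v w = 0 := by
    obtain ⟨c, hc⟩ := hsurj (S v w)
    by_contra hne
    have := ha.pos _ hψz _ hne
    have h0 := hzero v w c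
    rw [hc] at h0
    linarith
  simp only [hS, sub_eq_zero] at this
  exact this.symm

end Transformation

section ChartMetric

variable {n : ℕ} [NeZero n] {M : Type*} [TopologicalSpace M]
  [ChartedSpace (EuclideanHalfSpace n) M] [IsManifold (𝓡∂ n) ∞ M]

/-- The components of a tangent vector at `q` in the preferred chart at `c`. -/
noncomputable def reading (c q : M) (v : TangentSpace (𝓡∂ n) q) : Coord n :=
  (trivializationAt (Coord n) (fun y : M => TangentSpace (𝓡∂ n) y) c
    (TotalSpace.mk' (Coord n) q v)).2

variable {c q : M}

theorem mem_baseSet (hq : q ∈ (chartAt (EuclideanHalfSpace n) c).source) :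
    q ∈ (trivializationAt (Coord n) (fun y : M => TangentSpace (𝓡∂ n) y) c).baseSet := by
  rwa [TangentBundle.trivializationAt_baseSet]

theorem reading_eq_clm (hq : q ∈ (chartAt (EuclideanHalfSpace n) c).source)
    (v : TangentSpace (𝓡∂ n) q) : reading c q v =
      (trivializationAt (Coord n) (fun y : M => TangentSpace (𝓡∂ n) y) c).continuousLinearMapAt ℝ q
        v := by
  rw [Trivialization.continuousLinearMapAt_apply, Trivialization.coe_linearMapAt_of_mem _
    (mem_baseSet hq)]
  rfl

theorem coordVec_eq_clm (hq : q ∈ (chartAt (EuclideanHalfSpace n) c).source) (v : Coord n) :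
    coordVec c q v =
      (trivializationAt (Coord n) (fun y : M => TangentSpace (𝓡∂ n) y) c).symmL ℝ q v := by
  rw [Trivialization.symmL_apply _ (mem_baseSet hq)]
  rfl

theorem reading_eq_mfderiv (hq : q ∈ (chartAt (EuclideanHalfSpace n) c).source)
    (v : TangentSpace (𝓡∂ n) q) :
    reading c q v = mfderiv (𝓡∂ n) 𝓘(ℝ, Coord n) (extChartAt (𝓡∂ n) c) q v := by
  have : IsManifold (𝓡∂ n) 1 M := IsManifold.of_le (n := ∞) (by simp)
  rw [reading_eq_clm hq, TangentBundle.continuousLinearMapAt_trivializationAt hq]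
  rfl

theorem reading_add (hq : q ∈ (chartAt (EuclideanHalfSpace n) c).source)
    (v w : TangentSpace (𝓡∂ n) q) : reading c q (v + w) = reading c q v + reading c q w := by
  simp only [reading_eq_clm hq, map_add]

theorem reading_smul (hq : q ∈ (chartAt (EuclideanHalfSpace n) c).source) (r : ℝ)
    (v : TangentSpace (𝓡∂ n) q) : reading c q (r • v) = r • reading c q v := by
  simp only [reading_eq_clm hq, map_smul]

theorem coordVec_add (hq : q ∈ (chartAt (EuclideanHalfSpace n) c).source) (v w : Coord n) :
    coordVec c q (v + w) = coordVec c q v + coordVec c q w := by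
  simp only [coordVec_eq_clm hq, map_add]

theorem coordVec_smul (hq : q ∈ (chartAt (EuclideanHalfSpace n) c).source) (r : ℝ) (v : Coord n) :
    coordVec c q (r • v) = r • coordVec c q v := by
  simp only [coordVec_eq_clm hq, map_smul]

theorem coordVec_sum (hq : q ∈ (chartAt (EuclideanHalfSpace n) c).source) {ι : Type*}
    (s : Finset ι) (v : ι → Coord n) :
    coordVec c q (∑ i ∈ s, v i) = ∑ i ∈ s, coordVec c q (v i) := by
  simp only [coordVec_eq_clm hq, map_sum]

theorem reading_coordVec (hq : q ∈ (chartAt (EuclideanHalfSpace n) c).source) (v : Coord n) :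
    reading c q (coordVec c q v) = v := by
  rw [reading_eq_clm hq, coordVec_eq_clm hq,
    Trivialization.continuousLinearMapAt_symmL _ (mem_baseSet hq)]

theorem coordVec_reading (hq : q ∈ (chartAt (EuclideanHalfSpace n) c).source)
    (v : TangentSpace (𝓡∂ n) q) : coordVec c q (reading c q v) = v := by
  rw [reading_eq_clm hq, coordVec_eq_clm hq,
    Trivialization.symmL_continuousLinearMapAt _ (mem_baseSet hq)]

theorem reading_self (q : M) (v : TangentSpace (𝓡∂ n) q) : reading q q v = v := by
  have : IsManifold (𝓡∂ n) 1 M := IsManifold.of_le (n := ∞) (by simp)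
  rw [reading_eq_mfderiv (mem_chart_source _ q), mfderiv_extChartAt_self]
  rfl

/-- The rank one bilinear map `(v, w) ↦ (v_i w_j) a`. -/
noncomputable def elemBil {F : Type*} [NormedAddCommGroup F] [NormedSpace ℝ F] (i j : Fin n)
    (a : F) : Bil (Coord n) F :=
  Bil.mk ((EuclideanSpace.proj i : Coord n →L[ℝ] ℝ).smulRight
    ((EuclideanSpace.proj j : Coord n →L[ℝ] ℝ).smulRight a))

omit [NeZero n] in
@[simp] theorem elemBil_apply {F : Type*} [NormedAddCommGroup F] [NormedSpace ℝ F] (i j : Fin n)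
    (a : F) (v w : Coord n) : elemBil i j a v w = v i • w j • a := by
  simp [elemBil]

/-- The metric in the preferred chart at `c`. -/
noncomputable def chartMetric (g : RMetric n M) (c : M) (y : Coord n) : Bil (Coord n) ℝ :=
  ∑ i, ∑ j, metricMatrix g c y i j • elemBil i j (1 : ℝ)

/-- The Levi-Civita connection in the preferred chart at `c`. -/
noncomputable def chartGamma (g : RMetric n M) (c : M) (y : Coord n) : Bil (Coord n) (Coord n) :=
  ∑ k, ∑ i, ∑ j, christoffel g c y k i j • elemBil i j (stdVec k)

omit [NeZero n] in
theorem sum_stdVec (v : Coord n) : ∑ i, v i • (stdVec i : Coord n) = v := by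
  have := (EuclideanSpace.basisFun (Fin n) ℝ).sum_repr v
  simpa using this

variable (g : RMetric n M)

theorem chartMetric_apply' (c : M) (y v w : Coord n) :
    chartMetric g c y v w = ∑ i, ∑ j, metricMatrix g c y i j * v i * w j := by
  simp only [chartMetric, Bil.sum_apply, Bil.smul_apply, elemBil_apply, smul_eq_mul, mul_one, mul_assoc]

theorem chartMetric_stdVec (c : M) (y : Coord n) (i j : Fin n) :
    chartMetric g c y (stdVec i) (stdVec j) = metricMatrix g c y i j := by
  rw [chartMetric_apply', Finset.sum_eq_single i, Finset.sum_eq_single j] <;> simp +contextual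

theorem chartMetric_apply {y : Coord n} (hy : y ∈ (extChartAt (𝓡∂ n) c).target) (v w : Coord n) :
    chartMetric g c y v w = g.inner ((extChartAt (𝓡∂ n) c).symm y)
      (coordVec c ((extChartAt (𝓡∂ n) c).symm y) v)
      (coordVec c ((extChartAt (𝓡∂ n) c).symm y) w) := by
  have hq : (extChartAt (𝓡∂ n) c).symm y ∈ (chartAt (EuclideanHalfSpace n) c).source := by
    rw [← extChartAt_source (𝓡∂ n)]; exact (extChartAt (𝓡∂ n) c).map_target hy
  conv_rhs => rw [← sum_stdVec v, ← sum_stdVec w]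
  rw [chartMetric_apply', coordVec_sum hq, coordVec_sum hq]
  simp only [coordVec_smul hq, map_sum, map_smul, _root_.sum_apply, _root_.smul_apply, smul_eq_mul,
    metricMatrix, Matrix.of_apply, Finset.mul_sum]
  rw [Finset.sum_comm]
  exact Finset.sum_congr rfl fun j _ => Finset.sum_congr rfl fun i _ => by ring

theorem inner_eq_chartMetric (hq : q ∈ (chartAt (EuclideanHalfSpace n) c).source)
    (v w : TangentSpace (𝓡∂ n) q) :
    g.inner q v w = chartMetric g c (extChartAt (𝓡∂ n) c q) (reading c q v) (reading c q w) := by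
  have hq' : q ∈ (extChartAt (𝓡∂ n) c).source := by rwa [extChartAt_source]
  rw [chartMetric_apply g ((extChartAt (𝓡∂ n) c).map_source hq'),
    (extChartAt (𝓡∂ n) c).left_inv hq', coordVec_reading hq, coordVec_reading hq]

theorem contMDiffOn_coordVec (c : M) (v : Coord n) :
    ContMDiffOn (𝓡∂ n) (𝓡∂ n).tangent ∞
      (fun q => (⟨q, coordVec c q v⟩ : TangentBundle (𝓡∂ n) M))
      (chartAt (EuclideanHalfSpace n) c).source := by
  have : IsManifold (𝓡∂ n) 1 M := IsManifold.of_le (n := ∞) (by simp)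
  intro q hq
  have h1 := mem_baseSet hq
  have := (Trivialization.contMDiffWithinAt_section
    (e := trivializationAt (Coord n) (fun y : M => TangentSpace (𝓡∂ n) y) c) (IB := 𝓡∂ n) (n := ∞)
    (s := fun q => coordVec c q v) (a := (chartAt (EuclideanHalfSpace n) c).source) h1).2
  refine this ?_
  refine (contMDiffWithinAt_const (c := v)).congr (fun y hy => reading_coordVec hy v) ?_
  exact reading_coordVec hq v

end ChartMetric

section ChartMetric

variable {n : ℕ} [NeZero n] {M : Type*} [TopologicalSpace M]
  [ChartedSpace (EuclideanHalfSpace n) M] [IsManifold (𝓡∂ n) ∞ M] {c q : M} (g : RMetric n M)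

theorem contMDiffWithinAt_inner {EN : Type*} [NormedAddCommGroup EN] [NormedSpace ℝ EN]
    {HN : Type*} [TopologicalSpace HN] {J : ModelWithCorners ℝ EN HN} {N : Type*}
    [TopologicalSpace N] [ChartedSpace HN N] {b : N → M} {v w : ∀ x, TangentSpace (𝓡∂ n) (b x)}
    {s : Set N} {x : N}
    (hv : ContMDiffWithinAt J (𝓡∂ n).tangent ∞ (fun p => (⟨b p, v p⟩ : TangentBundle (𝓡∂ n) M)) s x)
    (hw : ContMDiffWithinAt J (𝓡∂ n).tangent ∞ (fun p => (⟨b p, w p⟩ : TangentBundle (𝓡∂ n) M)) s x) :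
    ContMDiffWithinAt J 𝓘(ℝ, ℝ) ∞ (fun p => g.inner (b p) (v p) (w p)) s x := by
  have hb : ContMDiffWithinAt J (𝓡∂ n) ∞ b s x := by
    have := (contMDiffWithinAt_totalSpace.1 hv).1
    exact this
  have : ContMDiffWithinAt J ((𝓡∂ n).prod 𝓘(ℝ)) ∞
      (fun m ↦ TotalSpace.mk' ℝ (E := Bundle.Trivial M ℝ) (b m) (g.inner (b m) (v m) (w m))) s x := by
    apply ContMDiffWithinAt.clm_bundle_apply₂ (F₁ := Coord n) (F₂ := Coord n)
      (E₁ := fun x : M => TangentSpace (𝓡∂ n) x) (E₂ := fun x : M => TangentSpace (𝓡∂ n) x)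
    · exact ContMDiffAt.comp_contMDiffWithinAt x g.contMDiff.contMDiffAt hb
    · exact hv
    · exact hw
  exact (contMDiffWithinAt_totalSpace.1 this).2

theorem contDiffOn_metricMatrix (c : M) (i j : Fin n) :
    ContDiffOn ℝ ∞ (fun y => metricMatrix g c y i j) (extChartAt (𝓡∂ n) c).target := by
  have h1 : ContMDiffOn (𝓡∂ n) 𝓘(ℝ, ℝ) ∞
      (fun q => g.inner q (coordVec c q (stdVec i)) (coordVec c q (stdVec j)))
      (chartAt (EuclideanHalfSpace n) c).source := fun q hq =>
    contMDiffWithinAt_inner g (b := fun q : M => q) (contMDiffOn_coordVec c (stdVec i) q hq)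
      (contMDiffOn_coordVec c (stdVec j) q hq)
  have h2 := h1.comp (contMDiffOn_extChartAt_symm (I := 𝓡∂ n) (n := ∞) c) (fun y hy => by
    rw [mem_preimage, ← extChartAt_source (𝓡∂ n)]; exact (extChartAt (𝓡∂ n) c).map_target hy)
  exact contMDiffOn_iff_contDiffOn.1 h2

theorem metricMatrix_symm (c : M) (y : Coord n) (i j : Fin n) :
    metricMatrix g c y i j = metricMatrix g c y j i := by
  simp only [metricMatrix, Matrix.of_apply]
  exact g.symm _ _ _

theorem chartMetric_pos {y : Coord n} (hy : y ∈ (extChartAt (𝓡∂ n) c).target) {v : Coord n}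
    (hv : v ≠ 0) : 0 < chartMetric g c y v v := by
  have hq : (extChartAt (𝓡∂ n) c).symm y ∈ (chartAt (EuclideanHalfSpace n) c).source := by
    rw [← extChartAt_source (𝓡∂ n)]; exact (extChartAt (𝓡∂ n) c).map_target hy
  rw [chartMetric_apply g hy]
  refine g.pos _ _ fun h => hv ?_
  have := reading_coordVec hq v
  rw [h, reading_eq_clm hq, map_zero] at this
  exact this.symm

theorem metricMatrix_posDef {y : Coord n} (hy : y ∈ (extChartAt (𝓡∂ n) c).target) :
    (metricMatrix g c y).PosDef := by
  refine Matrix.PosDef.of_dotProduct_mulVec_pos ?_ fun v hv => ?_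
  · ext i j
    simp [metricMatrix_symm g c y i j]
  · have h1 : (WithLp.toLp 2 v : Coord n) ≠ 0 := fun h => hv (by
      ext i; exact congrArg (fun x : Coord n => x i) h)
    have := chartMetric_pos g hy h1
    rw [chartMetric_apply'] at this
    refine this.trans_eq (Finset.sum_congr rfl fun i _ => ?_)
    simp only [Matrix.mulVec, dotProduct, Finset.mul_sum, star_trivial]
    exact Finset.sum_congr rfl fun j _ => by ring

theorem metricMatrix_det_ne {y : Coord n} (hy : y ∈ (extChartAt (𝓡∂ n) c).target) :
    (metricMatrix g c y).det ≠ 0 := (metricMatrix_posDef g hy).det_pos.ne'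

/-- The chart target is a neighbourhood of each of its points in the half-space. The definitions
differentiate within the half-space, the local theory within the target. -/
theorem fderivWithin_target {F : Type*} [NormedAddCommGroup F] [NormedSpace ℝ F]
    (u : Coord n → F) {y : Coord n} (hy : y ∈ (extChartAt (𝓡∂ n) c).target) :
    fderivWithin ℝ u (range (𝓡∂ n)) y = fderivWithin ℝ u (extChartAt (𝓡∂ n) c).target y :=
  fderivWithin_congr_set (extChartAt_target_eventuallyEq_of_mem hy).symm

theorem contDiffOn_partialDeriv {u : Coord n → ℝ}
    (hu : ContDiffOn ℝ ∞ u (extChartAt (𝓡∂ n) c).target) (i : Fin n) :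
    ContDiffOn ℝ ∞ (fun y => partialDeriv u y i) (extChartAt (𝓡∂ n) c).target := by
  have h1 : ContDiffOn ℝ ∞ (fun y => fderivWithin ℝ u (extChartAt (𝓡∂ n) c).target y (stdVec i))
      (extChartAt (𝓡∂ n) c).target :=
    (hu.fderivWithin (uniqueDiffOn_extChartAt_target c) (by simp)).clm_apply contDiffOn_const
  refine h1.congr fun y hy => ?_
  rw [partialDeriv, fderivWithin_target u hy]

theorem contDiffOn_christoffel (c : M) (k i j : Fin n) :
    ContDiffOn ℝ ∞ (fun y => christoffel g c y k i j) (extChartAt (𝓡∂ n) c).target := by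
  have h1 := fun a b d => contDiffOn_partialDeriv (contDiffOn_metricMatrix g c a b) d
  refine contDiffOn_const.mul (ContDiffOn.sum fun l _ => ContDiffOn.mul ?_ ?_)
  · exact contDiffOn_inv (contDiffOn_metricMatrix g c) (fun y hy => metricMatrix_det_ne g hy) k l
  · exact ((h1 j l i).add (h1 i l j)).sub (h1 i j l)

theorem christoffel_symm (c : M) (y : Coord n) (k i j : Fin n) :
    christoffel g c y k i j = christoffel g c y k j i := by
  simp only [christoffel]
  congr 1
  refine Finset.sum_congr rfl fun l _ => ?_
  rw [funext fun z => metricMatrix_symm g c z i j, add_comm (partialDeriv _ y i)]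

theorem chartGamma_apply (c : M) (y v w : Coord n) :
    chartGamma g c y v w = WithLp.toLp 2 fun k => ∑ i, ∑ j, christoffel g c y k i j * v i * w j := by
  ext k
  simp only [chartGamma, Bil.sum_apply, Bil.smul_apply, elemBil_apply, WithLp.ofLp_sum, Finset.sum_apply,
    WithLp.ofLp_smul, Pi.smul_apply, smul_eq_mul]
  rw [Finset.sum_eq_single k]
  · simp [mul_assoc]
  · intro b _ hb
    simp [hb.symm]
  · simp

theorem christoffelVec_eq (c : M) (v w : Coord n) :
    christoffelVec g c v w = chartGamma g c (extChartAt (𝓡∂ n) c c) v w := by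
  rw [chartGamma_apply]; rfl

/-- Lowering the index cancels the inverse metric and leaves the Christoffel symbols of the first
kind. -/
theorem metric_christoffel {y : Coord n} (hy : y ∈ (extChartAt (𝓡∂ n) c).target) (i j l : Fin n) :
    ∑ k, metricMatrix g c y l k * christoffel g c y k i j = (1 / 2 : ℝ) *
      (partialDeriv (fun z => metricMatrix g c z j l) y i
        + partialDeriv (fun z => metricMatrix g c z i l) y j
        - partialDeriv (fun z => metricMatrix g c z i j) y l) := by
  set R : Fin n → ℝ := fun l => partialDeriv (fun z => metricMatrix g c z j l) y i
        + partialDeriv (fun z => metricMatrix g c z i l) y j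
        - partialDeriv (fun z => metricMatrix g c z i j) y l with hR
  have h1 : ∀ k, christoffel g c y k i j = (1 / 2 : ℝ) * ((metricMatrix g c y)⁻¹.mulVec R) k :=
    fun k => rfl
  have h2 : (metricMatrix g c y).mulVec ((metricMatrix g c y)⁻¹.mulVec R) = R := by
    rw [Matrix.mulVec_mulVec, Matrix.mul_nonsing_inv _ (isUnit_iff_ne_zero.2 (metricMatrix_det_ne g hy)),
      Matrix.one_mulVec]
  have h3 := congrFun h2 l
  change ∑ k, metricMatrix g c y l k * ((metricMatrix g c y)⁻¹.mulVec R) k = R l at h3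
  change _ = (1 / 2 : ℝ) * R l
  rw [← h3, Finset.mul_sum]
  exact Finset.sum_congr rfl fun k _ => by rw [h1]; ring

theorem chartMetric_chartGamma_stdVec {y : Coord n} (hy : y ∈ (extChartAt (𝓡∂ n) c).target)
    (i j l : Fin n) : chartMetric g c y (chartGamma g c y (stdVec i) (stdVec j)) (stdVec l) =
      (1 / 2 : ℝ) * (partialDeriv (fun z => metricMatrix g c z j l) y i
        + partialDeriv (fun z => metricMatrix g c z i l) y j
        - partialDeriv (fun z => metricMatrix g c z i j) y l) := by
  rw [← metric_christoffel g hy, chartMetric_apply']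
  refine Finset.sum_congr rfl fun k _ => ?_
  rw [Finset.sum_eq_single l, chartGamma_apply]
  · simp only
    rw [Finset.sum_eq_single i, Finset.sum_eq_single j] <;>
      simp +contextual [metricMatrix_symm g c y l k]
  · intro b _ hb
    simp [hb]
  · simp

theorem contDiffOn_chartMetric (c : M) :
    ContDiffOn ℝ ∞ (chartMetric g c) (extChartAt (𝓡∂ n) c).target :=
  ContDiffOn.sum fun i _ => ContDiffOn.sum fun j _ =>
    (contDiffOn_metricMatrix g c i j).smul contDiffOn_const

theorem contDiffOn_chartGamma (c : M) :
    ContDiffOn ℝ ∞ (chartGamma g c) (extChartAt (𝓡∂ n) c).target :=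
  ContDiffOn.sum fun k _ => ContDiffOn.sum fun i _ => ContDiffOn.sum fun j _ =>
    (contDiffOn_christoffel g c k i j).smul contDiffOn_const

theorem fderivWithin_chartMetric {y : Coord n} (hy : y ∈ (extChartAt (𝓡∂ n) c).target)
    (l i j : Fin n) :
    fderivWithin ℝ (chartMetric g c) (extChartAt (𝓡∂ n) c).target y (stdVec l) (stdVec i) (stdVec j)
      = partialDeriv (fun z => metricMatrix g c z i j) y l := by
  have h1 := (((contDiffOn_chartMetric g c) y hy).differentiableWithinAt
    (by simp)).hasFDerivWithinAt.bil_apply (hasFDerivWithinAt_const (stdVec i) y _)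
      (hasFDerivWithinAt_const (stdVec j) y _)
  have h2 : (fun z => metricMatrix g c z i j) =
      fun z => chartMetric g c z (stdVec i) (stdVec j) := by
    funext z; rw [chartMetric_stdVec]
  rw [partialDeriv, fderivWithin_target _ hy, h2,
    h1.fderivWithin (uniqueDiffOn_extChartAt_target c y hy)]
  simp

theorem Bil.ext_stdVec {F : Type*} [NormedAddCommGroup F] [NormedSpace ℝ F] {u v w : Coord n}
    {A B : Coord n → Coord n → Coord n → F}
    (hA1 : ∀ v w, IsLinearMap ℝ fun u => A u v w) (hA2 : ∀ u w, IsLinearMap ℝ fun v => A u v w)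
    (hA3 : ∀ u v, IsLinearMap ℝ fun w => A u v w)
    (hB1 : ∀ v w, IsLinearMap ℝ fun u => B u v w) (hB2 : ∀ u w, IsLinearMap ℝ fun v => B u v w)
    (hB3 : ∀ u v, IsLinearMap ℝ fun w => B u v w)
    (h : ∀ l i j, A (stdVec l) (stdVec i) (stdVec j) = B (stdVec l) (stdVec i) (stdVec j)) :
    A u v w = B u v w := by
  have ext1 : ∀ {f k : Coord n → F}, IsLinearMap ℝ f → IsLinearMap ℝ k →
      (∀ i, f (stdVec i) = k (stdVec i)) → ∀ x, f x = k x := by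
    intro f k hf hk hfk x
    have := LinearMap.congr_fun (f := hf.mk' f) (g := hk.mk' k)
      ((EuclideanSpace.basisFun (Fin n) ℝ).toBasis.ext fun i => by simpa using hfk i) x
    exact this
  refine ext1 (hA1 v w) (hB1 v w) (fun l => ?_) u
  refine ext1 (hA2 _ w) (hB2 _ w) (fun i => ?_) v
  exact ext1 (hA3 _ _) (hB3 _ _) (fun j => h l i j) w

/-- This brings the charts of `M` into the local theory. Compatibility is checked on basis vectors,
where two Christoffel symbols of the first kind add up to a partial derivative of the metric. -/
theorem localMetric (c : M) :
    LocalMetric (extChartAt (𝓡∂ n) c).target (chartMetric g c) (chartGamma g c) where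
  uniq := uniqueDiffOn_extChartAt_target c
  accum := by
    intro z hz
    rw [extChartAt_target] at hz ⊢
    have ho : IsOpen ((𝓡∂ n).symm ⁻¹' (chartAt (EuclideanHalfSpace n) c).target) :=
      (chartAt (EuclideanHalfSpace n) c).open_target.preimage (𝓡∂ n).continuous_symm
    have h1 := ho.inter_closure ⟨hz.1, (𝓡∂ n).range_subset_closure_interior hz.2⟩
    rwa [interior_inter, ho.interior_eq]
  smoothG := contDiffOn_chartMetric g c
  smoothΓ := contDiffOn_chartGamma g c
  symm := by
    intro z _ v w
    rw [chartMetric_apply', chartMetric_apply', Finset.sum_comm]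
    exact Finset.sum_congr rfl fun j _ => Finset.sum_congr rfl fun i _ => by
      rw [metricMatrix_symm g c z i j]; ring
  pos := fun z hz v hv => chartMetric_pos g hz hv
  torsion := by
    intro z _ v w
    rw [chartGamma_apply, chartGamma_apply]
    congr 1
    funext k
    rw [Finset.sum_comm]
    exact Finset.sum_congr rfl fun j _ => Finset.sum_congr rfl fun i _ => by
      rw [christoffel_symm g c z k i j]; ring
  compat := by
    intro z hz u v w
    refine Bil.ext_stdVec
      (A := fun u v w => fderivWithin ℝ (chartMetric g c) (extChartAt (𝓡∂ n) c).target z u v w)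
      (B := fun u v w => chartMetric g c z (chartGamma g c z u v) w
        + chartMetric g c z v (chartGamma g c z u w))
      (fun _ _ => ⟨fun _ _ => by simp, fun _ _ => by simp⟩)
      (fun _ _ => ⟨fun _ _ => by simp, fun _ _ => by simp⟩)
      (fun _ _ => ⟨fun _ _ => by simp, fun _ _ => by simp⟩)
      (fun _ _ => ⟨fun _ _ => by simp; ring, fun _ _ => by simp; ring⟩)
      (fun _ _ => ⟨fun _ _ => by simp; ring, fun _ _ => by simp; ring⟩)
      (fun _ _ => ⟨fun _ _ => by simp; ring, fun _ _ => by simp; ring⟩) ?_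
    intro l i j
    have hsymm : ∀ v w, chartMetric g c z v w = chartMetric g c z w v := by
      intro v w
      rw [chartMetric_apply', chartMetric_apply', Finset.sum_comm]
      exact Finset.sum_congr rfl fun j _ => Finset.sum_congr rfl fun i _ => by
        rw [metricMatrix_symm g c z i j]; ring
    rw [fderivWithin_chartMetric g hz, chartMetric_chartGamma_stdVec g hz, hsymm (stdVec i),
      chartMetric_chartGamma_stdVec g hz, funext fun z => metricMatrix_symm g c z j i]
    ring

theorem fderivWithin_chartGamma {y : Coord n} (hy : y ∈ (extChartAt (𝓡∂ n) c).target)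
    (a i j l : Fin n) :
    fderivWithin ℝ (chartGamma g c) (extChartAt (𝓡∂ n) c).target y (stdVec a) (stdVec i) (stdVec j) l
      = partialDeriv (fun z => christoffel g c z l i j) y a := by
  have h1 := (((contDiffOn_chartGamma g c) y hy).differentiableWithinAt
    (by simp)).hasFDerivWithinAt.bil_apply (hasFDerivWithinAt_const (stdVec i) y _)
      (hasFDerivWithinAt_const (stdVec j) y _)
  have h1' := (EuclideanSpace.proj l : Coord n →L[ℝ] ℝ).hasFDerivAt.comp_hasFDerivWithinAt y h1
  have h2 : (fun z => christoffel g c z l i j) =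
      (EuclideanSpace.proj l : Coord n →L[ℝ] ℝ) ∘
        fun z => chartGamma g c z (stdVec i) (stdVec j) := by
    funext z
    simp only [Function.comp, chartGamma_apply]
    change _ = ∑ i', ∑ j', christoffel g c z l i' j' * (stdVec i : Coord n) i' *
      (stdVec j : Coord n) j'
    rw [Finset.sum_eq_single i, Finset.sum_eq_single j] <;> simp +contextual
  rw [partialDeriv, fderivWithin_target _ hy, h2,
    h1'.fderivWithin (uniqueDiffOn_extChartAt_target c y hy)]
  simp

theorem curv_stdVec {y : Coord n} (hy : y ∈ (extChartAt (𝓡∂ n) c).target) (i j k l : Fin n) :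
    curv (extChartAt (𝓡∂ n) c).target (chartGamma g c) y (stdVec i) (stdVec j) (stdVec k) l =
      riemann g c y l k i j := by
  have hΓ : ∀ i j, chartGamma g c y (stdVec i) (stdVec j) =
      ∑ p, christoffel g c y p i j • (stdVec p : Coord n) := by
    intro i j
    rw [chartGamma_apply]
    ext p
    simp only [WithLp.ofLp_sum, Finset.sum_apply, WithLp.ofLp_smul, Pi.smul_apply]
    rw [Finset.sum_eq_single i, Finset.sum_eq_single j, Finset.sum_eq_single p] <;>
      simp +contextual [eq_comm]
  have hΓ' : ∀ i j, (chartGamma g c y (stdVec i) (stdVec j)) l = christoffel g c y l i j := by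
    intro i j
    rw [chartGamma_apply]
    simp only
    rw [Finset.sum_eq_single i, Finset.sum_eq_single j] <;> simp +contextual
  simp only [curv, riemann, PiLp.add_apply, PiLp.sub_apply, fderivWithin_chartGamma g hy, hΓ j k, hΓ i k,
    Bil.sum_right, Bil.smul_right, WithLp.ofLp_sum, Finset.sum_apply, PiLp.smul_apply, hΓ', smul_eq_mul,
    Finset.sum_sub_distrib]
  simp only [mul_comm]

/-- Expanding the two fixed arguments in the standard basis reduces the trace to `curv_stdVec`. -/
theorem ricci_eq (q : M) (v w : Coord n) : ricci g q v w =
    ∑ l, curv (extChartAt (𝓡∂ n) q).target (chartGamma g q) (extChartAt (𝓡∂ n) q q)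
      (stdVec l) v w l := by
  have hy := mem_extChartAt_target (I := 𝓡∂ n) q
  have hc : ∀ l, curv (extChartAt (𝓡∂ n) q).target (chartGamma g q) (extChartAt (𝓡∂ n) q q)
      (stdVec l) v w = ∑ j, ∑ k, (v j * w k) • curv (extChartAt (𝓡∂ n) q).target (chartGamma g q)
        (extChartAt (𝓡∂ n) q q) (stdVec l) (stdVec j) (stdVec k) := by
    intro l
    conv_lhs => rw [← sum_stdVec v, ← sum_stdVec w]
    have L1 : ∀ (x b : Coord n), IsLinearMap ℝ fun a => curv (extChartAt (𝓡∂ n) q).target (chartGamma g q)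
        (extChartAt (𝓡∂ n) q q) (stdVec l) a b := fun x b =>
      ⟨fun a a' => by
        rw [curv_antisymm, curv_add_left, curv_antisymm _ a, curv_antisymm _ a']; abel,
       fun r a => by rw [curv_antisymm, curv_smul_left, curv_antisymm _ a, smul_neg, neg_neg]⟩
    have L2 : ∀ (a : Coord n), IsLinearMap ℝ fun b => curv (extChartAt (𝓡∂ n) q).target (chartGamma g q)
        (extChartAt (𝓡∂ n) q q) (stdVec l) a b := fun a =>
      ⟨fun b b' => curv_add_right _ _ _ _ _, fun r b => curv_smul_right _ _ _ _ _⟩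
    have e1 := map_sum ((L1 0 (∑ k, w k • stdVec k)).mk' _) (fun j => v j • (stdVec j : Coord n))
      Finset.univ
    refine e1.trans (Finset.sum_congr rfl fun j _ => ?_)
    rw [map_smul]
    have e2 := map_sum ((L2 (stdVec j)).mk' _) (fun k => w k • (stdVec k : Coord n)) Finset.univ
    have e3 := congrArg (fun x => v j • x) e2
    refine e3.trans ?_
    rw [Finset.smul_sum]
    refine Finset.sum_congr rfl fun k _ => ?_
    rw [map_smul, smul_smul]
    rfl
  simp only [hc, WithLp.ofLp_sum, Finset.sum_apply, PiLp.smul_apply, curv_stdVec g hy, smul_eq_mul]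
  rw [Finset.sum_comm]
  simp only [ricci]
  refine Finset.sum_congr rfl fun j _ => ?_
  rw [Finset.sum_comm]
  refine Finset.sum_congr rfl fun k _ => ?_
  rw [mul_assoc, Finset.sum_mul]
  exact Finset.sum_congr rfl fun l _ => mul_comm _ _

end ChartMetric

section Transition

variable {n : ℕ} [NeZero n] {M : Type*} [TopologicalSpace M]
  [ChartedSpace (EuclideanHalfSpace n) M] [IsManifold (𝓡∂ n) ∞ M] {a c q : M} (g : RMetric n M)

/-- The coordinate change from the preferred chart at `c` to the preferred chart at `a`. -/
noncomputable def transition (c a : M) : Coord n → Coord n :=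
  extChartAt (𝓡∂ n) a ∘ (extChartAt (𝓡∂ n) c).symm

theorem symm_mem_source {y : Coord n} (hy : y ∈ (extChartAt (𝓡∂ n) c).target) :
    (extChartAt (𝓡∂ n) c).symm y ∈ (chartAt (EuclideanHalfSpace n) c).source := by
  rw [← extChartAt_source (𝓡∂ n)]; exact (extChartAt (𝓡∂ n) c).map_target hy

theorem extChartAt_mem_target (hq : q ∈ (chartAt (EuclideanHalfSpace n) c).source) :
    extChartAt (𝓡∂ n) c q ∈ (extChartAt (𝓡∂ n) c).target :=
  (extChartAt (𝓡∂ n) c).map_source (by rwa [extChartAt_source])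

theorem extChartAt_symm_extChartAt (hq : q ∈ (chartAt (EuclideanHalfSpace n) c).source) :
    (extChartAt (𝓡∂ n) c).symm (extChartAt (𝓡∂ n) c q) = q :=
  (extChartAt (𝓡∂ n) c).left_inv (by rwa [extChartAt_source])

theorem transition_extChartAt (hq : q ∈ (chartAt (EuclideanHalfSpace n) c).source) :
    transition c a (extChartAt (𝓡∂ n) c q) = extChartAt (𝓡∂ n) a q := by
  rw [transition, Function.comp_apply, extChartAt_symm_extChartAt hq]

theorem contDiffWithinAt_transition (hc : q ∈ (chartAt (EuclideanHalfSpace n) c).source)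
    (ha : q ∈ (chartAt (EuclideanHalfSpace n) a).source) :
    ContDiffWithinAt ℝ ∞ (transition c a) (extChartAt (𝓡∂ n) c).target (extChartAt (𝓡∂ n) c q) := by
  refine (contDiffWithinAt_ext_coord_change (I := 𝓡∂ n) a c ?_).mono (extChartAt_target_subset_range c)
  rw [PartialEquiv.trans_source, PartialEquiv.symm_source]
  refine ⟨extChartAt_mem_target hc, ?_⟩
  rwa [mem_preimage, extChartAt_symm_extChartAt hc, extChartAt_source]

theorem reading_transition (hc : q ∈ (chartAt (EuclideanHalfSpace n) c).source)
    (ha : q ∈ (chartAt (EuclideanHalfSpace n) a).source) (v : TangentSpace (𝓡∂ n) q) :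
    reading a q v = fderivWithin ℝ (transition c a) (extChartAt (𝓡∂ n) c).target
      (extChartAt (𝓡∂ n) c q) (reading c q v) := by
  have : IsManifold (𝓡∂ n) 1 M := IsManifold.of_le (n := ∞) (by simp)
  rw [reading_eq_mfderiv ha, reading_eq_mfderiv hc]
  have h1 : HasMFDerivAt (𝓡∂ n) 𝓘(ℝ, Coord n) (extChartAt (𝓡∂ n) c) q
      (mfderiv (𝓡∂ n) 𝓘(ℝ, Coord n) (extChartAt (𝓡∂ n) c) q) :=
    (mdifferentiableAt_extChartAt hc).hasMFDerivAt
  have h2 : HasMFDerivWithinAt 𝓘(ℝ, Coord n) 𝓘(ℝ, Coord n) (transition c a)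
      (extChartAt (𝓡∂ n) c).target (extChartAt (𝓡∂ n) c q)
      (fderivWithin ℝ (transition c a) (extChartAt (𝓡∂ n) c).target (extChartAt (𝓡∂ n) c q)) :=
    (((contDiffWithinAt_transition hc ha).differentiableWithinAt
      (by simp)).hasFDerivWithinAt).hasMFDerivWithinAt
  have h3 := h2.comp (f := extChartAt (𝓡∂ n) c) (s := (chartAt (EuclideanHalfSpace n) c).source) q
    h1.hasMFDerivWithinAt (fun p hp => extChartAt_mem_target hp)
  have h4 := h3.hasMFDerivAt ((chartAt (EuclideanHalfSpace n) c).open_source.mem_nhds hc)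
  have h5 : extChartAt (𝓡∂ n) a =ᶠ[𝓝 q] transition c a ∘ extChartAt (𝓡∂ n) c := by
    filter_upwards [(chartAt (EuclideanHalfSpace n) c).open_source.mem_nhds hc] with p hp
    rw [Function.comp_apply, transition_extChartAt hp]
  rw [(h4.congr_of_eventuallyEq h5).mfderiv]
  rfl

theorem fderivWithin_transition_surjective (hc : q ∈ (chartAt (EuclideanHalfSpace n) c).source)
    (ha : q ∈ (chartAt (EuclideanHalfSpace n) a).source) :
    Function.Surjective (fderivWithin ℝ (transition c a) (extChartAt (𝓡∂ n) c).target
      (extChartAt (𝓡∂ n) c q)) := fun v =>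
  ⟨reading c q (coordVec a q v), by rw [← reading_transition hc ha, reading_coordVec ha]⟩

theorem chartMetric_transition (hc : q ∈ (chartAt (EuclideanHalfSpace n) c).source)
    (ha : q ∈ (chartAt (EuclideanHalfSpace n) a).source) (v w : Coord n) :
    chartMetric g c (extChartAt (𝓡∂ n) c q) v w =
      chartMetric g a (extChartAt (𝓡∂ n) a q)
        (fderivWithin ℝ (transition c a) (extChartAt (𝓡∂ n) c).target (extChartAt (𝓡∂ n) c q) v)
        (fderivWithin ℝ (transition c a) (extChartAt (𝓡∂ n) c).target (extChartAt (𝓡∂ n) c q) w) := by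
  conv_lhs => rw [← reading_coordVec hc v, ← reading_coordVec hc w, ← inner_eq_chartMetric g hc]
  rw [inner_eq_chartMetric g ha, reading_transition hc ha, reading_transition hc ha,
    reading_coordVec hc, reading_coordVec hc]

theorem transition_mem (hc : q ∈ (chartAt (EuclideanHalfSpace n) c).source)
    (ha : q ∈ (chartAt (EuclideanHalfSpace n) a).source) :
    ∀ᶠ y in 𝓝[(extChartAt (𝓡∂ n) c).target] (extChartAt (𝓡∂ n) c q),
      y ∈ (extChartAt (𝓡∂ n) c).target ∧
      (extChartAt (𝓡∂ n) c).symm y ∈ (chartAt (EuclideanHalfSpace n) a).source := by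
  refine (eventually_mem_nhdsWithin).and ?_
  have h1 := (continuousOn_extChartAt_symm (I := 𝓡∂ n) c) _ (extChartAt_mem_target hc)
  refine h1.eventually ((chartAt (EuclideanHalfSpace n) a).open_source.mem_nhds ?_)
  rwa [extChartAt_symm_extChartAt hc]

/-- The transformation law of the Christoffel symbols under change of charts. -/
theorem chartGamma_transition (hc : q ∈ (chartAt (EuclideanHalfSpace n) c).source)
    (ha : q ∈ (chartAt (EuclideanHalfSpace n) a).source) (v w : Coord n) :
    fderivWithin ℝ (transition c a) (extChartAt (𝓡∂ n) c).target (extChartAt (𝓡∂ n) c q)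
      (chartGamma g c (extChartAt (𝓡∂ n) c q) v w) =
      fderivWithin ℝ (fderivWithin ℝ (transition c a) (extChartAt (𝓡∂ n) c).target)
        (extChartAt (𝓡∂ n) c).target (extChartAt (𝓡∂ n) c q) v w
      + chartGamma g a (extChartAt (𝓡∂ n) a q)
        (fderivWithin ℝ (transition c a) (extChartAt (𝓡∂ n) c).target (extChartAt (𝓡∂ n) c q) v)
        (fderivWithin ℝ (transition c a) (extChartAt (𝓡∂ n) c).target (extChartAt (𝓡∂ n) c q) w) := by
  have h1 := (localMetric g a).transform (localMetric g c) (extChartAt_mem_target hc)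
    (contDiffWithinAt_transition hc ha)
    (by filter_upwards [transition_mem hc ha] with y hy using extChartAt_mem_target hy.2)
    (by
      filter_upwards [transition_mem hc ha] with y hy v w
      have h2 := chartMetric_transition g (symm_mem_source hy.1) hy.2 v w
      rw [(extChartAt (𝓡∂ n) c).right_inv hy.1] at h2
      exact h2) (fderivWithin_transition_surjective hc ha) v w
  rwa [transition_extChartAt hc] at h1

/-- The covariant derivative along a map, computed in an arbitrary preferred chart. -/
theorem covariant_eq_coordVec {D : Type*} [NormedAddCommGroup D] [NormedSpace ℝ D] {b : D → M}
    {V : ∀ y, TangentSpace (𝓡∂ n) (b y)} {y₀ : D} (hb : ContinuousAt b y₀)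
    (hc : b y₀ ∈ (chartAt (EuclideanHalfSpace n) c).source)
    (ha : b y₀ ∈ (chartAt (EuclideanHalfSpace n) a).source)
    (hd : DifferentiableAt ℝ (fun y => extChartAt (𝓡∂ n) c (b y)) y₀)
    (hV : DifferentiableAt ℝ (fun y => reading (n := n) c (b y) (V y)) y₀) (w : D) :
    DifferentiableAt ℝ (fun y => reading (n := n) a (b y) (V y)) y₀ ∧
    DifferentiableAt ℝ (fun y => extChartAt (𝓡∂ n) a (b y)) y₀ ∧
    cov (chartGamma g a) (fun y => extChartAt (𝓡∂ n) a (b y)) (fun y => reading (n := n) a (b y) (V y)) w y₀ =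
    fderivWithin ℝ (transition c a) (extChartAt (𝓡∂ n) c).target (extChartAt (𝓡∂ n) c (b y₀))
      (cov (chartGamma g c) (fun y => extChartAt (𝓡∂ n) c (b y)) (fun y => reading (n := n) c (b y) (V y))
        w y₀) := by
  set ψ := transition (n := n) c a with hψ
  set Ω := (extChartAt (𝓡∂ n) c).target with hΩ
  have hcs : ∀ᶠ y in 𝓝 y₀, b y ∈ (chartAt (EuclideanHalfSpace n) c).source :=
    hb.eventually ((chartAt (EuclideanHalfSpace n) c).open_source.mem_nhds hc)
  have has : ∀ᶠ y in 𝓝 y₀, b y ∈ (chartAt (EuclideanHalfSpace n) a).source :=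
    hb.eventually ((chartAt (EuclideanHalfSpace n) a).open_source.mem_nhds ha)
  have e1 : (fun y => extChartAt (𝓡∂ n) a (b y)) =ᶠ[𝓝 y₀]
      ψ ∘ fun y => extChartAt (𝓡∂ n) c (b y) := by
    filter_upwards [hcs] with y hy
    rw [Function.comp_apply, hψ, transition_extChartAt hy]
  have e2 : (fun y => reading (n := n) a (b y) (V y)) =ᶠ[𝓝 y₀]
      fun y => fderivWithin ℝ ψ Ω (extChartAt (𝓡∂ n) c (b y)) (reading (n := n) c (b y) (V y)) := by
    filter_upwards [hcs, has] with y hy hy' using reading_transition hy hy' (V y)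
  have hcd := contDiffWithinAt_transition hc ha
  have huniq : UniqueDiffOn ℝ Ω := uniqueDiffOn_extChartAt_target c
  have hmaps : ∀ᶠ y in 𝓝 y₀, extChartAt (𝓡∂ n) c (b y) ∈ Ω := by
    filter_upwards [hcs] with y hy using extChartAt_mem_target (n := n) hy
  have hψ1 : HasFDerivWithinAt ψ (fderivWithin ℝ ψ Ω (extChartAt (𝓡∂ n) c (b y₀))) Ω
      (extChartAt (𝓡∂ n) c (b y₀)) := (hcd.differentiableWithinAt (by simp)).hasFDerivWithinAt
  -- Differentiating the relation `reading a V = dψ (reading c V)` brings in the second derivative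
  -- of `ψ`. It is exactly the inhomogeneous term of `chartGamma_transition`.
  have hψ2 : HasFDerivWithinAt (fderivWithin ℝ ψ Ω)
      (fderivWithin ℝ (fderivWithin ℝ ψ Ω) Ω (extChartAt (𝓡∂ n) c (b y₀))) Ω
      (extChartAt (𝓡∂ n) c (b y₀)) :=
    ((hcd.fderivWithin_right (m := 1) huniq (by norm_cast)
      (extChartAt_mem_target hc)).differentiableWithinAt (by simp)).hasFDerivWithinAt
  have d1 : HasFDerivAt (fun y => extChartAt (𝓡∂ n) a (b y)) _ y₀ :=
    (hψ1.comp_hasFDerivAt_of_eq y₀ hd.hasFDerivAt hmaps rfl).congr_of_eventuallyEq e1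
  have d2' := hψ2.comp_hasFDerivAt_of_eq y₀ hd.hasFDerivAt hmaps rfl
  have d2 : HasFDerivAt (fun y => reading (n := n) a (b y) (V y)) _ y₀ :=
    (d2'.clm_apply hV.hasFDerivAt).congr_of_eventuallyEq e2
  refine ⟨d2.differentiableAt, d1.differentiableAt, ?_⟩
  simp only [cov, d1.fderiv, d2.fderiv]
  rw [map_add, chartGamma_transition g hc ha, reading_transition hc ha (V y₀)]
  simp only [_root_.add_apply, ContinuousLinearMap.comp_apply, ContinuousLinearMap.flip_apply,
    Function.comp_apply]
  exact add_assoc _ _ _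

variable {EN : Type*} [NormedAddCommGroup EN] [NormedSpace ℝ EN] {HN : Type*} [TopologicalSpace HN]
  {J : ModelWithCorners ℝ EN HN} {N : Type*} [TopologicalSpace N] [ChartedSpace HN N]

theorem reading_mfderiv {f : N → M} {p : N} (hf : MDifferentiableAt J (𝓡∂ n) f p)
    (hc : f p ∈ (chartAt (EuclideanHalfSpace n) c).source) (w : TangentSpace J p) :
    reading c (f p) (mfderiv J (𝓡∂ n) f p w) =
      mfderiv J 𝓘(ℝ, Coord n) (fun q => extChartAt (𝓡∂ n) c (f q)) p w := by
  have : IsManifold (𝓡∂ n) 1 M := IsManifold.of_le (n := ∞) (by simp)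
  rw [reading_eq_mfderiv hc]
  have := mfderiv_comp p (mdifferentiableAt_extChartAt (I := 𝓡∂ n) hc) hf
  exact (congrArg (fun L => L w) this).symm

/-- The covariant derivative along a map, computed in a parametrization of the domain and an
arbitrary preferred chart of the target. -/
theorem reading_covDerivAlong {D : Type*} [NormedAddCommGroup D] [NormedSpace ℝ D] {σ : D → N}
    {f : N → M} {V : ∀ p, TangentSpace (𝓡∂ n) (f p)} {y₀ : D} {w' : D} {w : TangentSpace J (σ y₀)}
    (hσ : ∀ u : N → Coord n, DifferentiableAt ℝ (u ∘ σ) y₀ →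
      mfderiv J 𝓘(ℝ, Coord n) u (σ y₀) w = fderiv ℝ (u ∘ σ) y₀ w')
    (hf : MDifferentiableAt J (𝓡∂ n) f (σ y₀)) (hb : ContinuousAt (f ∘ σ) y₀)
    (hc : f (σ y₀) ∈ (chartAt (EuclideanHalfSpace n) c).source)
    (hd : DifferentiableAt ℝ (fun y => extChartAt (𝓡∂ n) c (f (σ y))) y₀)
    (hV : DifferentiableAt ℝ (fun y => reading (n := n) c (f (σ y)) (V (σ y))) y₀) :
    reading c (f (σ y₀)) (covDerivAlong g J f V (σ y₀) w) =
      cov (chartGamma g c) (fun y => extChartAt (𝓡∂ n) c (f (σ y)))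
        (fun y => reading (n := n) c (f (σ y)) (V (σ y))) w' y₀ := by
  -- `covDerivAlong` is defined in the chart centred at the image point, where reading a vector is
  -- the identity. From there the derivative of the coordinate change leads to the chart at `c`.
  have ha := mem_chart_source (EuclideanHalfSpace n) (f (σ y₀))
  obtain ⟨h1, h2, h3⟩ := covariant_eq_coordVec g (b := f ∘ σ) (V := fun y => V (σ y)) hb hc ha hd hV w'
  simp only [Function.comp_apply] at h1 h2 h3
  set A := cov (chartGamma g c) (fun y => extChartAt (𝓡∂ n) c (f (σ y)))
        (fun y => reading (n := n) c (f (σ y)) (V (σ y))) w' y₀ with hA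
  have h4 : covDerivAlong g J f V (σ y₀) w = coordVec c (f (σ y₀)) A := by
    rw [← reading_self (f (σ y₀)) (coordVec c (f (σ y₀)) A), reading_transition hc ha,
      reading_coordVec hc, ← h3]
    have e1 := hσ (fun q => reading (n := n) (f (σ y₀)) (f q) (V q)) h1
    have e2 : (mfderiv J (𝓡∂ n) f (σ y₀) w : Coord n) =
        fderiv ℝ (fun y => extChartAt (𝓡∂ n) (f (σ y₀)) (f (σ y))) y₀ w' := by
      rw [← reading_self (f (σ y₀)) (mfderiv J (𝓡∂ n) f (σ y₀) w), reading_mfderiv hf ha]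
      exact hσ (fun q => extChartAt (𝓡∂ n) (f (σ y₀)) (f q)) h2
    simp only [covDerivAlong, cov]
    rw [reading_self]
    refine congrArg₂ (· + ·) e1 ?_
    rw [← e2]
    exact christoffelVec_eq g _ _ _
  rw [h4, reading_coordVec hc]

end Transition

/-! ### Charts and frames on the hypersurface. -/

section Domain

variable {m : ℕ} [NeZero m] {S : Type*} [TopologicalSpace S]
  [ChartedSpace (EuclideanHalfSpace m) S] [IsManifold (𝓡∂ m) ∞ S] {x p : S}

theorem mfderiv_eq_fderivWithin {F : Type*} [NormedAddCommGroup F] [NormedSpace ℝ F] {u : S → F}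
    (hx : p ∈ (chartAt (EuclideanHalfSpace m) x).source)
    (hu : DifferentiableWithinAt ℝ (u ∘ (extChartAt (𝓡∂ m) x).symm) (extChartAt (𝓡∂ m) x).target
      (extChartAt (𝓡∂ m) x p)) (w : TangentSpace (𝓡∂ m) p) :
    mfderiv (𝓡∂ m) 𝓘(ℝ, F) u p w = fderivWithin ℝ (u ∘ (extChartAt (𝓡∂ m) x).symm)
      (extChartAt (𝓡∂ m) x).target (extChartAt (𝓡∂ m) x p) (reading x p w) := by
  have : IsManifold (𝓡∂ m) 1 S := IsManifold.of_le (n := ∞) (by simp)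
  rw [reading_eq_mfderiv hx]
  have h1 : HasMFDerivAt (𝓡∂ m) 𝓘(ℝ, Coord m) (extChartAt (𝓡∂ m) x) p
      (mfderiv (𝓡∂ m) 𝓘(ℝ, Coord m) (extChartAt (𝓡∂ m) x) p) :=
    (mdifferentiableAt_extChartAt hx).hasMFDerivAt
  have h2 := hu.hasFDerivWithinAt.hasMFDerivWithinAt
  have h3 := h2.comp (f := extChartAt (𝓡∂ m) x) (s := (chartAt (EuclideanHalfSpace m) x).source) p
    h1.hasMFDerivWithinAt (fun p hp => extChartAt_mem_target hp)
  have h4 := h3.hasMFDerivAt ((chartAt (EuclideanHalfSpace m) x).open_source.mem_nhds hx)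
  have h5 : u =ᶠ[𝓝 p] (u ∘ (extChartAt (𝓡∂ m) x).symm) ∘ extChartAt (𝓡∂ m) x := by
    filter_upwards [(chartAt (EuclideanHalfSpace m) x).open_source.mem_nhds hx] with p hp
    rw [Function.comp_apply, Function.comp_apply, extChartAt_symm_extChartAt hp]
  rw [(h4.congr_of_eventuallyEq h5).mfderiv]
  rfl

theorem mfderiv_eq_fderiv_of_interior {F : Type*} [NormedAddCommGroup F] [NormedSpace ℝ F] {u : S → F}
    {y : Coord m} (hy : y ∈ interior (extChartAt (𝓡∂ m) x).target)
    (hu : DifferentiableAt ℝ (u ∘ (extChartAt (𝓡∂ m) x).symm) y)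
    (w : TangentSpace (𝓡∂ m) ((extChartAt (𝓡∂ m) x).symm y)) :
    mfderiv (𝓡∂ m) 𝓘(ℝ, F) u ((extChartAt (𝓡∂ m) x).symm y) w =
      fderiv ℝ (u ∘ (extChartAt (𝓡∂ m) x).symm) y (reading x _ w) := by
  have hy' := interior_subset hy
  have e := (extChartAt (𝓡∂ m) x).right_inv hy'
  rw [mfderiv_eq_fderivWithin (x := x) (symm_mem_source hy')
    (by rw [e]; exact hu.differentiableWithinAt), e,
    fderivWithin_of_mem_nhds (mem_interior_iff_mem_nhds.1 hy)]

end Domain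

section Frames

variable {m : ℕ} {E : Type*} [NormedAddCommGroup E] [NormedSpace ℝ E]
  {G : E → Bil E ℝ} {Γ : E → Bil E E} {f V Y : Coord m → E} {y : Coord m}

/-- The matrix whose rows are the vectors of a frame. -/
def frameMatrix (e : Fin m → Coord m) : Matrix (Fin m) (Fin m) ℝ := Matrix.of fun i j => e i j

/-- Expand both arguments in the standard basis. Combined with `contract_conj`, this makes
divergence, `|B|²`, `|∇φ|²` and the tangential part independent of the frame. -/
theorem frameMatrix_conj (B : Coord m → Coord m → ℝ) (h1 : ∀ w, IsLinearMap ℝ fun v => B v w)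
    (h2 : ∀ v, IsLinearMap ℝ fun w => B v w) (e : Fin m → Coord m) :
    (Matrix.of fun i j => B (e i) (e j)) =
      frameMatrix e * (Matrix.of fun i j => B (stdVec i) (stdVec j)) * (frameMatrix e).transpose := by
  have k1 : ∀ v w, B v w = ∑ i, v i * B (stdVec i) w := by
    intro v w
    have := map_sum ((h1 w).mk' _) (fun i => v i • (stdVec i : Coord m)) Finset.univ
    rw [sum_stdVec] at this
    refine this.trans (Finset.sum_congr rfl fun i _ => ?_)
    rw [map_smul]; rfl
  have k2 : ∀ v w, B v w = ∑ j, w j * B v (stdVec j) := by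
    intro v w
    have := map_sum ((h2 v).mk' _) (fun i => w i • (stdVec i : Coord m)) Finset.univ
    rw [sum_stdVec] at this
    refine this.trans (Finset.sum_congr rfl fun i _ => ?_)
    rw [map_smul]; rfl
  ext a b
  simp only [Matrix.mul_apply, Matrix.transpose_apply, Matrix.of_apply, frameMatrix]
  rw [k2]
  refine Finset.sum_congr rfl fun j _ => ?_
  rw [k1, mul_comm]

theorem gram_conj (e : Fin m → Coord m) :
    gram G f e y = frameMatrix e * gram G f stdVec y * (frameMatrix e).transpose :=
  frameMatrix_conj (fun v w => G (f y) (fderiv ℝ f y v) (fderiv ℝ f y w))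
    (fun _ => ⟨fun _ _ => by simp, fun _ _ => by simp⟩)
    (fun _ => ⟨fun _ _ => by simp, fun _ _ => by simp⟩) e

theorem covMat_conj (e : Fin m → Coord m) :
    covMat G Γ f e Y y = frameMatrix e * covMat G Γ f stdVec Y y * (frameMatrix e).transpose :=
  frameMatrix_conj (fun v w => G (f y) (cov Γ f Y v y) (fderiv ℝ f y w))
    (fun _ => ⟨fun _ _ => by simp [cov]; ring, fun _ _ => by simp [cov]; ring⟩)
    (fun _ => ⟨fun _ _ => by simp, fun _ _ => by simp⟩) e

variable {e e' : Fin m → Coord m}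

theorem sdiv_frame (he : IsUnit (frameMatrix e).det) :
    sdiv G Γ f e Y y = sdiv G Γ f stdVec Y y := by
  rw [sdiv, sdiv, gram_conj e, covMat_conj e, contract_conj he]

theorem contractSq_frame (he : IsUnit (frameMatrix e).det) :
    contractSq (gram G f e y) (covMat G Γ f e Y y) =
      contractSq (gram G f stdVec y) (covMat G Γ f stdVec Y y) := by
  rw [gram_conj e, covMat_conj e, contractSq_conj he]

theorem contract_fderiv_frame (he : IsUnit (frameMatrix e).det) (φ : Coord m → ℝ) :
    contract (gram G f e y) (Matrix.of fun i j => fderiv ℝ φ y (e i) * fderiv ℝ φ y (e j)) =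
      contract (gram G f stdVec y)
        (Matrix.of fun i j => fderiv ℝ φ y (stdVec i) * fderiv ℝ φ y (stdVec j)) := by
  rw [gram_conj e, frameMatrix_conj (fun v w => fderiv ℝ φ y v * fderiv ℝ φ y w)
    (fun _ => ⟨fun _ _ => by simp; ring, fun _ _ => by simp; ring⟩)
    (fun _ => ⟨fun _ _ => by simp; ring, fun _ _ => by simp; ring⟩), contract_conj he]

theorem tvec_apply (e : Fin m → Coord m) (l : Fin m) : tvec G f e V y l =
    contract (gram G f e y) (Matrix.of fun i j => e i l * G (f y) (V y) (fderiv ℝ f y (e j))) := by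
  simp only [tvec, tcomp, contract, WithLp.ofLp_sum, Finset.sum_apply, PiLp.smul_apply, smul_eq_mul,
    Finset.sum_mul, Matrix.of_apply, frame]
  exact Finset.sum_congr rfl fun i _ => Finset.sum_congr rfl fun j _ => by ring

theorem tvec_frame (he : IsUnit (frameMatrix e).det) :
    tvec G f e V y = tvec G f stdVec V y := by
  ext l
  rw [tvec_apply, tvec_apply, gram_conj e,
    frameMatrix_conj (fun v w => v l * G (f y) (V y) (fderiv ℝ f y w))
    (fun _ => ⟨fun _ _ => by simp; ring, fun _ _ => by simp; ring⟩)
    (fun _ => ⟨fun _ _ => by simp; ring, fun _ _ => by simp; ring⟩), contract_conj he]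

theorem tfield_frame (he : IsUnit (frameMatrix e).det) :
    tfield G f e V y = tfield G f stdVec V y := by rw [tfield, tfield, tvec_frame he]

theorem frameMatrix_stdVec : frameMatrix (stdVec : Fin m → Coord m) = 1 := by
  ext i j
  simp [frameMatrix, Matrix.one_apply, eq_comm]

end Frames

section ChartFrames

variable {m : ℕ} [NeZero m] {S : Type*} [TopologicalSpace S]
  [ChartedSpace (EuclideanHalfSpace m) S] [IsManifold (𝓡∂ m) ∞ S] {x x' p : S}

/-- The coordinate frame of the chart at `x'`, read in the chart at `x`. -/
noncomputable def readFrame (x x' p : S) (i : Fin m) : Coord m := reading (n := m) x p (coordVec x' p (stdVec i))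

/-- Each coordinate frame is expanded in the other, so the two matrices are mutually inverse. -/
theorem frameMatrix_readFrame_mul (hx : p ∈ (chartAt (EuclideanHalfSpace m) x).source)
    (hx' : p ∈ (chartAt (EuclideanHalfSpace m) x').source) :
    frameMatrix (readFrame (m := m) x x' p) * frameMatrix (readFrame (m := m) x' x p) = 1 := by
  ext i k
  have h1 : reading x' p (coordVec x p (readFrame (m := m) x x' p i)) = stdVec i := by
    rw [readFrame, coordVec_reading hx, reading_coordVec hx']
  rw [← sum_stdVec (readFrame (m := m) x x' p i), coordVec_sum hx] at h1
  simp only [coordVec_smul hx, reading_eq_clm hx', map_sum, map_smul] at h1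
  have h2 := congrArg (fun v : Coord m => v k) h1
  simp only [WithLp.ofLp_sum, Finset.sum_apply, PiLp.smul_apply, smul_eq_mul] at h2
  simp only [Matrix.mul_apply, frameMatrix, Matrix.of_apply]
  have h3 : (stdVec i : Coord m) k = (1 : Matrix (Fin m) (Fin m) ℝ) i k := by
    simp [Matrix.one_apply, eq_comm]
  rw [← h3, ← h2]
  refine Finset.sum_congr rfl fun j _ => ?_
  rw [← reading_eq_clm hx']; rfl

theorem isUnit_frameMatrix_readFrame (hx : p ∈ (chartAt (EuclideanHalfSpace m) x).source)
    (hx' : p ∈ (chartAt (EuclideanHalfSpace m) x').source) :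
    IsUnit (frameMatrix (readFrame (m := m) x x' p)).det := by
  have := congrArg Matrix.det (frameMatrix_readFrame_mul hx hx')
  rw [Matrix.det_mul, Matrix.det_one] at this
  exact IsUnit.of_mul_eq_one _ this

end ChartFrames

section Coordinates

variable {m n : ℕ} [NeZero m] [NeZero n] {M : Type*} [TopologicalSpace M]
  [ChartedSpace (EuclideanHalfSpace n) M] [IsManifold (𝓡∂ n) ∞ M]
  {S : Type*} [TopologicalSpace S] [ChartedSpace (EuclideanHalfSpace m) S]
  [IsManifold (𝓡∂ m) ∞ S] (g : RMetric n M) {f : S → M} {x : S} {c : M}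

/-- A map between manifolds, in the preferred charts at `x` and `c`. -/
noncomputable def mapCoord (x : S) (c : M) (f : S → M) (y : Coord m) : Coord n :=
  extChartAt (𝓡∂ n) c (f ((extChartAt (𝓡∂ m) x).symm y))

/-- A vector field along a map, in the preferred charts at `x` and `c`. -/
noncomputable def fieldCoord (x : S) (c : M) (f : S → M) (V : ∀ p, TangentSpace (𝓡∂ n) (f p))
    (y : Coord m) : Coord n :=
  reading c (f ((extChartAt (𝓡∂ m) x).symm y)) (V ((extChartAt (𝓡∂ m) x).symm y))

variable (n) in
/-- The interior coordinate points mapped to the domain of the preferred chart at `c`. -/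
def coordDomain (x : S) (c : M) (f : S → M) : Set (Coord m) :=
  interior (extChartAt (𝓡∂ m) x).target ∩
    (fun y => f ((extChartAt (𝓡∂ m) x).symm y)) ⁻¹' (chartAt (EuclideanHalfSpace n) c).source

theorem isOpen_coordDomain (hf : Continuous f) : IsOpen (coordDomain (m := m) n x c f) := by
  have h1 : ContinuousOn (fun y => f ((extChartAt (𝓡∂ m) x).symm y))
      (interior (extChartAt (𝓡∂ m) x).target) :=
    hf.comp_continuousOn ((continuousOn_extChartAt_symm x).mono interior_subset)
  exact h1.isOpen_inter_preimage isOpen_interior (chartAt (EuclideanHalfSpace n) c).open_source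

theorem contDiffOn_mapCoord (hf : ContMDiff (𝓡∂ m) (𝓡∂ n) ∞ f) :
    ContDiffOn ℝ ∞ (mapCoord (m := m) (n := n) x c f) ((extChartAt (𝓡∂ m) x).target ∩
      (fun y => f ((extChartAt (𝓡∂ m) x).symm y)) ⁻¹' (chartAt (EuclideanHalfSpace n) c).source) := by
  have h1 : ContMDiffOn 𝓘(ℝ, Coord m) (𝓡∂ n) ∞ (f ∘ (extChartAt (𝓡∂ m) x).symm)
      (extChartAt (𝓡∂ m) x).target := hf.comp_contMDiffOn (contMDiffOn_extChartAt_symm x)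
  have h2 := (contMDiffOn_extChartAt (I := 𝓡∂ n) (n := ∞) (x := c)).comp
    (h1.mono inter_subset_left) (s := (extChartAt (𝓡∂ m) x).target ∩
      (fun y => f ((extChartAt (𝓡∂ m) x).symm y)) ⁻¹' (chartAt (EuclideanHalfSpace n) c).source)
    (fun y hy => hy.2)
  exact contMDiffOn_iff_contDiffOn.1 h2

theorem contMDiffOn_reading {EN : Type*} [NormedAddCommGroup EN] [NormedSpace ℝ EN]
    {HN : Type*} [TopologicalSpace HN] {J : ModelWithCorners ℝ EN HN} {N : Type*}
    [TopologicalSpace N] [ChartedSpace HN N] {b : N → M} {v : ∀ x, TangentSpace (𝓡∂ n) (b x)}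
    {s : Set N}
    (hv : ContMDiffOn J (𝓡∂ n).tangent ∞ (fun p => (⟨b p, v p⟩ : TangentBundle (𝓡∂ n) M)) s)
    (hs : ∀ p ∈ s, b p ∈ (chartAt (EuclideanHalfSpace n) c).source) :
    ContMDiffOn J 𝓘(ℝ, Coord n) ∞ (fun p => reading (n := n) c (b p) (v p)) s := by
  have : IsManifold (𝓡∂ n) 1 M := IsManifold.of_le (n := ∞) (by simp)
  have h := (Trivialization.contMDiffOn_iff
    (e := trivializationAt (Coord n) (fun y : M => TangentSpace (𝓡∂ n) y) c) (IB := 𝓡∂ n) (n := ∞)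
    (f := fun p => (⟨b p, v p⟩ : TangentBundle (𝓡∂ n) M)) (s := s)
    (fun p hp => (Trivialization.mem_source _).2 (mem_baseSet (hs p hp)))).1 hv
  exact h.2

theorem contDiffOn_fieldCoord {V : ∀ p, TangentSpace (𝓡∂ n) (f p)}
    (hV : ContMDiff (𝓡∂ m) (𝓡∂ n).tangent ∞ (fun p => (⟨f p, V p⟩ : TangentBundle (𝓡∂ n) M))) :
    ContDiffOn ℝ ∞ (fieldCoord (m := m) (n := n) x c f V) ((extChartAt (𝓡∂ m) x).target ∩
      (fun y => f ((extChartAt (𝓡∂ m) x).symm y)) ⁻¹' (chartAt (EuclideanHalfSpace n) c).source) := by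
  have h1 : ContMDiffOn 𝓘(ℝ, Coord m) (𝓡∂ n).tangent ∞
      ((fun p => (⟨f p, V p⟩ : TangentBundle (𝓡∂ n) M)) ∘ (extChartAt (𝓡∂ m) x).symm)
      (extChartAt (𝓡∂ m) x).target := hV.comp_contMDiffOn (contMDiffOn_extChartAt_symm x)
  have h2 := contMDiffOn_reading (c := c) (b := fun y => f ((extChartAt (𝓡∂ m) x).symm y))
    (v := fun y => V ((extChartAt (𝓡∂ m) x).symm y)) (h1.mono inter_subset_left) (fun y hy => hy.2)
  exact contMDiffOn_iff_contDiffOn.1 h2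

theorem coordDomain_subset : coordDomain (m := m) n x c f ⊆ (extChartAt (𝓡∂ m) x).target ∩
      (fun y => f ((extChartAt (𝓡∂ m) x).symm y)) ⁻¹' (chartAt (EuclideanHalfSpace n) c).source :=
  fun _ hy => ⟨interior_subset hy.1, hy.2⟩

variable {y : Coord m}

theorem reading_mfderiv_coord (hf : ContMDiff (𝓡∂ m) (𝓡∂ n) ∞ f) (hy : y ∈ coordDomain n x c f)
    (w : TangentSpace (𝓡∂ m) ((extChartAt (𝓡∂ m) x).symm y)) :
    reading c (f ((extChartAt (𝓡∂ m) x).symm y))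
      (mfderiv (𝓡∂ m) (𝓡∂ n) f ((extChartAt (𝓡∂ m) x).symm y) w) =
      fderiv ℝ (mapCoord x c f) y (reading x _ w) := by
  rw [reading_mfderiv (hf.mdifferentiable (by simp) _) hy.2]
  refine mfderiv_eq_fderiv_of_interior hy.1 ?_ w
  exact LocalHypersurface.differentiableAt_of_contDiffOn (isOpen_coordDomain hf.continuous) hy
    ((contDiffOn_mapCoord hf).mono coordDomain_subset)

theorem inner_mfderiv (hf : ContMDiff (𝓡∂ m) (𝓡∂ n) ∞ f) (hy : y ∈ coordDomain n x c f)
    (v w : TangentSpace (𝓡∂ m) ((extChartAt (𝓡∂ m) x).symm y)) :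
    g.inner (f ((extChartAt (𝓡∂ m) x).symm y))
      (mfderiv (𝓡∂ m) (𝓡∂ n) f ((extChartAt (𝓡∂ m) x).symm y) v)
      (mfderiv (𝓡∂ m) (𝓡∂ n) f ((extChartAt (𝓡∂ m) x).symm y) w) =
    chartMetric g c (mapCoord x c f y) (fderiv ℝ (mapCoord x c f) y (reading x _ v))
      (fderiv ℝ (mapCoord x c f) y (reading x _ w)) := by
  rw [inner_eq_chartMetric g hy.2, reading_mfderiv_coord hf hy, reading_mfderiv_coord hf hy]
  rfl

theorem inducedMatrix_eq_gram (hf : ContMDiff (𝓡∂ m) (𝓡∂ n) ∞ f) (hy : y ∈ coordDomain n x c f)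
    (x' : S) : inducedMatrix m g f x' ((extChartAt (𝓡∂ m) x).symm y) =
      gram (chartMetric g c) (mapCoord x c f) (readFrame (m := m) x x' ((extChartAt (𝓡∂ m) x).symm y)) y := by
  ext i j
  exact inner_mfderiv g hf hy _ _

theorem readFrame_self (hx : y ∈ (extChartAt (𝓡∂ m) x).target) :
    readFrame (m := m) x x ((extChartAt (𝓡∂ m) x).symm y) = stdVec :=
  funext fun i => reading_coordVec (symm_mem_source hx) (stdVec i)

theorem reading_covDerivAlong_coord (hf : ContMDiff (𝓡∂ m) (𝓡∂ n) ∞ f)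
    (hy : y ∈ coordDomain n x c f) {V : ∀ p, TangentSpace (𝓡∂ n) (f p)}
    (hV : DifferentiableAt ℝ (fieldCoord x c f V) y)
    (w : TangentSpace (𝓡∂ m) ((extChartAt (𝓡∂ m) x).symm y)) :
    reading c (f ((extChartAt (𝓡∂ m) x).symm y))
      (covDerivAlong g (𝓡∂ m) f V ((extChartAt (𝓡∂ m) x).symm y) w) =
      cov (chartGamma g c) (mapCoord x c f) (fieldCoord x c f V) (reading x _ w) y := by
  refine reading_covDerivAlong g (σ := (extChartAt (𝓡∂ m) x).symm) (V := V)
    (fun u hu => mfderiv_eq_fderiv_of_interior hy.1 hu w) (hf.mdifferentiable (by simp) _) ?_ hy.2 ?_ hV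
  · exact hf.continuous.continuousAt.comp
      (((continuousOn_extChartAt_symm x).mono interior_subset).continuousAt
        (isOpen_interior.mem_nhds hy.1))
  · exact LocalHypersurface.differentiableAt_of_contDiffOn (isOpen_coordDomain hf.continuous) hy
      ((contDiffOn_mapCoord hf).mono coordDomain_subset)

/-- `divAlong` uses at each point the preferred chart of that very point, and this chart changes
from point to point without any continuity. Independence of the frame moves the computation to the
fixed chart at `x`, where it can be differentiated. -/
theorem divAlong_eq_sdiv (hf : ContMDiff (𝓡∂ m) (𝓡∂ n) ∞ f)
    (hy : y ∈ coordDomain n x c f) {V : ∀ p, TangentSpace (𝓡∂ n) (f p)}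
    (hV : DifferentiableAt ℝ (fieldCoord x c f V) y) :
    divAlong m g f V ((extChartAt (𝓡∂ m) x).symm y) =
      sdiv (chartMetric g c) (chartGamma g c) (mapCoord x c f) stdVec (fieldCoord x c f V) y := by
  have hq := symm_mem_source (interior_subset hy.1)
  rw [← sdiv_frame (isUnit_frameMatrix_readFrame hq
    (mem_chart_source _ ((extChartAt (𝓡∂ m) x).symm y))), sdiv, ← inducedMatrix_eq_gram g hf hy]
  simp only [divAlong, contract]
  refine Finset.sum_congr rfl fun i _ => Finset.sum_congr rfl fun j _ => ?_
  congr 1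
  rw [inner_eq_chartMetric g hy.2, reading_covDerivAlong_coord g hf hy hV]
  simp only [frameVec]
  rw [reading_mfderiv_coord hf hy]
  rfl

theorem secondFormNormSq_eq (hf : ContMDiff (𝓡∂ m) (𝓡∂ n) ∞ f)
    (hy : y ∈ coordDomain n x c f) {V : ∀ p, TangentSpace (𝓡∂ n) (f p)}
    (hV : DifferentiableAt ℝ (fieldCoord x c f V) y) :
    secondFormNormSq m g f V ((extChartAt (𝓡∂ m) x).symm y) =
      contractSq (gram (chartMetric g c) (mapCoord x c f) stdVec y)
        (covMat (chartMetric g c) (chartGamma g c) (mapCoord x c f) stdVec (fieldCoord x c f V) y) := by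
  have hq := symm_mem_source (interior_subset hy.1)
  rw [← contractSq_frame (isUnit_frameMatrix_readFrame hq
    (mem_chart_source _ ((extChartAt (𝓡∂ m) x).symm y))), contractSq_eq,
    ← inducedMatrix_eq_gram g hf hy]
  have key : ∀ i j, secondForm m g f V ((extChartAt (𝓡∂ m) x).symm y) i j =
      covMat (chartMetric g c) (chartGamma g c) (mapCoord x c f)
        (readFrame (m := m) x ((extChartAt (𝓡∂ m) x).symm y) ((extChartAt (𝓡∂ m) x).symm y))
        (fieldCoord x c f V) y i j := by
    intro i j
    simp only [secondForm, Matrix.of_apply]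
    rw [inner_eq_chartMetric g hy.2, reading_covDerivAlong_coord g hf hy hV]
    simp only [frameVec]
    rw [reading_mfderiv_coord hf hy]
    rfl
  simp only [secondFormNormSq, key]

theorem gradNormSq_eq (hf : ContMDiff (𝓡∂ m) (𝓡∂ n) ∞ f) (hy : y ∈ coordDomain n x c f)
    {φ : S → ℝ} (hφ : DifferentiableAt ℝ (φ ∘ (extChartAt (𝓡∂ m) x).symm) y) :
    gradNormSq m g f φ ((extChartAt (𝓡∂ m) x).symm y) =
      contract (gram (chartMetric g c) (mapCoord x c f) stdVec y)
        (Matrix.of fun i j => fderiv ℝ (φ ∘ (extChartAt (𝓡∂ m) x).symm) y (stdVec i) *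
          fderiv ℝ (φ ∘ (extChartAt (𝓡∂ m) x).symm) y (stdVec j)) := by
  have hq := symm_mem_source (interior_subset hy.1)
  rw [← contract_fderiv_frame (isUnit_frameMatrix_readFrame hq
    (mem_chart_source _ ((extChartAt (𝓡∂ m) x).symm y))), ← inducedMatrix_eq_gram g hf hy]
  simp only [gradNormSq, contract, Matrix.of_apply]
  simp only [mfderiv_eq_fderiv_of_interior hy.1 hφ]
  exact Finset.sum_congr rfl fun i _ => Finset.sum_congr rfl fun j _ => mul_assoc _ _ _

theorem reading_tangentPart (hf : ContMDiff (𝓡∂ m) (𝓡∂ n) ∞ f) (hy : y ∈ coordDomain n x c f)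
    (V : ∀ p, TangentSpace (𝓡∂ n) (f p)) :
    reading x ((extChartAt (𝓡∂ m) x).symm y) (tangentPart m g f ((extChartAt (𝓡∂ m) x).symm y)
      (V ((extChartAt (𝓡∂ m) x).symm y))) =
      tvec (chartMetric g c) (mapCoord x c f) stdVec (fieldCoord x c f V) y := by
  have hq := symm_mem_source (interior_subset hy.1)
  rw [← tvec_frame (isUnit_frameMatrix_readFrame hq
    (mem_chart_source _ ((extChartAt (𝓡∂ m) x).symm y))), tangentPart, reading_eq_clm hq, map_sum]
  simp only [map_smul, tvec, tcomp]
  refine Finset.sum_congr rfl fun i _ => ?_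
  rw [← reading_eq_clm hq, ← inducedMatrix_eq_gram g hf hy]
  refine congrArg₂ (· • ·) (Finset.sum_congr rfl fun j _ => ?_) rfl
  rw [inner_eq_chartMetric g hy.2, frameVec, reading_mfderiv_coord hf hy]
  rfl

theorem reading_tangentField (hf : ContMDiff (𝓡∂ m) (𝓡∂ n) ∞ f) (hy : y ∈ coordDomain n x c f)
    (V : ∀ p, TangentSpace (𝓡∂ n) (f p)) :
    fieldCoord x c f (fun q => mfderiv (𝓡∂ m) (𝓡∂ n) f q (tangentPart m g f q (V q))) y =
      tfield (chartMetric g c) (mapCoord x c f) stdVec (fieldCoord x c f V) y := by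
  rw [fieldCoord, reading_mfderiv_coord hf hy, reading_tangentPart g hf hy]
  rfl

end Coordinates

section Coordinates

variable {m n : ℕ} [NeZero m] [NeZero n] {M : Type*} [TopologicalSpace M]
  [ChartedSpace (EuclideanHalfSpace n) M] [IsManifold (𝓡∂ n) ∞ M]
  {S : Type*} [TopologicalSpace S] [ChartedSpace (EuclideanHalfSpace m) S]
  [IsManifold (𝓡∂ m) ∞ S] (g : RMetric n M) {f : S → M} {x p : S} {c : M}

theorem inducedMatrix_posDef (himm : Function.Injective (mfderiv (𝓡∂ m) (𝓡∂ n) f p))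
    (hp : p ∈ (chartAt (EuclideanHalfSpace m) x).source) : (inducedMatrix m g f x p).PosDef := by
  refine Matrix.PosDef.of_dotProduct_mulVec_pos ?_ fun v hv => ?_
  · ext i j
    simp only [inducedMatrix, Matrix.conjTranspose_apply, Matrix.of_apply, star_trivial]
    exact g.symm _ _ _
  · set w : Coord m := WithLp.toLp 2 v with hw
    have h1 : w ≠ 0 := fun h => hv (by ext i; exact congrArg (fun x : Coord m => x i) h)
    have h2 : mfderiv (𝓡∂ m) (𝓡∂ n) f p (coordVec x p w) ≠ 0 := by
      intro h
      have h3 := himm (h.trans (map_zero _).symm)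
      have h4 := reading_coordVec hp w
      rw [h3, reading_eq_clm hp, map_zero] at h4
      exact h1 h4.symm
    have h5 := g.pos _ _ h2
    have h6 : mfderiv (𝓡∂ m) (𝓡∂ n) f p (coordVec x p w) = ∑ i, v i • frameVec m f x p i := by
      rw [← sum_stdVec w, coordVec_sum hp, map_sum]
      refine Finset.sum_congr rfl fun i _ => ?_
      rw [coordVec_smul hp, map_smul]
      rfl
    rw [h6] at h5
    simp only [map_sum, map_smul, _root_.sum_apply, _root_.smul_apply, smul_eq_mul] at h5
    refine h5.trans_eq ?_
    simp only [dotProduct, Matrix.mulVec, star_trivial, Finset.mul_sum, inducedMatrix, Matrix.of_apply]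
    rw [Finset.sum_comm]
    exact Finset.sum_congr rfl fun i _ => Finset.sum_congr rfl fun j _ => by ring

variable {y : Coord m} {e : Fin m → Coord m}

theorem inducedMatrix_conj (hf : ContMDiff (𝓡∂ m) (𝓡∂ n) ∞ f) (hy : y ∈ coordDomain n x c f)
    (e : Fin m → Coord m) :
    gram (chartMetric g c) (mapCoord x c f) e y = frameMatrix e *
      inducedMatrix m g f x ((extChartAt (𝓡∂ m) x).symm y) * (frameMatrix e).transpose := by
  rw [gram_conj, inducedMatrix_eq_gram g hf hy, readFrame_self (interior_subset hy.1)]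

theorem divAlong_eq_sdiv_of_eventuallyEq (hf : ContMDiff (𝓡∂ m) (𝓡∂ n) ∞ f)
    (hy : y ∈ coordDomain n x c f) (he : IsUnit (frameMatrix e).det)
    {V : ∀ p, TangentSpace (𝓡∂ n) (f p)} {W : Coord m → Coord n}
    (hVW : fieldCoord x c f V =ᶠ[𝓝 y] W) (hW : DifferentiableAt ℝ W y) :
    divAlong m g f V ((extChartAt (𝓡∂ m) x).symm y) =
      sdiv (chartMetric g c) (chartGamma g c) (mapCoord x c f) e W y := by
  rw [divAlong_eq_sdiv g hf hy (hW.congr_of_eventuallyEq hVW), LocalHypersurface.sdiv_congr hVW,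
    sdiv_frame he]

end Coordinates

/-! ### The density of the second variation in charts. -/

section Trace

variable {n m : ℕ} {D : Type*} [NormedAddCommGroup D] [NormedSpace ℝ D] {Ω : Set (Coord n)}
  {G : Coord n → Bil (Coord n) ℝ} {Γ : Coord n → Bil (Coord n) (Coord n)} {U : Set D}
  {f ν : D → Coord n} {e : Fin m → D} {p : D}

/-- A trace does not depend on the basis: on the left it is taken in the standard basis, on the
right in the basis `e_i, ν`, orthonormal for `G`. -/
theorem LocalHypersurface.trace_eq (h : LocalHypersurface Ω G Γ U f ν e) (hp : p ∈ U)
    (h1 : gram G f e p = 1) {L : Coord n → Coord n} (hL : IsLinearMap ℝ L) :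
    ∑ l, L (stdVec l) l = ∑ i, G (f p) (L (frame f e i p)) (frame f e i p)
      + G (f p) (L (ν p)) (ν p) := by
  have hdec : ∀ v : Coord n, v = ∑ i, G (f p) v (frame f e i p) • frame f e i p
      + G (f p) v (ν p) • ν p := by
    intro v
    have := h.decomp hp (fun _ => v)
    rw [tfield_eq] at this
    rw [add_comm]
    refine this.trans ?_
    congr 1
    exact Finset.sum_congr rfl fun i _ => by rw [LocalHypersurface.tcomp_eq h1]
  have hLs : ∀ v : Coord n, L v = ∑ i, G (f p) v (frame f e i p) • L (frame f e i p)
      + G (f p) v (ν p) • L (ν p) := by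
    intro v
    have := congrArg (hL.mk' L) (hdec v)
    rw [map_add, map_sum, map_smul] at this
    refine this.trans ?_
    congr 1
    exact Finset.sum_congr rfl fun i _ => by rw [map_smul]; rfl
  have hG : ∀ v w : Coord n, ∑ l, G (f p) (stdVec l) w * v l = G (f p) v w := by
    intro v w
    conv_rhs => rw [← sum_stdVec v, Bil.sum_left]
    exact Finset.sum_congr rfl fun l _ => by rw [Bil.smul_left, smul_eq_mul, mul_comm]
  calc ∑ l, L (stdVec l) l = ∑ l, (∑ i, G (f p) (stdVec l) (frame f e i p) * L (frame f e i p) l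
        + G (f p) (stdVec l) (ν p) * L (ν p) l) := by
        refine Finset.sum_congr rfl fun l _ => ?_
        conv_lhs => rw [hLs (stdVec l)]
        simp
    _ = _ := by
        rw [Finset.sum_add_distrib, Finset.sum_comm, hG]
        congr 1
        exact Finset.sum_congr rfl fun i _ => hG _ _

/-- The normal direction contributes `R(ν, ν) = 0`, and exchanging the first two arguments of the
curvature gives the sign. -/
theorem LocalHypersurface.ricci_trace (h : LocalHypersurface Ω G Γ U f ν e) (hp : p ∈ U)
    (h1 : gram G f e p = 1) :
    ∑ l, curv Ω Γ (f p) (stdVec l) (ν p) (ν p) l =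
      - ∑ i, G (f p) (curv Ω Γ (f p) (ν p) (frame f e i p) (ν p)) (frame f e i p) := by
  have := h.trace_eq hp h1 (L := fun u => curv Ω Γ (f p) u (ν p) (ν p))
    ⟨fun _ _ => curv_add_left _ _ _ _ _, fun _ _ => curv_smul_left _ _ _ _ _⟩
  rw [this, curv_self, Bil.zero_left, add_zero, ← Finset.sum_neg_distrib]
  refine Finset.sum_congr rfl fun i _ => ?_
  rw [curv_antisymm, Bil.neg_left]

end Trace

section Hypersurface

variable {k : ℕ} {M : Type*} [TopologicalSpace M]
  [ChartedSpace (EuclideanHalfSpace (k + 2)) M] [IsManifold (𝓡∂ (k + 2)) ∞ M]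
  {S : Type*} [TopologicalSpace S] [ChartedSpace (EuclideanHalfSpace (k + 1)) S]
  [IsManifold (𝓡∂ (k + 1)) ∞ S] {g : RMetric (k + 2) M} {f : S → M}
  {ν : ∀ p, TangentSpace (𝓡∂ (k + 2)) (f p)}

/-- A smooth immersed hypersurface with a smooth unit normal field. -/
structure IsHypersurface (g : RMetric (k + 2) M) (f : S → M)
    (ν : ∀ p, TangentSpace (𝓡∂ (k + 2)) (f p)) : Prop where
  smooth : ContMDiff (𝓡∂ (k + 1)) (𝓡∂ (k + 2)) ∞ f
  immersion : ∀ p, Function.Injective (mfderiv (𝓡∂ (k + 1)) (𝓡∂ (k + 2)) f p)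
  smooth_normal : ContMDiff (𝓡∂ (k + 1)) (𝓡∂ (k + 2)).tangent ∞
      (fun p => (⟨f p, ν p⟩ : TangentBundle (𝓡∂ (k + 2)) M))
  unit : ∀ p, g.inner (f p) (ν p) (ν p) = 1
  normal : ∀ p (u : TangentSpace (𝓡∂ (k + 1)) p),
      g.inner (f p) (ν p) (mfderiv (𝓡∂ (k + 1)) (𝓡∂ (k + 2)) f p u) = 0

theorem IsHypersurface.localHypersurface (h : IsHypersurface g f ν) (x : S) (c : M)
    {e : Fin (k + 1) → Coord (k + 1)} (he : IsUnit (frameMatrix e).det) :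
    LocalHypersurface (extChartAt (𝓡∂ (k + 2)) c).target (chartMetric g c) (chartGamma g c)
      (coordDomain (k + 2) x c f) (mapCoord x c f) (fieldCoord x c f ν) e where
  metric := localMetric g c
  isOpen := isOpen_coordDomain h.smooth.continuous
  smooth := (contDiffOn_mapCoord h.smooth).mono coordDomain_subset
  mapsTo := fun y hy => extChartAt_mem_target hy.2
  finrank := by simp
  smoothν := (contDiffOn_fieldCoord h.smooth_normal).mono coordDomain_subset
  unit := fun y hy => by
    have := h.unit ((extChartAt (𝓡∂ (k + 1)) x).symm y)
    rwa [inner_eq_chartMetric g hy.2] at this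
  normal := fun y hy i => by
    have := h.normal _ (coordVec x ((extChartAt (𝓡∂ (k + 1)) x).symm y) (e i))
    rwa [inner_eq_chartMetric g hy.2, reading_mfderiv_coord h.smooth hy,
      reading_coordVec (symm_mem_source (interior_subset hy.1))] at this
  det_ne := fun y hy => by
    rw [inducedMatrix_conj g h.smooth hy e, Matrix.det_mul, Matrix.det_mul, Matrix.det_transpose]
    exact mul_ne_zero (mul_ne_zero he.ne_zero (inducedMatrix_posDef g (h.immersion _)
      (symm_mem_source (interior_subset hy.1))).det_pos.ne') he.ne_zero

theorem IsHypersurface.exists_orthonormal (h : IsHypersurface g f ν) {x : S} {c : M}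
    {y : Coord (k + 1)} (hy : y ∈ coordDomain (k + 2) x c f) :
    ∃ e : Fin (k + 1) → Coord (k + 1), IsUnit (frameMatrix e).det ∧
      gram (chartMetric g c) (mapCoord x c f) e y = 1 := by
  obtain ⟨P, hP, hP1⟩ := exists_conj_eq_one (inducedMatrix_posDef g (h.immersion _)
      (symm_mem_source (c := x) (interior_subset hy.1)))
  refine ⟨fun i => WithLp.toLp 2 (P i), hP, ?_⟩
  rw [inducedMatrix_conj g h.smooth hy]
  exact hP1

/-- The density of the second variation, computed in charts. -/
theorem IsHypersurface.density_eq (h : IsHypersurface g f ν)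
    (hH : ∀ (x : S), ∀ y ∈ interior (extChartAt (𝓡∂ (k + 1)) x).target,
      divAlong (k + 1) g f ν ((extChartAt (𝓡∂ (k + 1)) x).symm y) = 0)
    {X Z : ∀ p, TangentSpace (𝓡∂ (k + 2)) (f p)} {x : S} {y : Coord (k + 1)} {c : M}
    (hc : c = f ((extChartAt (𝓡∂ (k + 1)) x).symm y))
    (hy : y ∈ coordDomain (k + 2) x c f)
    (hX : ContDiffOn ℝ ∞ (fieldCoord (m := k + 1) (n := k + 2) x c f X) (coordDomain (k + 2) x c f))
    (hZ : ContDiffOn ℝ ∞ (fieldCoord (m := k + 1) (n := k + 2) x c f Z) (coordDomain (k + 2) x c f))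
    {e : Fin (k + 1) → Coord (k + 1)} (he : IsUnit (frameMatrix e).det)
    (h1 : gram (chartMetric g c) (mapCoord x c f) e y = 1) :
    secondVariationDensity (k + 1) g f ν X Z ((extChartAt (𝓡∂ (k + 1)) x).symm y) =
      secondVariationForm (extChartAt (𝓡∂ (k + 2)) c).target (chartMetric g c) (chartGamma g c)
        (mapCoord x c f) (fieldCoord x c f ν) e (fieldCoord x c f X) (fieldCoord x c f Z) y := by
  have hL := h.localHypersurface x c he
  set G := chartMetric (n := k + 2) g c with hG
  set Γ := chartGamma (n := k + 2) g c with hΓ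
  set F := mapCoord (m := k + 1) (n := k + 2) x c f with hF
  set N := fieldCoord (m := k + 1) (n := k + 2) x c f ν with hN
  set X' := fieldCoord (m := k + 1) (n := k + 2) x c f X with hX'
  set Z' := fieldCoord (m := k + 1) (n := k + 2) x c f Z with hZ'
  set U := coordDomain (m := k + 1) (k + 2) x c f with hU
  have hUy : ∀ᶠ y' in 𝓝 y, y' ∈ U := hL.isOpen.mem_nhds hy
  have hH' : ∀ y' ∈ U, sdiv G Γ F e N y' = 0 := by
    intro y' hy'
    rw [← hH x y' hy'.1, divAlong_eq_sdiv_of_eventuallyEq g h.smooth hy' he (Eventually.of_forall fun _ => rfl)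
      (LocalHypersurface.differentiableAt_of_contDiffOn hL.isOpen hy' hL.smoothν)]
  rw [← hL.localDensity_eq hy h1 hX hZ hH' (hL.ricci_trace hy h1).symm.symm]
  have hτ : ∀ (V : ∀ p, TangentSpace (𝓡∂ (k + 2)) (f p)), ∀ y' ∈ U,
      reading x ((extChartAt (𝓡∂ (k + 1)) x).symm y') (tangentPart (k + 1) g f
        ((extChartAt (𝓡∂ (k + 1)) x).symm y') (V ((extChartAt (𝓡∂ (k + 1)) x).symm y')))
        = tvec G F e (fieldCoord (m := k + 1) (n := k + 2) x c f V) y' := fun V y' hy' => by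
    rw [reading_tangentPart g h.smooth hy', tvec_frame he]
  have hT : ∀ (V : ∀ p, TangentSpace (𝓡∂ (k + 2)) (f p)), ∀ y' ∈ U,
      fieldCoord (m := k + 1) (n := k + 2) x c f (fun q => mfderiv (𝓡∂ (k + 1)) (𝓡∂ (k + 2)) f q
        (tangentPart (k + 1) g f q (V q))) y' = tfield G F e (fieldCoord (m := k + 1) (n := k + 2) x c f V) y' :=
    fun V y' hy' => by rw [reading_tangentField g h.smooth hy', tfield_frame he]
  have hφ : ∀ y' ∈ U, ((fun q => g.inner (f q) (X q) (ν q)) ∘ (extChartAt (𝓡∂ (k + 1)) x).symm) y' =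
      G (F y') (X' y') (N y') := fun y' hy' => inner_eq_chartMetric g hy'.2 _ _
  have hφe : ((fun q => g.inner (f q) (X q) (ν q)) ∘ (extChartAt (𝓡∂ (k + 1)) x).symm) =ᶠ[𝓝 y]
      fun q => G (F q) (X' q) (N q) := hUy.mono hφ
  have hφd : ContDiffOn ℝ ∞ (fun q => G (F q) (X' q) (N q)) U := hL.contDiffOn_inner hX hL.smoothν
  have hdX := hL.contDiffOn_tfield hX
  have hdZ := hL.contDiffOn_tfield hZ
  have hcovw : ∀ (V : ∀ p, TangentSpace (𝓡∂ (k + 2)) (f p)) (W : Coord (k + 1) → Coord (k + 2)),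
      ContDiffOn ℝ ∞ W U → (∀ y' ∈ U, fieldCoord (m := k + 1) (n := k + 2) x c f V y' = W y') → ∀ y' ∈ U,
      fieldCoord (m := k + 1) (n := k + 2) x c f (fun q => covDerivAlong g (𝓡∂ (k + 1)) f V q (tangentPart (k + 1) g f q (X q))) y'
        = cov Γ F W (tvec G F e X' y') y' := by
    intro V W hW hVW y' hy'
    have he' : fieldCoord (m := k + 1) (n := k + 2) x c f V =ᶠ[𝓝 y'] W := by
      filter_upwards [hL.isOpen.mem_nhds hy'] with z hz using hVW z hz
    have hd := (LocalHypersurface.differentiableAt_of_contDiffOn hL.isOpen hy' hW)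
    have := reading_covDerivAlong_coord g h.smooth hy' (hd.congr_of_eventuallyEq he')
      (tangentPart (k + 1) g f _ (X ((extChartAt (𝓡∂ (k + 1)) x).symm y')))
    rw [hτ X y' hy'] at this
    refine this.trans ?_
    exact cov_congr he'
  have hcovs : ∀ (W : Coord (k + 1) → Coord (k + 2)), ContDiffOn ℝ ∞ W U →
      ContDiffOn ℝ ∞ (fun y' => cov Γ F W (tvec G F e X' y') y') U := by
    intro W hW
    have : (fun y' => cov Γ F W (tvec G F e X' y') y') =
        fun y' => ∑ i, tcomp G F e X' i y' • cov Γ F W (e i) y' := by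
      funext y'
      rw [tvec, cov_sum_dir]
    rw [this]
    exact ContDiffOn.sum fun i _ => (hL.contDiffOn_tcomp hX i).smul (hL.contDiffOn_cov hW (e i))
  have hdiv := fun (V : ∀ p, TangentSpace (𝓡∂ (k + 2)) (f p)) (W : Coord (k + 1) → Coord (k + 2))
    (hW : ContDiffOn ℝ ∞ W U) (hVW : ∀ y' ∈ U, fieldCoord (m := k + 1) (n := k + 2) x c f V y' = W y')
    (y' : Coord (k + 1)) (hy' : y' ∈ U) =>
    divAlong_eq_sdiv_of_eventuallyEq g h.smooth hy' he
      (show fieldCoord (m := k + 1) (n := k + 2) x c f V =ᶠ[𝓝 y'] W by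
        filter_upwards [hL.isOpen.mem_nhds hy'] with z hz using hVW z hz)
      (LocalHypersurface.differentiableAt_of_contDiffOn hL.isOpen hy' hW)
  simp only [secondVariationDensity, localDensity]
  congr 1
  · congr 1
    · congr 1
      · congr 1
        · congr 1
          · rw [gradNormSq_eq g h.smooth hy ((LocalHypersurface.differentiableAt_of_contDiffOn
              hL.isOpen hy hφd).congr_of_eventuallyEq hφe), hφe.fderiv_eq, contract_fderiv_frame he]
          · refine congrArg₂ (· * ·) (congrArg (· ^ 2) (hφ y hy)) ?_
            have e1 : N y = (ν ((extChartAt (𝓡∂ (k + 1)) x).symm y) : Coord (k + 2)) := by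
              rw [hN, fieldCoord, hc, reading_self]
            have e2 : extChartAt (𝓡∂ (k + 2)) c c = F y := by
              rw [hF, mapCoord, ← hc]
            -- `ricci` is defined in the chart at its own base point, which is why `c` has to be `f`
            -- of the point. The base point is generalized so that the equality can be substituted.
            have key : ∀ (a : M) (v : Coord (k + 2)), c = a → N y = v → ricci g a v v =
                ∑ l, curv (extChartAt (𝓡∂ (k + 2)) c).target Γ (F y) (stdVec l) (N y) (N y) l := by
              intro a v ha hv
              subst ha
              subst hv
              rw [← e2]
              exact ricci_eq g _ _ _
            exact key _ _ hc e1
        · refine congrArg₂ (· * ·) (congrArg (· ^ 2) (hφ y hy)) ?_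
          rw [secondFormNormSq_eq g h.smooth hy (LocalHypersurface.differentiableAt_of_contDiffOn
              hL.isOpen hy hL.smoothν), contractSq_frame he]
      · refine hdiv _ (fun q => sdiv G Γ F e (tfield G F e X') q • tfield G F e X' q
          - cov Γ F (tfield G F e X') (tvec G F e X' q) q) ?_ ?_ y hy
        · exact ((hL.contDiffOn_sdiv hdX).smul hdX).sub (hcovs _ hdX)
        · intro y' hy'
          have k1 := hcovw _ _ hdX (hT X) y' hy'
          have k2 := hdiv _ _ hdX (hT X) y' hy'
          rw [← hT X y' hy', ← k1, ← k2]
          simp only [fieldCoord, sub_eq_add_neg]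
          rw [reading_add hy'.2, reading_smul hy'.2, ← neg_one_smul ℝ, reading_smul hy'.2, neg_one_smul]
    · exact hdiv _ _ hdZ (hT Z) y hy
  · congr 1
    refine hdiv _ (fun q => G (F q) (X' q) (N q) • cov Γ F N (tvec G F e X' q) q) ?_ ?_ y hy
    · exact hφd.smul (hcovs _ hL.smoothν)
    · intro y' hy'
      have k1 := hcovw ν N hL.smoothν (fun _ _ => rfl) y' hy'
      rw [← k1, ← hφ y' hy']
      simp only [fieldCoord, Function.comp_apply]
      rw [reading_smul hy'.2]

end Hypersurface

/-! ### Variations of the hypersurface in charts. -/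

section Variation

variable {m n : ℕ} [NeZero m] [NeZero n] {M : Type*} [TopologicalSpace M]
  [ChartedSpace (EuclideanHalfSpace n) M] [IsManifold (𝓡∂ n) ∞ M]
  {S : Type*} [TopologicalSpace S] [ChartedSpace (EuclideanHalfSpace m) S]
  [IsManifold (𝓡∂ m) ∞ S] (g : RMetric n M) {F : ℝ → S → M} {J : Set ℝ} {x : S} {c : M}

/-- A variation in charts. -/
noncomputable def timeMap (x : S) (c : M) (F : ℝ → S → M) (q : ℝ × Coord m) : Coord n :=
  mapCoord x c (F q.1) q.2

/-- The coordinate points which a variation maps to the domain of the preferred chart at `c`. -/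
def timeDomain (n : ℕ) [NeZero n] {M : Type*} [TopologicalSpace M]
    [ChartedSpace (EuclideanHalfSpace n) M] (J : Set ℝ) (x : S) (c : M) (F : ℝ → S → M) :
    Set (ℝ × Coord m) :=
  J ×ˢ (extChartAt (𝓡∂ m) x).target ∩
    (fun q => F q.1 ((extChartAt (𝓡∂ m) x).symm q.2)) ⁻¹' (chartAt (EuclideanHalfSpace n) c).source

/-- A smooth family of maps, with times in `J`. -/
def IsSmoothFamily (m n : ℕ) [NeZero m] [NeZero n] {M : Type*} [TopologicalSpace M]
    [ChartedSpace (EuclideanHalfSpace n) M] {S : Type*} [TopologicalSpace S]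
    [ChartedSpace (EuclideanHalfSpace m) S] (F : ℝ → S → M) (J : Set ℝ) : Prop :=
  ContMDiffOn (𝓘(ℝ, ℝ).prod (𝓡∂ m)) (𝓡∂ n) ∞ (fun q : ℝ × S => F q.1 q.2) (J ×ˢ univ)

variable (hF : IsSmoothFamily m n F J)

include hF

theorem IsSmoothFamily.contMDiff {t : ℝ} (ht : t ∈ J) : ContMDiff (𝓡∂ m) (𝓡∂ n) ∞ (F t) := by
  have h1 : ContMDiff (𝓡∂ m) (𝓘(ℝ, ℝ).prod (𝓡∂ m)) ∞ (fun p : S => (t, p)) :=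
    contMDiff_const.prodMk contMDiff_id
  exact hF.comp_contMDiff h1 fun p => ⟨ht, mem_univ _⟩

theorem IsSmoothFamily.contMDiffOn_coord : ContMDiffOn 𝓘(ℝ, ℝ × Coord m) (𝓡∂ n) ∞
    (fun q : ℝ × Coord m => F q.1 ((extChartAt (𝓡∂ m) x).symm q.2))
    (J ×ˢ (extChartAt (𝓡∂ m) x).target) := by
  have h1 : ContMDiffOn 𝓘(ℝ, ℝ × Coord m) (𝓘(ℝ, ℝ).prod (𝓡∂ m)) ∞
      (fun q : ℝ × Coord m => (q.1, (extChartAt (𝓡∂ m) x).symm q.2))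
      (J ×ˢ (extChartAt (𝓡∂ m) x).target) :=
    (contDiff_fst.contMDiff.contMDiffOn).prodMk
      ((contMDiffOn_extChartAt_symm x).comp contDiff_snd.contMDiff.contMDiffOn fun q hq => hq.2)
  exact ContMDiffOn.comp hF h1 fun q hq => ⟨hq.1, mem_univ _⟩

theorem IsSmoothFamily.contDiffOn_timeMap :
    ContDiffOn ℝ ∞ (timeMap (m := m) (n := n) x c F) (timeDomain n J x c F) := by
  have h2 := (contMDiffOn_extChartAt (I := 𝓡∂ n) (n := ∞) (x := c)).comp
    (hF.contMDiffOn_coord.mono inter_subset_left) (s := timeDomain n J x c F) (fun q hq => hq.2)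
  exact contMDiffOn_iff_contDiffOn.1 h2

theorem IsSmoothFamily.timeDomain_mem_nhdsWithin {q : ℝ × Coord m} (hq : q ∈ timeDomain n J x c F) :
    timeDomain n J x c F ∈ 𝓝[J ×ˢ (extChartAt (𝓡∂ m) x).target] q :=
  inter_mem self_mem_nhdsWithin ((hF.contMDiffOn_coord.continuousOn q hq.1)
    ((chartAt (EuclideanHalfSpace n) c).open_source.mem_nhds hq.2))

theorem IsSmoothFamily.contDiffWithinAt_timeMap {q : ℝ × Coord m} (hq : q ∈ timeDomain n J x c F) :
    ContDiffWithinAt ℝ ∞ (timeMap (m := m) (n := n) x c F) (J ×ˢ (extChartAt (𝓡∂ m) x).target) q :=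
  (hF.contDiffOn_timeMap q hq).mono_of_mem_nhdsWithin (hF.timeDomain_mem_nhdsWithin hq)

theorem IsSmoothFamily.hasFDerivWithinAt_space {t : ℝ} {y : Coord m}
    (hq : (t, y) ∈ timeDomain n J x c F) :
    HasFDerivWithinAt (mapCoord (m := m) (n := n) x c (F t))
      ((fderivWithin ℝ (timeMap x c F) (J ×ˢ (extChartAt (𝓡∂ m) x).target) (t, y)).comp
        (ContinuousLinearMap.inr ℝ ℝ (Coord m))) (extChartAt (𝓡∂ m) x).target y := by
  have h1 := ((hF.contDiffWithinAt_timeMap hq).differentiableWithinAt (by simp)).hasFDerivWithinAt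
  exact h1.comp y (hasFDerivAt_prodMk_right t y).hasFDerivWithinAt fun z hz => ⟨hq.1.1, hz⟩

theorem IsSmoothFamily.reading_mfderiv {t : ℝ} {y : Coord m}
    (hq : (t, y) ∈ timeDomain n J x c F)
    (w : TangentSpace (𝓡∂ m) ((extChartAt (𝓡∂ m) x).symm y)) :
    reading c (F t ((extChartAt (𝓡∂ m) x).symm y))
      (mfderiv (𝓡∂ m) (𝓡∂ n) (F t) ((extChartAt (𝓡∂ m) x).symm y) w) =
      fderivWithin ℝ (timeMap x c F) (J ×ˢ (extChartAt (𝓡∂ m) x).target) (t, y)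
        (0, reading x _ w) := by
  have h1 := hF.hasFDerivWithinAt_space hq
  have hy := hq.1.2
  have e := (extChartAt (𝓡∂ m) x).right_inv hy
  rw [FreeBoundary.reading_mfderiv ((hF.contMDiff hq.1.1).mdifferentiable (by simp) _) hq.2,
    mfderiv_eq_fderivWithin (x := x) (symm_mem_source hy) (by rw [e]; exact h1.differentiableWithinAt), e]
  have h2 : fderivWithin ℝ ((fun p => extChartAt (𝓡∂ n) c (F t p)) ∘ (extChartAt (𝓡∂ m) x).symm)
      (extChartAt (𝓡∂ m) x).target y = _ :=
    h1.fderivWithin (uniqueDiffOn_extChartAt_target x y hy)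
  rw [h2]
  simp

theorem IsSmoothFamily.inducedMatrix_eq {t : ℝ} {y : Coord m}
    (hq : (t, y) ∈ timeDomain n J x c F) (i j : Fin m) :
    inducedMatrix m g (F t) x ((extChartAt (𝓡∂ m) x).symm y) i j =
      chartMetric g c (timeMap x c F (t, y))
        (fderivWithin ℝ (timeMap x c F) (J ×ˢ (extChartAt (𝓡∂ m) x).target) (t, y) (0, stdVec i))
        (fderivWithin ℝ (timeMap x c F) (J ×ˢ (extChartAt (𝓡∂ m) x).target) (t, y) (0, stdVec j)) := by
  have hy := symm_mem_source hq.1.2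
  simp only [inducedMatrix, Matrix.of_apply, frameVec]
  rw [inner_eq_chartMetric g hq.2, hF.reading_mfderiv hq, hF.reading_mfderiv hq, reading_coordVec hy,
    reading_coordVec hy]
  rfl

/-- The induced metric depends smoothly on the time and the point, up to the boundary. -/
theorem IsSmoothFamily.contDiffOn_inducedMatrix (hJ : UniqueDiffOn ℝ J) (x : S) (i j : Fin m) :
    ContDiffOn ℝ ∞ (fun q : ℝ × Coord m =>
      inducedMatrix m g (F q.1) x ((extChartAt (𝓡∂ m) x).symm q.2) i j)
      (J ×ˢ (extChartAt (𝓡∂ m) x).target) := by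
  intro q hq
  -- Smoothness is local, so at each point the target chart may be the one at the image point; the
  -- induced metric does not depend on it.
  set c := F q.1 ((extChartAt (𝓡∂ m) x).symm q.2) with hc
  have hqc : q ∈ timeDomain n J x c F := ⟨hq, mem_chart_source _ _⟩
  have huniq : UniqueDiffOn ℝ (J ×ˢ (extChartAt (𝓡∂ m) x).target) :=
    hJ.prod (uniqueDiffOn_extChartAt_target x)
  have hn := hF.timeDomain_mem_nhdsWithin hqc
  have h1 := hF.contDiffWithinAt_timeMap hqc
  have h2 : ∀ i, ContDiffOn ℝ ∞ (fun q => fderivWithin ℝ (timeMap (m := m) (n := n) x c F)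
      (J ×ˢ (extChartAt (𝓡∂ m) x).target) q ((0 : ℝ), stdVec i)) (timeDomain n J x c F) := by
    intro i q' hq'
    refine (ContDiffWithinAt.clm_apply (ContDiffWithinAt.mono
      ((hF.contDiffWithinAt_timeMap hq').fderivWithin_right (m := ∞) huniq (by simp) hq'.1)
      inter_subset_left) contDiffWithinAt_const)
  have h3 : ContDiffOn ℝ ∞ (fun q => chartMetric g c (timeMap (m := m) (n := n) x c F q))
      (timeDomain n J x c F) :=
    (contDiffOn_chartMetric g c).comp hF.contDiffOn_timeMap fun q hq => extChartAt_mem_target hq.2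
  have h4 := (h3.bil_apply (h2 i) (h2 j)) q hqc
  refine (h4.mono_of_mem_nhdsWithin hn).congr_of_eventuallyEq ?_ (hF.inducedMatrix_eq g hqc i j)
  filter_upwards [hn] with q' hq' using hF.inducedMatrix_eq g hq' i j

end Variation

section SecondVariation

variable {k : ℕ} {M : Type*} [TopologicalSpace M]
  [ChartedSpace (EuclideanHalfSpace (k + 2)) M] [IsManifold (𝓡∂ (k + 2)) ∞ M]
  {S : Type*} [TopologicalSpace S] [ChartedSpace (EuclideanHalfSpace (k + 1)) S]
  [IsManifold (𝓡∂ (k + 1)) ∞ S] {g : RMetric (k + 2) M} {f : S → M}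
  {ν : ∀ p, TangentSpace (𝓡∂ (k + 2)) (f p)} {F : ℝ → S → M} {ε : ℝ} {x : S} {c : M}
  {y : Coord (k + 1)}

/-- The interior part of the domain of a variation in charts. -/
def openTimeDomain (ε : ℝ) (x : S) (c : M) (F : ℝ → S → M) : Set (ℝ × Coord (k + 1)) :=
  Ioo (-ε) ε ×ˢ interior (extChartAt (𝓡∂ (k + 1)) x).target ∩
    (fun q => F q.1 ((extChartAt (𝓡∂ (k + 1)) x).symm q.2)) ⁻¹'
      (chartAt (EuclideanHalfSpace (k + 2)) c).source

variable (hF : IsSmoothFamily (k + 1) (k + 2) F (Ioo (-ε) ε)) (hε : 0 < ε) (hF0 : ∀ p, F 0 p = f p)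

include hF

theorem isOpen_openTimeDomain : IsOpen (openTimeDomain (k := k) ε x c F) := by
  refine ContinuousOn.isOpen_inter_preimage ?_ (isOpen_Ioo.prod isOpen_interior)
    (chartAt (EuclideanHalfSpace (k + 2)) c).open_source
  exact (hF.contMDiffOn_coord (x := x)).continuousOn.mono (prod_mono_right interior_subset)

theorem contDiffOn_timeMap_interior :
    ContDiffOn ℝ ∞ (timeMap (m := k + 1) (n := k + 2) x c F) (openTimeDomain ε x c F) :=
  hF.contDiffOn_timeMap.mono fun _ hq => ⟨⟨hq.1.1, interior_subset hq.1.2⟩, hq.2⟩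

theorem timeMap_differentiableAt {q : ℝ × Coord (k + 1)} (hq : q ∈ openTimeDomain ε x c F) :
    DifferentiableAt ℝ (timeMap (m := k + 1) (n := k + 2) x c F) q :=
  LocalHypersurface.differentiableAt_of_contDiffOn (isOpen_openTimeDomain hF) hq
    (contDiffOn_timeMap_interior hF)

theorem fderiv_mapCoord_eq {t : ℝ} (hq : (t, y) ∈ openTimeDomain ε x c F) (v : Coord (k + 1)) :
    fderiv ℝ (mapCoord (m := k + 1) (n := k + 2) x c (F t)) y v =
      fderiv ℝ (timeMap x c F) (t, y) (0, v) := by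
  have h := (timeMap_differentiableAt hF hq).hasFDerivAt.comp y (hasFDerivAt_prodMk_right t y)
  rw [show mapCoord (m := k + 1) (n := k + 2) x c (F t) = timeMap x c F ∘ fun z => (t, z) from rfl,
    h.fderiv]
  simp

theorem fderiv_time_eq {t : ℝ} (hq : (t, y) ∈ openTimeDomain ε x c F) :
    HasDerivAt (fun s => timeMap (m := k + 1) (n := k + 2) x c F (s, y))
      (fderiv ℝ (timeMap x c F) (t, y) (1, 0)) t := by
  have h := (timeMap_differentiableAt hF hq).hasFDerivAt.comp (f := fun s : ℝ => (s, y)) t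
    (hasFDerivAt_prodMk_left (𝕜 := ℝ) t y)
  have h2 := h.hasDerivAt
  simp only [ContinuousLinearMap.comp_apply, ContinuousLinearMap.inl_apply] at h2
  exact h2

theorem reading_velocity {t : ℝ} (hq : (t, y) ∈ openTimeDomain ε x c F) :
    reading c (F t ((extChartAt (𝓡∂ (k + 1)) x).symm y))
      (mfderiv 𝓘(ℝ, ℝ) (𝓡∂ (k + 2)) (fun s => F s ((extChartAt (𝓡∂ (k + 1)) x).symm y)) t (1 : ℝ)) =
      fderiv ℝ (timeMap x c F) (t, y) (1, 0) := by
  have h1 : MDifferentiableAt 𝓘(ℝ, ℝ) (𝓡∂ (k + 2))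
      (fun s => F s ((extChartAt (𝓡∂ (k + 1)) x).symm y)) t := by
    have h2 : ContMDiff 𝓘(ℝ, ℝ) (𝓘(ℝ, ℝ).prod (𝓡∂ (k + 1))) ∞
      (fun s : ℝ => (s, (extChartAt (𝓡∂ (k + 1)) x).symm y)) := contMDiff_id.prodMk contMDiff_const
    have h3 := ContMDiffOn.comp hF h2.contMDiffOn (s := Ioo (-ε) ε) fun s hs => ⟨hs, mem_univ _⟩
    exact (h3.contMDiffAt (isOpen_Ioo.mem_nhds hq.1.1)).mdifferentiableAt (by simp)
  refine (reading_mfderiv h1 hq.2 (1 : ℝ)).trans ?_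
  rw [mfderiv_eq_fderiv]
  have := (fderiv_time_eq hF hq).hasFDerivAt.fderiv
  refine (congrArg (fun L : ℝ →L[ℝ] Coord (k + 2) => L 1) this).trans ?_
  simp

omit hF in
theorem reading_congr {a b : M} (h : a = b) (v : Coord (k + 2)) :
    reading (n := k + 2) c a v = reading (n := k + 2) c b v := by rw [h]

include hε hF0

theorem mem_openTimeDomain (hy : y ∈ coordDomain (k + 2) x c f) :
    ((0 : ℝ), y) ∈ openTimeDomain ε x c F :=
  ⟨⟨⟨neg_lt_zero.2 hε, hε⟩, hy.1⟩, by
    rw [mem_preimage]; simp only [hF0]; exact hy.2⟩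

theorem fieldCoord_variationField (hy : y ∈ coordDomain (k + 2) x c f) :
    fieldCoord x c f (variationField (k + 2) f F) y = fderiv ℝ (timeMap x c F) (0, y) (1, 0) := by
  rw [← reading_velocity hF (mem_openTimeDomain hF hε hF0 hy)]
  exact (reading_congr (hF0 _) _).symm

/-- The time curve of a point is handled by `reading_covDerivAlong` with the identity of `ℝ` as
parametrization. Its velocity reads as the time derivative of `timeMap`, so the acceleration is a
covariant derivative along `timeMap` in the direction `(1, 0)`. -/
theorem fieldCoord_variationAcceleration (hy : y ∈ coordDomain (k + 2) x c f) :
    fieldCoord x c f (variationAcceleration g f F) y =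
      cov (chartGamma g c) (timeMap x c F) (fun q => fderiv ℝ (timeMap x c F) q (1, 0)) (1, 0)
        (0, y) := by
  have hm := mem_openTimeDomain hF hε hF0 hy
  have hO := isOpen_openTimeDomain hF (x := x) (c := c)
  set p := (extChartAt (𝓡∂ (k + 1)) x).symm y with hp
  have hline : Tendsto (fun s : ℝ => (s, y)) (𝓝 0) (𝓝 ((0 : ℝ), y)) :=
    (Continuous.prodMk_left y).tendsto 0
  have h1 : MDifferentiableAt 𝓘(ℝ, ℝ) (𝓡∂ (k + 2)) (fun s => F s p) 0 := by
    have h2 : ContMDiff 𝓘(ℝ, ℝ) (𝓘(ℝ, ℝ).prod (𝓡∂ (k + 1))) ∞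
      (fun s : ℝ => (s, p)) := contMDiff_id.prodMk contMDiff_const
    have h3 := ContMDiffOn.comp hF h2.contMDiffOn (s := Ioo (-ε) ε) fun s hs => ⟨hs, mem_univ _⟩
    exact (h3.contMDiffAt (isOpen_Ioo.mem_nhds hm.1.1)).mdifferentiableAt (by simp)
  have hvel : (fun s => reading (n := k + 2) c (F s p)
      (mfderiv 𝓘(ℝ, ℝ) (𝓡∂ (k + 2)) (fun t : ℝ => F t p) s (1 : ℝ))) =ᶠ[𝓝 0]
      fun s => fderiv ℝ (timeMap x c F) (s, y) (1, 0) := by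
    filter_upwards [hline.eventually (hO.mem_nhds hm)] with s hs using reading_velocity hF hs
  have hsm : ContDiffOn ℝ ∞ (fun q => fderiv ℝ (timeMap (m := k + 1) (n := k + 2) x c F) q (1, 0))
      (openTimeDomain ε x c F) :=
    ((contDiffOn_timeMap_interior hF).fderiv_of_isOpen hO (by simp)).clm_apply contDiffOn_const
  have hdv : HasDerivAt (fun s => fderiv ℝ (timeMap (m := k + 1) (n := k + 2) x c F) (s, y) (1, 0))
      (fderiv ℝ (fun q => fderiv ℝ (timeMap (m := k + 1) (n := k + 2) x c F) q (1, 0)) (0, y) (1, 0))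
      0 := by
    have h := (LocalHypersurface.differentiableAt_of_contDiffOn hO hm hsm).hasFDerivAt.comp
      (f := fun s : ℝ => (s, y)) (0 : ℝ) (hasFDerivAt_prodMk_left (𝕜 := ℝ) (0 : ℝ) y)
    have h2 := h.hasDerivAt
    simp only [ContinuousLinearMap.comp_apply, ContinuousLinearMap.inl_apply] at h2
    exact h2
  have key := reading_covDerivAlong g (c := c) (J := 𝓘(ℝ, ℝ)) (σ := fun s : ℝ => s)
    (f := fun s => F s p) (V := fun s => mfderiv 𝓘(ℝ, ℝ) (𝓡∂ (k + 2)) (fun t : ℝ => F t p) s (1 : ℝ))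
    (y₀ := 0) (w := (1 : ℝ)) (w' := (1 : ℝ)) (fun u _ => by rw [mfderiv_eq_fderiv]; rfl) h1
    h1.continuousAt hm.2 (fderiv_time_eq hF hm).differentiableAt
    (hdv.differentiableAt.congr_of_eventuallyEq hvel)
  refine Eq.trans ?_ (key.trans ?_)
  · exact (reading_congr (hF0 _) _).symm
  · refine (cov_congr hvel).trans ?_
    simp only [cov]
    congr 1
    · rw [hdv.hasFDerivAt.fderiv]; simp
    · have e := (fderiv_time_eq hF hm).hasFDerivAt.fderiv
      have e' := congrArg (fun L : ℝ →L[ℝ] Coord (k + 2) => L 1) e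
      simp only [ContinuousLinearMap.toSpanSingleton_apply, one_smul] at e'
      rw [← e']
      rfl

theorem contDiffOn_fieldCoord_variation :
    ContDiffOn ℝ ∞ (fieldCoord (m := k + 1) (n := k + 2) x c f (variationField (k + 2) f F))
      (coordDomain (k + 2) x c f) ∧
    ContDiffOn ℝ ∞ (fieldCoord (m := k + 1) (n := k + 2) x c f (variationAcceleration g f F))
      (coordDomain (k + 2) x c f) := by
  have hO := isOpen_openTimeDomain hF (x := x) (c := c)
  have hin : ContDiff ℝ ∞ (fun z : Coord (k + 1) => ((0 : ℝ), z)) := contDiff_prodMk_right 0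
  have hsm : ContDiffOn ℝ ∞ (fun q => fderiv ℝ (timeMap (m := k + 1) (n := k + 2) x c F) q (1, 0))
      (openTimeDomain ε x c F) :=
    ((contDiffOn_timeMap_interior hF).fderiv_of_isOpen hO (by simp)).clm_apply contDiffOn_const
  constructor
  · exact (hsm.comp hin.contDiffOn fun z hz => mem_openTimeDomain hF hε hF0 hz).congr fun z hz =>
      fieldCoord_variationField hF hε hF0 hz
  · have := (localMetric g c).contDiffOn_cov hO (contDiffOn_timeMap_interior hF)
      (fun q hq => extChartAt_mem_target hq.2) hsm (1, 0)
    exact (this.comp hin.contDiffOn fun z hz => mem_openTimeDomain hF hε hF0 hz).congr fun z hz =>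
      fieldCoord_variationAcceleration hF hε hF0 hz

/-- The second derivative of the volume element. -/
theorem IsHypersurface.secondDeriv_volumeElement (h : IsHypersurface g f ν)
    (hH : ∀ (x : S), ∀ y ∈ interior (extChartAt (𝓡∂ (k + 1)) x).target,
      divAlong (k + 1) g f ν ((extChartAt (𝓡∂ (k + 1)) x).symm y) = 0)
    (hy : y ∈ interior (extChartAt (𝓡∂ (k + 1)) x).target) :
    HasDerivAt (deriv fun t => √(inducedMatrix (k + 1) g (F t) x
        ((extChartAt (𝓡∂ (k + 1)) x).symm y)).det)
      (√(inducedMatrix (k + 1) g f x ((extChartAt (𝓡∂ (k + 1)) x).symm y)).det *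
        secondVariationDensity (k + 1) g f ν (variationField (k + 2) f F)
          (variationAcceleration g f F) ((extChartAt (𝓡∂ (k + 1)) x).symm y)) 0 := by
  set p := (extChartAt (𝓡∂ (k + 1)) x).symm y with hp
  obtain ⟨c, hc⟩ : ∃ c, c = f p := ⟨_, rfl⟩
  have hyc : y ∈ coordDomain (k + 2) x c f := ⟨hy, by
    rw [mem_preimage, hc]; exact mem_chart_source _ _⟩
  obtain ⟨e, he, h1⟩ := h.exists_orthonormal hyc
  have hL := h.localHypersurface x c he
  have hO := isOpen_openTimeDomain hF (x := x) (c := c)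
  have hm := mem_openTimeDomain hF hε hF0 hyc
  have hsd := hL.secondDeriv_volumeElement hyc h1 hO (contDiffOn_timeMap_interior hF)
    (fun q hq => extChartAt_mem_target hq.2) hm
    (Eventually.of_forall fun z => by simp only [timeMap, mapCoord, hF0])
  have hX := (contDiffOn_fieldCoord_variation (g := g) (x := x) (c := c) hF hε hF0)
  have hden := h.density_eq hH hc hyc hX.1 hX.2 he h1
  have hgram : ∀ t, (t, y) ∈ openTimeDomain ε x c F →
      gram (chartMetric g c) (timeMap x c F) (fun i => ((0 : ℝ), e i)) (t, y) =
      frameMatrix e * inducedMatrix (k + 1) g (F t) x p * (frameMatrix e).transpose := by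
    intro t ht
    rw [← inducedMatrix_conj g (hF.contMDiff ht.1.1) (c := c) ⟨hy, ht.2⟩ e]
    ext i j
    simp only [gram, Matrix.of_apply, frame]
    rw [fderiv_mapCoord_eq hF ht, fderiv_mapCoord_eq hF ht]
    rfl
  have hsqrt : ∀ A : Matrix (Fin (k + 1)) (Fin (k + 1)) ℝ,
      √(frameMatrix e * A * (frameMatrix e).transpose).det = |(frameMatrix e).det| * √A.det := by
    intro A
    rw [Matrix.det_mul, Matrix.det_mul, Matrix.det_transpose,
      show (frameMatrix e).det * A.det * (frameMatrix e).det = (frameMatrix e).det ^ 2 * A.det by ring,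
      Real.sqrt_mul (sq_nonneg _), Real.sqrt_sq_eq_abs]
  -- At time zero the Gram matrix in the frame `e` is the identity, so `|det e|` is the reciprocal
  -- of the volume element of `f`. This constant converts between the orthonormal frame and the
  -- coordinate frame.
  have hunit : |(frameMatrix e).det| * √(inducedMatrix (k + 1) g f x p).det = 1 := by
    rw [← hsqrt, ← inducedMatrix_conj g h.smooth hyc e, h1, Matrix.det_one, Real.sqrt_one]
  have hne : |(frameMatrix e).det| ≠ 0 := by
    intro h0; rw [h0, zero_mul] at hunit; exact zero_ne_one hunit
  have hline : Tendsto (fun s : ℝ => (s, y)) (𝓝 0) (𝓝 ((0 : ℝ), y)) :=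
    (Continuous.prodMk_left y).tendsto 0
  have hev : (fun t => √(inducedMatrix (k + 1) g (F t) x p).det) =ᶠ[𝓝 0] fun t =>
      √(inducedMatrix (k + 1) g f x p).det *
        √(gram (chartMetric g c) (timeMap x c F) (fun i => ((0 : ℝ), e i)) (t, y)).det := by
    filter_upwards [hline.eventually (hO.mem_nhds hm)] with t ht
    rw [hgram t ht, hsqrt, ← mul_assoc, mul_comm (√_) |_|, hunit, one_mul]
  have hderiv := hev.deriv
  rw [hden]
  have hsd' := (hsd.const_mul (√(inducedMatrix (k + 1) g f x p).det))
  have heq : secondVariationForm (extChartAt (𝓡∂ (k + 2)) c).target (chartMetric g c) (chartGamma g c)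
      (mapCoord x c f) (fieldCoord x c f ν) e
      (fieldCoord x c f (variationField (k + 2) f F)) (fieldCoord x c f (variationAcceleration g f F)) y
      = secondVariationForm (extChartAt (𝓡∂ (k + 2)) c).target (chartMetric g c) (chartGamma g c)
      (mapCoord x c f) (fieldCoord x c f ν) e (fun y => fderiv ℝ (timeMap x c F) (0, y) (1, 0))
        (fun y => cov (chartGamma g c) (timeMap x c F) (fun q => fderiv ℝ (timeMap x c F) q (1, 0)) (1, 0)
          (0, y)) y := by
    have e1 : fieldCoord (m := k + 1) (n := k + 2) x c f (variationField (k + 2) f F) =ᶠ[𝓝 y]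
        fun y => fderiv ℝ (timeMap x c F) (0, y) (1, 0) := by
      filter_upwards [hL.isOpen.mem_nhds hyc] with z hz using fieldCoord_variationField hF hε hF0 hz
    have e2 : fieldCoord (m := k + 1) (n := k + 2) x c f (variationAcceleration g f F) =ᶠ[𝓝 y]
        fun y => cov (chartGamma g c) (timeMap x c F) (fun q => fderiv ℝ (timeMap x c F) q (1, 0)) (1, 0)
          (0, y) := by
      filter_upwards [hL.isOpen.mem_nhds hyc] with z hz using
        fieldCoord_variationAcceleration hF hε hF0 hz
    simp only [secondVariationForm, covMat, cov_congr e1, cov_congr e2, e1.eq_of_nhds]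
  rw [heq]
  refine hsd'.congr_of_eventuallyEq ?_
  filter_upwards [hderiv] with t ht
  rw [ht, deriv_const_mul_field]

end SecondVariation

/-! ### The volume measure of an induced metric. -/

section ChangeOfChart

variable {m n : ℕ} [NeZero m] [NeZero n] {M : Type*} [TopologicalSpace M]
  [ChartedSpace (EuclideanHalfSpace n) M] [IsManifold (𝓡∂ n) ∞ M]
  {S : Type*} [TopologicalSpace S] [ChartedSpace (EuclideanHalfSpace m) S]
  [IsManifold (𝓡∂ m) ∞ S] (g : RMetric n M) {f : S → M} {x x' p : S}

theorem inducedMatrix_change (hx : p ∈ (chartAt (EuclideanHalfSpace m) x).source) (x' : S) :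
    inducedMatrix m g f x' p = frameMatrix (readFrame (m := m) x x' p) * inducedMatrix m g f x p *
      (frameMatrix (readFrame (m := m) x x' p)).transpose := by
  have h1 := frameMatrix_conj (fun v w : Coord m => g.inner (f p)
      (mfderiv (𝓡∂ m) (𝓡∂ n) f p (coordVec x p v)) (mfderiv (𝓡∂ m) (𝓡∂ n) f p (coordVec x p w)))
    (fun _ => ⟨fun _ _ => by rw [coordVec_add hx, map_add, map_add]; rfl,
      fun _ _ => by rw [coordVec_smul hx, map_smul, map_smul]; rfl⟩)
    (fun _ => ⟨fun _ _ => by rw [coordVec_add hx, map_add, map_add],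
      fun _ _ => by rw [coordVec_smul hx, map_smul, map_smul]⟩) (readFrame (m := m) x x' p)
  refine Eq.trans ?_ h1
  ext i j
  simp only [inducedMatrix, Matrix.of_apply, frameVec, readFrame]
  rw [coordVec_reading hx, coordVec_reading hx]

theorem det_inducedMatrix_change (hx : p ∈ (chartAt (EuclideanHalfSpace m) x).source) (x' : S) :
    (inducedMatrix m g f x' p).det =
      (frameMatrix (readFrame (m := m) x x' p)).det ^ 2 * (inducedMatrix m g f x p).det := by
  rw [inducedMatrix_change g hx x', Matrix.det_mul, Matrix.det_mul, Matrix.det_transpose]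
  ring

/-- The matrix of the coordinate change is the transpose of the matrix that relates the two frames.
Its determinant is thus the Jacobian that compensates the factor in `det_inducedMatrix_change`. -/
theorem det_fderivWithin_transition (hx : p ∈ (chartAt (EuclideanHalfSpace m) x).source)
    (hx' : p ∈ (chartAt (EuclideanHalfSpace m) x').source) :
    (fderivWithin ℝ (transition x x') (extChartAt (𝓡∂ m) x).target (extChartAt (𝓡∂ m) x p)).det =
      (frameMatrix (readFrame (m := m) x' x p)).det := by
  set L := fderivWithin ℝ (transition (n := m) x x') (extChartAt (𝓡∂ m) x).target
    (extChartAt (𝓡∂ m) x p) with hL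
  have : LinearMap.toMatrix (EuclideanSpace.basisFun (Fin m) ℝ).toBasis
      (EuclideanSpace.basisFun (Fin m) ℝ).toBasis (L : Coord m →ₗ[ℝ] Coord m) =
      (frameMatrix (readFrame (m := m) x' x p)).transpose := by
    ext i j
    simp only [LinearMap.toMatrix_apply, Matrix.transpose_apply, frameMatrix, Matrix.of_apply]
    have := reading_transition hx hx' (coordVec x p (stdVec j))
    rw [reading_coordVec hx] at this
    rw [readFrame, this]
    simp [hL]
  rw [ContinuousLinearMap.det, ← LinearMap.det_toMatrix (EuclideanSpace.basisFun (Fin m) ℝ).toBasis,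
    this, Matrix.det_transpose]

end ChangeOfChart

section Volume

variable {n : ℕ} {k : ℕ} [NeZero n] {M : Type*} [TopologicalSpace M]
  [ChartedSpace (EuclideanHalfSpace n) M] [IsManifold (𝓡∂ n) ∞ M]
  {S : Type*} [TopologicalSpace S] [T2Space S] [SigmaCompactSpace S]
  [ChartedSpace (EuclideanHalfSpace (k + 1)) S] [IsManifold (𝓡∂ (k + 1)) ∞ S]
  [MeasurableSpace S] [BorelSpace S] (g : RMetric n M) {f : S → M} {x x' : S}

theorem measurableSet_target (x : S) : MeasurableSet (extChartAt (𝓡∂ (k + 1)) x).target := by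
  rw [extChartAt_target]
  exact ((chartAt (EuclideanHalfSpace (k + 1)) x).open_target.preimage
    (𝓡∂ (k + 1)).continuous_symm).measurableSet.inter (𝓡∂ (k + 1)).isClosed_range.measurableSet

theorem aemeasurable_extChartAt_symm (x : S) : AEMeasurable (extChartAt (𝓡∂ (k + 1)) x).symm
    (volume.restrict (extChartAt (𝓡∂ (k + 1)) x).target) :=
  (continuousOn_extChartAt_symm x).aemeasurable (measurableSet_target x)

/-- The volume element of the induced metric in the preferred chart at `x`. -/
noncomputable def volumeElement (g : RMetric n M) (f : S → M) (x : S) (y : Coord (k + 1)) : ℝ :=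
  √(inducedMatrix (k + 1) g f x ((extChartAt (𝓡∂ (k + 1)) x).symm y)).det

omit [T2Space S] [SigmaCompactSpace S] [MeasurableSpace S] [BorelSpace S] in
theorem contDiffOn_inducedMatrix (hf : ContMDiff (𝓡∂ (k + 1)) (𝓡∂ n) ∞ f) (x : S) (i j : Fin (k + 1)) :
    ContDiffOn ℝ ∞ (fun y => inducedMatrix (k + 1) g f x ((extChartAt (𝓡∂ (k + 1)) x).symm y) i j)
      (extChartAt (𝓡∂ (k + 1)) x).target := by
  have h0 : ContMDiff (𝓘(ℝ, ℝ).prod (𝓡∂ (k + 1))) (𝓡∂ n) ∞ (fun q : ℝ × S => f q.2) :=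
    hf.comp contMDiff_snd
  have h1 : IsSmoothFamily (k + 1) n (fun _ : ℝ => f) univ := h0.contMDiffOn
  have h2 := h1.contDiffOn_inducedMatrix g uniqueDiffOn_univ x i j
  have h3 : ContDiff ℝ ∞ (fun z : Coord (k + 1) => ((0 : ℝ), z)) := contDiff_prodMk_right 0
  exact ContDiffOn.comp (f := fun z : Coord (k + 1) => ((0 : ℝ), z)) h2 h3.contDiffOn
    fun y hy => ⟨mem_univ _, hy⟩

theorem continuousOn_volumeElement (hf : ContMDiff (𝓡∂ (k + 1)) (𝓡∂ n) ∞ f) (x : S) :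
    ContinuousOn (volumeElement g f x) (extChartAt (𝓡∂ (k + 1)) x).target :=
  Real.continuous_sqrt.comp_continuousOn
    (contDiffOn_det (contDiffOn_inducedMatrix g hf x)).continuousOn

theorem aemeasurable_volumeElement (hf : ContMDiff (𝓡∂ (k + 1)) (𝓡∂ n) ∞ f) (x : S) :
    AEMeasurable (fun y => ENNReal.ofReal (volumeElement g f x y))
      (volume.restrict (extChartAt (𝓡∂ (k + 1)) x).target) :=
  ((continuousOn_volumeElement g hf x).aemeasurable (measurableSet_target x)).ennreal_ofReal

theorem chartVolume_eq (x : S) : chartVolume k g f x =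
    ((volume.restrict (extChartAt (𝓡∂ (k + 1)) x).target).withDensity fun y : Coord (k + 1) =>
      ENNReal.ofReal (volumeElement g f x y)).map (extChartAt (𝓡∂ (k + 1)) x).symm := rfl

theorem chartVolume_apply {B : Set S} (hB : MeasurableSet B) :
    chartVolume k g f x B = ∫⁻ y in (extChartAt (𝓡∂ (k + 1)) x).target ∩
      (extChartAt (𝓡∂ (k + 1)) x).symm ⁻¹' B, ENNReal.ofReal (volumeElement g f x y) := by
  have h1 := (aemeasurable_extChartAt_symm x).mono_ac
    (withDensity_absolutelyContinuous _ fun y : Coord (k + 1) => ENNReal.ofReal (volumeElement g f x y))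
  rw [chartVolume_eq, Measure.map_apply_of_aemeasurable h1 hB]
  have hm : NullMeasurableSet ((extChartAt (𝓡∂ (k + 1)) x).symm ⁻¹' B)
      (volume.restrict (extChartAt (𝓡∂ (k + 1)) x).target) :=
    (aemeasurable_extChartAt_symm x).nullMeasurable hB
  rw [withDensity_apply₀ _ hm, Measure.restrict_restrict₀ hm, inter_comm]

theorem measurableSet_target_inter {B : Set S} (hB : MeasurableSet B) :
    MeasurableSet ((extChartAt (𝓡∂ (k + 1)) x).target ∩ (extChartAt (𝓡∂ (k + 1)) x).symm ⁻¹' B) := by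
  have h1 : Measurable ((extChartAt (𝓡∂ (k + 1)) x).target.domRestrict (extChartAt (𝓡∂ (k + 1)) x).symm) :=
    (continuousOn_iff_continuous_domRestrict.1 (continuousOn_extChartAt_symm x)).measurable
  have h2 := (MeasurableEmbedding.subtype_coe (measurableSet_target x)).measurableSet_image.2 (h1 hB)
  convert h2 using 1
  ext y
  constructor
  · rintro ⟨h, h'⟩; exact ⟨⟨y, h⟩, h', rfl⟩
  · rintro ⟨⟨y, h⟩, h', rfl⟩; exact ⟨h, h'⟩

theorem source_inter_preimage_eq {B : Set S} (hB : B ⊆ (chartAt (EuclideanHalfSpace (k + 1)) x).source) :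
    (extChartAt (𝓡∂ (k + 1)) x).target ∩ (extChartAt (𝓡∂ (k + 1)) x).symm ⁻¹' B =
      extChartAt (𝓡∂ (k + 1)) x '' B := by
  ext y
  constructor
  · rintro ⟨h, h'⟩; exact ⟨_, h', (extChartAt (𝓡∂ (k + 1)) x).right_inv h⟩
  · rintro ⟨p, hp, rfl⟩
    refine ⟨extChartAt_mem_target (hB hp), ?_⟩
    rwa [mem_preimage, extChartAt_symm_extChartAt (hB hp)]

/-- The chart volumes agree on the overlap of two charts. -/
theorem chartVolume_overlap {B : Set S}
    (hB : MeasurableSet B) (hx : B ⊆ (chartAt (EuclideanHalfSpace (k + 1)) x).source)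
    (hx' : B ⊆ (chartAt (EuclideanHalfSpace (k + 1)) x').source) :
    chartVolume k g f x' B = chartVolume k g f x B := by
  rw [chartVolume_apply g hB, chartVolume_apply g hB, source_inter_preimage_eq hx,
    source_inter_preimage_eq hx']
  have hA : MeasurableSet (extChartAt (𝓡∂ (k + 1)) x '' B) := by
    rw [← source_inter_preimage_eq hx]; exact measurableSet_target_inter hB
  have himg : extChartAt (𝓡∂ (k + 1)) x' '' B = transition x x' '' (extChartAt (𝓡∂ (k + 1)) x '' B) := by
    rw [image_image]
    exact image_congr fun p hp => (transition_extChartAt (hx hp)).symm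
  have hd : ∀ y ∈ extChartAt (𝓡∂ (k + 1)) x '' B, HasFDerivWithinAt (transition x x')
      (fderivWithin ℝ (transition x x') (extChartAt (𝓡∂ (k + 1)) x).target y)
      (extChartAt (𝓡∂ (k + 1)) x '' B) y := by
    rintro _ ⟨p, hp, rfl⟩
    refine (((contDiffWithinAt_transition (hx hp) (hx' hp)).differentiableWithinAt
      (by simp)).hasFDerivWithinAt).mono ?_
    rintro _ ⟨q, hq, rfl⟩
    exact extChartAt_mem_target (hx hq)
  have hinj : InjOn (transition (n := k + 1) x x') (extChartAt (𝓡∂ (k + 1)) x '' B) := by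
    rintro _ ⟨p, hp, rfl⟩ _ ⟨q, hq, rfl⟩ h
    rw [transition_extChartAt (hx hp), transition_extChartAt (hx hq)] at h
    congr 1
    exact (extChartAt (𝓡∂ (k + 1)) x').injOn (by rw [extChartAt_source]; exact hx' hp)
      (by rw [extChartAt_source]; exact hx' hq) h
  -- This change of variables asks only for injectivity and derivatives within the set, so charts
  -- reaching the boundary are covered.
  rw [himg, lintegral_image_eq_lintegral_abs_det_fderiv_mul volume hA hd hinj]
  refine setLIntegral_congr_fun hA ?_
  rintro _ ⟨p, hp, rfl⟩
  have h1 := hx hp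
  have h2 := hx' hp
  simp only
  rw [det_fderivWithin_transition h1 h2, transition_extChartAt h1,
    ← ENNReal.ofReal_mul (abs_nonneg _), volumeElement, volumeElement, extChartAt_symm_extChartAt h1,
    extChartAt_symm_extChartAt h2, det_inducedMatrix_change g h2 x, Real.sqrt_mul (sq_nonneg _),
    Real.sqrt_sq_eq_abs]

theorem lintegral_chartVolume (hf : ContMDiff (𝓡∂ (k + 1)) (𝓡∂ n) ∞ f) {u : S → ENNReal}
    (hu : Measurable u) : ∫⁻ p, u p ∂(chartVolume k g f x) =
      ∫⁻ y in (extChartAt (𝓡∂ (k + 1)) x).target, ENNReal.ofReal (volumeElement g f x y) *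
        u ((extChartAt (𝓡∂ (k + 1)) x).symm y) := by
  have h1 := (aemeasurable_extChartAt_symm x).mono_ac
    (withDensity_absolutelyContinuous _ fun y : Coord (k + 1) => ENNReal.ofReal (volumeElement g f x y))
  have h2 := lintegral_withDensity_eq_lintegral_mul₀ (aemeasurable_volumeElement g hf x)
    (hu.comp_aemeasurable (aemeasurable_extChartAt_symm x))
  rw [chartVolume_eq, lintegral_map' hu.aemeasurable h1]
  exact h2

theorem chartPartition_subordinate (x : S) :
    tsupport (chartPartition k S x) ⊆ (chartAt (EuclideanHalfSpace (k + 1)) x).source :=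
  (SmoothPartitionOfUnity.exists_isSubordinate_chartAt_source (𝓡∂ (k + 1)) S).choose_spec x

variable (k) in
theorem exists_finset_chartPartition {K : Set S} (hK : IsCompact K) :
    ∃ s : Finset S, (∀ x ∉ s, ∀ p ∈ K, chartPartition k S x p = 0) ∧
      ∀ p ∈ K, ∑ x ∈ s, chartPartition k S x p = 1 := by
  have hfin := (chartPartition k S).locallyFinite.finite_nonempty_inter_compact hK
  refine ⟨hfin.toFinset, ?_, ?_⟩
  · intro x hx p hp
    by_contra hne
    exact hx (hfin.mem_toFinset.2 ⟨p, hne, hp⟩)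
  · intro p hp
    rw [← (chartPartition k S).sum_eq_one (mem_univ p)]
    refine (finsum_eq_sum_of_support_subset _ fun x hx => ?_).symm
    exact hfin.mem_toFinset.2 ⟨p, hx, hp⟩

theorem measure_sum_restrict_eq {ι α : Type*} [MeasurableSpace α] (μ : ι → Measure α) {K : Set α}
    (hK : MeasurableSet K) (s : Finset ι) (h : ∀ i ∉ s, μ i K = 0) :
    (Measure.sum μ).restrict K = ∑ i ∈ s, (μ i).restrict K := by
  ext B hB
  rw [Measure.restrict_sum _ hK, Measure.sum_apply _ hB, Measure.finsetSum_apply]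
  refine tsum_eq_sum fun i hi => ?_
  rw [Measure.restrict_eq_zero.2 (h i hi)]
  rfl

theorem withDensity_chartPartition_null (μ : Measure S) {K : Set S} (hK : MeasurableSet K) {x : S}
    (h : ∀ p ∈ K, chartPartition k S x p = 0) :
    μ.withDensity (fun p => ENNReal.ofReal (chartPartition k S x p)) K = 0 := by
  rw [withDensity_apply _ hK, setLIntegral_congr_fun hK (g := fun _ => 0)]
  · simp
  · intro p hp; simp [h p hp]

theorem inducedVolume_restrict {K : Set S} (hK : IsCompact K) {s : Finset S}
    (hs : ∀ x ∉ s, ∀ p ∈ K, chartPartition k S x p = 0) :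
    (inducedVolume k g f).restrict K = ∑ x ∈ s, ((chartVolume k g f x).withDensity
      fun p => ENNReal.ofReal (chartPartition k S x p)).restrict K :=
  measure_sum_restrict_eq _ hK.measurableSet s fun x hx =>
    withDensity_chartPartition_null _ hK.measurableSet (hs x hx)

theorem measurable_chartPartition (x : S) :
    Measurable fun p => ENNReal.ofReal (chartPartition k S x p) :=
  ((chartPartition k S x).contMDiff.continuous.measurable).ennreal_ofReal

/-- The chart measures agree on overlaps, so each may be replaced by the one at `x`; the weights of
the partition then sum to one on `K`. -/
theorem inducedVolume_restrict_eq {K : Set S}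
    (hK : IsCompact K) (hKx : K ⊆ (chartAt (EuclideanHalfSpace (k + 1)) x).source) :
    (inducedVolume k g f).restrict K = (chartVolume k g f x).restrict K := by
  obtain ⟨s, hs, hs1⟩ := exists_finset_chartPartition k hK
  rw [inducedVolume_restrict g hK hs]
  have h1 : ∀ x' ∈ s, ((chartVolume k g f x').withDensity
      fun p => ENNReal.ofReal (chartPartition k S x' p)).restrict K =
      ((chartVolume k g f x).restrict K).withDensity
        fun p => ENNReal.ofReal (chartPartition k S x' p) := by
    intro x' _
    set O := (chartAt (EuclideanHalfSpace (k + 1)) x').source with hO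
    have hOm : MeasurableSet O := (chartAt (EuclideanHalfSpace (k + 1)) x').open_source.measurableSet
    have hzero : ∀ p ∉ O, chartPartition k S x' p = 0 := fun p hp => by
      by_contra hne
      exact hp (chartPartition_subordinate x' (subset_tsupport _ hne))
    -- The weight vanishes outside the chart domain `O`, so only the overlap with `O` has to be
    -- compared.
    have hrestr : ∀ μ : Measure S, μ.withDensity (fun p => ENNReal.ofReal (chartPartition k S x' p)) =
        (μ.restrict O).withDensity (fun p => ENNReal.ofReal (chartPartition k S x' p)) := by
      intro μ
      rw [← withDensity_indicator hOm]
      congr 1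
      funext p
      by_cases hp : p ∈ O
      · rw [indicator_of_mem hp]
      · rw [indicator_of_notMem hp, hzero p hp, ENNReal.ofReal_zero]
    rw [restrict_withDensity hK.measurableSet, hrestr, hrestr ((chartVolume k g f x).restrict K)]
    congr 1
    ext B hB
    rw [Measure.restrict_apply hB, Measure.restrict_apply (hB.inter hOm), Measure.restrict_apply hB,
      Measure.restrict_apply (hB.inter hOm)]
    refine chartVolume_overlap g ((hB.inter hOm).inter hK.measurableSet) ?_ ?_
    · exact inter_subset_right.trans hKx
    · exact inter_subset_left.trans inter_subset_right
  rw [Finset.sum_congr rfl h1]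
  ext B hB
  rw [Measure.finsetSum_apply]
  simp only [withDensity_apply _ hB]
  rw [← lintegral_finsetSum _ fun x _ => measurable_chartPartition x, Measure.restrict_restrict hB]
  rw [setLIntegral_congr_fun (hB.inter hK.measurableSet) (g := fun _ => 1), setLIntegral_one,
    Measure.restrict_apply hB]
  intro p hp
  simp only
  rw [← ENNReal.ofReal_sum_of_nonneg fun x _ => (chartPartition k S).nonneg x p, hs1 p hp.2,
    ENNReal.ofReal_one]

/-- Only finitely many weights meet `K`. Each is at most the indicator of `K ∩ tsupport`, a compact
subset of the chart domain on whose image the continuous volume element is integrable. -/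
theorem inducedVolume_lt_top (hf : ContMDiff (𝓡∂ (k + 1)) (𝓡∂ n) ∞ f) {K : Set S}
    (hK : IsCompact K) : inducedVolume k g f K < ⊤ := by
  obtain ⟨s, hs, -⟩ := exists_finset_chartPartition k hK
  rw [← Measure.restrict_apply_univ, inducedVolume_restrict g hK hs, Measure.finsetSum_apply]
  refine ENNReal.sum_lt_top.2 fun x _ => ?_
  rw [Measure.restrict_apply_univ, withDensity_apply _ hK.measurableSet]
  set C := K ∩ tsupport (chartPartition k S x) with hC
  have hCc : IsCompact C := hK.inter_right (isClosed_tsupport _)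
  have hCx : C ⊆ (chartAt (EuclideanHalfSpace (k + 1)) x).source :=
    inter_subset_right.trans (chartPartition_subordinate x)
  calc ∫⁻ p in K, ENNReal.ofReal (chartPartition k S x p) ∂(chartVolume k g f x)
      ≤ ∫⁻ p in K, C.indicator (fun _ => 1) p ∂(chartVolume k g f x) := by
        refine setLIntegral_mono' hK.measurableSet fun p hp => ?_
        by_cases h : p ∈ tsupport (chartPartition k S x)
        · rw [indicator_of_mem (show p ∈ C from ⟨hp, h⟩)]
          exact ENNReal.ofReal_le_one.2 ((chartPartition k S).le_one x p)
        · have : chartPartition k S x p = 0 := by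
            by_contra hne; exact h (subset_tsupport _ hne)
          simp [this]
    _ ≤ ∫⁻ p, C.indicator (fun _ => 1) p ∂(chartVolume k g f x) := setLIntegral_le_lintegral _ _
    _ = chartVolume k g f x C := by
        rw [lintegral_indicator hCc.measurableSet, setLIntegral_one]
    _ < ⊤ := by
        rw [chartVolume_apply g hCc.measurableSet, source_inter_preimage_eq hCx]
        have hic : IsCompact (extChartAt (𝓡∂ (k + 1)) x '' C) :=
          hCc.image_of_continuousOn ((continuousOn_extChartAt x).mono (by
            rw [extChartAt_source]; exact hCx))
        have hsub : extChartAt (𝓡∂ (k + 1)) x '' C ⊆ (extChartAt (𝓡∂ (k + 1)) x).target := by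
          rintro _ ⟨p, hp, rfl⟩; exact extChartAt_mem_target (hCx hp)
        have := ((continuousOn_volumeElement g hf x).mono hsub).integrableOn_compact hic (μ := volume)
        exact this.lintegral_lt_top

-- The target is the intersection of an open set with the half-space, whose interior is given by a
-- positive zeroth coordinate.
omit [T2Space S] [SigmaCompactSpace S] [MeasurableSpace S] [BorelSpace S] in
theorem mem_interior_target {y : Coord (k + 1)} :
    y ∈ interior (extChartAt (𝓡∂ (k + 1)) x).target ↔
      y ∈ (extChartAt (𝓡∂ (k + 1)) x).target ∧ 0 < y 0 := by
  have ho : IsOpen ((𝓡∂ (k + 1)).symm ⁻¹' (chartAt (EuclideanHalfSpace (k + 1)) x).target) :=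
    (chartAt (EuclideanHalfSpace (k + 1)) x).open_target.preimage (𝓡∂ (k + 1)).continuous_symm
  have h1 : interior (range (𝓡∂ (k + 1))) = {y | 0 < y 0} :=
    interior_range_modelWithCornersEuclideanHalfSpace (k + 1)
  have h2 : range (𝓡∂ (k + 1)) = {y | 0 ≤ y 0} := range_modelWithCornersEuclideanHalfSpace (k + 1)
  rw [extChartAt_target, interior_inter, ho.interior_eq, h1, h2]
  constructor
  · rintro ⟨a, b⟩; exact ⟨⟨a, le_of_lt (show (0 : ℝ) < y 0 from b)⟩, b⟩
  · rintro ⟨⟨a, -⟩, b⟩; exact ⟨a, b⟩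

omit [T2Space S] [SigmaCompactSpace S] [MeasurableSpace S] [BorelSpace S] in
theorem nonneg_of_mem_target {y : Coord (k + 1)} (hy : y ∈ (extChartAt (𝓡∂ (k + 1)) x).target) :
    0 ≤ y 0 := by
  have h2 : range (𝓡∂ (k + 1)) = {y | 0 ≤ y 0} := range_modelWithCornersEuclideanHalfSpace (k + 1)
  have := extChartAt_target_subset_range x hy
  rwa [h2] at this

omit [T2Space S] [SigmaCompactSpace S] [MeasurableSpace S] [BorelSpace S] in
theorem mem_boundary_iff {y : Coord (k + 1)} (hy : y ∈ (extChartAt (𝓡∂ (k + 1)) x).target) :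
    (extChartAt (𝓡∂ (k + 1)) x).symm y ∈ (𝓡∂ (k + 1)).boundary S ↔ y 0 = 0 := by
  have : IsManifold (𝓡∂ (k + 1)) 1 S := IsManifold.of_le (n := ∞) (by simp)
  have h1 := ModelWithCorners.isInteriorPoint_iff_of_mem_atlas (I := 𝓡∂ (k + 1)) (n := 1) one_ne_zero
    (chart_mem_atlas (EuclideanHalfSpace (k + 1)) x) (symm_mem_source hy)
  rw [← ModelWithCorners.compl_interior, mem_compl_iff]
  change ¬ (𝓡∂ (k + 1)).IsInteriorPoint _ ↔ _
  rw [h1]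
  change ¬ (extChartAt (𝓡∂ (k + 1)) x ((extChartAt (𝓡∂ (k + 1)) x).symm y) ∈
    interior (extChartAt (𝓡∂ (k + 1)) x).target) ↔ _
  rw [(extChartAt (𝓡∂ (k + 1)) x).right_inv hy, mem_interior_target]
  have := nonneg_of_mem_target hy
  constructor
  · intro h
    by_contra hne
    exact h ⟨hy, lt_of_le_of_ne this (Ne.symm hne)⟩
  · rintro h ⟨-, h'⟩
    exact h'.ne' h

theorem volume_hyperplane : volume {y : Coord (k + 1) | y 0 = 0} = 0 := by
  have h := Measure.addHaar_submodule (volume : Measure (Coord (k + 1)))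
    (LinearMap.ker (EuclideanSpace.proj (0 : Fin (k + 1)) : Coord (k + 1) →L[ℝ] ℝ).toLinearMap) (by
      intro h
      have : (stdVec 0 : Coord (k + 1)) ∈ LinearMap.ker
          (EuclideanSpace.proj (0 : Fin (k + 1)) : Coord (k + 1) →L[ℝ] ℝ).toLinearMap := by
        rw [h]; trivial
      rw [LinearMap.mem_ker] at this
      simp at this)
  refine Eq.trans (congrArg _ ?_) h
  ext y
  simp only [mem_ofPred_eq, SetLike.mem_coe, LinearMap.mem_ker]
  rfl

theorem chartVolume_boundary (x : S) :
    chartVolume k g f x ((𝓡∂ (k + 1)).boundary S) = 0 := by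
  have : IsManifold (𝓡∂ (k + 1)) 1 S := IsManifold.of_le (n := ∞) (by simp)
  rw [chartVolume_apply g (ModelWithCorners.isClosed_boundary (n := 1) one_ne_zero).measurableSet]
  refine le_antisymm ((setLIntegral_measure_zero _ _ ?_).le) zero_le
  refine measure_mono_null (fun y hy => ?_) volume_hyperplane
  exact (mem_boundary_iff hy.1).1 hy.2

/-- In every chart the boundary lies in the hyperplane `y 0 = 0`. Identities between integrands are
therefore needed at interior points only. -/
theorem inducedVolume_boundary :
    inducedVolume k g f ((𝓡∂ (k + 1)).boundary S) = 0 := by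
  have : IsManifold (𝓡∂ (k + 1)) 1 S := IsManifold.of_le (n := ∞) (by simp)
  rw [inducedVolume, Measure.sum_apply _
    (ModelWithCorners.isClosed_boundary (n := 1) one_ne_zero).measurableSet]
  refine ENNReal.tsum_eq_zero.2 fun x => ?_
  exact withDensity_absolutelyContinuous _ _ (chartVolume_boundary g x)

end Volume

/-! ### Differentiation of the volume under the integral sign. -/

section Parametric

/-- Differentiation under the integral sign, within a convex set of parameters. -/
theorem hasDerivWithinAt_integral {α : Type*} [MeasurableSpace α] {μ : Measure α} [IsFiniteMeasure μ]
    {s : Set ℝ} (hs : Convex ℝ s) {φ φ' : ℝ → α → ℝ} {C : ℝ}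
    (hd : ∀ᵐ p ∂μ, ∀ t ∈ s, HasDerivWithinAt (fun t => φ t p) (φ' t p) s t)
    (hC : ∀ᵐ p ∂μ, ∀ t ∈ s, ‖φ' t p‖ ≤ C) (hi : ∀ t ∈ s, Integrable (φ t) μ) {t₀ : ℝ} (ht₀ : t₀ ∈ s) :
    HasDerivWithinAt (fun t => ∫ p, φ t p ∂μ) (∫ p, φ' t₀ p ∂μ) s t₀ := by
  rw [hasDerivWithinAt_iff_tendsto_slope]
  have hmem : ∀ᶠ t in 𝓝[s \ {t₀}] t₀, t ∈ s \ {t₀} := eventually_mem_nhdsWithin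
  have h1 : (fun t => ∫ p, slope (fun t => φ t p) t₀ t ∂μ) =ᶠ[𝓝[s \ {t₀}] t₀]
      slope (fun t => ∫ p, φ t p ∂μ) t₀ := by
    filter_upwards [hmem] with t ht
    simp only [slope_def_field]
    rw [integral_div, integral_sub (hi t ht.1) (hi t₀ ht₀)]
  refine Tendsto.congr' h1 ?_
  refine tendsto_integral_filter_of_dominated_convergence (fun _ => C) ?_ ?_ (integrable_const C) ?_
  · filter_upwards [hmem] with t ht
    simp only [slope_def_field]
    exact (((hi t ht.1).sub (hi t₀ ht₀)).div_const _).aestronglyMeasurable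
  · filter_upwards [hmem] with t ht
    filter_upwards [hd, hC] with p hp hpC
    -- On the convex set `s` the mean value inequality bounds the difference quotients by `C`, which
    -- serves as dominating function on a finite measure space.
    have h2 := hs.norm_image_sub_le_of_norm_hasDerivWithin_le hp hpC ht₀ ht.1
    rw [slope_def_field, norm_div]
    exact div_le_of_le_mul₀ (norm_nonneg _)
      ((norm_nonneg _).trans (hpC t ht.1)) h2
  · filter_upwards [hd] with p hp
    exact hasDerivWithinAt_iff_tendsto_slope.1 (hp t₀ ht₀)

end Parametric

section SmoothInTime

variable {m : ℕ} [NeZero m] {S : Type*} [TopologicalSpace S]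
  [ChartedSpace (EuclideanHalfSpace m) S] [IsManifold (𝓡∂ m) ∞ S] {J J' : Set ℝ} {r : ℝ → S → ℝ}

/-- A function of time and a point which is smooth, up to the boundary. -/
def SmoothInTime (m : ℕ) [NeZero m] {S : Type*} [TopologicalSpace S]
    [ChartedSpace (EuclideanHalfSpace m) S] (J : Set ℝ) (r : ℝ → S → ℝ) : Prop :=
  ∀ x : S, ContDiffOn ℝ ∞ (fun q : ℝ × Coord m => r q.1 ((extChartAt (𝓡∂ m) x).symm q.2))
    (J ×ˢ (extChartAt (𝓡∂ m) x).target)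

theorem SmoothInTime.mono (h : SmoothInTime m J r) (hJ : J' ⊆ J) : SmoothInTime m J' r :=
  fun x => (h x).mono (prod_mono_left hJ)

theorem SmoothInTime.continuousOn (h : SmoothInTime m J r) :
    ContinuousOn (fun q : ℝ × S => r q.1 q.2) (J ×ˢ univ) := by
  rintro ⟨t, p⟩ ⟨ht, -⟩
  have hp := mem_chart_source (EuclideanHalfSpace m) p
  have h1 : ContinuousWithinAt (fun q : ℝ × Coord m => r q.1 ((extChartAt (𝓡∂ m) p).symm q.2))
    (J ×ˢ (extChartAt (𝓡∂ m) p).target) (t, extChartAt (𝓡∂ m) p p) :=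
    (h p).continuousOn _ ⟨ht, extChartAt_mem_target hp⟩
  set O := (chartAt (EuclideanHalfSpace m) p).source with hO
  have h2 : ContinuousWithinAt (fun q : ℝ × S => (q.1, extChartAt (𝓡∂ m) p q.2)) (J ×ˢ O) (t, p) :=
    continuousWithinAt_fst.prodMk (((continuousAt_extChartAt (I := 𝓡∂ m) p).comp
      (f := Prod.snd) (x := (t, p)) continuousAt_snd).continuousWithinAt)
  have h3 := h1.comp (f := fun q : ℝ × S => (q.1, extChartAt (𝓡∂ m) p q.2)) (x := (t, p)) h2
    fun _ hq => ⟨hq.1, extChartAt_mem_target hq.2⟩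
  have h4 : ContinuousWithinAt (fun q : ℝ × S => r q.1 q.2) (J ×ˢ O) (t, p) := by
    refine h3.congr (fun _ hq => ?_) ?_
    · simp only [Function.comp_apply, extChartAt_symm_extChartAt hq.2]
    · simp only [Function.comp_apply, extChartAt_symm_extChartAt hp]
  refine h4.mono_of_mem_nhdsWithin ?_
  have h5 : (univ : Set ℝ) ×ˢ O ∈ 𝓝 (t, p) :=
    prod_mem_nhds univ_mem ((chartAt (EuclideanHalfSpace m) p).open_source.mem_nhds hp)
  filter_upwards [self_mem_nhdsWithin, mem_nhdsWithin_of_mem_nhds h5] with q hq hq'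
    using ⟨hq.1, hq'.2⟩

theorem SmoothInTime.continuous (h : SmoothInTime m J r) {t : ℝ} (ht : t ∈ J) :
    Continuous (r t) := by
  have := h.continuousOn.comp_continuous (f := fun p : S => (t, p)) (by fun_prop)
    fun p => ⟨ht, mem_univ _⟩
  exact this

theorem SmoothInTime.hasDerivWithinAt_coord (h : SmoothInTime m J r) {t : ℝ} (ht : t ∈ J) {x : S}
    {y : Coord m} (hy : y ∈ (extChartAt (𝓡∂ m) x).target) :
    HasDerivWithinAt (fun s => r s ((extChartAt (𝓡∂ m) x).symm y))
      (fderivWithin ℝ (fun q : ℝ × Coord m => r q.1 ((extChartAt (𝓡∂ m) x).symm q.2))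
        (J ×ˢ (extChartAt (𝓡∂ m) x).target) (t, y) (1, 0)) J t := by
  have h1 := (((h x) (t, y) ⟨ht, hy⟩).differentiableWithinAt (by simp)).hasFDerivWithinAt
  have h2 := h1.comp (f := fun s : ℝ => (s, y)) t
    (hasFDerivAt_prodMk_left (𝕜 := ℝ) t y).hasFDerivWithinAt (t := J ×ˢ (extChartAt (𝓡∂ m) x).target)
    (s := J) fun s hs => ⟨hs, hy⟩
  have h3 := h2.hasDerivWithinAt
  simp only [ContinuousLinearMap.comp_apply, ContinuousLinearMap.inl_apply] at h3
  exact h3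

theorem SmoothInTime.hasDerivWithinAt (h : SmoothInTime m J r) {t : ℝ} (ht : t ∈ J) (p : S) :
    HasDerivWithinAt (fun s => r s p) (derivWithin (fun s => r s p) J t) J t := by
  have hp := mem_chart_source (EuclideanHalfSpace m) p
  have := (h.hasDerivWithinAt_coord ht (extChartAt_mem_target hp)).differentiableWithinAt
  simp only [extChartAt_symm_extChartAt hp] at this
  exact this.hasDerivWithinAt

theorem SmoothInTime.derivWithin (h : SmoothInTime m J r) (hJ : UniqueDiffOn ℝ J) :
    SmoothInTime m J fun t p => derivWithin (fun s => r s p) J t := by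
  intro x
  have huniq : UniqueDiffOn ℝ (J ×ˢ (extChartAt (𝓡∂ m) x).target) :=
    hJ.prod (uniqueDiffOn_extChartAt_target x)
  have h1 := ((h x).fderivWithin (m := ∞) huniq (by simp)).clm_apply
    (contDiffOn_const (c := ((1 : ℝ), (0 : Coord m))))
  refine h1.congr fun q hq => ?_
  exact (h.hasDerivWithinAt_coord hq.1 hq.2).derivWithin (hJ _ hq.1)

theorem SmoothInTime.sqrt (h : SmoothInTime m J r) (hpos : ∀ t ∈ J, ∀ p, 0 < r t p) :
    SmoothInTime m J fun t p => √(r t p) :=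
  fun x => (h x).sqrt fun _ hq => (hpos _ hq.1 _).ne'

variable [T2Space S] [MeasurableSpace S] [BorelSpace S] {μ : Measure S} {K : Set S} {J₀ : Set ℝ}

/-- The integral of a smooth family over a compact set may be differentiated under the integral
sign. -/
theorem SmoothInTime.hasDerivWithinAt_setIntegral (h : SmoothInTime m J r) (hJ : UniqueDiffOn ℝ J)
    (hK : IsCompact K) (hμ : μ K < ⊤) (hJ₀ : J₀ ⊆ J) (hJ₀c : IsCompact J₀) (hJ₀' : Convex ℝ J₀) {t : ℝ}
    (ht : t ∈ J₀) :
    HasDerivWithinAt (fun s => ∫ p in K, r s p ∂μ)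
      (∫ p in K, _root_.derivWithin (fun s => r s p) J t ∂μ) J₀ t := by
  have hfin : IsFiniteMeasure (μ.restrict K) := ⟨by rwa [Measure.restrict_apply_univ]⟩
  have h' := h.derivWithin hJ
  obtain ⟨C, hC⟩ := (hJ₀c.prod hK).exists_bound_of_continuousOn
    (h'.continuousOn.mono (prod_mono hJ₀ (subset_univ _)))
  refine hasDerivWithinAt_integral (C := C) hJ₀'
    (φ' := fun t p => _root_.derivWithin (fun s => r s p) J t) ?_ ?_ ?_ ht
  · exact Eventually.of_forall fun p t ht => (h.hasDerivWithinAt (hJ₀ ht) p).mono hJ₀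
  · refine (ae_restrict_iff' hK.measurableSet).2 (Eventually.of_forall fun p hp t ht => ?_)
    exact hC (t, p) ⟨ht, hp⟩
  · intro t ht
    obtain ⟨D, hD⟩ := hK.exists_bound_of_continuousOn (h.continuous (hJ₀ ht)).continuousOn
    refine Integrable.of_bound (h.continuous (hJ₀ ht)).aestronglyMeasurable D ?_
    exact (ae_restrict_iff' hK.measurableSet).2 (Eventually.of_forall hD)

end SmoothInTime

section RelativeVolume

variable {n : ℕ} {k : ℕ} [NeZero n] {M : Type*} [TopologicalSpace M]
  [ChartedSpace (EuclideanHalfSpace n) M] [IsManifold (𝓡∂ n) ∞ M]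
  {S : Type*} [TopologicalSpace S]
  [ChartedSpace (EuclideanHalfSpace (k + 1)) S] [IsManifold (𝓡∂ (k + 1)) ∞ S]
  {g : RMetric n M} {f : S → M} {F : ℝ → S → M} {J : Set ℝ} {K : Set S}

theorem inducedMatrix_congr {f₁ f₂ : S → M} {p : S} (h : f₁ =ᶠ[𝓝 p] f₂) (x : S) :
    inducedMatrix (k + 1) g f₁ x p = inducedMatrix (k + 1) g f₂ x p := by
  have key : ∀ (q q' : M) (a a' b b' : Coord n), q = q' → a = a' → b = b' →
      g.inner q a b = g.inner q' a' b' := by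
    rintro q _ a _ b _ rfl rfl rfl; rfl
  have hm : mfderiv (𝓡∂ (k + 1)) (𝓡∂ n) f₁ p = (mfderiv (𝓡∂ (k + 1)) (𝓡∂ n) f₂ p : _) := h.mfderiv_eq
  ext i j
  exact key _ _ _ _ _ _ h.eq_of_nhds (congrArg (fun L : Coord (k + 1) →L[ℝ] Coord n => L _) hm)
    (congrArg (fun L : Coord (k + 1) →L[ℝ] Coord n => L _) hm)

/-- The determinant of the metric at time `t` relative to the metric induced by `f`. -/
noncomputable def relDet (k : ℕ) {n : ℕ} [NeZero n] {M : Type*} [TopologicalSpace M]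
    [ChartedSpace (EuclideanHalfSpace n) M] [IsManifold (𝓡∂ n) ∞ M] {S : Type*} [TopologicalSpace S]
    [ChartedSpace (EuclideanHalfSpace (k + 1)) S] [IsManifold (𝓡∂ (k + 1)) ∞ S]
    (g : RMetric n M) (f : S → M) (F : ℝ → S → M) (t : ℝ) (p : S) : ℝ :=
  (inducedMatrix (k + 1) g (F t) p p).det / (inducedMatrix (k + 1) g f p p).det

/-- A change of chart multiplies both determinants by the same nonzero square. The ratio is thus a
function on `S`, although it is defined with the chart at the point itself. -/
theorem relDet_eq {x p : S} (hp : p ∈ (chartAt (EuclideanHalfSpace (k + 1)) x).source) (t : ℝ) :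
    relDet k g f F t p =
      (inducedMatrix (k + 1) g (F t) x p).det / (inducedMatrix (k + 1) g f x p).det := by
  have hu := (isUnit_frameMatrix_readFrame hp (mem_chart_source (EuclideanHalfSpace (k + 1)) p)).ne_zero
  rw [relDet, det_inducedMatrix_change g hp p, det_inducedMatrix_change g hp p,
    mul_div_mul_left _ _ (pow_ne_zero 2 hu)]

variable (hf : ContMDiff (𝓡∂ (k + 1)) (𝓡∂ n) ∞ f)
  (himm : ∀ p, Function.Injective (mfderiv (𝓡∂ (k + 1)) (𝓡∂ n) f p))
  (hF : IsSmoothFamily (k + 1) n F J)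

include hf himm hF

theorem smoothInTime_relDet (hJ : UniqueDiffOn ℝ J) : SmoothInTime (k + 1) J (relDet k g f F) := by
  intro x
  have h1 := contDiffOn_det (hF.contDiffOn_inducedMatrix g hJ x)
  have hconst : IsSmoothFamily (k + 1) n (fun _ : ℝ => f) J := by
    have h0 : ContMDiff (𝓘(ℝ, ℝ).prod (𝓡∂ (k + 1))) (𝓡∂ n) ∞ (fun q : ℝ × S => f q.2) :=
      hf.comp contMDiff_snd
    exact h0.contMDiffOn
  have h2 := contDiffOn_det (hconst.contDiffOn_inducedMatrix g hJ x)
  refine (h1.div h2 fun _ hq => ?_).congr fun q hq => ?_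
  · exact (inducedMatrix_posDef g (himm _) (symm_mem_source hq.2)).det_pos.ne'
  · exact relDet_eq (symm_mem_source hq.2) _

-- The complement of the compact set `K` is open, so near `p` the maps `F t` and `f` agree together
-- with their differentials.
omit hf hF in
theorem relDet_of_notMem [T2Space S] (hK : IsCompact K) (hoff : ∀ t ∈ J, ∀ p, p ∉ K → F t p = f p) {t : ℝ}
    (ht : t ∈ J) {p : S} (hp : p ∉ K) : relDet k g f F t p = 1 := by
  have : F t =ᶠ[𝓝 p] f := by
    filter_upwards [hK.isClosed.isOpen_compl.mem_nhds hp] with q hq using hoff t ht q hq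
  rw [relDet, inducedMatrix_congr this,
    div_self (inducedMatrix_posDef g (himm _) (mem_chart_source _ p)).det_pos.ne']

/-- The ratio is one at time zero and jointly continuous, so compactness of `K` gives a uniform
time; off `K` it is constantly one. -/
theorem exists_relDet_pos [T2Space S] (hJ : UniqueDiffOn ℝ J) (h0J : (0 : ℝ) ∈ J)
    (hF0 : ∀ p, F 0 p = f p) (hK : IsCompact K)
    (hoff : ∀ t ∈ J, ∀ p, p ∉ K → F t p = f p) :
    ∃ δ > 0, ∀ t ∈ J, |t| < δ → ∀ p, 0 < relDet k g f F t p := by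
  have hdet : ∀ p, (inducedMatrix (k + 1) g f p p).det ≠ 0 := fun p =>
    (inducedMatrix_posDef g (himm _) (mem_chart_source _ p)).det_pos.ne'
  have hc := (smoothInTime_relDet (g := g) hf himm hF hJ).continuousOn
  have h0 : F 0 = f := funext hF0
  have h1 : ∀ᶠ t in 𝓝 (0 : ℝ), ∀ p ∈ K, t ∈ J → 0 < relDet k g f F t p := by
    refine hK.eventually_forall_of_forall_eventually fun p _ => ?_
    have h2 := hc ((0 : ℝ), p) ⟨h0J, mem_univ _⟩
    have h3 : (0 : ℝ) < relDet k g f F 0 p := by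
      rw [relDet, h0, div_self (hdet p)]; exact one_pos
    have h4 := h2.eventually (lt_mem_nhds h3)
    filter_upwards [eventually_nhdsWithin_iff.1 h4] with q hq hqJ using hq ⟨hqJ, mem_univ _⟩
  obtain ⟨δ, hδ, hball⟩ := Metric.eventually_nhds_iff.1 h1
  refine ⟨δ, hδ, fun t htJ ht p => ?_⟩
  by_cases hp : p ∈ K
  · exact hball (by simpa using ht) p hp htJ
  · rw [relDet_of_notMem himm hK hoff htJ hp]
    exact one_pos

end RelativeVolume

section VolumeFunction

variable {n : ℕ} {k : ℕ} [NeZero n] {M : Type*} [TopologicalSpace M]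
  [ChartedSpace (EuclideanHalfSpace n) M] [IsManifold (𝓡∂ n) ∞ M]
  {S : Type*} [TopologicalSpace S] [T2Space S] [SigmaCompactSpace S]
  [ChartedSpace (EuclideanHalfSpace (k + 1)) S] [IsManifold (𝓡∂ (k + 1)) ∞ S]
  [MeasurableSpace S] [BorelSpace S]
  {g : RMetric n M} {f : S → M} {F : ℝ → S → M} {J : Set ℝ} {K : Set S}
  (hf : ContMDiff (𝓡∂ (k + 1)) (𝓡∂ n) ∞ f)
  (himm : ∀ p, Function.Injective (mfderiv (𝓡∂ (k + 1)) (𝓡∂ n) f p))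
  (hF : IsSmoothFamily (k + 1) n F J)

include hf himm hF

/-- In each chart the two volume elements differ by the factor `√relDet`. Dividing only requires the
determinant of `f` to be positive, so `F t` may fail to be an immersion. -/
theorem inducedVolume_eq_withDensity (hJ : UniqueDiffOn ℝ J) {t : ℝ} (ht : t ∈ J) :
    inducedVolume k g (F t) = (inducedVolume k g f).withDensity
      fun p => ENNReal.ofReal √(relDet k g f F t p) := by
  have hR : Measurable fun p => ENNReal.ofReal √(relDet k g f F t p) :=
    (Real.continuous_sqrt.comp ((smoothInTime_relDet (g := g) hf himm hF hJ).continuous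
      ht)).measurable.ennreal_ofReal
  rw [inducedVolume, inducedVolume, withDensity_sum]
  congr 1
  funext x
  have h1 : chartVolume k g (F t) x = (chartVolume k g f x).withDensity
      fun p => ENNReal.ofReal √(relDet k g f F t p) := by
    ext B hB
    rw [withDensity_apply _ hB, ← lintegral_indicator hB,
      lintegral_chartVolume g hf (hR.indicator hB), ← lintegral_indicator_one hB,
      lintegral_chartVolume g (hF.contMDiff ht) (measurable_one.indicator hB)]
    refine setLIntegral_congr_fun (measurableSet_target x) fun y hy => ?_
    by_cases hyB : (extChartAt (𝓡∂ (k + 1)) x).symm y ∈ B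
    · have hpos := (inducedMatrix_posDef g (himm _) (symm_mem_source hy)).det_pos
      rw [indicator_of_mem hyB, indicator_of_mem hyB, Pi.one_apply, mul_one,
        volumeElement, volumeElement, ← ENNReal.ofReal_mul (Real.sqrt_nonneg _),
        relDet_eq (symm_mem_source hy), ← Real.sqrt_mul hpos.le, mul_div_cancel₀ _ hpos.ne']
    · rw [indicator_of_notMem hyB, indicator_of_notMem hyB, mul_zero, mul_zero]
  rw [h1, ← withDensity_mul _ hR (measurable_chartPartition x),
    ← withDensity_mul _ (measurable_chartPartition x) hR, mul_comm]

theorem volumeFunction_eq (hJ : UniqueDiffOn ℝ J) (hK : IsCompact K) {t : ℝ} (ht : t ∈ J) :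
    volumeFunction k g F K t = ∫ p in K, √(relDet k g f F t p) ∂(inducedVolume k g f) := by
  have hR : Continuous fun p => √(relDet k g f F t p) :=
    Real.continuous_sqrt.comp ((smoothInTime_relDet (g := g) hf himm hF hJ).continuous ht)
  rw [volumeFunction, Measure.real, inducedVolume_eq_withDensity hf himm hF hJ ht,
    withDensity_apply _ hK.measurableSet, integral_eq_lintegral_of_nonneg_ae
      (Eventually.of_forall fun p => Real.sqrt_nonneg _) hR.aestronglyMeasurable]

end VolumeFunction

section Volume

variable {n : ℕ} {k : ℕ} [NeZero n] {M : Type*} [TopologicalSpace M]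
  [ChartedSpace (EuclideanHalfSpace n) M] [IsManifold (𝓡∂ n) ∞ M]
  {S : Type*} [TopologicalSpace S] [T2Space S] [SigmaCompactSpace S]
  [ChartedSpace (EuclideanHalfSpace (k + 1)) S] [IsManifold (𝓡∂ (k + 1)) ∞ S]
  [MeasurableSpace S] [BorelSpace S]
  {g : RMetric n M} {f : S → M} {F : ℝ → S → M} {ε : ℝ} {K : Set S}

omit [T2Space S] [SigmaCompactSpace S] [MeasurableSpace S] [BorelSpace S] in
theorem extChartAt_mem_interior {p : S} (hp : p ∉ (𝓡∂ (k + 1)).boundary S) {x : S}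
    (hx : p ∈ (chartAt (EuclideanHalfSpace (k + 1)) x).source) :
    extChartAt (𝓡∂ (k + 1)) x p ∈ interior (extChartAt (𝓡∂ (k + 1)) x).target := by
  have hy := extChartAt_mem_target hx
  refine mem_interior_target.2 ⟨hy, (nonneg_of_mem_target hy).lt_of_ne' fun h => hp ?_⟩
  rw [← extChartAt_symm_extChartAt hx]
  exact (mem_boundary_iff hy).2 h

theorem ae_of_interior {P : S → Prop} (h : ∀ p, p ∉ (𝓡∂ (k + 1)).boundary S → P p) :
    ∀ᵐ p ∂(inducedVolume k g f), P p := by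
  rw [ae_iff]
  refine measure_mono_null (fun p hp => ?_) (inducedVolume_boundary g (f := f))
  by_contra hb
  exact hp (h p hb)

variable (hf : ContMDiff (𝓡∂ (k + 1)) (𝓡∂ n) ∞ f)
  (himm : ∀ p, Function.Injective (mfderiv (𝓡∂ (k + 1)) (𝓡∂ n) f p))

include hf himm

/-- The first variation of volume, for one-sided variations. -/
theorem IsVariation.hasDerivWithinAt_volumeFunction (hF : IsVariation n k f F (Ico 0 ε) K)
    (hε : 0 < ε) : ∃ δ > 0, δ ≤ ε ∧
      SmoothInTime (k + 1) (Ico 0 δ) (fun t p => √(relDet k g f F t p)) ∧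
      HasDerivWithinAt (volumeFunction k g F K)
        (∫ p in K, derivWithin (fun t => √(relDet k g f F t p)) (Ico 0 δ) 0 ∂(inducedVolume k g f))
        (Ici 0) 0 := by
  have hu : ∀ b : ℝ, UniqueDiffOn ℝ (Ico 0 b) := fun b => uniqueDiffOn_Ico 0 b
  obtain ⟨δ₀, hδ₀, hpos⟩ := exists_relDet_pos (g := g) hf himm hF.smooth (hu ε) ⟨le_rfl, hε⟩ hF.zero
    hF.isCompact hF.eq_off
  -- Up to time `δ₀` the ratio of determinants is positive, which makes its square root smooth; up
  -- to `ε` the variation is defined.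
  set δ := min δ₀ ε with hδ
  have hδ0 : 0 < δ := lt_min hδ₀ hε
  have hsub : Ico 0 δ ⊆ Ico 0 ε := Ico_subset_Ico_right (min_le_right _ _)
  have hsm : SmoothInTime (k + 1) (Ico 0 δ) (fun t p => √(relDet k g f F t p)) := by
    refine ((smoothInTime_relDet (g := g) hf himm hF.smooth (hu ε)).mono hsub).sqrt fun t ht p => ?_
    refine hpos t (hsub ht) ?_ p
    rw [abs_of_nonneg ht.1]
    exact ht.2.trans_le (min_le_left _ _)
  refine ⟨δ, hδ0, min_le_right _ _, hsm, ?_⟩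
  -- A compact time interval supplies the uniform bound on the time derivative over `K`.
  have hIcc : Icc 0 (δ / 2) ⊆ Ico 0 δ := fun t ht => ⟨ht.1, by linarith [ht.2]⟩
  have h1 := hsm.hasDerivWithinAt_setIntegral (J₀ := Icc 0 (δ / 2)) (hu δ) hF.isCompact
    (inducedVolume_lt_top g hf hF.isCompact) hIcc isCompact_Icc (convex_Icc _ _) (t := 0)
    ⟨le_rfl, by linarith⟩
  refine (h1.mono_of_mem_nhdsWithin (Icc_mem_nhdsGE (by linarith))).congr_of_eventuallyEq ?_ ?_
  · filter_upwards [Ico_mem_nhdsGE hδ0] with t ht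
    exact volumeFunction_eq hf himm hF.smooth (hu ε) hF.isCompact (hsub ht)
  · exact volumeFunction_eq hf himm hF.smooth (hu ε) hF.isCompact ⟨le_rfl, hε⟩

/-- The second variation of volume, for two-sided variations. -/
theorem IsVariation.hasSecondDerivAtZero_volumeFunction (hF : IsVariation n k f F (Ioo (-ε) ε) K)
    (hε : 0 < ε) : ∃ w : S → ℝ, Continuous w ∧ (∀ p ∉ K, w p = 0) ∧
      (∀ p, w p = deriv (deriv fun t => √(relDet k g f F t p)) 0) ∧
      HasSecondDerivAtZero (volumeFunction k g F K) (∫ p in K, w p ∂(inducedVolume k g f)) := by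
  have hu : ∀ b : ℝ, UniqueDiffOn ℝ (Ioo (-b) b) := fun b => isOpen_Ioo.uniqueDiffOn
  obtain ⟨δ₀, hδ₀, hpos⟩ := exists_relDet_pos (g := g) hf himm hF.smooth (hu ε)
    ⟨neg_lt_zero.2 hε, hε⟩ hF.zero hF.isCompact hF.eq_off
  set δ := min δ₀ ε with hδ
  have hδ0 : 0 < δ := lt_min hδ₀ hε
  have hsub : Ioo (-δ) δ ⊆ Ioo (-ε) ε :=
    Ioo_subset_Ioo (neg_le_neg (min_le_right _ _)) (min_le_right _ _)
  set r : ℝ → S → ℝ := fun t p => √(relDet k g f F t p) with hr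
  have hsm : SmoothInTime (k + 1) (Ioo (-δ) δ) r := by
    refine ((smoothInTime_relDet (g := g) hf himm hF.smooth (hu ε)).mono hsub).sqrt fun t ht p => ?_
    exact hpos t (hsub ht) ((abs_lt.2 ht).trans_le (min_le_left _ _)) p
  have hsm1 := hsm.derivWithin (hu δ)
  have hsm2 := hsm1.derivWithin (hu δ)
  have h0 : (0 : ℝ) ∈ Ioo (-δ) δ := ⟨neg_lt_zero.2 hδ0, hδ0⟩
  have hd1 : ∀ t ∈ Ioo (-δ) δ, ∀ p, derivWithin (fun s => r s p) (Ioo (-δ) δ) t =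
      deriv (fun s => r s p) t := fun t ht p => derivWithin_of_isOpen isOpen_Ioo ht
  have hd2 : ∀ p, derivWithin (fun t => derivWithin (fun s => r s p) (Ioo (-δ) δ) t) (Ioo (-δ) δ) 0 =
      deriv (deriv fun t => r t p) 0 := by
    intro p
    rw [derivWithin_of_isOpen isOpen_Ioo h0]
    refine Filter.EventuallyEq.deriv_eq ?_
    filter_upwards [isOpen_Ioo.mem_nhds h0] with t ht using hd1 t ht p
  have hIcc : Icc (-(δ / 2)) (δ / 2) ⊆ Ioo (-δ) δ :=
    fun t ht => ⟨by linarith [ht.1], by linarith [ht.2]⟩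
  have hfin := inducedVolume_lt_top g hf hF.isCompact
  have hV : ∀ t ∈ Ioo (-(δ / 2)) (δ / 2), HasDerivAt (volumeFunction k g F K)
      (∫ p in K, derivWithin (fun s => r s p) (Ioo (-δ) δ) t ∂(inducedVolume k g f)) t := by
    intro t ht
    have h1 := hsm.hasDerivWithinAt_setIntegral (J₀ := Icc (-(δ / 2)) (δ / 2)) (hu δ) hF.isCompact
      hfin hIcc isCompact_Icc (convex_Icc _ _) (Ioo_subset_Icc_self ht)
    refine (h1.hasDerivAt (Icc_mem_nhds ht.1 ht.2)).congr_of_eventuallyEq ?_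
    filter_upwards [isOpen_Ioo.mem_nhds ht] with s hs
    exact volumeFunction_eq hf himm hF.smooth (hu ε) hF.isCompact
      (hsub (hIcc (Ioo_subset_Icc_self hs)))
  have h0' : (0 : ℝ) ∈ Ioo (-(δ / 2)) (δ / 2) := ⟨by linarith, by linarith⟩
  have hnear := isOpen_Ioo.mem_nhds h0'
  refine ⟨fun p => derivWithin (fun t => derivWithin (fun s => r s p) (Ioo (-δ) δ) t) (Ioo (-δ) δ) 0,
    hsm2.continuous h0, fun p hp => ?_, hd2, ?_, ?_⟩
  · have h1 : ∀ t ∈ Ioo (-δ) δ, r t p = 1 := fun t ht => by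
      simp only [hr, relDet_of_notMem himm hF.isCompact hF.eq_off (hsub ht) hp, Real.sqrt_one]
    have h2 : ∀ t ∈ Ioo (-δ) δ, derivWithin (fun s => r s p) (Ioo (-δ) δ) t = 0 := fun t ht => by
      rw [derivWithin_congr h1 (h1 t ht), derivWithin_fun_const]; rfl
    exact (derivWithin_congr h2 (h2 0 h0)).trans (by rw [derivWithin_fun_const]; rfl)
  · filter_upwards [hnear] with t ht using (hV t ht).differentiableAt
  · have h1 := hsm1.hasDerivWithinAt_setIntegral (J₀ := Icc (-(δ / 2)) (δ / 2)) (hu δ) hF.isCompact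
      hfin hIcc isCompact_Icc (convex_Icc _ _) (Ioo_subset_Icc_self h0')
    refine (h1.hasDerivAt (Icc_mem_nhds h0'.1 h0'.2)).congr_of_eventuallyEq ?_
    filter_upwards [hnear] with t ht using (hV t ht).deriv

omit [T2Space S] [SigmaCompactSpace S] [MeasurableSpace S] [BorelSpace S] in
theorem sqrt_relDet_eq {x p : S} (hp : p ∈ (chartAt (EuclideanHalfSpace (k + 1)) x).source) (t : ℝ) :
    √(relDet k g f F t p) =
      √(inducedMatrix (k + 1) g (F t) x p).det / √(inducedMatrix (k + 1) g f x p).det := by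
  rw [relDet_eq hp, Real.sqrt_div' _ (inducedMatrix_posDef g (himm _) hp).det_pos.le]

end Volume

/-! ### The second variation formula for vanishing mean curvature. -/

section Main

variable {k : ℕ} {M : Type*} [TopologicalSpace M]
  [ChartedSpace (EuclideanHalfSpace (k + 2)) M] [IsManifold (𝓡∂ (k + 2)) ∞ M]
  {S : Type*} [TopologicalSpace S] [T2Space S] [SigmaCompactSpace S]
  [ChartedSpace (EuclideanHalfSpace (k + 1)) S]
  [IsManifold (𝓡∂ (k + 1)) ∞ S] [MeasurableSpace S] [BorelSpace S] {g : RMetric (k + 2) M} {f : S → M}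
  {ν : ∀ p, TangentSpace (𝓡∂ (k + 2)) (f p)} {F : ℝ → S → M} {ε : ℝ} {K : Set S}

/-- The second variation formula for a minimal hypersurface. -/
theorem IsHypersurface.hasSecondDerivAtZero (h : IsHypersurface g f ν)
    (hH : ∀ (x : S), ∀ y ∈ interior (extChartAt (𝓡∂ (k + 1)) x).target,
      divAlong (k + 1) g f ν ((extChartAt (𝓡∂ (k + 1)) x).symm y) = 0)
    (hF : IsVariation (k + 2) k f F (Ioo (-ε) ε) K) (hε : 0 < ε) :
    Integrable (secondVariationDensity (k + 1) g f ν (variationField (k + 2) f F)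
      (variationAcceleration g f F)) (inducedVolume k g f) ∧
    HasSecondDerivAtZero (volumeFunction k g F K)
      (∫ p, secondVariationDensity (k + 1) g f ν (variationField (k + 2) f F)
        (variationAcceleration g f F) p ∂(inducedVolume k g f)) := by
  obtain ⟨w, hwc, hw0, hw, hV⟩ :=
    hF.hasSecondDerivAtZero_volumeFunction (g := g) h.smooth h.immersion hε
  -- At interior points the density is the second time derivative of `√relDet`, that is `w`, which
  -- is continuous on all of `S` and vanishes off `K`. Integrability and the formula both follow
  -- from this almost everywhere equality.
  have hae : secondVariationDensity (k + 1) g f ν (variationField (k + 2) f F)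
      (variationAcceleration g f F) =ᵐ[inducedVolume k g f] w := by
    refine ae_of_interior fun p hp => ?_
    have hs := mem_chart_source (EuclideanHalfSpace (k + 1)) p
    have h1 := h.secondDeriv_volumeElement hF.smooth hε hF.zero hH (extChartAt_mem_interior hp hs)
    rw [extChartAt_symm_extChartAt hs] at h1
    have hpos : 0 < √(inducedMatrix (k + 1) g f p p).det :=
      Real.sqrt_pos.2 (inducedMatrix_posDef g (h.immersion _) hs).det_pos
    rw [hw p, funext fun t => sqrt_relDet_eq h.smooth h.immersion hs t]
    have h2 : (deriv fun t => √(inducedMatrix (k + 1) g (F t) p p).det /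
        √(inducedMatrix (k + 1) g f p p).det) = fun t =>
        deriv (fun t => √(inducedMatrix (k + 1) g (F t) p p).det) t /
        √(inducedMatrix (k + 1) g f p p).det := funext fun t => deriv_div_const _
    rw [h2, (h1.div_const _).deriv, mul_div_cancel_left₀ _ hpos.ne']
  have hint : Integrable w (inducedVolume k g f) := by
    have := hwc.continuousOn.integrableOn_of_subset_isCompact (μ := inducedVolume k g f)
      hF.isCompact hF.isCompact.measurableSet subset_rfl (inducedVolume_lt_top g h.smooth hF.isCompact).ne
    exact (integrableOn_iff_integrable_of_support_subset fun p hp => by_contra fun h => hp (hw0 p h)).1 this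
  refine ⟨hint.congr hae.symm, ?_⟩
  rw [integral_congr_ae hae, ← setIntegral_eq_integral_of_forall_compl_eq_zero hw0]
  exact hV

end Main

/-! ### The divergence theorem on a hypersurface, within one chart. -/

section Contract

variable {m : ℕ}

theorem contract_add (h a b : Matrix (Fin m) (Fin m) ℝ) :
    contract h (a + b) = contract h a + contract h b := by
  simp only [contract, Matrix.add_apply, mul_add, Finset.sum_add_distrib]

theorem contract_transpose {h : Matrix (Fin m) (Fin m) ℝ} (hh : h.transpose = h)
    (a : Matrix (Fin m) (Fin m) ℝ) : contract h a.transpose = contract h a := by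
  have hi : ∀ i j, h⁻¹ i j = h⁻¹ j i := fun i j => by
    conv_lhs => rw [← hh, ← Matrix.transpose_nonsing_inv]
    rfl
  simp only [contract, Matrix.transpose_apply]
  rw [Finset.sum_comm]
  exact Finset.sum_congr rfl fun i _ => Finset.sum_congr rfl fun j _ => by rw [hi]

/-- Derivatives of Gram matrices have the form `A + Aᵀ`. The two halves have equal contractions with
the symmetric `M`, which absorbs the factor one half. -/
theorem hasDerivWithinAt_sqrt_det_of_symm {M : ℝ → Matrix (Fin m) (Fin m) ℝ}
    {A : Matrix (Fin m) (Fin m) ℝ} {s : Set ℝ} {t : ℝ}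
    (hM : ∀ i j, HasDerivWithinAt (fun t => M t i j) (A i j + A j i) s t) (hpos : 0 < (M t).det)
    (hs : (M t).transpose = M t) :
    HasDerivWithinAt (fun t => √(M t).det) (√(M t).det * contract (M t) A) s t := by
  have h1 := hasDerivWithinAt_sqrt_det (M' := A + A.transpose) hM hpos
  refine h1.congr_deriv ?_
  have hsymm : (A + A.transpose).transpose = A + A.transpose := by
    rw [Matrix.transpose_add, Matrix.transpose_transpose, add_comm]
  have : ((M t)⁻¹ * (A + A.transpose)).trace = contract (M t) (A + A.transpose) := by
    rw [← Matrix.trace_transpose, Matrix.transpose_mul, hsymm, Matrix.transpose_nonsing_inv, hs,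
      Matrix.trace_mul_comm]
    simp only [contract, Matrix.trace, Matrix.diag, Matrix.mul_apply]
    refine Finset.sum_congr rfl fun i _ => Finset.sum_congr rfl fun j _ => ?_
    rw [← Matrix.transpose_apply (A + A.transpose), hsymm]
  rw [this, contract_add, contract_transpose hs]
  ring

end Contract

namespace LocalHypersurface

variable {E D : Type*} [NormedAddCommGroup E] [NormedSpace ℝ E] [NormedAddCommGroup D]
  [NormedSpace ℝ D] {m : ℕ} {Ω : Set E} {G : E → Bil E ℝ} {Γ : E → Bil E E} {U : Set D} {f ν : D → E}
  {e : Fin m → D} (h : LocalHypersurface Ω G Γ U f ν e) {V : D → E} {p : D}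

include h

theorem gram_transpose (hp : p ∈ U) : (gram G f e p).transpose = gram G f e p := by
  ext i j
  exact h.metric.symm _ (h.mapsTo hp) _ _

/-- The one-variable formula is applied along the line `p + t u`; metric compatibility puts the
derivative of the Gram matrix into the form `A + Aᵀ`. -/
theorem hasFDerivAt_sqrt_det (hp : p ∈ U) (hpos : 0 < (gram G f e p).det) :
    DifferentiableAt ℝ (fun y => √(gram G f e y).det) p ∧ ∀ u,
      fderiv ℝ (fun y => √(gram G f e y).det) p u = √(gram G f e p).det * contract (gram G f e p)
        (Matrix.of fun i j => G (f p) (cov Γ f (frame f e i) u p) (frame f e j p)) := by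
  have hd : DifferentiableAt ℝ (fun y => √(gram G f e y).det) p :=
    (differentiableAt_of_contDiffOn h.isOpen hp (contDiffOn_det h.contDiffOn_gram)).sqrt hpos.ne'
  refine ⟨hd, fun u => ?_⟩
  have hl : HasDerivAt (fun t : ℝ => p + t • u) u 0 := by
    simpa using ((hasDerivAt_id (0 : ℝ)).smul_const u).const_add p
  have e0 : p + (0 : ℝ) • u = p := by rw [zero_smul, add_zero]
  have h1 := hasDerivWithinAt_sqrt_det_of_symm (M := fun t : ℝ => gram G f e (p + t • u))
    (A := Matrix.of fun i j => G (f p) (cov Γ f (frame f e i) u p) (frame f e j p)) (s := univ)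
    (t := 0) (fun i j => ?_) (by rwa [e0]) (by rw [e0]; exact h.gram_transpose hp)
  · rw [e0, hasDerivWithinAt_univ] at h1
    have h2 := HasFDerivAt.comp_hasDerivAt_of_eq (0 : ℝ) hd.hasFDerivAt hl e0.symm
    exact h2.unique h1
  · rw [hasDerivWithinAt_univ]
    have hg := differentiableAt_of_contDiffOn h.isOpen hp (h.contDiffOn_gram i j)
    refine (HasFDerivAt.comp_hasDerivAt_of_eq (0 : ℝ) hg.hasFDerivAt hl e0.symm).congr_deriv ?_
    have := h.fderiv_inner hp (h.contDiffOn_frame i) (h.contDiffOn_frame j) u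
    refine this.trans ?_
    rw [Matrix.of_apply, Matrix.of_apply, h.metric.symm _ (h.mapsTo hp) (frame f e i p)]

/-- The coordinate expression of the divergence of the tangential part of a vector field. -/
theorem sum_fderiv_sqrt_det_tcomp (hp : p ∈ U) (hpos : 0 < (gram G f e p).det)
    (hV : ContDiffOn ℝ ∞ V U) :
    ∑ i, fderiv ℝ (fun y => √(gram G f e y).det * tcomp G f e V i y) p (e i) =
      √(gram G f e p).det * sdiv G Γ f e (tfield G f e V) p := by
  obtain ⟨hd, hd'⟩ := h.hasFDerivAt_sqrt_det hp hpos
  have ht := fun i => differentiableAt_of_contDiffOn h.isOpen hp (h.contDiffOn_tcomp hV i)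
  have hinv : (gram G f e p)⁻¹ * gram G f e p = 1 :=
    Matrix.nonsing_inv_mul _ (isUnit_iff_ne_zero.2 hpos.ne')
  -- The divergence is `Σ ∂_i t^i` plus the traces of the induced connection. By the symmetry of
  -- `∇_k ∂_i f` these traces are the logarithmic derivatives of `√det`.
  have e1 : sdiv G Γ f e (tfield G f e V) p = ∑ i, fderiv ℝ (tcomp G f e V i) p (e i) +
      ∑ k, tcomp G f e V k p * contract (gram G f e p)
        (Matrix.of fun i j => G (f p) (cov Γ f (frame f e i) (e k) p) (frame f e j p)) := by
    have c1 : covMat G Γ f e (tfield G f e V) p =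
        (Matrix.of fun i k => fderiv ℝ (tcomp G f e V k) p (e i)) * gram G f e p +
        Matrix.of fun i j => ∑ k, tcomp G f e V k p *
          G (f p) (cov Γ f (frame f e i) (e k) p) (frame f e j p) := by
      ext i j
      rw [covMat, Matrix.of_apply, h.cov_tfield hp hV, Bil.sum_left, Matrix.add_apply,
        Matrix.mul_apply, Matrix.of_apply, ← Finset.sum_add_distrib]
      refine Finset.sum_congr rfl fun k _ => ?_
      rw [Bil.add_left, Bil.smul_left, Bil.smul_left, h.cov_frame_symm hp k i]
      rfl
    rw [sdiv, c1, contract_add]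
    congr 1
    · have hsy : ∀ i j, gram G f e p i j = gram G f e p j i := fun i j =>
        (congrFun (congrFun (h.gram_transpose hp) i) j).symm.trans rfl
      simp only [contract, Matrix.mul_apply, Finset.mul_sum, Matrix.of_apply]
      have : ∀ i, ∑ j, ∑ k, (gram G f e p)⁻¹ i j * (fderiv ℝ (tcomp G f e V k) p (e i) * gram G f e p k j)
          = fderiv ℝ (tcomp G f e V i) p (e i) := by
        intro i
        rw [Finset.sum_comm]
        have : ∀ k, ∑ j, (gram G f e p)⁻¹ i j * (fderiv ℝ (tcomp G f e V k) p (e i) * gram G f e p k j) =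
            fderiv ℝ (tcomp G f e V k) p (e i) * (1 : Matrix (Fin m) (Fin m) ℝ) i k := by
          intro k
          rw [← hinv, Matrix.mul_apply, Finset.mul_sum]
          exact Finset.sum_congr rfl fun j _ => by rw [hsy k j]; ring
        simp only [this, Matrix.one_apply, mul_ite, mul_one, mul_zero, Finset.sum_ite_eq,
          Finset.mem_univ, if_true]
      exact Finset.sum_congr rfl fun i _ => this i
    · simp only [contract, Matrix.of_apply, Finset.mul_sum]
      rw [Finset.sum_comm_cycle]
      exact Finset.sum_congr rfl fun k _ => Finset.sum_congr rfl fun i _ =>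
        Finset.sum_congr rfl fun j _ => by ring
  have e2 : ∀ i, fderiv ℝ (fun y => √(gram G f e y).det * tcomp G f e V i y) p (e i) =
      √(gram G f e p).det * fderiv ℝ (tcomp G f e V i) p (e i) + tcomp G f e V i p *
        fderiv ℝ (fun y => √(gram G f e y).det) p (e i) := by
    intro i
    rw [fderiv_fun_mul hd (ht i)]
    simp
  simp only [e2, hd', e1, mul_add, Finset.mul_sum, Finset.sum_add_distrib]
  congr 1
  exact Finset.sum_congr rfl fun i _ => by ring

end LocalHypersurface

section HalfSpace

variable {k : ℕ}

theorem continuous_boundaryIncl : Continuous (boundaryIncl k) := by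
  refine (PiLp.continuous_toLp 2 _).comp (continuous_pi fun i => ?_)
  refine Fin.cases ?_ (fun j => ?_) i
  · simpa using continuous_const
  · simp only [Fin.cons_succ]; fun_prop

@[simp] theorem boundaryIncl_zero (z : Coord k) : boundaryIncl k z 0 = 0 := rfl

theorem boundaryIncl_tail {y : Coord (k + 1)} (hy : y 0 = 0) :
    boundaryIncl k (WithLp.toLp 2 fun i => y i.succ) = y := by
  ext i
  refine Fin.cases ?_ (fun j => ?_) i
  · exact hy.symm
  · rfl

/-- The divergence theorem on a half-space, for compactly supported fields. -/
theorem integral_halfSpace_divergence {u : Fin (k + 1) → Coord (k + 1) → ℝ} {d : Coord (k + 1) → ℝ}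
    {C : Set (Coord (k + 1))} (hC : IsCompact C) (hu : ∀ i, ContinuousOn (u i) {y | 0 ≤ y 0})
    (hd : ContinuousOn d {y | 0 ≤ y 0}) (hu0 : ∀ i, ∀ y ∉ C, u i y = 0) (hd0 : ∀ y ∉ C, d y = 0)
    (hdiff : ∀ i, ∀ y : Coord (k + 1), 0 < y 0 → DifferentiableAt ℝ (u i) y)
    (hdiv : ∀ y : Coord (k + 1), 0 < y 0 → ∑ i, fderiv ℝ (u i) y (stdVec i) = d y) :
    ∫ y in {y : Coord (k + 1) | 0 ≤ y 0}, d y = - ∫ z, u 0 (boundaryIncl k z) := by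
  obtain ⟨R, hR0, hR⟩ : ∃ R : ℝ, 0 < R ∧ ∀ y ∈ C, ∀ i, |y i| < R := by
    obtain ⟨R, hR⟩ := hC.isBounded.exists_norm_le
    refine ⟨|R| + 1, by positivity, fun y hy i => ?_⟩
    have := (PiLp.norm_apply_le y i).trans (hR y hy)
    rw [Real.norm_eq_abs] at this
    linarith [le_abs_self R]
  set L : (Fin (k + 1) → ℝ) →L[ℝ] Coord (k + 1) :=
    (EuclideanSpace.equiv (Fin (k + 1)) ℝ).symm.toContinuousLinearMap with hL
  have hLa : ∀ w i, L w i = w i := fun w i => rfl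
  have hLe : ∀ i, L (Pi.single i 1) = stdVec i := fun i => by ext j; rfl
  -- The box `[0, R] × [-R, R]^k` contains the part of `C` in the half-space. Since `|y i| < R` on
  -- `C`, no face of the box except `y 0 = 0` meets it, and that face carries a minus sign.
  set a : Fin (k + 1) → ℝ := Fin.cons 0 fun _ => -R with ha
  set b : Fin (k + 1) → ℝ := fun _ => R with hb
  have ha0 : a 0 = 0 := rfl
  have has : ∀ i, a (Fin.succ i) = -R := fun i => rfl
  have hab : a ≤ b := by
    intro i
    refine Fin.cases ?_ (fun j => ?_) i
    · exact hR0.le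
    · rw [has]; simp only [hb]; linarith
  have hmaps : MapsTo L (Icc a b) {y | 0 ≤ y 0} := fun w hw => hw.1 0
  have hzero : ∀ w : Fin (k + 1) → ℝ, 0 ≤ w 0 → w ∉ Icc a b → L w ∉ C := by
    intro w hw hn hc
    refine hn ⟨fun i => ?_, fun i => (le_abs_self _).trans (hR _ hc i).le⟩
    refine Fin.cases hw (fun j => ?_) i
    rw [has]
    exact (abs_le.1 (hR _ hc j.succ).le).1
  have hcd : ContinuousOn (fun w => d (L w)) (Icc a b) := hd.comp L.continuous.continuousOn hmaps
  have hopen : (Set.pi univ fun i => Ioo (a i) (b i)) =ᵐ[volume] Icc a b :=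
    Measure.univ_pi_Ioo_ae_eq_Icc
  have hpos : ∀ w ∈ Set.pi univ fun i => Ioo (a i) (b i), 0 < L w 0 := fun w hw => (hw 0 trivial).1
  -- The divergence is known where `y 0 > 0`, in particular on the open box, which has full measure.
  have hae : (fun w => ∑ i, ((fderiv ℝ (u i) (L w)).comp L) (Pi.single i 1)) =ᵐ[volume.restrict (Icc a b)]
      fun w => d (L w) := by
    rw [← Measure.restrict_congr_set hopen]
    refine (ae_restrict_iff' (MeasurableSet.univ_pi fun _ => measurableSet_Ioo)).2
      (Eventually.of_forall fun w hw => ?_)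
    simp only [ContinuousLinearMap.comp_apply, hLe]
    exact hdiv _ (hpos w hw)
  have key := integral_divergence_of_hasFDerivAt_off_countable' a b hab (fun i w => u i (L w))
    (fun i w => (fderiv ℝ (u i) (L w)).comp L) ∅ countable_empty
    (fun i => (hu i).comp L.continuous.continuousOn hmaps)
    (fun w hw i => (hdiff i _ (hpos w hw.1)).hasFDerivAt.comp w L.hasFDerivAt)
    ((hcd.integrableOn_compact isCompact_Icc).congr hae.symm)
  rw [integral_congr_ae hae] at key
  have hlhs : ∫ y in {y : Coord (k + 1) | 0 ≤ y 0}, d y = ∫ w in Icc a b, d (L w) := by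
    have h1 := (PiLp.volume_preserving_toLp (Fin (k + 1))).setIntegral_preimage_emb
      (MeasurableEquiv.toLp 2 (Fin (k + 1) → ℝ)).measurableEmbedding d {y : Coord (k + 1) | 0 ≤ y 0}
    rw [← h1]
    have hm : MeasurableSet {w : Fin (k + 1) → ℝ | 0 ≤ w 0} :=
      measurableSet_le measurable_const (measurable_pi_apply 0)
    exact setIntegral_eq_of_subset_of_forall_sdiff_eq_zero hm (fun w hw => hw.1 0) fun w hw =>
      hd0 _ (hzero w hw.1 hw.2)
  rw [hlhs, key, Fin.sum_univ_succ]
  have hfront : ∀ i : Fin (k + 1), ∀ w : Fin k → ℝ, u i (L (i.insertNth (b i) w)) = 0 := by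
    intro i w
    refine hu0 i _ fun hc => ?_
    have := hR _ hc i
    rw [hLa, Fin.insertNth_apply_same] at this
    exact absurd ((le_abs_self _).trans_lt this) (lt_irrefl _)
  have hback : ∀ j : Fin k, ∀ w : Fin k → ℝ, u j.succ (L (j.succ.insertNth (a j.succ) w)) = 0 := by
    intro j w
    refine hu0 _ _ fun hc => ?_
    have := hR _ hc j.succ
    rw [hLa, Fin.insertNth_apply_same, has, abs_neg] at this
    exact absurd ((le_abs_self _).trans_lt this) (lt_irrefl _)
  simp only [hfront, hback, integral_zero, sub_zero, Finset.sum_const_zero, add_zero, zero_sub]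
  congr 1
  have h2 := (PiLp.volume_preserving_toLp (Fin k)).integral_comp
    (MeasurableEquiv.toLp 2 (Fin k → ℝ)).measurableEmbedding fun z => u 0 (boundaryIncl k z)
  rw [← h2]
  have e : ∀ w : Fin k → ℝ, L (Fin.insertNth 0 (a 0) w) = boundaryIncl k (WithLp.toLp 2 w) := by
    intro w
    ext i
    rw [hLa, Fin.insertNth_zero]
    rfl
  simp only [e]
  refine setIntegral_eq_integral_of_forall_compl_eq_zero fun w hw => hu0 0 _ fun hc => hw ?_
  exact ⟨fun i => (abs_le.1 (hR _ hc i.succ).le).1, fun i => (abs_le.1 (hR _ hc i.succ).le).2⟩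

end HalfSpace

section Lift

variable {k : ℕ} {S : Type*} [TopologicalSpace S] [T2Space S]
  [ChartedSpace (EuclideanHalfSpace (k + 1)) S] [IsManifold (𝓡∂ (k + 1)) ∞ S] {x : S} {K : Set S}
  {v : Coord (k + 1) → ℝ}

omit [T2Space S] in
theorem isCompact_image_extChartAt (hK : IsCompact K)
    (hKx : K ⊆ (chartAt (EuclideanHalfSpace (k + 1)) x).source) :
    IsCompact (extChartAt (𝓡∂ (k + 1)) x '' K) :=
  hK.image_of_continuousOn ((continuousOn_extChartAt x).mono (by rwa [extChartAt_source]))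

omit [T2Space S] [IsManifold (𝓡∂ (k + 1)) ∞ S] in
theorem notMem_image_extChartAt {y : Coord (k + 1)} (hy : y ∈ (extChartAt (𝓡∂ (k + 1)) x).target)
    (hyK : y ∉ extChartAt (𝓡∂ (k + 1)) x '' K) : (extChartAt (𝓡∂ (k + 1)) x).symm y ∉ K :=
  fun h => hyK ⟨_, h, (extChartAt (𝓡∂ (k + 1)) x).right_inv hy⟩

/-- A function with compact support in a chart domain extends by zero to the half-space. -/
theorem continuousOn_indicator_target (hv : ContinuousOn v (extChartAt (𝓡∂ (k + 1)) x).target)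
    (hK : IsCompact K) (hKx : K ⊆ (chartAt (EuclideanHalfSpace (k + 1)) x).source)
    (h0 : ∀ y ∈ (extChartAt (𝓡∂ (k + 1)) x).target, (extChartAt (𝓡∂ (k + 1)) x).symm y ∉ K → v y = 0) :
    ContinuousOn ((extChartAt (𝓡∂ (k + 1)) x).target.indicator v) {y | 0 ≤ y 0} := by
  intro y hy
  have hr : range (𝓡∂ (k + 1)) = {y | 0 ≤ y 0} := range_modelWithCornersEuclideanHalfSpace (k + 1)
  by_cases hyT : y ∈ (extChartAt (𝓡∂ (k + 1)) x).target
  · have h1 : ContinuousWithinAt ((extChartAt (𝓡∂ (k + 1)) x).target.indicator v)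
        (extChartAt (𝓡∂ (k + 1)) x).target y :=
      (hv y hyT).congr (fun z hz => indicator_of_mem hz v) (indicator_of_mem hyT v)
    rw [← hr]
    exact h1.mono_of_mem_nhdsWithin (extChartAt_target_mem_nhdsWithin_of_mem hyT)
  · have hcl := (isCompact_image_extChartAt hK hKx).isClosed
    have hyC : y ∉ extChartAt (𝓡∂ (k + 1)) x '' K := by
      rintro ⟨p, hp, rfl⟩; exact hyT (extChartAt_mem_target (hKx hp))
    have : (extChartAt (𝓡∂ (k + 1)) x).target.indicator v =ᶠ[𝓝 y] fun _ => 0 := by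
      filter_upwards [hcl.isOpen_compl.mem_nhds hyC] with z hz
      by_cases hzT : z ∈ (extChartAt (𝓡∂ (k + 1)) x).target
      · rw [indicator_of_mem hzT]; exact h0 z hzT (notMem_image_extChartAt hzT hz)
      · exact indicator_of_notMem hzT v
    exact (continuousAt_const.congr this.symm).continuousWithinAt

/-- A function with compact support in a chart domain extends by zero to the manifold. -/
theorem continuous_indicator_source (hv : ContinuousOn v (extChartAt (𝓡∂ (k + 1)) x).target)
    (hK : IsCompact K) (hKx : K ⊆ (chartAt (EuclideanHalfSpace (k + 1)) x).source)
    (h0 : ∀ y ∈ (extChartAt (𝓡∂ (k + 1)) x).target, (extChartAt (𝓡∂ (k + 1)) x).symm y ∉ K → v y = 0) :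
    Continuous ((chartAt (EuclideanHalfSpace (k + 1)) x).source.indicator
      fun p => v (extChartAt (𝓡∂ (k + 1)) x p)) := by
  refine continuous_iff_continuousAt.2 fun p => ?_
  by_cases hp : p ∈ (chartAt (EuclideanHalfSpace (k + 1)) x).source
  · have hO := (chartAt (EuclideanHalfSpace (k + 1)) x).open_source
    have h1 : ContinuousOn (fun p => v (extChartAt (𝓡∂ (k + 1)) x p))
        (chartAt (EuclideanHalfSpace (k + 1)) x).source :=
      hv.comp (by rw [← extChartAt_source (𝓡∂ (k + 1)) x]; exact continuousOn_extChartAt x)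
        fun q hq => extChartAt_mem_target hq
    refine (h1.continuousAt (hO.mem_nhds hp)).congr ?_
    filter_upwards [hO.mem_nhds hp] with q hq
    rw [indicator_of_mem hq]
  · have : (chartAt (EuclideanHalfSpace (k + 1)) x).source.indicator
        (fun p => v (extChartAt (𝓡∂ (k + 1)) x p)) =ᶠ[𝓝 p] fun _ => 0 := by
      filter_upwards [hK.isClosed.isOpen_compl.mem_nhds fun h => hp (hKx h)] with q hq
      by_cases hqs : q ∈ (chartAt (EuclideanHalfSpace (k + 1)) x).source
      · rw [indicator_of_mem hqs]
        exact h0 _ (extChartAt_mem_target hqs) (by rwa [extChartAt_symm_extChartAt hqs])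
      · exact indicator_of_notMem hqs _
    exact continuousAt_const.congr this.symm

end Lift

section Divergence

variable {n : ℕ} {k : ℕ} [NeZero n] {M : Type*} [TopologicalSpace M]
  [ChartedSpace (EuclideanHalfSpace n) M] [IsManifold (𝓡∂ n) ∞ M]
  {S : Type*} [TopologicalSpace S] [T2Space S] [SigmaCompactSpace S]
  [ChartedSpace (EuclideanHalfSpace (k + 1)) S] [IsManifold (𝓡∂ (k + 1)) ∞ S]
  [MeasurableSpace S] [BorelSpace S] (g : RMetric n M) {f : S → M} {x : S} {K : Set S}
  (hf : ContMDiff (𝓡∂ (k + 1)) (𝓡∂ n) ∞ f)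

include hf

theorem integrable_inducedVolume {u : S → ℝ} (hu : Continuous u) (hK : IsCompact K)
    (h0 : ∀ p ∉ K, u p = 0) : Integrable u (inducedVolume k g f) := by
  have := hu.continuousOn.integrableOn_of_subset_isCompact (μ := inducedVolume k g f)
    hK hK.measurableSet subset_rfl (inducedVolume_lt_top g hf hK).ne
  exact (integrableOn_iff_integrable_of_support_subset fun p hp => by_contra fun h => hp (h0 p h)).1 this

theorem integral_inducedVolume {u : S → ℝ} (hu : Continuous u) (hK : IsCompact K)
    (hKx : K ⊆ (chartAt (EuclideanHalfSpace (k + 1)) x).source) (h0 : ∀ p ∉ K, u p = 0) :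
    ∫ p, u p ∂(inducedVolume k g f) = ∫ y in (extChartAt (𝓡∂ (k + 1)) x).target,
      volumeElement g f x y * u ((extChartAt (𝓡∂ (k + 1)) x).symm y) := by
  have h1 := (aemeasurable_extChartAt_symm x).mono_ac
    (withDensity_absolutelyContinuous _ fun y : Coord (k + 1) => ENNReal.ofReal (volumeElement g f x y))
  rw [← setIntegral_eq_integral_of_forall_compl_eq_zero h0, inducedVolume_restrict_eq g hK hKx,
    setIntegral_eq_integral_of_forall_compl_eq_zero h0, chartVolume_eq,
    integral_map h1 hu.aestronglyMeasurable,
    integral_withDensity_eq_integral_toReal_smul₀ (aemeasurable_volumeElement g hf x)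
      (Eventually.of_forall fun _ => ENNReal.ofReal_lt_top)]
  refine integral_congr_ae (Eventually.of_forall fun y => ?_)
  simp only [volumeElement, ENNReal.toReal_ofReal (Real.sqrt_nonneg _), smul_eq_mul]

variable (himm : ∀ p, Function.Injective (mfderiv (𝓡∂ (k + 1)) (𝓡∂ n) f p))

include himm

omit [SigmaCompactSpace S] [MeasurableSpace S] [BorelSpace S] hf [T2Space S] in
theorem volumeElement_pos {y : Coord (k + 1)} (hy : y ∈ (extChartAt (𝓡∂ (k + 1)) x).target) :
    0 < volumeElement g f x y :=
  Real.sqrt_pos.2 (inducedMatrix_posDef g (himm _) (symm_mem_source hy)).det_pos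

/-- The divergence theorem for fields with compact support in a chart domain. -/
theorem integral_divergence_chart (hK : IsCompact K)
    (hKx : K ⊆ (chartAt (EuclideanHalfSpace (k + 1)) x).source) {u : Fin (k + 1) → Coord (k + 1) → ℝ}
    {b : S → ℝ} (hu : ∀ i, ContDiffOn ℝ ∞ (u i) (extChartAt (𝓡∂ (k + 1)) x).target)
    (hu0 : ∀ i, ∀ y ∈ (extChartAt (𝓡∂ (k + 1)) x).target,
      (extChartAt (𝓡∂ (k + 1)) x).symm y ∉ K → u i y = 0)
    (hb0 : ∀ p ∉ K, p ∉ (𝓡∂ (k + 1)).boundary S → b p = 0)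
    (hb : ∀ y ∈ interior (extChartAt (𝓡∂ (k + 1)) x).target, ∑ i, fderiv ℝ (u i) y (stdVec i) =
      volumeElement g f x y * b ((extChartAt (𝓡∂ (k + 1)) x).symm y)) :
    Integrable b (inducedVolume k g f) ∧ ∫ p, b p ∂(inducedVolume k g f) =
      - ∫ z in boundaryIncl k ⁻¹' (extChartAt (𝓡∂ (k + 1)) x).target, u 0 (boundaryIncl k z) := by
  set T := (extChartAt (𝓡∂ (k + 1)) x).target with hT
  have huniq : UniqueDiffOn ℝ T := uniqueDiffOn_extChartAt_target x
  have hcl := (isCompact_image_extChartAt hK hKx).isClosed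
  -- The derivative within the target continues the divergence up to the boundary. Dividing by the
  -- volume element gives the continuous function `q`, which replaces `b`, whose values are
  -- controlled at interior points only.
  set D : Coord (k + 1) → ℝ := fun y => ∑ i, fderivWithin ℝ (u i) T y (stdVec i) with hD
  have hDc : ContinuousOn D T := continuousOn_finsetSum _ fun i _ =>
    (((hu i).fderivWithin (m := ∞) huniq (by simp)).continuousOn).clm_apply continuousOn_const
  have hD0 : ∀ y ∈ T, (extChartAt (𝓡∂ (k + 1)) x).symm y ∉ K → D y = 0 := by
    intro y hy hyK
    have hyC : y ∉ extChartAt (𝓡∂ (k + 1)) x '' K := by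
      rintro ⟨p, hp, rfl⟩
      rw [extChartAt_symm_extChartAt (hKx hp)] at hyK
      exact hyK hp
    refine Finset.sum_eq_zero fun i _ => ?_
    have : u i =ᶠ[𝓝[T] y] fun _ => 0 := by
      filter_upwards [mem_nhdsWithin_of_mem_nhds (hcl.isOpen_compl.mem_nhds hyC),
        self_mem_nhdsWithin] with z hz hzT using hu0 i z hzT (notMem_image_extChartAt hzT hz)
    rw [this.fderivWithin_eq (hu0 i y hy hyK), fderivWithin_const_apply]
    rfl
  have hDint : ∀ y ∈ interior T, D y = ∑ i, fderiv ℝ (u i) y (stdVec i) := fun y hy => by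
    simp only [hD, fderivWithin_of_mem_nhds (mem_interior_iff_mem_nhds.1 hy)]
  have hvol := continuousOn_volumeElement g hf x
  have hpos : ∀ y ∈ T, 0 < volumeElement g f x y := fun y hy => volumeElement_pos g himm hy
  set v : Coord (k + 1) → ℝ := fun y => D y / volumeElement g f x y with hv
  have hvc : ContinuousOn v T := hDc.div hvol fun y hy => (hpos y hy).ne'
  have hv0 : ∀ y ∈ T, (extChartAt (𝓡∂ (k + 1)) x).symm y ∉ K → v y = 0 := fun y hy hyK => by
    simp only [hv, hD0 y hy hyK, zero_div]
  set q := (chartAt (EuclideanHalfSpace (k + 1)) x).source.indicator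
      fun p => v (extChartAt (𝓡∂ (k + 1)) x p) with hq
  have hqc : Continuous q := continuous_indicator_source hvc hK hKx hv0
  have hq0 : ∀ p ∉ K, q p = 0 := by
    intro p hp
    by_cases hps : p ∈ (chartAt (EuclideanHalfSpace (k + 1)) x).source
    · rw [hq, indicator_of_mem hps]
      exact hv0 _ (extChartAt_mem_target hps) (by rwa [extChartAt_symm_extChartAt hps])
    · exact indicator_of_notMem hps _
  have hae : b =ᵐ[inducedVolume k g f] q := by
    refine ae_of_interior fun p hp => ?_
    by_cases hps : p ∈ (chartAt (EuclideanHalfSpace (k + 1)) x).source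
    · have hi := extChartAt_mem_interior hp hps
      have h1 := hb _ hi
      rw [extChartAt_symm_extChartAt hps, ← hDint _ hi] at h1
      rw [hq, indicator_of_mem hps]
      simp only [hv]
      rw [h1, mul_div_cancel_left₀ _ (hpos _ (interior_subset hi)).ne']
    · rw [hb0 p (fun h => hps (hKx h)) hp]
      exact (indicator_of_notMem hps _).symm
  refine ⟨(integrable_inducedVolume g hf hqc hK hq0).congr hae.symm, ?_⟩
  rw [integral_congr_ae hae, integral_inducedVolume g hf hqc hK hKx hq0]
  have h1 : ∫ y in T, volumeElement g f x y * q ((extChartAt (𝓡∂ (k + 1)) x).symm y) =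
      ∫ y in T, D y := by
    refine setIntegral_congr_fun (measurableSet_target x) fun y hy => ?_
    simp only [hq, indicator_of_mem (symm_mem_source hy), hv]
    rw [(extChartAt (𝓡∂ (k + 1)) x).right_inv hy, mul_div_cancel₀ _ (hpos y hy).ne']
  have hTH : T ⊆ {y | 0 ≤ y 0} := fun y hy => nonneg_of_mem_target hy
  have hzero : ∀ (w : Coord (k + 1) → ℝ), (∀ y ∈ T, (extChartAt (𝓡∂ (k + 1)) x).symm y ∉ K → w y = 0) →
      ∀ y ∉ extChartAt (𝓡∂ (k + 1)) x '' K, T.indicator w y = 0 := by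
    intro w hw y hy
    by_cases hyT : y ∈ T
    · rw [indicator_of_mem hyT]; exact hw y hyT (notMem_image_extChartAt hyT hy)
    · exact indicator_of_notMem hyT w
  -- Extension by zero stays differentiable in the open half-space: the image of `K` is compact, so
  -- at points outside the target the extension vanishes nearby.
  have hnear : ∀ i, ∀ y : Coord (k + 1), 0 < y 0 → DifferentiableAt ℝ (T.indicator (u i)) y ∧
      (y ∈ interior T → fderiv ℝ (T.indicator (u i)) y = fderiv ℝ (u i) y) ∧
      (y ∉ T → fderiv ℝ (T.indicator (u i)) y = 0) := by
    intro i y hy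
    by_cases hyT : y ∈ T
    · have hyi : y ∈ interior T := mem_interior_target.2 ⟨hyT, hy⟩
      have he : T.indicator (u i) =ᶠ[𝓝 y] u i := by
        filter_upwards [mem_interior_iff_mem_nhds.1 hyi] with z hz using indicator_of_mem hz _
      have hd : DifferentiableAt ℝ (u i) y := LocalHypersurface.differentiableAt_of_contDiffOn
        isOpen_interior hyi ((hu i).mono interior_subset)
      exact ⟨hd.congr_of_eventuallyEq he, fun _ => he.fderiv_eq, fun h => absurd hyT h⟩
    · have hyC : y ∉ extChartAt (𝓡∂ (k + 1)) x '' K := by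
        rintro ⟨p, hp, rfl⟩; exact hyT (extChartAt_mem_target (hKx hp))
      have he : T.indicator (u i) =ᶠ[𝓝 y] fun _ => 0 := by
        filter_upwards [hcl.isOpen_compl.mem_nhds hyC] with z hz using hzero _ (hu0 i) z hz
      refine ⟨(differentiableAt_const (0 : ℝ)).congr_of_eventuallyEq he,
        fun h => absurd (interior_subset h) hyT, fun _ => ?_⟩
      rw [he.fderiv_eq, fderiv_const_apply]
  have key := integral_halfSpace_divergence (u := fun i => T.indicator (u i)) (d := T.indicator D)
    (isCompact_image_extChartAt hK hKx)
    (fun i => continuousOn_indicator_target (hu i).continuousOn hK hKx (hu0 i))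
    (continuousOn_indicator_target hDc hK hKx hD0) (fun i => hzero _ (hu0 i)) (hzero _ hD0)
    (fun i y hy => (hnear i y hy).1) (fun y hy => by
      by_cases hyT : y ∈ T
      · have hyi : y ∈ interior T := mem_interior_target.2 ⟨hyT, hy⟩
        rw [indicator_of_mem hyT, hDint y hyi]
        exact Finset.sum_congr rfl fun i _ => by rw [(hnear i y hy).2.1 hyi]
      · rw [indicator_of_notMem hyT]
        exact Finset.sum_eq_zero fun i _ => by rw [(hnear i y hy).2.2 hyT]; rfl)
  have hm : MeasurableSet {y : Coord (k + 1) | 0 ≤ y 0} := by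
    rw [← range_modelWithCornersEuclideanHalfSpace]
    exact (𝓡∂ (k + 1)).isClosed_range.measurableSet
  rw [h1, ← integral_indicator (continuous_boundaryIncl.measurable (measurableSet_target x))]
  rw [setIntegral_indicator (measurableSet_target x), inter_eq_self_of_subset_right hTH] at key
  exact key

end Divergence

section SmoothField

variable {m n : ℕ} [NeZero m] [NeZero n] {M : Type*} [TopologicalSpace M]
  [ChartedSpace (EuclideanHalfSpace n) M] [IsManifold (𝓡∂ n) ∞ M]
  {S : Type*} [TopologicalSpace S] [ChartedSpace (EuclideanHalfSpace m) S]
  [IsManifold (𝓡∂ m) ∞ S] (g : RMetric n M) {f : S → M} {V : ∀ p, TangentSpace (𝓡∂ n) (f p)}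
  {x : S} {c : M}

/-- A vector field along `f` which is smooth, up to the boundary. -/
def SmoothField (m n : ℕ) [NeZero m] [NeZero n] {M : Type*} [TopologicalSpace M]
    [ChartedSpace (EuclideanHalfSpace n) M] [IsManifold (𝓡∂ n) ∞ M]
    {S : Type*} [TopologicalSpace S] [ChartedSpace (EuclideanHalfSpace m) S] (f : S → M)
    (V : ∀ p, TangentSpace (𝓡∂ n) (f p)) : Prop :=
  ∀ (x : S) (c : M), ContDiffOn ℝ ∞ (fun y => reading (n := n) c (f ((extChartAt (𝓡∂ m) x).symm y))
      (V ((extChartAt (𝓡∂ m) x).symm y)))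
    ((extChartAt (𝓡∂ m) x).target ∩
      (fun y => f ((extChartAt (𝓡∂ m) x).symm y)) ⁻¹' (chartAt (EuclideanHalfSpace n) c).source)

variable (m) in
/-- The components of the tangential part of `V` in the preferred chart at `x`. -/
noncomputable def tangentComp (g : RMetric n M) (f : S → M) (x : S) (V : ∀ p, TangentSpace (𝓡∂ n) (f p))
    (i : Fin m) (p : S) : ℝ :=
  ∑ j, (inducedMatrix m g f x p)⁻¹ i j * g.inner (f p) (V p) (frameVec m f x p j)

variable (hf : ContMDiff (𝓡∂ m) (𝓡∂ n) ∞ f)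

include hf

/-- Unlike `reading_mfderiv_coord` this includes boundary points, the derivative being taken within
the target. -/
theorem reading_frameVec {y : Coord m} (hy : y ∈ (extChartAt (𝓡∂ m) x).target)
    (hc : f ((extChartAt (𝓡∂ m) x).symm y) ∈ (chartAt (EuclideanHalfSpace n) c).source) (j : Fin m) :
    reading c (f ((extChartAt (𝓡∂ m) x).symm y)) (frameVec m f x ((extChartAt (𝓡∂ m) x).symm y) j) =
      fderivWithin ℝ (mapCoord (m := m) (n := n) x c f) (extChartAt (𝓡∂ m) x).target y (stdVec j) := by
  have h1 := (contDiffOn_mapCoord (x := x) (c := c) hf y ⟨hy, hc⟩).differentiableWithinAt (by simp)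
  have hopen : (fun y => f ((extChartAt (𝓡∂ m) x).symm y)) ⁻¹' (chartAt (EuclideanHalfSpace n) c).source
      ∈ 𝓝[(extChartAt (𝓡∂ m) x).target] y :=
    (hf.continuous.comp_continuousOn (continuousOn_extChartAt_symm x) y hy)
      ((chartAt (EuclideanHalfSpace n) c).open_source.mem_nhds hc)
  have h2 : DifferentiableWithinAt ℝ (mapCoord (m := m) (n := n) x c f) (extChartAt (𝓡∂ m) x).target y :=
    h1.mono_of_mem_nhdsWithin (inter_mem self_mem_nhdsWithin hopen)
  rw [frameVec, reading_mfderiv (hf.mdifferentiable (by simp) _) hc,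
    mfderiv_eq_fderivWithin (x := x) (symm_mem_source hy) (by
      rw [(extChartAt (𝓡∂ m) x).right_inv hy]; exact h2), (extChartAt (𝓡∂ m) x).right_inv hy,
    reading_coordVec (symm_mem_source hy)]
  rfl

theorem SmoothField.contDiffOn_inner_frameVec (hV : SmoothField m n f V) (x : S) (j : Fin m) :
    ContDiffOn ℝ ∞ (fun y => g.inner (f ((extChartAt (𝓡∂ m) x).symm y)) (V ((extChartAt (𝓡∂ m) x).symm y))
      (frameVec m f x ((extChartAt (𝓡∂ m) x).symm y) j)) (extChartAt (𝓡∂ m) x).target := by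
  intro y hy
  obtain ⟨c, hc⟩ : ∃ c, c = f ((extChartAt (𝓡∂ m) x).symm y) := ⟨_, rfl⟩
  set T := (extChartAt (𝓡∂ m) x).target with hT
  set A := (fun y => f ((extChartAt (𝓡∂ m) x).symm y)) ⁻¹' (chartAt (EuclideanHalfSpace n) c).source
    with hA
  have hyA : y ∈ A := by rw [hA, hc]; exact mem_chart_source _ _
  have hcont := hf.continuous.comp_continuousOn (continuousOn_extChartAt_symm (I := 𝓡∂ m) x)
  have hmem : ∀ z ∈ T ∩ A, T ∩ A ∈ 𝓝[T] z := fun z hz => inter_mem self_mem_nhdsWithin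
    ((hcont z hz.1) ((chartAt (EuclideanHalfSpace n) c).open_source.mem_nhds hz.2))
  have h1 := contDiffOn_mapCoord (x := x) (c := c) hf
  have h2 : ContDiffOn ℝ ∞ (fun z => fderivWithin ℝ (mapCoord (m := m) (n := n) x c f) T z (stdVec j))
      (T ∩ A) := by
    intro z hz
    refine ContDiffWithinAt.clm_apply (ContDiffWithinAt.mono (ContDiffWithinAt.fderivWithin_right
      (m := ∞) (n := ∞) ((h1 z hz).mono_of_mem_nhdsWithin (hmem z hz)) (uniqueDiffOn_extChartAt_target x)
      (by simp) hz.1) inter_subset_left) contDiffWithinAt_const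
  have h3 : ContDiffOn ℝ ∞ (fun z => chartMetric g c (mapCoord (m := m) (n := n) x c f z)) (T ∩ A) :=
    (contDiffOn_chartMetric g c).comp h1 fun z hz => extChartAt_mem_target hz.2
  have h4 := (h3.bil_apply (hV x c) h2) y ⟨hy, hyA⟩
  have heq : ∀ z ∈ T ∩ A, g.inner (f ((extChartAt (𝓡∂ m) x).symm z)) (V ((extChartAt (𝓡∂ m) x).symm z))
      (frameVec m f x ((extChartAt (𝓡∂ m) x).symm z) j) = _ := fun z hz => by
    rw [inner_eq_chartMetric g hz.2, reading_frameVec hf hz.1 hz.2]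
  refine ((h4.congr (fun z hz => ?_) ?_).mono_of_mem_nhdsWithin (hmem y ⟨hy, hyA⟩))
  · exact heq z hz
  · exact heq y ⟨hy, hyA⟩

end SmoothField

section TangentDivergence

variable {k : ℕ} {M : Type*} [TopologicalSpace M]
  [ChartedSpace (EuclideanHalfSpace (k + 2)) M] [IsManifold (𝓡∂ (k + 2)) ∞ M]
  {S : Type*} [TopologicalSpace S] [T2Space S] [SigmaCompactSpace S]
  [ChartedSpace (EuclideanHalfSpace (k + 1)) S]
  [IsManifold (𝓡∂ (k + 1)) ∞ S] [MeasurableSpace S] [BorelSpace S] {g : RMetric (k + 2) M} {f : S → M}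
  {ν V : ∀ p, TangentSpace (𝓡∂ (k + 2)) (f p)} {x : S} {K : Set S}

/-- The tangential part of a field along `f`, as a field along `f`. -/
noncomputable def tangentialField (g : RMetric (k + 2) M) (f : S → M)
    (V : ∀ p, TangentSpace (𝓡∂ (k + 2)) (f p)) (q : S) : TangentSpace (𝓡∂ (k + 2)) (f q) :=
  mfderiv (𝓡∂ (k + 1)) (𝓡∂ (k + 2)) f q (tangentPart (k + 1) g f q (V q))

omit [T2Space S] [SigmaCompactSpace S] [MeasurableSpace S] [BorelSpace S]

theorem IsHypersurface.contDiffOn_tangentComp (h : IsHypersurface g f ν)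
    (hV : SmoothField (k + 1) (k + 2) f V) (x : S) (i : Fin (k + 1)) :
    ContDiffOn ℝ ∞ (fun y => tangentComp (k + 1) g f x V i ((extChartAt (𝓡∂ (k + 1)) x).symm y))
      (extChartAt (𝓡∂ (k + 1)) x).target :=
  ContDiffOn.sum fun j _ => (contDiffOn_inv (contDiffOn_inducedMatrix g h.smooth x) (fun _ hy =>
    (inducedMatrix_posDef g (h.immersion _) (symm_mem_source hy)).det_pos.ne') i j).mul
    (hV.contDiffOn_inner_frameVec g h.smooth x j)

theorem IsHypersurface.contDiffOn_volumeElement (h : IsHypersurface g f ν) (x : S) :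
    ContDiffOn ℝ ∞ (volumeElement g f x) (extChartAt (𝓡∂ (k + 1)) x).target :=
  (contDiffOn_det (contDiffOn_inducedMatrix g h.smooth x)).sqrt fun _ hy =>
    (inducedMatrix_posDef g (h.immersion _) (symm_mem_source hy)).det_pos.ne'

theorem sdiv_zero {E D : Type*} [NormedAddCommGroup E] [NormedSpace ℝ E] [NormedAddCommGroup D]
    [NormedSpace ℝ D] {m : ℕ} (G : E → Bil E ℝ) (Γ : E → Bil E E) (f : D → E) (e : Fin m → D) (p : D) :
    sdiv G Γ f e (fun _ => 0) p = 0 := by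
  simp [sdiv, contract, covMat, cov]

theorem divAlong_of_eventuallyEq_zero (h : IsHypersurface g f ν) {p : S}
    (hp : p ∉ (𝓡∂ (k + 1)).boundary S) (hV : ∀ᶠ q in 𝓝 p, V q = 0) :
    divAlong (k + 1) g f V p = 0 := by
  have hs := mem_chart_source (EuclideanHalfSpace (k + 1)) p
  have hi := extChartAt_mem_interior hp hs
  have hy : extChartAt (𝓡∂ (k + 1)) p p ∈ coordDomain (m := k + 1) (k + 2) p (f p) f := ⟨hi, by
    rw [mem_preimage, extChartAt_symm_extChartAt hs]; exact mem_chart_source _ _⟩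
  have hcont : ContinuousAt (extChartAt (𝓡∂ (k + 1)) p).symm (extChartAt (𝓡∂ (k + 1)) p p) :=
    ((continuousOn_extChartAt_symm p).mono interior_subset).continuousAt (isOpen_interior.mem_nhds hi)
  have hV' : ∀ᶠ q in 𝓝 ((extChartAt (𝓡∂ (k + 1)) p).symm (extChartAt (𝓡∂ (k + 1)) p p)), V q = 0 := by
    rwa [extChartAt_symm_extChartAt hs]
  have h0 : fieldCoord (m := k + 1) (n := k + 2) p (f p) f V =ᶠ[𝓝 (extChartAt (𝓡∂ (k + 1)) p p)]
      fun _ => 0 := by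
    filter_upwards [hcont.eventually hV', (isOpen_coordDomain h.smooth.continuous).mem_nhds hy]
      with z hz hzU
    rw [fieldCoord, hz, reading_eq_clm hzU.2, map_zero]
  have := divAlong_eq_sdiv_of_eventuallyEq g h.smooth hy (e := stdVec)
    (by rw [frameMatrix_stdVec, Matrix.det_one]; exact isUnit_one) h0 (differentiableAt_const _)
  rwa [extChartAt_symm_extChartAt hs, sdiv_zero] at this

theorem tangentialField_eq_zero {q : S} (hV : V q = 0) : tangentialField g f V q = 0 := by
  have : tangentPart (k + 1) g f q (V q) = 0 := by
    simp [tangentPart, hV]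
  rw [tangentialField, this, map_zero]

/-- The divergence of a tangential field in coordinates. -/
theorem IsHypersurface.sum_fderiv_tangentComp (h : IsHypersurface g f ν)
    (hV : SmoothField (k + 1) (k + 2) f V) {y : Coord (k + 1)}
    (hy : y ∈ interior (extChartAt (𝓡∂ (k + 1)) x).target) :
    ∑ i, fderiv ℝ (fun y => volumeElement g f x y *
        tangentComp (k + 1) g f x V i ((extChartAt (𝓡∂ (k + 1)) x).symm y)) y (stdVec i) =
      volumeElement g f x y *
        divAlong (k + 1) g f (tangentialField g f V) ((extChartAt (𝓡∂ (k + 1)) x).symm y) := by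
  obtain ⟨c, hc⟩ : ∃ c, c = f ((extChartAt (𝓡∂ (k + 1)) x).symm y) := ⟨_, rfl⟩
  have hyc : y ∈ coordDomain (k + 2) x c f := ⟨hy, by
    rw [mem_preimage, hc]; exact mem_chart_source _ _⟩
  have he : IsUnit (frameMatrix (stdVec : Fin (k + 1) → Coord (k + 1))).det := by
    rw [frameMatrix_stdVec, Matrix.det_one]; exact isUnit_one
  have hL := h.localHypersurface x c he
  have hVc : ContDiffOn ℝ ∞ (fieldCoord (m := k + 1) (n := k + 2) x c f V) (coordDomain (k + 2) x c f) :=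
    (hV x c).mono coordDomain_subset
  have hgram : ∀ z ∈ coordDomain (k + 2) x c f, gram (chartMetric g c) (mapCoord x c f) stdVec z =
      inducedMatrix (k + 1) g f x ((extChartAt (𝓡∂ (k + 1)) x).symm z) := fun z hz => by
    rw [inducedMatrix_eq_gram g h.smooth hz, readFrame_self (interior_subset hz.1)]
  have hpos : 0 < (gram (chartMetric g c) (mapCoord x c f) stdVec y).det := by
    rw [hgram y hyc]
    exact (inducedMatrix_posDef g (h.immersion _) (symm_mem_source (interior_subset hy))).det_pos
  have key := hL.sum_fderiv_sqrt_det_tcomp hyc hpos hVc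
  have hdiv := divAlong_eq_sdiv_of_eventuallyEq g h.smooth hyc he (V := tangentialField g f V)
    (W := tfield (chartMetric g c) (mapCoord x c f) stdVec (fieldCoord x c f V)) (by
      filter_upwards [hL.isOpen.mem_nhds hyc] with z hz using reading_tangentField g h.smooth hz V)
    (LocalHypersurface.differentiableAt_of_contDiffOn hL.isOpen hyc (hL.contDiffOn_tfield hVc))
  rw [hdiv, volumeElement, ← hgram y hyc, ← key]
  refine Finset.sum_congr rfl fun i _ => ?_
  congr 1
  refine Filter.EventuallyEq.fderiv_eq ?_
  filter_upwards [hL.isOpen.mem_nhds hyc] with z hz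
  rw [volumeElement, ← hgram z hz, tangentComp, tcomp, hgram z hz]
  congr 1
  refine Finset.sum_congr rfl fun j _ => ?_
  rw [inner_eq_chartMetric g hz.2, frameVec, reading_mfderiv_coord h.smooth hz,
    reading_coordVec (symm_mem_source (interior_subset hz.1))]
  rfl

variable [T2Space S] [SigmaCompactSpace S] [MeasurableSpace S] [BorelSpace S]

/-- The divergence theorem for tangential fields with compact support in a chart domain. -/
theorem IsHypersurface.integral_divAlong_tangentialField (h : IsHypersurface g f ν)
    (hV : SmoothField (k + 1) (k + 2) f V) (hK : IsCompact K)
    (hKx : K ⊆ (chartAt (EuclideanHalfSpace (k + 1)) x).source) (h0 : ∀ p ∉ K, V p = 0) :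
    Integrable (divAlong (k + 1) g f (tangentialField g f V)) (inducedVolume k g f) ∧
    ∫ p, divAlong (k + 1) g f (tangentialField g f V) p ∂(inducedVolume k g f) =
      - ∫ z in boundaryIncl k ⁻¹' (extChartAt (𝓡∂ (k + 1)) x).target,
        volumeElement g f x (boundaryIncl k z) * tangentComp (k + 1) g f x V 0
          ((extChartAt (𝓡∂ (k + 1)) x).symm (boundaryIncl k z)) := by
  refine integral_divergence_chart g h.smooth h.immersion hK hKx
    (u := fun i y => volumeElement g f x y *
      tangentComp (k + 1) g f x V i ((extChartAt (𝓡∂ (k + 1)) x).symm y))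
    (fun i => (h.contDiffOn_volumeElement x).mul (h.contDiffOn_tangentComp hV x i)) ?_ ?_
    (fun y hy => h.sum_fderiv_tangentComp hV hy)
  · intro i y _ hyK
    simp only [tangentComp, h0 _ hyK, map_zero, _root_.zero_apply, mul_zero, Finset.sum_const_zero]
  · intro p hp hpb
    refine divAlong_of_eventuallyEq_zero h hpb ?_
    filter_upwards [hK.isClosed.isOpen_compl.mem_nhds hp] with q hq
      using tangentialField_eq_zero (h0 q hq)

end TangentDivergence

/-! ### The first variation along pushes in a chart. -/

theorem LocalMetric.hasDerivWithinAt_line {E : Type*} [NormedAddCommGroup E] [NormedSpace ℝ E]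
    {Ω : Set E} {G : E → Bil E ℝ} {Γ : E → Bil E E} (h : LocalMetric Ω G Γ) {a ξ v v' w w' : E}
    {J : Set ℝ} (hJ0 : (0 : ℝ) ∈ J) (ha : ∀ t ∈ J, a + t • ξ ∈ Ω) :
    HasDerivWithinAt (fun t : ℝ => G (a + t • ξ) (v + t • v') (w + t • w'))
      (G a (v' + Γ a v ξ) w + G a v (w' + Γ a w ξ)) J 0 := by
  have ha0 : a ∈ Ω := by simpa using ha 0 hJ0
  have hl : ∀ b b' : E, HasFDerivWithinAt (fun t : ℝ => b + t • b')
      ((ContinuousLinearMap.id ℝ ℝ).smulRight b') J 0 := fun b b' =>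
    (((hasFDerivWithinAt_id (0 : ℝ) J).smul_const b').const_add b)
  have hG : HasFDerivWithinAt (fun t : ℝ => G (a + t • ξ)) ((fderivWithin ℝ G Ω a).comp
      ((ContinuousLinearMap.id ℝ ℝ).smulRight ξ)) J 0 := by
    have h1 : HasFDerivWithinAt G (fderivWithin ℝ G Ω a) Ω (a + (0 : ℝ) • ξ) := by
      rw [zero_smul, add_zero]; exact (h.differentiableG ha0).hasFDerivWithinAt
    exact h1.comp (0 : ℝ) (hl a ξ) ha
  have h2 := (hG.bil_apply (hl v v') (hl w w')).hasDerivWithinAt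
  refine h2.congr_deriv ?_
  rw [Bil.derivApply_apply]
  simp only [ContinuousLinearMap.comp_apply, ContinuousLinearMap.smulRight_apply,
    ContinuousLinearMap.id_apply, one_smul, zero_smul, add_zero]
  -- Symmetry turns `Γ ξ v` into `Γ v ξ`, so that `v' + Γ v ξ` is the covariant derivative of the
  -- pushing field in the direction `v`.
  rw [h.compat a ha0, Bil.add_left, Bil.add_right, h.torsion a ha0 ξ v, h.torsion a ha0 ξ w]
  ring

section Push

variable {k : ℕ} {M : Type*} [TopologicalSpace M]
  [ChartedSpace (EuclideanHalfSpace (k + 2)) M] [IsManifold (𝓡∂ (k + 2)) ∞ M]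
  {S : Type*} [TopologicalSpace S]
  [ChartedSpace (EuclideanHalfSpace (k + 1)) S] [IsManifold (𝓡∂ (k + 1)) ∞ S]
  {f : S → M} {c : M} {ξ : S → Coord (k + 2)} {K : Set S} {t : ℝ} {q : S}

open Classical in
/-- The map `f`, pushed in the direction `ξ` in the preferred chart at `c`. -/
noncomputable def pushMap (c : M) (f : S → M) (ξ : S → Coord (k + 2)) (t : ℝ) (q : S) : M :=
  if f q ∈ (chartAt (EuclideanHalfSpace (k + 2)) c).source then
    (extChartAt (𝓡∂ (k + 2)) c).symm (extChartAt (𝓡∂ (k + 2)) c (f q) + t • ξ q) else f q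

theorem pushMap_of_mem (hq : f q ∈ (chartAt (EuclideanHalfSpace (k + 2)) c).source) (t : ℝ) :
    pushMap c f ξ t q =
      (extChartAt (𝓡∂ (k + 2)) c).symm (extChartAt (𝓡∂ (k + 2)) c (f q) + t • ξ q) := if_pos hq

theorem pushMap_of_eq_zero (hq : t • ξ q = 0) : pushMap c f ξ t q = f q := by
  by_cases h : f q ∈ (chartAt (EuclideanHalfSpace (k + 2)) c).source
  · rw [pushMap_of_mem h, hq, add_zero, extChartAt_symm_extChartAt h]
  · exact if_neg h

theorem mem_range_iff {n : ℕ} {y : Coord (n + 1)} : y ∈ range (𝓡∂ (n + 1)) ↔ 0 ≤ y 0 := by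
  rw [range_modelWithCornersEuclideanHalfSpace]; rfl

/-- A compactly supported push which points into `M` stays in the chart for a short time. -/
theorem exists_push_mem_target (hf : Continuous f) (hξ : Continuous ξ) (hK : IsCompact K)
    (hKc : ∀ q ∈ K, f q ∈ (chartAt (EuclideanHalfSpace (k + 2)) c).source) (h0 : ∀ q ∉ K, ξ q = 0)
    (hpos : ∀ q ∈ K, ∀ᶠ z in 𝓝 ((0 : ℝ), q), 0 ≤ z.1 →
      0 ≤ (extChartAt (𝓡∂ (k + 2)) c (f z.2) + z.1 • ξ z.2) 0) :
    ∃ δ : ℝ, 0 < δ ∧ ∀ t ∈ Ico 0 δ, ∀ q, f q ∈ (chartAt (EuclideanHalfSpace (k + 2)) c).source →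
      extChartAt (𝓡∂ (k + 2)) c (f q) + t • ξ q ∈ (extChartAt (𝓡∂ (k + 2)) c).target := by
  -- The target is a neighbourhood within the half-space, so near each point only the sign of the
  -- zeroth coordinate matters; compactness of `K` makes the time uniform.
  have h1 : ∀ᶠ t in 𝓝 (0 : ℝ), ∀ q ∈ K, 0 ≤ t →
      extChartAt (𝓡∂ (k + 2)) c (f q) + t • ξ q ∈ (extChartAt (𝓡∂ (k + 2)) c).target := by
    refine hK.eventually_forall_of_forall_eventually fun q hq => ?_
    have hmem := extChartAt_mem_target (hKc q hq)
    have hcont : ContinuousAt (fun z : ℝ × S => extChartAt (𝓡∂ (k + 2)) c (f z.2) + z.1 • ξ z.2) (0, q) := by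
      have hc : ContinuousAt (extChartAt (𝓡∂ (k + 2)) c) (f q) :=
        continuousAt_extChartAt' (by rw [extChartAt_source]; exact hKc q hq)
      have hc' : ContinuousAt (fun z : ℝ × S => extChartAt (𝓡∂ (k + 2)) c (f z.2)) (0, q) :=
        ContinuousAt.comp (g := extChartAt (𝓡∂ (k + 2)) c) (f := fun z : ℝ × S => f z.2) hc
          (hf.comp continuous_snd).continuousAt
      exact hc'.add ((continuous_fst.smul (hξ.comp continuous_snd)).continuousAt)
    have h2 := eventually_nhdsWithin_iff.1 (extChartAt_target_mem_nhdsWithin_of_mem hmem)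
    have h3 := hcont.eventually (p := fun w => w ∈ range (𝓡∂ (k + 2)) →
      w ∈ (extChartAt (𝓡∂ (k + 2)) c).target) (by simp only [zero_smul, add_zero]; exact h2)
    filter_upwards [h3, hpos q hq] with z hz hz' ht using hz (mem_range_iff.2 (hz' ht))
  obtain ⟨δ, hδ, hball⟩ := Metric.eventually_nhds_iff.1 h1
  refine ⟨δ, hδ, fun t ht q hq => ?_⟩
  by_cases hqK : q ∈ K
  · exact hball (by rw [Real.dist_eq, sub_zero, abs_of_nonneg ht.1]; exact ht.2) q hqK ht.1
  · rw [h0 q hqK, smul_zero, add_zero]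
    exact extChartAt_mem_target hq

variable [T2Space S] [SigmaCompactSpace S] {δ : ℝ}

-- Near points that `f` maps into the chart the push is given by its formula, with smooth
-- ingredients. Any other point lies off the closed set `K`, and near it the push is constant in
-- time.
omit [SigmaCompactSpace S] in
theorem isVariation_pushMap (hf : ContMDiff (𝓡∂ (k + 1)) (𝓡∂ (k + 2)) ∞ f)
    (hξ : ContMDiff (𝓡∂ (k + 1)) 𝓘(ℝ, Coord (k + 2)) ∞ ξ) (hK : IsCompact K)
    (hKc : ∀ q ∈ K, f q ∈ (chartAt (EuclideanHalfSpace (k + 2)) c).source) (h0 : ∀ q ∉ K, ξ q = 0)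
    (hδ : ∀ t ∈ Ico 0 δ, ∀ q, f q ∈ (chartAt (EuclideanHalfSpace (k + 2)) c).source →
      extChartAt (𝓡∂ (k + 2)) c (f q) + t • ξ q ∈ (extChartAt (𝓡∂ (k + 2)) c).target) :
    IsVariation (k + 2) k f (pushMap c f ξ) (Ico 0 δ) K where
  zero p := pushMap_of_eq_zero (by rw [zero_smul])
  isCompact := hK
  eq_off t _ p hp := pushMap_of_eq_zero (by rw [h0 p hp, smul_zero])
  smooth := by
    rintro ⟨t, q⟩ ⟨ht, -⟩
    by_cases hq : f q ∈ (chartAt (EuclideanHalfSpace (k + 2)) c).source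
    · set A := f ⁻¹' (chartAt (EuclideanHalfSpace (k + 2)) c).source with hA
      have hAo : IsOpen A := (chartAt (EuclideanHalfSpace (k + 2)) c).open_source.preimage hf.continuous
      have h1 : ContMDiffOn (𝓘(ℝ, ℝ).prod (𝓡∂ (k + 1))) 𝓘(ℝ, Coord (k + 2)) ∞
          (fun z : ℝ × S => extChartAt (𝓡∂ (k + 2)) c (f z.2)) (Ico 0 δ ×ˢ A) :=
        (contMDiffOn_extChartAt (I := 𝓡∂ (k + 2)) (n := ∞) (x := c)).comp
          (hf.comp contMDiff_snd).contMDiffOn fun z hz => hz.2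
      have h2 : ContMDiff (𝓘(ℝ, ℝ).prod (𝓡∂ (k + 1))) 𝓘(ℝ, Coord (k + 2)) ∞
          (fun z : ℝ × S => z.1 • ξ z.2) := contMDiff_fst.smul (hξ.comp contMDiff_snd)
      have h3 : ContMDiffOn (𝓘(ℝ, ℝ).prod (𝓡∂ (k + 1))) (𝓡∂ (k + 2)) ∞
          (fun z : ℝ × S => (extChartAt (𝓡∂ (k + 2)) c).symm
            (extChartAt (𝓡∂ (k + 2)) c (f z.2) + z.1 • ξ z.2)) (Ico 0 δ ×ˢ A) :=
        (contMDiffOn_extChartAt_symm c).comp (h1.add h2.contMDiffOn) fun z hz => hδ z.1 hz.1 z.2 hz.2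
      have h4 : ContMDiffWithinAt (𝓘(ℝ, ℝ).prod (𝓡∂ (k + 1))) (𝓡∂ (k + 2)) ∞
          (fun z : ℝ × S => pushMap c f ξ z.1 z.2) (Ico 0 δ ×ˢ A) (t, q) :=
        (h3 (t, q) ⟨ht, hq⟩).congr (fun z hz => pushMap_of_mem hz.2 _) (pushMap_of_mem hq _)
      refine h4.mono_of_mem_nhdsWithin ?_
      have h5 : (univ : Set ℝ) ×ˢ A ∈ 𝓝 (t, q) := prod_mem_nhds univ_mem (hAo.mem_nhds hq)
      filter_upwards [self_mem_nhdsWithin, mem_nhdsWithin_of_mem_nhds h5] with z hz hz'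
        using ⟨hz.1, hz'.2⟩
    · have hqK : q ∉ K := fun h => hq (hKc q h)
      have h5 : (univ : Set ℝ) ×ˢ Kᶜ ∈ 𝓝 (t, q) :=
        prod_mem_nhds univ_mem (hK.isClosed.isOpen_compl.mem_nhds hqK)
      have h6 : ContMDiffAt (𝓘(ℝ, ℝ).prod (𝓡∂ (k + 1))) (𝓡∂ (k + 2)) ∞
          (fun z : ℝ × S => pushMap c f ξ z.1 z.2) (t, q) := by
        refine ((hf.comp contMDiff_snd) (t, q)).congr_of_eventuallyEq ?_
        filter_upwards [h5] with z hz
        exact pushMap_of_eq_zero (by rw [h0 z.2 hz.2, smul_zero])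
      exact h6.contMDiffWithinAt

/-- In the chart `∂M` is `x_0 = 0`, and along `∂S` the push leaves the zeroth coordinate unchanged.
-/
theorem keepsBoundary_pushMap
    (hbd : ∀ p ∈ (𝓡∂ (k + 1)).boundary S, f p ∈ (𝓡∂ (k + 2)).boundary M)
    (hξ : ∀ p ∈ (𝓡∂ (k + 1)).boundary S, ξ p 0 = 0)
    (hδ : ∀ t ∈ Ico 0 δ, ∀ q, f q ∈ (chartAt (EuclideanHalfSpace (k + 2)) c).source →
      extChartAt (𝓡∂ (k + 2)) c (f q) + t • ξ q ∈ (extChartAt (𝓡∂ (k + 2)) c).target) :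
    KeepsBoundary (k + 2) k (pushMap c f ξ) (Ico 0 δ) := by
  intro t ht p hp
  by_cases hq : f p ∈ (chartAt (EuclideanHalfSpace (k + 2)) c).source
  · rw [pushMap_of_mem hq, mem_boundary_iff (hδ t ht p hq)]
    have h1 := hbd p hp
    rw [← extChartAt_symm_extChartAt hq, mem_boundary_iff (extChartAt_mem_target hq)] at h1
    rw [PiLp.add_apply, PiLp.smul_apply, hξ p hp, smul_zero, add_zero]
    exact h1
  · rw [pushMap, if_neg hq]
    exact hbd p hp

variable [MeasurableSpace S] [BorelSpace S] {g : RMetric (k + 2) M}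
  {ν : ∀ p, TangentSpace (𝓡∂ (k + 2)) (f p)}

/-- The first variation of volume along a push in a chart. -/
theorem IsHypersurface.exists_firstVariation (h : IsHypersurface g f ν)
    (hmin : IsFreeBoundaryMinimal k g f)
    (hbd : ∀ p ∈ (𝓡∂ (k + 1)).boundary S, f p ∈ (𝓡∂ (k + 2)).boundary M)
    (hξ : ContMDiff (𝓡∂ (k + 1)) 𝓘(ℝ, Coord (k + 2)) ∞ ξ) (hK : IsCompact K)
    (hKc : ∀ q ∈ K, f q ∈ (chartAt (EuclideanHalfSpace (k + 2)) c).source) (h0 : ∀ q ∉ K, ξ q = 0)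
    (hpos : ∀ q ∈ K, ∀ᶠ z in 𝓝 ((0 : ℝ), q), 0 ≤ z.1 →
      0 ≤ (extChartAt (𝓡∂ (k + 2)) c (f z.2) + z.1 • ξ z.2) 0)
    (hξb : ∀ p ∈ (𝓡∂ (k + 1)).boundary S, ξ p 0 = 0) :
    ∃ w : S → ℝ, Continuous w ∧ (∀ p ∉ K, w p = 0) ∧ ∫ p, w p ∂(inducedVolume k g f) = 0 ∧
      ∀ (x : S), ∀ y ∈ coordDomain (m := k + 1) (k + 2) x c f, w ((extChartAt (𝓡∂ (k + 1)) x).symm y) =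
        sdiv (chartMetric g c) (chartGamma g c) (mapCoord x c f) stdVec
          (fun y => ξ ((extChartAt (𝓡∂ (k + 1)) x).symm y)) y := by
  obtain ⟨δ, hδ0, hδ⟩ := exists_push_mem_target h.smooth.continuous hξ.continuous hK hKc h0 hpos
  have hvar := isVariation_pushMap h.smooth hξ hK hKc h0 hδ
  obtain ⟨δ', hδ'0, hδ', hsm, hV⟩ := hvar.hasDerivWithinAt_volumeFunction (g := g) h.smooth
    h.immersion hδ0
  have hzero := hmin δ _ K hδ0 hvar (keepsBoundary_pushMap hbd hξb hδ)
  have hsub : Ico 0 δ' ⊆ Ico 0 δ := Ico_subset_Ico_right hδ'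
  have hu : UniqueDiffOn ℝ (Ico 0 δ') := uniqueDiffOn_Ico 0 δ'
  have h00 : (0 : ℝ) ∈ Ico 0 δ' := ⟨le_rfl, hδ'0⟩
  -- The one-sided derivative of the volume is the integral of `w`, and it is zero by criticality.
  have hint := (uniqueDiffOn_Ici (0 : ℝ) 0 self_mem_Ici).eq_deriv _ hV hzero
  set w : S → ℝ := fun p => derivWithin (fun t => √(relDet k g f (pushMap c f ξ) t p)) (Ico 0 δ') 0 with hw
  have hw0 : ∀ p ∉ K, w p = 0 := by
    intro p hp
    have h1 : ∀ t ∈ Ico 0 δ', √(relDet k g f (pushMap c f ξ) t p) = 1 := fun t ht => by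
      rw [relDet_of_notMem h.immersion hK hvar.eq_off (hsub ht) hp, Real.sqrt_one]
    exact (derivWithin_congr h1 (h1 0 h00)).trans (by rw [derivWithin_fun_const]; rfl)
  refine ⟨w, (hsm.derivWithin hu).continuous h00, hw0, ?_, fun x y hy => ?_⟩
  · rw [← setIntegral_eq_integral_of_forall_compl_eq_zero hw0]
    exact hint
  set p := (extChartAt (𝓡∂ (k + 1)) x).symm y with hp
  have hpx : p ∈ (chartAt (EuclideanHalfSpace (k + 1)) x).source := symm_mem_source (interior_subset hy.1)
  have hUo := isOpen_coordDomain (m := k + 1) (n := k + 2) (x := x) (c := c) h.smooth.continuous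
  have hL := h.localHypersurface x c (e := stdVec) (by
    rw [frameMatrix_stdVec, Matrix.det_one]; exact isUnit_one)
  set ξ' : Coord (k + 1) → Coord (k + 2) := fun y => ξ ((extChartAt (𝓡∂ (k + 1)) x).symm y) with hξ'
  have hξd : DifferentiableAt ℝ ξ' y := by
    have h1 := hξ.comp_contMDiffOn (contMDiffOn_extChartAt_symm (I := 𝓡∂ (k + 1)) (n := ∞) x)
    exact LocalHypersurface.differentiableAt_of_contDiffOn isOpen_interior hy.1
      ((contMDiffOn_iff_contDiffOn.1 h1).mono interior_subset)
  have hfd : DifferentiableAt ℝ (mapCoord (m := k + 1) (n := k + 2) x c f) y :=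
    LocalHypersurface.differentiableAt_of_contDiffOn hUo hy hL.smooth
  have hmap : ∀ t ∈ Ico 0 δ', ∀ z ∈ coordDomain (m := k + 1) (k + 2) x c f,
      mapCoord x c (pushMap c f ξ t) z = mapCoord x c f z + t • ξ' z := by
    intro t ht z hz
    rw [mapCoord, pushMap_of_mem hz.2, (extChartAt (𝓡∂ (k + 2)) c).right_inv (hδ t (hsub ht) _ hz.2)]
    rfl
  have hmat : ∀ t ∈ Ico 0 δ', ∀ i j, inducedMatrix (k + 1) g (pushMap c f ξ t) x p i j =
      chartMetric g c (mapCoord x c f y + t • ξ' y)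
        (frame (mapCoord x c f) stdVec i y + t • fderiv ℝ ξ' y (stdVec i))
        (frame (mapCoord x c f) stdVec j y + t • fderiv ℝ ξ' y (stdVec j)) := by
    intro t ht i j
    have hyt : y ∈ coordDomain (m := k + 1) (k + 2) x c (pushMap c f ξ t) := ⟨hy.1, by
      rw [mem_preimage, pushMap_of_mem hy.2]
      exact symm_mem_source (hδ t (hsub ht) _ hy.2)⟩
    have hd : fderiv ℝ (mapCoord (m := k + 1) (n := k + 2) x c (pushMap c f ξ t)) y =
        fderiv ℝ (mapCoord x c f) y + t • fderiv ℝ ξ' y := by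
      have : mapCoord (m := k + 1) (n := k + 2) x c (pushMap c f ξ t) =ᶠ[𝓝 y]
          fun z => mapCoord x c f z + t • ξ' z := by
        filter_upwards [hUo.mem_nhds hy] with z hz using hmap t ht z hz
      rw [this.fderiv_eq, fderiv_fun_add hfd (hξd.fun_const_smul t), fderiv_fun_const_smul hξd]
    rw [inducedMatrix_eq_gram g (IsSmoothFamily.contMDiff hvar.smooth (hsub ht)) hyt,
      readFrame_self (interior_subset hy.1), gram, Matrix.of_apply, hmap t ht y hy, frame, frame, hd]
    rfl
  have hdm : ∀ i j, HasDerivWithinAt (fun t => inducedMatrix (k + 1) g (pushMap c f ξ t) x p i j)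
      (covMat (chartMetric g c) (chartGamma g c) (mapCoord x c f) stdVec ξ' y i j +
       covMat (chartMetric g c) (chartGamma g c) (mapCoord x c f) stdVec ξ' y j i) (Ico 0 δ') 0 := by
    intro i j
    have h1 := (localMetric g c).hasDerivWithinAt_line (a := mapCoord x c f y) (ξ := ξ' y)
      (v := frame (mapCoord x c f) stdVec i y) (v' := fderiv ℝ ξ' y (stdVec i))
      (w := frame (mapCoord x c f) stdVec j y) (w' := fderiv ℝ ξ' y (stdVec j)) h00
      (fun t ht => hδ t (hsub ht) _ hy.2)
    refine (h1.congr_deriv ?_).congr (fun t ht => hmat t ht i j) (hmat 0 h00 i j)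
    rw [(localMetric g c).symm _ (hL.mapsTo hy) (frame (mapCoord x c f) stdVec i y)]
    rfl
  have hpush0 : pushMap c f ξ 0 = f := funext fun q => pushMap_of_eq_zero (zero_smul _ _)
  have hgram : inducedMatrix (k + 1) g (pushMap c f ξ 0) x p =
      gram (chartMetric g c) (mapCoord x c f) stdVec y := by
    rw [hpush0, inducedMatrix_eq_gram g h.smooth hy, readFrame_self (interior_subset hy.1)]
  have hdet : 0 < (inducedMatrix (k + 1) g f x p).det :=
    (inducedMatrix_posDef g (h.immersion _) hpx).det_pos
  have hsq := hasDerivWithinAt_sqrt_det_of_symm hdm (by rwa [hpush0])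
    (by rw [hgram]; exact hL.gram_transpose hy)
  have hfin := (hsq.div_const (√(inducedMatrix (k + 1) g f x p).det)).derivWithin (hu 0 h00)
  simp only [hw, funext fun t => sqrt_relDet_eq (F := pushMap c f ξ) h.smooth h.immersion hpx t, sdiv]
  rw [hfin, hgram, ← hgram, hpush0, mul_div_cancel_left₀ _ (Real.sqrt_pos.2 hdet).ne']

end Push

theorem exists_bump {m : ℕ} [NeZero m] {S : Type*} [TopologicalSpace S] [T2Space S]
    [ChartedSpace (EuclideanHalfSpace m) S] [IsManifold (𝓡∂ m) ∞ S] {p : S} {O : Set S} (hO : O ∈ 𝓝 p) :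
    ∃ (χ : S → ℝ) (K : Set S), ContMDiff (𝓡∂ m) 𝓘(ℝ, ℝ) ∞ χ ∧ (∀ q, 0 ≤ χ q) ∧ χ p = 1 ∧
      IsCompact K ∧ K ⊆ O ∧ ∀ q ∉ K, χ q = 0 := by
  obtain ⟨b, -, hb⟩ := (SmoothBumpFunction.nhds_basis_tsupport (I := 𝓡∂ m) p).mem_iff.1 hO
  exact ⟨b, tsupport b, b.contMDiff, fun q => b.nonneg, b.eq_one, b.hasCompactSupport, hb,
    fun q hq => image_eq_zero_of_notMem_tsupport hq⟩

theorem contMDiff_smul_of_support {m : ℕ} [NeZero m] {S : Type*} [TopologicalSpace S]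
    [ChartedSpace (EuclideanHalfSpace m) S] {E : Type*} [NormedAddCommGroup E] [NormedSpace ℝ E]
    {χ : S → ℝ} {v : S → E} {A K : Set S} (hχ : ContMDiff (𝓡∂ m) 𝓘(ℝ, ℝ) ∞ χ)
    (hv : ContMDiffOn (𝓡∂ m) 𝓘(ℝ, E) ∞ v A) (hA : IsOpen A) (hK : IsClosed K) (hKA : K ⊆ A)
    (h0 : ∀ q ∉ K, χ q = 0) : ContMDiff (𝓡∂ m) 𝓘(ℝ, E) ∞ (fun q => χ q • v q) := by
  intro q
  by_cases hq : q ∈ K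
  · exact (hχ q).smul ((hv q (hKA hq)).contMDiffAt (hA.mem_nhds (hKA hq)))
  · refine (contMDiffAt_const (c := (0 : E))).congr_of_eventuallyEq ?_
    filter_upwards [hK.isOpen_compl.mem_nhds hq] with z hz
    rw [h0 z hz, zero_smul]

/-! ### Free boundary minimal hypersurfaces have vanishing mean curvature. -/

section Minimal

variable {k : ℕ} {M : Type*} [TopologicalSpace M]
  [ChartedSpace (EuclideanHalfSpace (k + 2)) M] [IsManifold (𝓡∂ (k + 2)) ∞ M]
  {S : Type*} [TopologicalSpace S] [T2Space S] [SigmaCompactSpace S]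
  [ChartedSpace (EuclideanHalfSpace (k + 1)) S] [IsManifold (𝓡∂ (k + 1)) ∞ S]
  [MeasurableSpace S] [BorelSpace S] {g : RMetric (k + 2) M} {f : S → M} {x : S} {c : M} {K : Set S}
  {ν : ∀ p, TangentSpace (𝓡∂ (k + 2)) (f p)}

/-- The nonnegative `w` vanishes almost everywhere. The volume element is positive, so it does so
for Lebesgue measure in the chart, and by continuity it vanishes on the whole open set. -/
theorem eq_zero_of_integral_inducedVolume_eq_zero (hf : ContMDiff (𝓡∂ (k + 1)) (𝓡∂ (k + 2)) ∞ f)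
    (himm : ∀ p, Function.Injective (mfderiv (𝓡∂ (k + 1)) (𝓡∂ (k + 2)) f p))
    {w : S → ℝ} (hw : Continuous w) (hK : IsCompact K)
    (hKx : K ⊆ (chartAt (EuclideanHalfSpace (k + 1)) x).source) (h0 : ∀ p ∉ K, w p = 0)
    (hnn : ∀ p, 0 ≤ w p) (hint : ∫ p, w p ∂(inducedVolume k g f) = 0) {y : Coord (k + 1)}
    (hy : y ∈ interior (extChartAt (𝓡∂ (k + 1)) x).target) :
    w ((extChartAt (𝓡∂ (k + 1)) x).symm y) = 0 := by
  have hi := integrable_inducedVolume g hf hw hK h0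
  set T := (extChartAt (𝓡∂ (k + 1)) x).target with hT
  have h1 : ContinuousOn (fun y => w ((extChartAt (𝓡∂ (k + 1)) x).symm y)) (interior T) :=
    (hw.comp_continuousOn (continuousOn_extChartAt_symm x)).mono interior_subset
  have h2 := (integral_eq_zero_iff_of_nonneg hnn hi).1 hint
  have h3 : ∀ᵐ p ∂(chartVolume k g f x).restrict K, w p = 0 := by
    rw [← inducedVolume_restrict_eq g hK hKx]
    exact ae_restrict_of_ae h2
  have h4 : ∀ᵐ p ∂(chartVolume k g f x), w p = 0 := by
    filter_upwards [(ae_restrict_iff' hK.measurableSet).1 h3] with p hp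
    by_cases hpK : p ∈ K
    · exact hp hpK
    · exact h0 p hpK
  have h5 := (aemeasurable_extChartAt_symm x).mono_ac
    (withDensity_absolutelyContinuous _ fun y : Coord (k + 1) => ENNReal.ofReal (volumeElement g f x y))
  rw [chartVolume_eq] at h4
  have h6 := ae_of_ae_map h5 h4
  rw [ae_withDensity_iff' (aemeasurable_volumeElement g hf x),
    ae_restrict_iff' (measurableSet_target x)] at h6
  refine Measure.eqOn_open_of_ae_eq (μ := volume) (g := fun _ => (0 : ℝ)) ?_ isOpen_interior h1 continuousOn_const hy
  rw [EventuallyEq, ae_restrict_iff' isOpen_interior.measurableSet]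
  filter_upwards [h6] with z hz hzi
  refine hz (interior_subset hzi) ?_
  rw [Ne, ENNReal.ofReal_eq_zero, not_le]
  exact volumeElement_pos g himm (interior_subset hzi)

omit [T2Space S] [SigmaCompactSpace S] [MeasurableSpace S] [BorelSpace S] in
/-- Near an interior point, the hypersurface can be pushed along some multiple of its normal. -/
theorem IsHypersurface.exists_push_direction (h : IsHypersurface g f ν) {y : Coord (k + 1)}
    (hy : y ∈ coordDomain (k + 2) x c f) :
    ∃ s : ℝ, s ≠ 0 ∧ ∀ᶠ z in 𝓝 y, 0 < mapCoord (m := k + 1) (n := k + 2) x c f z 0 ∨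
      0 < s * fieldCoord (m := k + 1) (n := k + 2) x c f ν z 0 := by
  have hL := h.localHypersurface x c (e := stdVec) (by
    rw [frameMatrix_stdVec, Matrix.det_one]; exact isUnit_one)
  have hnn : ∀ z ∈ coordDomain (m := k + 1) (k + 2) x c f, 0 ≤ mapCoord (m := k + 1) (n := k + 2) x c f z 0 := fun z hz =>
    nonneg_of_mem_target (hL.mapsTo hz)
  have hfd := LocalHypersurface.differentiableAt_of_contDiffOn hL.isOpen hy hL.smooth
  have hνd := LocalHypersurface.differentiableAt_of_contDiffOn hL.isOpen hy hL.smoothν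
  have hc : ∀ (u : Coord (k + 1) → Coord (k + 2)), DifferentiableAt ℝ u y →
      ContinuousAt (fun z => u z 0) y := fun u hu =>
    (EuclideanSpace.proj (0 : Fin (k + 2)) : Coord (k + 2) →L[ℝ] ℝ).continuous.continuousAt.comp
      hu.continuousAt
  rcases (hnn y hy).lt_or_eq with h0 | h0
  · exact ⟨1, one_ne_zero, ((hc _ hfd).eventually_const_lt h0).mono fun z hz => Or.inl hz⟩
  -- At a point on `∂M` the zeroth coordinate of `f` is minimal, so the tangent space of the
  -- hypersurface lies in that of `∂M`. The normal must then have a nonzero zeroth component, and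
  -- multiplying by that component makes it point into `M`.
  have hmin : IsLocalMin (fun z => mapCoord (m := k + 1) (n := k + 2) x c f z 0) y := by
    filter_upwards [hL.isOpen.mem_nhds hy] with z hz
    rw [← h0]; exact hnn z hz
  have hd : ∀ v, fderiv ℝ (mapCoord (m := k + 1) (n := k + 2) x c f) y v 0 = 0 := fun v => by
    have h1 := (EuclideanSpace.proj (0 : Fin (k + 2)) : Coord (k + 2) →L[ℝ] ℝ).hasFDerivAt.comp y
      hfd.hasFDerivAt
    have h2 := hmin.hasFDerivAt_eq_zero h1
    exact congrArg (fun L : Coord (k + 1) →L[ℝ] ℝ => L v) h2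
  have hdec := congrArg (fun v : Coord (k + 2) => v 0) (hL.decomp hy fun _ => stdVec 0)
  simp only [PiLp.add_apply, PiLp.smul_apply, smul_eq_mul, tfield, hd, add_zero] at hdec
  have hne : fieldCoord x c f ν y 0 ≠ 0 := fun h => by
    rw [h, mul_zero] at hdec; simp at hdec
  refine ⟨fieldCoord x c f ν y 0, hne, ?_⟩
  have h3 : 0 < fieldCoord x c f ν y 0 * fieldCoord x c f ν y 0 := mul_self_pos.2 hne
  exact (((hc _ hνd).const_mul _).eventually_const_lt h3).mono fun z hz => Or.inr hz

/-- A free boundary minimal hypersurface has vanishing mean curvature. -/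
theorem IsHypersurface.divAlong_normal_eq_zero (h : IsHypersurface g f ν)
    (hmin : IsFreeBoundaryMinimal k g f)
    (hbd : ∀ p ∈ (𝓡∂ (k + 1)).boundary S, f p ∈ (𝓡∂ (k + 2)).boundary M) (x : S) {y₀ : Coord (k + 1)}
    (hy₀ : y₀ ∈ interior (extChartAt (𝓡∂ (k + 1)) x).target) :
    divAlong (k + 1) g f ν ((extChartAt (𝓡∂ (k + 1)) x).symm y₀) = 0 := by
  set p₀ := (extChartAt (𝓡∂ (k + 1)) x).symm y₀ with hp₀
  obtain ⟨c, hc⟩ : ∃ c, c = f p₀ := ⟨_, rfl⟩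
  have hyU : y₀ ∈ coordDomain (m := k + 1) (k + 2) x c f := ⟨hy₀, by
    rw [mem_preimage, ← hp₀, hc]; exact mem_chart_source _ _⟩
  have he : IsUnit (frameMatrix (stdVec : Fin (k + 1) → Coord (k + 1))).det := by
    rw [frameMatrix_stdVec, Matrix.det_one]; exact isUnit_one
  have hL := h.localHypersurface x c he
  set H : Coord (k + 1) → ℝ := sdiv (chartMetric g c) (chartGamma g c) (mapCoord x c f) stdVec
    (fieldCoord x c f ν) with hH
  have hHdiv : divAlong (k + 1) g f ν p₀ = H y₀ :=
    divAlong_eq_sdiv g h.smooth hyU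
      (LocalHypersurface.differentiableAt_of_contDiffOn hL.isOpen hyU hL.smoothν)
  rw [hHdiv]
  by_contra hne
  have hHc : ContinuousAt H y₀ := (LocalHypersurface.differentiableAt_of_contDiffOn hL.isOpen hyU
    (hL.contDiffOn_sdiv hL.smoothν)).continuousAt
  -- The test field is `s χ ν` with a bump function `χ` supported where `H` has the sign of `H y₀`.
  -- On `∂M` the sign of `s` is forced; this does no harm, since the one-sided derivative is
  -- required to vanish and not merely to be nonnegative.
  obtain ⟨s, hs, hpush⟩ := h.exists_push_direction hyU
  have hsign : ∀ᶠ z in 𝓝 y₀, 0 < H y₀ * H z :=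
    (hHc.const_mul _).eventually_const_lt (mul_self_pos.2 hne)
  have hp₀x : p₀ ∈ (chartAt (EuclideanHalfSpace (k + 1)) x).source :=
    symm_mem_source (interior_subset hy₀)
  have hext : extChartAt (𝓡∂ (k + 1)) x p₀ = y₀ :=
    (extChartAt (𝓡∂ (k + 1)) x).right_inv (interior_subset hy₀)
  have hcx : ContinuousAt (extChartAt (𝓡∂ (k + 1)) x) p₀ :=
    continuousAt_extChartAt' (by rwa [extChartAt_source])
  obtain ⟨V, hV, hVo, hyV⟩ := eventually_nhds_iff.1 ((hpush.and hsign).and (hL.isOpen.mem_nhds hyU))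
  have hO : {p | p ∈ (chartAt (EuclideanHalfSpace (k + 1)) x).source ∧
      extChartAt (𝓡∂ (k + 1)) x p ∈ V} ∈ 𝓝 p₀ :=
    inter_mem ((chartAt (EuclideanHalfSpace (k + 1)) x).open_source.mem_nhds hp₀x)
      (hcx.preimage_mem_nhds (hVo.mem_nhds (by rwa [hext])))
  obtain ⟨O, hOsub, hOo, hpO⟩ := mem_nhds_iff.1 hO
  obtain ⟨χ, K, hχ, hχ0, hχ1, hK, hKO, hχK⟩ := exists_bump (m := k + 1) (hOo.mem_nhds hpO)
  have hOU : ∀ q ∈ O, extChartAt (𝓡∂ (k + 1)) x q ∈ coordDomain (m := k + 1) (k + 2) x c f := fun q hq =>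
    (hV _ (hOsub hq).2).2
  have hσ : ∀ q ∈ O, (extChartAt (𝓡∂ (k + 1)) x).symm (extChartAt (𝓡∂ (k + 1)) x q) = q := fun q hq =>
    extChartAt_symm_extChartAt (hOsub hq).1
  have hOc : ∀ q ∈ O, f q ∈ (chartAt (EuclideanHalfSpace (k + 2)) c).source := fun q hq => by
    have := (hOU q hq).2
    rwa [mem_preimage, hσ q hq] at this
  set n : S → Coord (k + 2) := fun q => reading (n := k + 2) c (f q) (ν q) with hn
  have hnO : ∀ q ∈ O, n q = fieldCoord x c f ν (extChartAt (𝓡∂ (k + 1)) x q) := fun q hq => by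
    have := congrArg n (hσ q hq)
    exact this.symm
  have hξ : ContMDiff (𝓡∂ (k + 1)) 𝓘(ℝ, Coord (k + 2)) ∞ (fun q => (s * χ q) • n q) :=
    contMDiff_smul_of_support (K := K) (A := O) (contMDiff_const.mul hχ)
      (contMDiffOn_reading h.smooth_normal.contMDiffOn hOc) hOo hK.isClosed hKO
      (fun q hq => by rw [hχK q hq, mul_zero])
  have hξcont : ∀ q ∈ O, ContinuousAt
      (fun z : ℝ × S => (extChartAt (𝓡∂ (k + 2)) c (f z.2) + z.1 • ((s * χ z.2) • n z.2)) 0) (0, q) := by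
    intro q hq
    have hc' : ContinuousAt (fun z : ℝ × S => extChartAt (𝓡∂ (k + 2)) c (f z.2)) (0, q) :=
      ContinuousAt.comp (g := extChartAt (𝓡∂ (k + 2)) c) (f := fun z : ℝ × S => f z.2)
        (continuousAt_extChartAt' (by rw [extChartAt_source]; exact hOc q hq))
        (h.smooth.continuous.comp continuous_snd).continuousAt
    exact ContinuousAt.comp
      (g := (EuclideanSpace.proj (0 : Fin (k + 2)) : Coord (k + 2) →L[ℝ] ℝ))
      (ContinuousLinearMap.continuous _).continuousAt
      (hc'.add (continuous_fst.smul (hξ.continuous.comp continuous_snd)).continuousAt)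
  obtain ⟨w, hw, hw0, hwint, hwsdiv⟩ := h.exists_firstVariation hmin hbd hξ hK
    (fun q hq => hOc q (hKO hq)) (fun q hq => by rw [hχK q hq, mul_zero, zero_smul]) (by
      intro q hq
      -- Either the point has positive zeroth coordinate, which persists for short times, or the
      -- pushing direction has nonnegative zeroth component nearby.
      rcases (hV _ (hOsub (hKO hq)).2).1.1 with h1 | h1
      · rw [mapCoord, hσ q (hKO hq)] at h1
        have h2 := (hξcont q (hKO hq)).eventually_const_lt (u := 0) (by simpa using h1)
        exact h2.mono fun z hz _ => hz.le
      · have h3 : ∀ᶠ z in 𝓝 ((0 : ℝ), q), z.2 ∈ O :=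
          continuous_snd.continuousAt.eventually (hOo.mem_nhds (hKO hq))
        have h4 : ContinuousAt n q := (contMDiffOn_reading (c := c) h.smooth_normal.contMDiffOn hOc
          |>.continuousOn).continuousAt (hOo.mem_nhds (hKO hq))
        have h5 : ContinuousAt (fun p => s * n p 0) q :=
          ((EuclideanSpace.proj (0 : Fin (k + 2)) : Coord (k + 2) →L[ℝ] ℝ).continuous.continuousAt.comp
            h4).const_mul s
        rw [← hnO q (hKO hq)] at h1
        have h8 : ∀ᶠ p in 𝓝 q, 0 < s * n p 0 := h5.eventually_const_lt h1
        have h8 : ∀ᶠ z in 𝓝 ((0 : ℝ), q), 0 < s * n z.2 0 :=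
          (continuous_snd.continuousAt (x := ((0 : ℝ), q))).eventually h8
        filter_upwards [h3, h8] with z hz hz' ht
        have h6 := nonneg_of_mem_target (extChartAt_mem_target (hOc z.2 hz))
        have h7 : 0 ≤ z.1 * (χ z.2 * (s * n z.2 0)) :=
          mul_nonneg ht (mul_nonneg (hχ0 _) hz'.le)
        simp only [PiLp.add_apply, PiLp.smul_apply, smul_eq_mul]
        linarith [show z.1 * (s * χ z.2 * n z.2 0) = z.1 * (χ z.2 * (s * n z.2 0)) by ring]) (by
      intro p hp
      have : p ∉ K := fun hpK => by
        have h1 := (hOU p (hKO hpK)).1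
        rw [← hσ p (hKO hpK), mem_boundary_iff (interior_subset h1)] at hp
        exact (mem_interior_target.1 h1).2.ne' hp
      rw [hχK p this, mul_zero, zero_smul]; rfl)
  -- In `div (sχν)` the gradient of `sχ` is paired with the tangential part of `ν`, which is zero.
  have hval : ∀ q ∈ O, w q = s * χ q * H (extChartAt (𝓡∂ (k + 1)) x q) := by
    intro q hq
    set y := extChartAt (𝓡∂ (k + 1)) x q with hy
    have h1 := hwsdiv x y (hOU q hq)
    rw [hσ q hq] at h1
    obtain ⟨e, he', hgr⟩ := h.exists_orthonormal (hOU q hq)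
    have hL' := h.localHypersurface x c he'
    have hχs : ContDiffOn ℝ ∞ (fun y => s * χ ((extChartAt (𝓡∂ (k + 1)) x).symm y))
        (coordDomain (m := k + 1) (k + 2) x c f) := by
      have h2 := (contMDiff_const (c := s)).mul hχ |>.comp_contMDiffOn
        (contMDiffOn_extChartAt_symm (I := 𝓡∂ (k + 1)) (n := ∞) x)
      exact (contMDiffOn_iff_contDiffOn.1 h2).mono fun z hz => interior_subset hz.1
    have h3 := hL'.sdiv_smul (hOU q hq) hgr hχs hL'.smoothν
    rw [sdiv_frame he', sdiv_frame he'] at h3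
    rw [h1]
    refine h3.trans ?_
    rw [hσ q hq, Finset.sum_eq_zero, zero_add]
    intro i _
    rw [hL'.normal _ (hOU q hq) i, mul_zero]
  -- The constant `s * H y₀` turns the integrand into `s² χ H(y₀) H`, which is nonnegative whatever
  -- the sign of `s`.
  have hfin := eq_zero_of_integral_inducedVolume_eq_zero (g := g) (x := x) h.smooth h.immersion
    (w := fun p => s * H y₀ * w p) (continuous_const.mul hw) hK (fun q hq => (hOsub (hKO hq)).1)
    (fun p hp => by rw [hw0 p hp, mul_zero]) (fun p => by
      by_cases hpK : p ∈ K
      · rw [hval p (hKO hpK)]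
        have h1 := (hV _ (hOsub (hKO hpK)).2).1.2
        calc (0 : ℝ) ≤ s ^ 2 * χ p * (H y₀ * H (extChartAt (𝓡∂ (k + 1)) x p)) :=
              mul_nonneg (mul_nonneg (sq_nonneg s) (hχ0 p)) h1.le
          _ = _ := by ring
      · rw [hw0 p hpK, mul_zero]) (by rw [integral_const_mul, hwint, mul_zero]) hy₀
  rw [← hp₀, hval p₀ hpO, hext, hχ1] at hfin
  have : s ^ 2 * H y₀ ^ 2 = 0 := by linarith [hfin, show s * H y₀ * (s * 1 * H y₀) = s ^ 2 * H y₀ ^ 2 by ring]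
  exact (mul_ne_zero (pow_ne_zero 2 hs) (pow_ne_zero 2 hne)) this

end Minimal

/-! ### Free boundary minimal hypersurfaces meet the boundary orthogonally. -/

section SmoothFields

variable {m n : ℕ} [NeZero m] [NeZero n] {M : Type*} [TopologicalSpace M]
  [ChartedSpace (EuclideanHalfSpace n) M] [IsManifold (𝓡∂ n) ∞ M]
  {S : Type*} [TopologicalSpace S] [ChartedSpace (EuclideanHalfSpace m) S]
  [IsManifold (𝓡∂ m) ∞ S] {f : S → M} {V W : ∀ p, TangentSpace (𝓡∂ n) (f p)} {χ : S → ℝ}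

theorem contDiffOn_comp_symm (hχ : ContMDiff (𝓡∂ m) 𝓘(ℝ, ℝ) ∞ χ) (x : S) :
    ContDiffOn ℝ ∞ (fun y => χ ((extChartAt (𝓡∂ m) x).symm y)) (extChartAt (𝓡∂ m) x).target :=
  contMDiffOn_iff_contDiffOn.1
    (hχ.comp_contMDiffOn (contMDiffOn_extChartAt_symm (I := 𝓡∂ m) (n := ∞) x))

theorem SmoothField.smul (hχ : ContMDiff (𝓡∂ m) 𝓘(ℝ, ℝ) ∞ χ) (hV : SmoothField m n f V) :
    SmoothField m n f (fun q => χ q • V q) := fun x c =>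
  (((contDiffOn_comp_symm hχ x).mono inter_subset_left).smul (hV x c)).congr fun _ hy =>
    reading_smul hy.2 _ _

theorem smoothField_smul_of_support (hf : ContMDiff (𝓡∂ m) (𝓡∂ n) ∞ f) {A K : Set S}
    (hχ : ContMDiff (𝓡∂ m) 𝓘(ℝ, ℝ) ∞ χ)
    (hV : ContMDiffOn (𝓡∂ m) (𝓡∂ n).tangent ∞ (fun p => (⟨f p, V p⟩ : TangentBundle (𝓡∂ n) M)) A)
    (hA : IsOpen A) (hK : IsClosed K) (hKA : K ⊆ A) (h0 : ∀ q ∉ K, χ q = 0) :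
    SmoothField m n f (fun q => χ q • V q) := by
  intro x c
  set D := (extChartAt (𝓡∂ m) x).target ∩
      (fun y => f ((extChartAt (𝓡∂ m) x).symm y)) ⁻¹' (chartAt (EuclideanHalfSpace n) c).source with hD
  have hB : IsOpen (A ∩ f ⁻¹' (chartAt (EuclideanHalfSpace n) c).source) :=
    hA.inter ((chartAt (EuclideanHalfSpace n) c).open_source.preimage hf.continuous)
  have h1 : ContMDiffOn (𝓡∂ m) 𝓘(ℝ, Coord n) ∞ (fun p => reading (n := n) c (f p) (V p))
      (A ∩ f ⁻¹' (chartAt (EuclideanHalfSpace n) c).source) :=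
    contMDiffOn_reading (hV.mono inter_subset_left) fun p hp => hp.2
  have h2 : ContMDiffOn (𝓡∂ m) 𝓘(ℝ, Coord n) ∞ (fun p => χ p • reading (n := n) c (f p) (V p))
      (f ⁻¹' (chartAt (EuclideanHalfSpace n) c).source) := by
    intro q hq
    by_cases hqK : q ∈ K
    · exact ((hχ q).smul ((h1 q ⟨hKA hqK, hq⟩).contMDiffAt
        (hB.mem_nhds ⟨hKA hqK, hq⟩))).contMDiffWithinAt
    · refine ContMDiffAt.contMDiffWithinAt
        ((contMDiffAt_const (c := (0 : Coord n))).congr_of_eventuallyEq ?_)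
      filter_upwards [hK.isOpen_compl.mem_nhds hqK] with z hz
      rw [h0 z hz, zero_smul]
  have h3 := h2.comp ((contMDiffOn_extChartAt_symm (I := 𝓡∂ m) (n := ∞) x).mono
    (inter_subset_left : D ⊆ _)) (fun y hy => hy.2)
  exact (contMDiffOn_iff_contDiffOn.1 h3).congr fun _ hy => reading_smul hy.2 _ _

theorem tangentComp_smul (g : RMetric n M) (x : S) (i : Fin m) (p : S) :
    tangentComp m g f x (fun q => χ q • V q) i p = χ p * tangentComp m g f x V i p := by
  simp only [tangentComp, map_smul, _root_.smul_apply, smul_eq_mul, Finset.mul_sum]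
  exact Finset.sum_congr rfl fun j _ => by ring

end SmoothFields

section BoundaryLift

variable {k : ℕ} {S : Type*} [TopologicalSpace S] [T2Space S]
  [ChartedSpace (EuclideanHalfSpace (k + 1)) S] [IsManifold (𝓡∂ (k + 1)) ∞ S] {x : S} {K : Set S}
  {v : Coord (k + 1) → ℝ}

theorem continuous_indicator_boundaryIncl (hv : ContinuousOn v (extChartAt (𝓡∂ (k + 1)) x).target)
    (hK : IsCompact K) (hKx : K ⊆ (chartAt (EuclideanHalfSpace (k + 1)) x).source)
    (h0 : ∀ y ∈ (extChartAt (𝓡∂ (k + 1)) x).target, (extChartAt (𝓡∂ (k + 1)) x).symm y ∉ K → v y = 0) :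
    Continuous ((boundaryIncl k ⁻¹' (extChartAt (𝓡∂ (k + 1)) x).target).indicator
      fun z => v (boundaryIncl k z)) :=
  (continuousOn_indicator_target hv hK hKx h0).comp_continuous continuous_boundaryIncl
    fun z => (boundaryIncl_zero z).ge

theorem hasCompactSupport_indicator_boundaryIncl
    (hK : IsCompact K) (hKx : K ⊆ (chartAt (EuclideanHalfSpace (k + 1)) x).source)
    (h0 : ∀ y ∈ (extChartAt (𝓡∂ (k + 1)) x).target, (extChartAt (𝓡∂ (k + 1)) x).symm y ∉ K → v y = 0) :
    HasCompactSupport ((boundaryIncl k ⁻¹' (extChartAt (𝓡∂ (k + 1)) x).target).indicator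
      fun z => v (boundaryIncl k z)) := by
  have hC := isCompact_image_extChartAt hK hKx
  have hpr : Continuous fun y : Coord (k + 1) => (WithLp.toLp 2 fun i : Fin k => y i.succ : Coord k) := by
    fun_prop
  refine HasCompactSupport.intro (K := boundaryIncl k ⁻¹' (extChartAt (𝓡∂ (k + 1)) x '' K))
    ((hC.image hpr).of_isClosed_subset (hC.isClosed.preimage continuous_boundaryIncl)
      fun z hz => ⟨_, hz, rfl⟩) fun z hz => ?_
  by_cases hzT : z ∈ boundaryIncl k ⁻¹' (extChartAt (𝓡∂ (k + 1)) x).target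
  · rw [indicator_of_mem hzT]; exact h0 _ hzT (notMem_image_extChartAt hzT hz)
  · exact indicator_of_notMem hzT _

end BoundaryLift

section Conormal

variable {k : ℕ} {M : Type*} [TopologicalSpace M]
  [ChartedSpace (EuclideanHalfSpace (k + 2)) M] [IsManifold (𝓡∂ (k + 2)) ∞ M]
  {S : Type*} [TopologicalSpace S] [T2Space S] [SigmaCompactSpace S]
  [ChartedSpace (EuclideanHalfSpace (k + 1)) S] [IsManifold (𝓡∂ (k + 1)) ∞ S]
  [MeasurableSpace S] [BorelSpace S] {g : RMetric (k + 2) M} {f : S → M} {x : S} {c : M} {K : Set S}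
  {ν : ∀ p, TangentSpace (𝓡∂ (k + 2)) (f p)} {χ : S → ℝ} {e : Coord (k + 2)}

/-- A constant coordinate field `e` with `e 0 = 0`, cut off by `χ`, is tangent to `∂M` and hence an
admissible push, so the integral of its divergence is zero. The mean curvature vanishes, so this is
also the divergence of its tangential part, and the divergence theorem leaves the boundary integral.
-/
theorem IsHypersurface.conormal_integral (h : IsHypersurface g f ν)
    (hmin : IsFreeBoundaryMinimal k g f)
    (hbd : ∀ p ∈ (𝓡∂ (k + 1)).boundary S, f p ∈ (𝓡∂ (k + 2)).boundary M)
    (hχ : ContMDiff (𝓡∂ (k + 1)) 𝓘(ℝ, ℝ) ∞ χ) (hK : IsCompact K)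
    (hKx : K ⊆ (chartAt (EuclideanHalfSpace (k + 1)) x).source)
    (hKc : K ⊆ f ⁻¹' (chartAt (EuclideanHalfSpace (k + 2)) c).source) (h0 : ∀ q ∉ K, χ q = 0)
    (he : e 0 = 0) :
    SmoothField (k + 1) (k + 2) f (fun q => χ q • coordVec c (f q) e) ∧
    ∫ z in boundaryIncl k ⁻¹' (extChartAt (𝓡∂ (k + 1)) x).target,
      volumeElement g f x (boundaryIncl k z) *
        tangentComp (k + 1) g f x (fun q => χ q • coordVec c (f q) e) 0
          ((extChartAt (𝓡∂ (k + 1)) x).symm (boundaryIncl k z)) = 0 := by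
  set V : ∀ p, TangentSpace (𝓡∂ (k + 2)) (f p) := fun q => χ q • coordVec c (f q) e with hV
  have hVs : SmoothField (k + 1) (k + 2) f V :=
    smoothField_smul_of_support h.smooth hχ ((contMDiffOn_coordVec c e).comp
      (h.smooth.contMDiffOn (s := f ⁻¹' (chartAt (EuclideanHalfSpace (k + 2)) c).source)) subset_rfl)
      ((chartAt (EuclideanHalfSpace (k + 2)) c).open_source.preimage h.smooth.continuous) hK.isClosed
      hKc h0
  refine ⟨hVs, ?_⟩
  obtain ⟨w, hw, hw0, hwint, hwsdiv⟩ := h.exists_firstVariation (c := c) hmin hbd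
    (hχ.smul (contMDiff_const (c := e))) hK hKc (fun q hq => by
      change χ q • e = 0
      rw [h0 q hq, zero_smul]) (by
    intro q hq
    have h3 : ∀ᶠ z in 𝓝 ((0 : ℝ), q), f z.2 ∈ (chartAt (EuclideanHalfSpace (k + 2)) c).source :=
      (h.smooth.continuous.comp continuous_snd).continuousAt.eventually
        ((chartAt (EuclideanHalfSpace (k + 2)) c).open_source.mem_nhds (hKc hq))
    filter_upwards [h3] with z hz _
    simp only [Pi.smul_apply', PiLp.add_apply, PiLp.smul_apply, smul_eq_mul, he, mul_zero, add_zero]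
    exact nonneg_of_mem_target (extChartAt_mem_target hz)) (by
    intro p _
    simp only [Pi.smul_apply', PiLp.smul_apply, smul_eq_mul, he, mul_zero])
  have hae : ∀ᵐ p ∂(inducedVolume k g f), divAlong (k + 1) g f (tangentialField g f V) p = w p := by
    refine ae_of_interior fun p hp => ?_
    by_cases hpK : p ∈ K
    · set y := extChartAt (𝓡∂ (k + 1)) x p with hy
      have hσ : (extChartAt (𝓡∂ (k + 1)) x).symm y = p := extChartAt_symm_extChartAt (hKx hpK)
      have hi := extChartAt_mem_interior hp (hKx hpK)
      have hyU : y ∈ coordDomain (m := k + 1) (k + 2) x c f := ⟨hi, by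
        rw [mem_preimage, hσ]; exact hKc hpK⟩
      obtain ⟨e', he', hgr⟩ := h.exists_orthonormal hyU
      have hL := h.localHypersurface x c he'
      have h1 := hwsdiv x y hyU
      have hVc : ContDiffOn ℝ ∞ (fieldCoord (m := k + 1) (n := k + 2) x c f V) (coordDomain (k + 2) x c f) :=
        (hVs x c).mono coordDomain_subset
      have h2 := divAlong_eq_sdiv_of_eventuallyEq g h.smooth hyU he' (V := tangentialField g f V)
        (W := tfield (chartMetric g c) (mapCoord x c f) e' (fieldCoord x c f V)) (by
          filter_upwards [hL.isOpen.mem_nhds hyU] with z hz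
          rw [tfield_frame he']
          exact reading_tangentField g h.smooth hz V)
        (LocalHypersurface.differentiableAt_of_contDiffOn hL.isOpen hyU (hL.contDiffOn_tfield hVc))
      have hH : sdiv (chartMetric g c) (chartGamma g c) (mapCoord x c f) e' (fieldCoord x c f ν) y = 0 := by
        rw [← h.divAlong_normal_eq_zero hmin hbd x hi]
        exact (divAlong_eq_sdiv_of_eventuallyEq g h.smooth hyU he' EventuallyEq.rfl
          (LocalHypersurface.differentiableAt_of_contDiffOn hL.isOpen hyU hL.smoothν)).symm
      rw [hL.sdiv_tfield hyU hgr hVc hH, sdiv_frame he'] at h2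
      rw [hσ] at h1 h2
      rw [h1, h2]
      refine LocalHypersurface.sdiv_congr ?_
      filter_upwards [hL.isOpen.mem_nhds hyU] with z hz
      rw [fieldCoord, hV, reading_smul hz.2, reading_coordVec hz.2]
      rfl
    · rw [hw0 p hpK]
      refine divAlong_of_eventuallyEq_zero h hp ?_
      filter_upwards [hK.isClosed.isOpen_compl.mem_nhds hpK] with q hq
      exact tangentialField_eq_zero (by rw [hV]; simp only [h0 q hq, zero_smul])
  have hdiv := (h.integral_divAlong_tangentialField hVs hK hKx fun q hq => by
    rw [hV]; simp only [h0 q hq, zero_smul]).2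
  rw [integral_congr_ae hae, hwint] at hdiv
  exact neg_eq_zero.1 hdiv.symm

/-- A free boundary minimal hypersurface meets the boundary orthogonally: its conormal is orthogonal
to the boundary. -/
theorem IsHypersurface.conormal_orthogonal (h : IsHypersurface g f ν)
    (hmin : IsFreeBoundaryMinimal k g f)
    (hbd : ∀ p ∈ (𝓡∂ (k + 1)).boundary S, f p ∈ (𝓡∂ (k + 2)).boundary M) {z₀ : Coord k}
    (hz₀ : boundaryIncl k z₀ ∈ (extChartAt (𝓡∂ (k + 1)) x).target)
    (hc : f ((extChartAt (𝓡∂ (k + 1)) x).symm (boundaryIncl k z₀)) ∈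
      (chartAt (EuclideanHalfSpace (k + 2)) c).source) (he : e 0 = 0) :
    tangentComp (k + 1) g f x (fun q => coordVec c (f q) e) 0
      ((extChartAt (𝓡∂ (k + 1)) x).symm (boundaryIncl k z₀)) = 0 := by
  set p₀ := (extChartAt (𝓡∂ (k + 1)) x).symm (boundaryIncl k z₀) with hp₀
  have hp₀x : p₀ ∈ (chartAt (EuclideanHalfSpace (k + 1)) x).source := symm_mem_source hz₀
  set O := (chartAt (EuclideanHalfSpace (k + 1)) x).source ∩
    f ⁻¹' (chartAt (EuclideanHalfSpace (k + 2)) c).source with hO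
  have hOo : IsOpen O := (chartAt (EuclideanHalfSpace (k + 1)) x).open_source.inter
    ((chartAt (EuclideanHalfSpace (k + 2)) c).open_source.preimage h.smooth.continuous)
  -- Two cut-offs are used. The first turns the coordinate field into a smooth field on all of `S`,
  -- so that the conormal component `b` is continuous near the point and its sign there can be
  -- discussed.
  obtain ⟨χ₁, K₁, hχ₁, -, hχ₁1, hK₁, hK₁O, hχ₁K⟩ := exists_bump (m := k + 1) (hOo.mem_nhds ⟨hp₀x, hc⟩)
  set V₁ : ∀ p, TangentSpace (𝓡∂ (k + 2)) (f p) := fun q => χ₁ q • coordVec c (f q) e with hV₁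
  have hV₁s : SmoothField (k + 1) (k + 2) f V₁ := (h.conormal_integral hmin hbd hχ₁ hK₁
    (hK₁O.trans inter_subset_left) (hK₁O.trans inter_subset_right) hχ₁K he).1
  set b : S → ℝ := tangentComp (k + 1) g f x V₁ 0 with hb
  have hbp : b p₀ = tangentComp (k + 1) g f x (fun q => coordVec c (f q) e) 0 p₀ := by
    rw [hb, hV₁, tangentComp_smul, hχ₁1, one_mul]
  rw [← hbp]
  by_contra hne
  have hbc : ContinuousAt b p₀ := by
    have h1 : ContinuousOn (fun p => b ((extChartAt (𝓡∂ (k + 1)) x).symm (extChartAt (𝓡∂ (k + 1)) x p)))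
        (chartAt (EuclideanHalfSpace (k + 1)) x).source :=
      (h.contDiffOn_tangentComp hV₁s x 0).continuousOn.comp
        (by rw [← extChartAt_source (𝓡∂ (k + 1)) x]; exact continuousOn_extChartAt x)
        fun q hq => extChartAt_mem_target hq
    refine (h1.congr fun p hp => ?_).continuousAt
      ((chartAt (EuclideanHalfSpace (k + 1)) x).open_source.mem_nhds hp₀x)
    rw [extChartAt_symm_extChartAt hp]
  have hsign : ∀ᶠ p in 𝓝 p₀, 0 < b p₀ * b p :=
    (hbc.const_mul _).eventually_const_lt (mul_self_pos.2 hne)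
  -- The second cut-off is supported where `b` has the sign of `b p₀`. After multiplication by `b
  -- p₀` the boundary integrand is nonnegative, and it is nonzero at `z₀`, so its integral cannot
  -- vanish.
  obtain ⟨χ₂, K₂, hχ₂, hχ₂0, hχ₂1, hK₂, hK₂O, hχ₂K⟩ :=
    exists_bump (m := k + 1) (hsign.and (hOo.mem_nhds ⟨hp₀x, hc⟩))
  have hχ₀ : ∀ q ∉ K₂, χ₂ q * χ₁ q = 0 := fun q hq => by rw [hχ₂K q hq, zero_mul]
  have hKx : K₂ ⊆ (chartAt (EuclideanHalfSpace (k + 1)) x).source := fun q hq => (hK₂O hq).2.1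
  obtain ⟨hVs, hint⟩ := h.conormal_integral hmin hbd (χ := fun q => χ₂ q * χ₁ q) (hχ₂.mul hχ₁) hK₂
    hKx (fun q hq => (hK₂O hq).2.2) hχ₀ he
  set V : ∀ p, TangentSpace (𝓡∂ (k + 2)) (f p) := fun q => (χ₂ q * χ₁ q) • coordVec c (f q) e with hV
  have hcomp : ∀ p, tangentComp (k + 1) g f x V 0 p = χ₂ p * b p := fun p => by
    rw [hb, hV₁, hV, tangentComp_smul, tangentComp_smul]
    ring
  set u : Coord (k + 1) → ℝ := fun y => b p₀ * (volumeElement g f x y *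
    tangentComp (k + 1) g f x V 0 ((extChartAt (𝓡∂ (k + 1)) x).symm y)) with hu
  have huc : ContinuousOn u (extChartAt (𝓡∂ (k + 1)) x).target := continuousOn_const.mul
    ((continuousOn_volumeElement g h.smooth x).mul (h.contDiffOn_tangentComp hVs x 0).continuousOn)
  have hu0 : ∀ y ∈ (extChartAt (𝓡∂ (k + 1)) x).target,
      (extChartAt (𝓡∂ (k + 1)) x).symm y ∉ K₂ → u y = 0 := fun y _ hyK => by
    simp only [hu, hcomp, hχ₂K _ hyK, zero_mul, mul_zero]
  have hunn : ∀ y ∈ (extChartAt (𝓡∂ (k + 1)) x).target, 0 ≤ u y := fun y hy => by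
    by_cases hyK : (extChartAt (𝓡∂ (k + 1)) x).symm y ∈ K₂
    · simp only [hu, hcomp]
      have h1 := (hK₂O hyK).1
      calc (0 : ℝ) ≤ volumeElement g f x y * χ₂ ((extChartAt (𝓡∂ (k + 1)) x).symm y) *
            (b p₀ * b ((extChartAt (𝓡∂ (k + 1)) x).symm y)) :=
            mul_nonneg (mul_nonneg (volumeElement_pos g h.immersion hy).le (hχ₂0 _)) h1.le
        _ = _ := by ring
    · exact (hu0 y hy hyK).ge
  have hpos := Continuous.integral_pos_of_hasCompactSupport_nonneg_nonzero (μ := volume) (x := z₀)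
    (continuous_indicator_boundaryIncl huc hK₂ hKx hu0)
    (hasCompactSupport_indicator_boundaryIncl hK₂ hKx hu0)
    (indicator_nonneg fun z hz => hunn _ hz) (by
      rw [indicator_of_mem (mem_preimage.2 hz₀)]
      simp only [hu, hcomp]
      rw [← hp₀, hχ₂1, one_mul]
      exact mul_ne_zero hne (mul_ne_zero (volumeElement_pos g h.immersion hz₀).ne' hne))
  rw [integral_indicator (continuous_boundaryIncl.measurable (measurableSet_target x)),
    integral_const_mul, hint, mul_zero] at hpos
  exact lt_irrefl _ hpos

end Conormal

/-! ### Velocity and acceleration of a variation up to the boundary. -/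

theorem hasDerivAt_slice {D E : Type*} [NormedAddCommGroup D] [NormedSpace ℝ D] [NormedAddCommGroup E]
    [NormedSpace ℝ E] {u : ℝ × D → E} {J : Set ℝ} {T : Set D} {t : ℝ} {y : D} (hJ : IsOpen J)
    (ht : t ∈ J) (hy : y ∈ T) (hu : ContDiffWithinAt ℝ ∞ u (J ×ˢ T) (t, y)) :
    HasDerivAt (fun s => u (s, y)) (fderivWithin ℝ u (J ×ˢ T) (t, y) (1, 0)) t := by
  have h1 := (hu.differentiableWithinAt (by simp)).hasFDerivWithinAt.comp (f := fun s : ℝ => (s, y))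
    (s := J) t (hasFDerivAt_prodMk_left (𝕜 := ℝ) t y).hasFDerivWithinAt fun s hs => ⟨hs, hy⟩
  have h2 := (h1.hasFDerivAt (hJ.mem_nhds ht)).hasDerivAt
  simp only [ContinuousLinearMap.comp_apply, ContinuousLinearMap.inl_apply] at h2
  exact h2

section Acceleration

variable {k : ℕ} {M : Type*} [TopologicalSpace M]
  [ChartedSpace (EuclideanHalfSpace (k + 2)) M] [IsManifold (𝓡∂ (k + 2)) ∞ M]
  {S : Type*} [TopologicalSpace S] [ChartedSpace (EuclideanHalfSpace (k + 1)) S]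
  [IsManifold (𝓡∂ (k + 1)) ∞ S] {g : RMetric (k + 2) M} {f : S → M} {x : S} {c : M} {ε : ℝ}
  {F : ℝ → S → M} {y : Coord (k + 1)}

/-- The velocity of a family of maps, in charts. -/
noncomputable def timeVelocity (J : Set ℝ) (x : S) (c : M) (F : ℝ → S → M) (q : ℝ × Coord (k + 1)) :
    Coord (k + 2) :=
  fderivWithin ℝ (timeMap x c F) (J ×ˢ (extChartAt (𝓡∂ (k + 1)) x).target) q (1, 0)

variable (hF : IsSmoothFamily (k + 1) (k + 2) F (Ioo (-ε) ε))

include hF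

theorem contDiffWithinAt_fderivWithin_time {E : Type*} [NormedAddCommGroup E] [NormedSpace ℝ E]
    {u : ℝ × Coord (k + 1) → E} (hu : ContDiffOn ℝ ∞ u (timeDomain (k + 2) (Ioo (-ε) ε) x c F))
    {q : ℝ × Coord (k + 1)} (hq : q ∈ timeDomain (k + 2) (Ioo (-ε) ε) x c F) :
    ContDiffWithinAt ℝ ∞ u (Ioo (-ε) ε ×ˢ (extChartAt (𝓡∂ (k + 1)) x).target) q ∧
    ContDiffWithinAt ℝ ∞ (fun q => fderivWithin ℝ u
      (Ioo (-ε) ε ×ˢ (extChartAt (𝓡∂ (k + 1)) x).target) q (1, 0))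
      (timeDomain (k + 2) (Ioo (-ε) ε) x c F) q := by
  have h1 := (hu q hq).mono_of_mem_nhdsWithin (hF.timeDomain_mem_nhdsWithin hq)
  refine ⟨h1, ContDiffWithinAt.clm_apply (ContDiffWithinAt.mono (h1.fderivWithin_right (m := ∞) (n := ∞)
    (isOpen_Ioo.uniqueDiffOn.prod (uniqueDiffOn_extChartAt_target x)) (by simp) hq.1)
    inter_subset_left) contDiffWithinAt_const⟩

theorem contDiffOn_timeVelocity : ContDiffOn ℝ ∞ (timeVelocity (k := k) (Ioo (-ε) ε) x c F)
    (timeDomain (k + 2) (Ioo (-ε) ε) x c F) := fun _ hq =>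
  (contDiffWithinAt_fderivWithin_time hF hF.contDiffOn_timeMap hq).2

theorem hasDerivAt_timeMap {t : ℝ} (hq : (t, y) ∈ timeDomain (k + 2) (Ioo (-ε) ε) x c F) :
    HasDerivAt (fun s => timeMap (m := k + 1) (n := k + 2) x c F (s, y))
      (timeVelocity (Ioo (-ε) ε) x c F (t, y)) t :=
  hasDerivAt_slice isOpen_Ioo hq.1.1 hq.1.2
    (contDiffWithinAt_fderivWithin_time hF hF.contDiffOn_timeMap hq).1

theorem hasDerivAt_timeVelocity {t : ℝ} (hq : (t, y) ∈ timeDomain (k + 2) (Ioo (-ε) ε) x c F) :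
    HasDerivAt (fun s => timeVelocity (Ioo (-ε) ε) x c F (s, y))
      (fderivWithin ℝ (timeVelocity (Ioo (-ε) ε) x c F)
        (Ioo (-ε) ε ×ˢ (extChartAt (𝓡∂ (k + 1)) x).target) (t, y) (1, 0)) t :=
  hasDerivAt_slice isOpen_Ioo hq.1.1 hq.1.2
    (contDiffWithinAt_fderivWithin_time hF (contDiffOn_timeVelocity hF) hq).1

theorem mdifferentiableAt_time {t : ℝ} (ht : t ∈ Ioo (-ε) ε) (p : S) :
    MDifferentiableAt 𝓘(ℝ, ℝ) (𝓡∂ (k + 2)) (fun s => F s p) t := by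
  have h2 : ContMDiff 𝓘(ℝ, ℝ) (𝓘(ℝ, ℝ).prod (𝓡∂ (k + 1))) ∞ (fun s : ℝ => (s, p)) :=
    contMDiff_id.prodMk contMDiff_const
  have h3 := ContMDiffOn.comp hF h2.contMDiffOn (s := Ioo (-ε) ε) fun s hs => ⟨hs, mem_univ _⟩
  exact (h3.contMDiffAt (isOpen_Ioo.mem_nhds ht)).mdifferentiableAt (by simp)

theorem reading_timeVelocity {t : ℝ} (hq : (t, y) ∈ timeDomain (k + 2) (Ioo (-ε) ε) x c F) :
    reading c (F t ((extChartAt (𝓡∂ (k + 1)) x).symm y))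
      (mfderiv 𝓘(ℝ, ℝ) (𝓡∂ (k + 2)) (fun s => F s ((extChartAt (𝓡∂ (k + 1)) x).symm y)) t (1 : ℝ)) =
      timeVelocity (Ioo (-ε) ε) x c F (t, y) := by
  refine (reading_mfderiv (mdifferentiableAt_time hF hq.1.1 _) hq.2 (1 : ℝ)).trans ?_
  rw [mfderiv_eq_fderiv]
  have := (hasDerivAt_timeMap hF hq).hasFDerivAt.fderiv
  refine (congrArg (fun L : ℝ →L[ℝ] Coord (k + 2) => L 1) this).trans ?_
  simp

theorem eventually_mem_timeDomain {t : ℝ} (hq : (t, y) ∈ timeDomain (k + 2) (Ioo (-ε) ε) x c F) :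
    ∀ᶠ s in 𝓝 t, (s, y) ∈ timeDomain (k + 2) (Ioo (-ε) ε) x c F := by
  have h1 := (mdifferentiableAt_time hF hq.1.1 ((extChartAt (𝓡∂ (k + 1)) x).symm y)).continuousAt
  filter_upwards [isOpen_Ioo.mem_nhds hq.1.1,
    h1.eventually ((chartAt (EuclideanHalfSpace (k + 2)) c).open_source.mem_nhds hq.2)] with s hs hs'
    using ⟨⟨hs, hq.1.2⟩, hs'⟩

variable (hε : 0 < ε) (hF0 : ∀ p, F 0 p = f p)

include hε hF0

omit hF in
theorem mem_timeDomain (hy : y ∈ (extChartAt (𝓡∂ (k + 1)) x).target ∩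
      (fun y => f ((extChartAt (𝓡∂ (k + 1)) x).symm y)) ⁻¹' (chartAt (EuclideanHalfSpace (k + 2)) c).source) :
    ((0 : ℝ), y) ∈ timeDomain (k + 2) (Ioo (-ε) ε) x c F :=
  ⟨⟨⟨neg_lt_zero.2 hε, hε⟩, hy.1⟩, by rw [mem_preimage]; simp only [hF0]; exact hy.2⟩

theorem reading_variationField (hy : y ∈ (extChartAt (𝓡∂ (k + 1)) x).target ∩
      (fun y => f ((extChartAt (𝓡∂ (k + 1)) x).symm y)) ⁻¹' (chartAt (EuclideanHalfSpace (k + 2)) c).source) :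
    reading c (f ((extChartAt (𝓡∂ (k + 1)) x).symm y))
      (variationField (k + 2) f F ((extChartAt (𝓡∂ (k + 1)) x).symm y)) =
      timeVelocity (Ioo (-ε) ε) x c F (0, y) := by
  rw [← reading_timeVelocity hF (mem_timeDomain hε hF0 hy)]
  exact (reading_congr (hF0 _) _).symm

theorem reading_variationAcceleration (hy : y ∈ (extChartAt (𝓡∂ (k + 1)) x).target ∩
      (fun y => f ((extChartAt (𝓡∂ (k + 1)) x).symm y)) ⁻¹' (chartAt (EuclideanHalfSpace (k + 2)) c).source) :
    reading c (f ((extChartAt (𝓡∂ (k + 1)) x).symm y))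
      (variationAcceleration g f F ((extChartAt (𝓡∂ (k + 1)) x).symm y)) =
      fderivWithin ℝ (timeVelocity (Ioo (-ε) ε) x c F)
        (Ioo (-ε) ε ×ˢ (extChartAt (𝓡∂ (k + 1)) x).target) (0, y) (1, 0) +
      chartGamma g c (timeMap x c F (0, y)) (timeVelocity (Ioo (-ε) ε) x c F (0, y))
        (timeVelocity (Ioo (-ε) ε) x c F (0, y)) := by
  have hm := mem_timeDomain hε hF0 hy
  set p := (extChartAt (𝓡∂ (k + 1)) x).symm y with hp
  have h1 := mdifferentiableAt_time hF hm.1.1 p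
  have hvel : (fun s => reading (n := k + 2) c (F s p)
      (mfderiv 𝓘(ℝ, ℝ) (𝓡∂ (k + 2)) (fun t : ℝ => F t p) s (1 : ℝ))) =ᶠ[𝓝 0]
      fun s => timeVelocity (Ioo (-ε) ε) x c F (s, y) := by
    filter_upwards [eventually_mem_timeDomain hF hm] with s hs using reading_timeVelocity hF hs
  have hdv := hasDerivAt_timeVelocity hF hm
  have key := reading_covDerivAlong g (c := c) (J := 𝓘(ℝ, ℝ)) (σ := fun s : ℝ => s)
    (f := fun s => F s p) (V := fun s => mfderiv 𝓘(ℝ, ℝ) (𝓡∂ (k + 2)) (fun t : ℝ => F t p) s (1 : ℝ))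
    (y₀ := 0) (w := (1 : ℝ)) (w' := (1 : ℝ)) (fun u _ => by rw [mfderiv_eq_fderiv]; rfl) h1
    h1.continuousAt hm.2 (hasDerivAt_timeMap hF hm).differentiableAt
    (hdv.differentiableAt.congr_of_eventuallyEq hvel)
  refine Eq.trans ?_ (key.trans ?_)
  · exact (reading_congr (hF0 _) _).symm
  · refine (cov_congr hvel).trans ?_
    simp only [cov]
    congr 1
    · rw [hdv.hasFDerivAt.fderiv]; simp
    · have e := (hasDerivAt_timeMap hF hm).hasFDerivAt.fderiv
      have e' := congrArg (fun L : ℝ →L[ℝ] Coord (k + 2) => L 1) e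
      simp only [ContinuousLinearMap.toSpanSingleton_apply, one_smul] at e'
      conv_rhs => rw [← e']
      rw [← e']
      rfl

/-- The divergence theorem for the tangential part of the acceleration needs smoothness up to `∂S`;
it comes from the coordinate expression with derivatives taken within the target. -/
theorem smoothField_variationAcceleration :
    SmoothField (k + 1) (k + 2) f (variationAcceleration g f F) := by
  intro x c
  have hin : ContDiff ℝ ∞ (fun z : Coord (k + 1) => ((0 : ℝ), z)) := contDiff_prodMk_right 0
  have hv := contDiffOn_timeVelocity hF (x := x) (c := c)
  have h1 : ContDiffOn ℝ ∞ (fun q => chartGamma g c (timeMap x c F q)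
      (timeVelocity (Ioo (-ε) ε) x c F q) (timeVelocity (Ioo (-ε) ε) x c F q))
      (timeDomain (k + 2) (Ioo (-ε) ε) x c F) :=
    ((contDiffOn_chartGamma g c).comp hF.contDiffOn_timeMap fun q hq =>
      extChartAt_mem_target hq.2).bil_apply hv hv
  have h2 : ContDiffOn ℝ ∞ (fun q => fderivWithin ℝ (timeVelocity (Ioo (-ε) ε) x c F)
      (Ioo (-ε) ε ×ˢ (extChartAt (𝓡∂ (k + 1)) x).target) q (1, 0))
      (timeDomain (k + 2) (Ioo (-ε) ε) x c F) := fun q hq =>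
    (contDiffWithinAt_fderivWithin_time hF hv hq).2
  exact ((h2.add h1).comp hin.contDiffOn fun z hz => mem_timeDomain hε hF0 hz).congr fun z hz =>
    reading_variationAcceleration hF hε hF0 hz

/-- Along the boundary, the normal components of velocity and acceleration of a variation through
surfaces with boundary on the boundary. -/
theorem variation_boundary (hFb : KeepsBoundary (k + 2) k F (Ioo (-ε) ε)) {p : S}
    (hp : p ∈ (𝓡∂ (k + 1)).boundary S) :
    reading (n := k + 2) (f p) (f p) (variationField (k + 2) f F p) 0 = 0 ∧
    reading (n := k + 2) (f p) (f p) (variationAcceleration g f F p) 0 =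
      chartGamma g (f p) (extChartAt (𝓡∂ (k + 2)) (f p) (f p))
        (reading (f p) (f p) (variationField (k + 2) f F p))
        (reading (f p) (f p) (variationField (k + 2) f F p)) 0 := by
  obtain ⟨y, hy⟩ : ∃ y, y = extChartAt (𝓡∂ (k + 1)) p p := ⟨_, rfl⟩
  obtain ⟨c, hc⟩ : ∃ c, c = f p := ⟨_, rfl⟩
  have hσ : (extChartAt (𝓡∂ (k + 1)) p).symm y = p := by
    rw [hy]; exact extChartAt_symm_extChartAt (mem_chart_source _ p)
  have hyD : y ∈ (extChartAt (𝓡∂ (k + 1)) p).target ∩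
      (fun y => f ((extChartAt (𝓡∂ (k + 1)) p).symm y)) ⁻¹' (chartAt (EuclideanHalfSpace (k + 2)) c).source :=
    ⟨by rw [hy]; exact mem_extChartAt_target p, by
      rw [mem_preimage, hσ, hc]; exact mem_chart_source _ _⟩
  have hm := mem_timeDomain (F := F) hε hF0 hyD
  -- The zeroth coordinate of `F s p` is zero for all small `s`, so its first two time derivatives
  -- vanish and the acceleration keeps only its Christoffel term in that component.
  have hzero : ∀ s, (s, y) ∈ timeDomain (k + 2) (Ioo (-ε) ε) p c F →
      timeMap (m := k + 1) (n := k + 2) p c F (s, y) 0 = 0 := by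
    intro s hs
    have h1 := hFb s hs.1.1 p hp
    have h2 : F s p ∈ (chartAt (EuclideanHalfSpace (k + 2)) c).source := by
      have := hs.2; rwa [mem_preimage, hσ] at this
    rw [← extChartAt_symm_extChartAt h2, mem_boundary_iff (extChartAt_mem_target h2)] at h1
    rwa [timeMap, mapCoord, hσ]
  have hproj : ∀ {u : ℝ → Coord (k + 2)} {u' : Coord (k + 2)} {s : ℝ}, HasDerivAt u u' s →
      (∀ᶠ r in 𝓝 s, u r 0 = 0) → u' 0 = 0 := by
    intro u u' s hu h0
    have h1 := (EuclideanSpace.proj (0 : Fin (k + 2)) : Coord (k + 2) →L[ℝ] ℝ).hasFDerivAt.comp_hasDerivAt s hu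
    exact h1.unique ((hasDerivAt_const s (0 : ℝ)).congr_of_eventuallyEq h0)
  have hv0 : ∀ s, (s, y) ∈ timeDomain (k + 2) (Ioo (-ε) ε) p c F →
      timeVelocity (k := k) (Ioo (-ε) ε) p c F (s, y) 0 = 0 := fun s hs =>
    hproj (hasDerivAt_timeMap hF hs) ((eventually_mem_timeDomain hF hs).mono hzero)
  have ha0 := hproj (hasDerivAt_timeVelocity hF hm) ((eventually_mem_timeDomain hF hm).mono hv0)
  have hX := reading_variationField hF hε hF0 hyD
  have hZ := reading_variationAcceleration (g := g) hF hε hF0 hyD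
  have ht : timeMap (m := k + 1) (n := k + 2) p c F (0, y) = extChartAt (𝓡∂ (k + 2)) c c := by
    rw [timeMap, mapCoord, hσ, hF0, hc]
  rw [← hX, ht, hσ] at hZ
  rw [hσ] at hX
  subst hc
  refine ⟨(congrArg (fun v : Coord (k + 2) => v 0) hX).trans (hv0 0 hm), ?_⟩
  refine (congrArg (fun v : Coord (k + 2) => v 0) hZ).trans ?_
  rw [PiLp.add_apply, ha0, zero_add]

end Acceleration

/-! ### The second fundamental form of the boundary and the conormal. -/

section BoundaryForm

variable {n : ℕ} {M : Type*} [TopologicalSpace M]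
  [ChartedSpace (EuclideanHalfSpace (n + 1)) M] [IsManifold (𝓡∂ (n + 1)) ∞ M] (g : RMetric (n + 1) M)
  {c : M} {b : Coord (n + 1)}

theorem inv_metricMatrix_pos (hb : b ∈ (extChartAt (𝓡∂ (n + 1)) c).target) :
    0 < (metricMatrix g c b)⁻¹ 0 0 :=
  (metricMatrix_posDef g hb).inv.diag_pos

/-- The field is `-grad x_0 / |grad x_0|`, and pairing with a gradient is applying the differential.
-/
theorem chartMetric_outwardNormal (hb : b ∈ (extChartAt (𝓡∂ (n + 1)) c).target) (w : Coord (n + 1)) :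
    chartMetric g c b w (outwardNormal g c b) = -(w 0) / √((metricMatrix g c b)⁻¹ 0 0) := by
  have h1 : metricMatrix g c b * (metricMatrix g c b)⁻¹ = 1 :=
    Matrix.mul_nonsing_inv _ (isUnit_iff_ne_zero.2 (metricMatrix_det_ne g hb))
  rw [chartMetric_apply']
  have h2 : ∀ i, ∑ j, metricMatrix g c b i j * (outwardNormal g c b) j =
      -((1 : Matrix (Fin (n + 1)) (Fin (n + 1)) ℝ) i 0) / √((metricMatrix g c b)⁻¹ 0 0) := by
    intro i
    rw [← h1, Matrix.mul_apply, ← Finset.sum_neg_distrib, Finset.sum_div]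
    exact Finset.sum_congr rfl fun j _ => by simp only [outwardNormal]; ring
  calc ∑ i, ∑ j, metricMatrix g c b i j * w i * outwardNormal g c b j
      = ∑ i, w i * ∑ j, metricMatrix g c b i j * (outwardNormal g c b) j := by
        refine Finset.sum_congr rfl fun i _ => ?_
        rw [Finset.mul_sum]
        exact Finset.sum_congr rfl fun j _ => by ring
    _ = _ := by
        simp only [h2]
        rw [Finset.sum_eq_single 0 (fun i _ hi => by rw [Matrix.one_apply_ne hi]; simp) (by simp),
          Matrix.one_apply_eq]
        ring

theorem differentiableWithinAt_outwardNormal (hb : b ∈ (extChartAt (𝓡∂ (n + 1)) c).target) :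
    DifferentiableWithinAt ℝ (outwardNormal g c) (extChartAt (𝓡∂ (n + 1)) c).target b := by
  have h1 := fun a => ((contDiffOn_inv (contDiffOn_metricMatrix g c)
    (fun y hy => metricMatrix_det_ne g hy) a 0) b hb).differentiableWithinAt (by simp)
  refine differentiableWithinAt_euclidean.2 fun a => ?_
  have h2 : DifferentiableWithinAt ℝ (fun y => √((metricMatrix g c y)⁻¹ 0 0))
      (extChartAt (𝓡∂ (n + 1)) c).target b := (h1 0).sqrt (inv_metricMatrix_pos g hb).ne'
  have h3 : DifferentiableWithinAt ℝ (fun y => -((metricMatrix g c y)⁻¹ a 0))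
      (extChartAt (𝓡∂ (n + 1)) c).target b := (h1 a).neg
  simp only [outwardNormal, div_eq_mul_inv]
  exact h3.fun_mul (h2.inv (Real.sqrt_pos.2 (inv_metricMatrix_pos g hb)).ne')

/-- The second fundamental form of the boundary in terms of the Christoffel symbols. -/
theorem boundaryForm_eq (v : TangentSpace (𝓡∂ (n + 1)) c) (hv : reading (n := n + 1) c c v 0 = 0) :
    boundaryForm g c v v =
      chartGamma g c (extChartAt (𝓡∂ (n + 1)) c c) (reading c c v) (reading c c v) 0 /
      √((metricMatrix g c (extChartAt (𝓡∂ (n + 1)) c c))⁻¹ 0 0) := by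
  set v' : Coord (n + 1) := reading c c v with hv'
  set T := (extChartAt (𝓡∂ (n + 1)) c).target with hT
  set a := extChartAt (𝓡∂ (n + 1)) c c with ha
  have haT : a ∈ T := mem_extChartAt_target c
  have hL := localMetric g c
  have h1 := (hL.differentiableG haT).hasFDerivWithinAt.bil_apply
    (hasFDerivWithinAt_const v' a T) (differentiableWithinAt_outwardNormal g haT).hasFDerivWithinAt
  -- For constant `v'` with zero zeroth component, `⟨v', η⟩` vanishes on the whole chart and not
  -- just on the boundary. Its derivative in the direction `v'` gives `A(v, v) = -⟨Γ(v, v), η⟩`.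
  have h2 : HasFDerivWithinAt (fun b => chartMetric g c b v' (outwardNormal g c b))
      (0 : Coord (n + 1) →L[ℝ] ℝ) T a := by
    refine (hasFDerivWithinAt_const (0 : ℝ) a T).congr (fun b hb => ?_) ?_
    · rw [chartMetric_outwardNormal g hb, hv, neg_zero, zero_div]
    · rw [chartMetric_outwardNormal g haT, hv, neg_zero, zero_div]
  have h3 := congrArg (fun L : Coord (n + 1) →L[ℝ] ℝ => L v') ((hL.uniq a haT).eq h1 h2)
  simp only [Bil.derivApply_apply, _root_.zero_apply, Bil.zero_left] at h3
  rw [hL.compat a haT, chartMetric_outwardNormal g haT] at h3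
  have h5 : ∀ u w : Coord (n + 1), g.inner c u w = chartMetric g c a u w := fun u w =>
    (inner_eq_chartMetric g (mem_chart_source _ c) (u : TangentSpace (𝓡∂ (n + 1)) c) w).trans
      (congrArg₂ (fun v v' : Coord (n + 1) => chartMetric g c a v v') (reading_self c u)
        (reading_self c w))
  have h6 : ∀ w : Coord (n + 1), boundaryForm g c w w = chartMetric g c a
      (fderivWithin ℝ (outwardNormal g c) T a w + chartGamma g c a w (outwardNormal g c a)) w := by
    intro w
    refine (h5 _ _).trans ?_
    rw [christoffelVec_eq, fderivWithin_target _ haT]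
  have h4 := h6 v'
  have hvv : (v' : TangentSpace (𝓡∂ (n + 1)) c) = v := reading_self c v
  have h7 : boundaryForm g c v v = boundaryForm g c v' v' := by rw [hvv]
  rw [h7, h4, hL.symm a haT _ v', Bil.add_right]
  linarith [neg_div (√((metricMatrix g c a)⁻¹ 0 0)) (chartGamma g c a v' v' 0)]

end BoundaryForm

/-- The cofactor formula for the inverse. For Gram matrices it says that the squared boundary
element is `h^{00}` times the squared volume element. -/
theorem det_submatrix_succ {m : ℕ} {H : Matrix (Fin (m + 1)) (Fin (m + 1)) ℝ} (hH : H.PosDef) :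
    (H.submatrix Fin.succ Fin.succ).det = H⁻¹ 0 0 * H.det := by
  have h1 : H⁻¹ 0 0 = H.det⁻¹ * H.adjugate 0 0 := by
    rw [Matrix.inv_def, Ring.inverse_eq_inv', Matrix.smul_apply, smul_eq_mul]
  rw [h1, Matrix.adjugate_fin_succ_eq_det_submatrix]
  have := hH.det_pos.ne'
  simp only [Fin.succAbove_zero, Fin.val_zero, add_zero, pow_zero, one_mul]
  field_simp

section BoundaryTerm

variable {k : ℕ} {M : Type*} [TopologicalSpace M]
  [ChartedSpace (EuclideanHalfSpace (k + 2)) M] [IsManifold (𝓡∂ (k + 2)) ∞ M]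
  {S : Type*} [TopologicalSpace S]
  [ChartedSpace (EuclideanHalfSpace (k + 1)) S] [IsManifold (𝓡∂ (k + 1)) ∞ S]
  {g : RMetric (k + 2) M} {f : S → M} {x : S} {c : M} {y : Coord (k + 1)}
  {ν : ∀ p, TangentSpace (𝓡∂ (k + 2)) (f p)}

/-- The inward coordinate direction is mapped to the inward side. -/
theorem reading_frameVec_zero_nonneg (hf : ContMDiff (𝓡∂ (k + 1)) (𝓡∂ (k + 2)) ∞ f)
    (hy : y ∈ (extChartAt (𝓡∂ (k + 1)) x).target)
    (hc : f ((extChartAt (𝓡∂ (k + 1)) x).symm y) ∈ (chartAt (EuclideanHalfSpace (k + 2)) c).source)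
    (h0 : mapCoord (m := k + 1) (n := k + 2) x c f y 0 = 0) :
    0 ≤ reading (n := k + 2) c (f ((extChartAt (𝓡∂ (k + 1)) x).symm y))
      (frameVec (k + 1) f x ((extChartAt (𝓡∂ (k + 1)) x).symm y) 0) 0 := by
  rw [reading_frameVec hf hy hc]
  set T := (extChartAt (𝓡∂ (k + 1)) x).target with hT
  have hopen : (fun y => f ((extChartAt (𝓡∂ (k + 1)) x).symm y)) ⁻¹'
      (chartAt (EuclideanHalfSpace (k + 2)) c).source ∈ 𝓝[T] y :=
    (hf.continuous.comp_continuousOn (continuousOn_extChartAt_symm x) y hy)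
      ((chartAt (EuclideanHalfSpace (k + 2)) c).open_source.mem_nhds hc)
  have h2 : DifferentiableWithinAt ℝ (mapCoord (m := k + 1) (n := k + 2) x c f) T y :=
    ((contDiffOn_mapCoord (x := x) (c := c) hf y ⟨hy, hc⟩).differentiableWithinAt
      (by simp)).mono_of_mem_nhdsWithin (inter_mem self_mem_nhdsWithin hopen)
  -- The zeroth coordinate of `f` has a minimum at `y`, and `y + t stdVec 0` stays in the target for
  -- small `t > 0`, so the one-sided derivative is nonnegative.
  have hmin : IsLocalMinOn (fun z => mapCoord (m := k + 1) (n := k + 2) x c f z 0) T y := by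
    filter_upwards [hopen] with z hz
    rw [h0]
    exact nonneg_of_mem_target (extChartAt_mem_target hz)
  have h3 := (EuclideanSpace.proj (0 : Fin (k + 2)) : Coord (k + 2) →L[ℝ] ℝ).hasFDerivAt.comp_hasFDerivWithinAt
    y h2.hasFDerivWithinAt
  refine hmin.hasFDerivWithinAt_nonneg h3 (mem_posTangentConeAt_of_frequently_mem ?_)
  have h4 := eventually_nhdsWithin_iff.1 (extChartAt_target_mem_nhdsWithin_of_mem hy)
  have h5 : ContinuousAt (fun t : ℝ => y + t • (stdVec 0 : Coord (k + 1))) 0 := by fun_prop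
  have h6 := h5.eventually (p := fun w => w ∈ range (𝓡∂ (k + 1)) → w ∈ T)
    (by simp only [zero_smul, add_zero]; exact h4)
  refine Eventually.frequently ?_
  filter_upwards [mem_nhdsWithin_of_mem_nhds h6, self_mem_nhdsWithin] with t ht ht0
  refine ht (mem_range_iff.2 ?_)
  have := nonneg_of_mem_target hy
  simp only [PiLp.add_apply, PiLp.smul_apply, smul_eq_mul, PiLp.single_apply, if_true, mul_one]
  exact add_nonneg this (mem_Ioi.1 ht0).le

variable [T2Space S] [SigmaCompactSpace S] [MeasurableSpace S] [BorelSpace S]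

/-- The conormal component of a field at a boundary point. -/
theorem IsHypersurface.volumeElement_mul_tangentComp (h : IsHypersurface g f ν)
    (hmin : IsFreeBoundaryMinimal k g f)
    (hbd : ∀ p ∈ (𝓡∂ (k + 1)).boundary S, f p ∈ (𝓡∂ (k + 2)).boundary M) {z : Coord k} {p : S}
    (hz : boundaryIncl k z ∈ (extChartAt (𝓡∂ (k + 1)) x).target)
    (hp : p = (extChartAt (𝓡∂ (k + 1)) x).symm (boundaryIncl k z))
    (V : ∀ p, TangentSpace (𝓡∂ (k + 2)) (f p)) :
    volumeElement g f x (boundaryIncl k z) * tangentComp (k + 1) g f x V 0 p =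
      √((inducedMatrix (k + 1) g f x p).submatrix Fin.succ Fin.succ).det *
        (reading (n := k + 2) (f p) (f p) (V p) 0 /
          √((metricMatrix g (f p) (extChartAt (𝓡∂ (k + 2)) (f p) (f p)))⁻¹ 0 0)) := by
  obtain ⟨c, hc⟩ : ∃ c, c = f p := ⟨_, rfl⟩
  have hcs : f p ∈ (chartAt (EuclideanHalfSpace (k + 2)) c).source := by rw [hc]; exact mem_chart_source _ _
  have hpx : p ∈ (chartAt (EuclideanHalfSpace (k + 1)) x).source := by rw [hp]; exact symm_mem_source hz
  rw [← hc]
  set a := extChartAt (𝓡∂ (k + 2)) c c with ha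
  have haT : a ∈ (extChartAt (𝓡∂ (k + 2)) c).target := mem_extChartAt_target c
  have hfa : extChartAt (𝓡∂ (k + 2)) c (f p) = a := by rw [← hc]
  have hL := localMetric g c
  set G := chartMetric g c a with hG
  set H := inducedMatrix (k + 1) g f x p with hH
  have hHpos : H.PosDef := inducedMatrix_posDef g (h.immersion _) hpx
  have hHinv : H⁻¹ * H = 1 := Matrix.nonsing_inv_mul _ (isUnit_iff_ne_zero.2 hHpos.det_pos.ne')
  set E : Fin (k + 1) → Coord (k + 2) := fun j => reading (n := k + 2) c (f p) (frameVec (k + 1) f x p j) with hE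
  have hHE : ∀ i j, H i j = G (E i) (E j) := fun i j => by
    rw [hG, ← hfa]
    exact inner_eq_chartMetric g hcs _ _
  -- `N` is the tangent vector dual to `∂_0`: it is orthogonal to the boundary directions, `⟨N, ∂_0
  -- f⟩ = 1` and `|N|² = h^{00}`. By `conormal_orthogonal` it is orthogonal to `∂M` as well, so `⟨w,
  -- N⟩` sees only the zeroth component of `w`.
  set N : Coord (k + 2) := ∑ j, H⁻¹ 0 j • E j with hN
  have hcomp : ∀ W : ∀ p, TangentSpace (𝓡∂ (k + 2)) (f p),
      tangentComp (k + 1) g f x W 0 p = G (reading c (f p) (W p)) N := fun W => by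
    rw [tangentComp, hN, Bil.sum_right]
    refine Finset.sum_congr rfl fun j _ => ?_
    rw [inner_eq_chartMetric g hcs, hfa, Bil.smul_right]
    rfl
  set l := G (stdVec 0) N with hl
  have hGN : ∀ w : Coord (k + 2), G w N = w 0 * l := by
    intro w
    have he : (w - w 0 • (stdVec 0 : Coord (k + 2))) 0 = 0 := by simp
    have h1 := h.conormal_orthogonal hmin hbd (c := c) hz (by rwa [← hp]) he
    rw [← hp, hcomp, reading_coordVec hcs, sub_eq_add_neg, Bil.add_left, Bil.neg_left, Bil.smul_left] at h1
    rw [hl, ← smul_eq_mul]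
    linarith
  have hNE : ∀ i, G N (E i) = (1 : Matrix (Fin (k + 1)) (Fin (k + 1)) ℝ) 0 i := fun i => by
    rw [← hHinv, Matrix.mul_apply, hN, Bil.sum_left]
    exact Finset.sum_congr rfl fun j _ => by rw [Bil.smul_left, hHE, smul_eq_mul]
  have hNN : G N N = H⁻¹ 0 0 := by
    conv_lhs => rw [hN]
    rw [Bil.sum_left, Finset.sum_eq_single 0]
    · rw [Bil.smul_left, hL.symm a haT, hNE, Matrix.one_apply_eq, smul_eq_mul, mul_one]
    · intro j _ hj
      rw [Bil.smul_left, hL.symm a haT, hNE, Matrix.one_apply_ne hj.symm, smul_zero]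
    · simp
  -- From `⟨N, ∂_0 f⟩ = 1` and the fact that `∂_0 f` does not point out of `M`.
  have hlpos : 0 < l := by
    have h1 := hNE 0
    rw [hL.symm a haT, hGN, Matrix.one_apply_eq] at h1
    have h2 : mapCoord (m := k + 1) (n := k + 2) x c f (boundaryIncl k z) 0 = 0 := by
      have h3 := hbd p (by rw [hp, mem_boundary_iff hz, boundaryIncl_zero])
      rw [← extChartAt_symm_extChartAt hcs, mem_boundary_iff (extChartAt_mem_target hcs)] at h3
      rw [mapCoord, ← hp]
      exact h3
    have h4 := reading_frameVec_zero_nonneg h.smooth hz (by rwa [← hp]) h2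
    rw [← hp] at h4
    by_contra hl0
    have h5 : E 0 0 * l ≤ 0 := mul_nonpos_of_nonneg_of_nonpos h4 (not_lt.1 hl0)
    linarith
  set γ := (metricMatrix g c a)⁻¹ 0 0 with hγ
  have hγ0 : 0 < γ := inv_metricMatrix_pos g haT
  have hsγ := Real.sqrt_pos.2 hγ0
  have hγγ := Real.mul_self_sqrt hγ0.le
  have hN0 : N 0 = l * γ := by
    have h1 := chartMetric_outwardNormal g haT N
    rw [hL.symm a haT, hGN] at h1
    have h2 : outwardNormal g c a 0 = -γ / √γ := rfl
    rw [h2, div_mul_eq_mul_div, ← hγ, div_left_inj' hsγ.ne'] at h1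
    linarith
  -- In other words `N = l grad x_0`. Taking lengths gives `h^{00} = l² g^{00}`, which relates the
  -- volume element to the boundary element.
  have hinv : H⁻¹ 0 0 = l ^ 2 * γ := by
    rw [← hNN, hGN, hN0]; ring
  have hsq : √(H⁻¹ 0 0) = l * √γ := by
    rw [hinv, Real.sqrt_mul (sq_nonneg l), Real.sqrt_sq hlpos.le]
  rw [hcomp, hGN, volumeElement, ← hp, det_submatrix_succ hHpos, Real.sqrt_mul hHpos.inv.diag_pos.le, hsq]
  field_simp
  subst hc
  rfl

end BoundaryTerm

/-! ### Global divergence theorem and boundary measure. -/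

section Sums

variable {k : ℕ} {M : Type*} [TopologicalSpace M]
  [ChartedSpace (EuclideanHalfSpace (k + 2)) M] [IsManifold (𝓡∂ (k + 2)) ∞ M]
  {S : Type*} [TopologicalSpace S] [T2Space S] [SigmaCompactSpace S]
  [ChartedSpace (EuclideanHalfSpace (k + 1)) S] [IsManifold (𝓡∂ (k + 1)) ∞ S]
  [MeasurableSpace S] [BorelSpace S] {g : RMetric (k + 2) M} {f : S → M}
  {ν V W : ∀ p, TangentSpace (𝓡∂ (k + 2)) (f p)} {x : S} {K : Set S}

omit [T2Space S] [SigmaCompactSpace S] [MeasurableSpace S] [BorelSpace S]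

theorem SmoothField.add (hV : SmoothField (k + 1) (k + 2) f V) (hW : SmoothField (k + 1) (k + 2) f W) :
    SmoothField (k + 1) (k + 2) f (fun q => V q + W q) := fun x c =>
  ((hV x c).add (hW x c)).congr fun _ hy => reading_add hy.2 _ _

theorem SmoothField.zero : SmoothField (k + 1) (k + 2) f (fun _ => 0) := fun _ _ =>
  (contDiffOn_const (c := (0 : Coord (k + 2)))).congr fun _ hy => by rw [reading_eq_clm hy.2, map_zero]

theorem tangentialField_add (q : S) : tangentialField g f (fun q => V q + W q) q =
    tangentialField g f V q + tangentialField g f W q := by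
  simp only [tangentialField, ← map_add]
  congr 1
  simp only [tangentPart, map_add, _root_.add_apply, mul_add, Finset.sum_add_distrib, add_smul]

theorem IsHypersurface.divAlong_tangentialField_add (h : IsHypersurface g f ν)
    (hV : SmoothField (k + 1) (k + 2) f V) (hW : SmoothField (k + 1) (k + 2) f W) {p : S}
    (hp : p ∉ (𝓡∂ (k + 1)).boundary S) :
    divAlong (k + 1) g f (tangentialField g f fun q => V q + W q) p =
      divAlong (k + 1) g f (tangentialField g f V) p + divAlong (k + 1) g f (tangentialField g f W) p := by
  have hs := mem_chart_source (EuclideanHalfSpace (k + 1)) p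
  obtain ⟨y, hy⟩ : ∃ y, y = extChartAt (𝓡∂ (k + 1)) p p := ⟨_, rfl⟩
  have hσ : (extChartAt (𝓡∂ (k + 1)) p).symm y = p := by rw [hy]; exact extChartAt_symm_extChartAt hs
  have hyU : y ∈ coordDomain (m := k + 1) (k + 2) p (f p) f := ⟨by
    rw [hy]; exact extChartAt_mem_interior hp hs, by rw [mem_preimage, hσ]; exact mem_chart_source _ _⟩
  have he : IsUnit (frameMatrix (stdVec : Fin (k + 1) → Coord (k + 1))).det := by
    rw [frameMatrix_stdVec, Matrix.det_one]; exact isUnit_one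
  have hL := h.localHypersurface p (f p) he
  have hA : ∀ {A : ∀ p, TangentSpace (𝓡∂ (k + 2)) (f p)}, SmoothField (k + 1) (k + 2) f A →
      ContDiffOn ℝ ∞ (fieldCoord (m := k + 1) (n := k + 2) p (f p) f (tangentialField g f A))
        (coordDomain (k + 2) p (f p) f) := fun hA =>
    (hL.contDiffOn_tfield ((hA p (f p)).mono coordDomain_subset)).congr fun z hz =>
      reading_tangentField g h.smooth hz _
  have h1 := divAlong_eq_sdiv_of_eventuallyEq g h.smooth hyU he
    (V := tangentialField g f fun q => V q + W q)
    (W := fun z => fieldCoord p (f p) f (tangentialField g f V) z +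
      fieldCoord p (f p) f (tangentialField g f W) z) (by
      filter_upwards [hL.isOpen.mem_nhds hyU] with z hz
      simp only [fieldCoord, tangentialField_add]
      rw [reading_add hz.2])
    (LocalHypersurface.differentiableAt_of_contDiffOn hL.isOpen hyU ((hA hV).add (hA hW)))
  have h2 := fun {A : ∀ p, TangentSpace (𝓡∂ (k + 2)) (f p)} (hs : SmoothField (k + 1) (k + 2) f A) =>
    divAlong_eq_sdiv_of_eventuallyEq g h.smooth hyU he (V := tangentialField g f A) EventuallyEq.rfl
      (LocalHypersurface.differentiableAt_of_contDiffOn hL.isOpen hyU (hA hs))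
  have h3 := h2 hV
  have h4 := h2 hW
  rw [hσ] at h1 h3 h4
  rw [h1, h3, h4, hL.sdiv_add hyU (hA hV) (hA hW)]

variable [T2Space S] [SigmaCompactSpace S] [MeasurableSpace S] [BorelSpace S]

/-- The divergence theorem for finite sums of fields with supports in chart domains. -/
theorem IsHypersurface.integral_divAlong_sum (h : IsHypersurface g f ν)
    {V : S → ∀ p, TangentSpace (𝓡∂ (k + 2)) (f p)} {C : S → Set S}
    (hV : ∀ x, SmoothField (k + 1) (k + 2) f (V x)) (hC : ∀ x, IsCompact (C x))
    (hCx : ∀ x, C x ⊆ (chartAt (EuclideanHalfSpace (k + 1)) x).source) (h0 : ∀ x, ∀ p ∉ C x, V x p = 0)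
    (s : Finset S) :
    SmoothField (k + 1) (k + 2) f (fun p => ∑ x ∈ s, V x p) ∧
    Integrable (divAlong (k + 1) g f (tangentialField g f fun p => ∑ x ∈ s, V x p)) (inducedVolume k g f) ∧
    ∫ p, divAlong (k + 1) g f (tangentialField g f fun p => ∑ x ∈ s, V x p) p ∂(inducedVolume k g f) =
      - ∑ x ∈ s, ∫ z in boundaryIncl k ⁻¹' (extChartAt (𝓡∂ (k + 1)) x).target,
        volumeElement g f x (boundaryIncl k z) * tangentComp (k + 1) g f x (V x) 0
          ((extChartAt (𝓡∂ (k + 1)) x).symm (boundaryIncl k z)) := by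
  classical
  induction s using Finset.induction_on with
  | empty =>
    have hae : divAlong (k + 1) g f (tangentialField g f fun p => ∑ x ∈ (∅ : Finset S), V x p)
        =ᵐ[inducedVolume k g f] fun _ => 0 := ae_of_interior fun p hp =>
      divAlong_of_eventuallyEq_zero h hp (Eventually.of_forall fun q => tangentialField_eq_zero (by simp))
    simp only [Finset.sum_empty] at hae ⊢
    refine ⟨SmoothField.zero, (integrable_zero _ _ _).congr hae.symm, ?_⟩
    rw [integral_congr_ae hae]; simp
  | insert a s ha ih =>
    obtain ⟨h1, h2, h3⟩ := ih
    obtain ⟨h4, h5⟩ := h.integral_divAlong_tangentialField (hV a) (hC a) (hCx a) (h0 a)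
    simp only [Finset.sum_insert ha]
    have hae : divAlong (k + 1) g f (tangentialField g f fun p => V a p + ∑ x ∈ s, V x p)
        =ᵐ[inducedVolume k g f] fun p => divAlong (k + 1) g f (tangentialField g f (V a)) p +
          divAlong (k + 1) g f (tangentialField g f fun p => ∑ x ∈ s, V x p) p :=
      ae_of_interior fun p hp => h.divAlong_tangentialField_add (hV a) h1 hp
    refine ⟨(hV a).add h1, (h4.add h2).congr hae.symm, ?_⟩
    rw [integral_congr_ae hae, integral_add h4 h2, h3, h5, neg_add]

end Sums

section BoundaryMeasure

variable {k : ℕ} {M : Type*} [TopologicalSpace M]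
  [ChartedSpace (EuclideanHalfSpace (k + 2)) M] [IsManifold (𝓡∂ (k + 2)) ∞ M]
  {S : Type*} [TopologicalSpace S] [T2Space S] [SigmaCompactSpace S]
  [ChartedSpace (EuclideanHalfSpace (k + 1)) S] [IsManifold (𝓡∂ (k + 1)) ∞ S]
  [MeasurableSpace S] [BorelSpace S] {g : RMetric (k + 2) M} {f : S → M}
  {x : S} {K : Set S}

/-- The volume element of the boundary in the preferred chart at `x`. -/
noncomputable def boundaryElement (g : RMetric (k + 2) M) (f : S → M) (x : S) (y : Coord (k + 1)) : ℝ :=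
  √((inducedMatrix (k + 1) g f x ((extChartAt (𝓡∂ (k + 1)) x).symm y)).submatrix Fin.succ Fin.succ).det

omit [T2Space S] [SigmaCompactSpace S] [MeasurableSpace S] [BorelSpace S] in
theorem continuousOn_boundaryElement (hf : ContMDiff (𝓡∂ (k + 1)) (𝓡∂ (k + 2)) ∞ f) (x : S) :
    ContinuousOn (boundaryElement g f x) (extChartAt (𝓡∂ (k + 1)) x).target :=
  Real.continuous_sqrt.comp_continuousOn (contDiffOn_det (M := fun y =>
    (inducedMatrix (k + 1) g f x ((extChartAt (𝓡∂ (k + 1)) x).symm y)).submatrix Fin.succ Fin.succ)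
    fun i j => contDiffOn_inducedMatrix g hf x i.succ j.succ).continuousOn

omit [T2Space S] [SigmaCompactSpace S] [MeasurableSpace S] [BorelSpace S] in
theorem boundaryElement_pos (himm : ∀ p, Function.Injective (mfderiv (𝓡∂ (k + 1)) (𝓡∂ (k + 2)) f p))
    {y : Coord (k + 1)} (hy : y ∈ (extChartAt (𝓡∂ (k + 1)) x).target) : 0 < boundaryElement g f x y := by
  have h1 := inducedMatrix_posDef g (himm _) (symm_mem_source (c := x) hy)
  rw [boundaryElement, det_submatrix_succ h1]
  exact Real.sqrt_pos.2 (mul_pos h1.inv.diag_pos h1.det_pos)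

theorem measurableSet_boundaryTarget (x : S) :
    MeasurableSet (boundaryIncl k ⁻¹' (extChartAt (𝓡∂ (k + 1)) x).target) :=
  continuous_boundaryIncl.measurable (measurableSet_target x)

theorem aemeasurable_boundaryParam (x : S) :
    AEMeasurable (fun z : Coord k => (extChartAt (𝓡∂ (k + 1)) x).symm (boundaryIncl k z))
      (volume.restrict (boundaryIncl k ⁻¹' (extChartAt (𝓡∂ (k + 1)) x).target)) :=
  ((continuousOn_extChartAt_symm x).comp continuous_boundaryIncl.continuousOn
    (mapsTo_preimage _ _)).aemeasurable (measurableSet_boundaryTarget x)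

theorem aemeasurable_boundaryElement (hf : ContMDiff (𝓡∂ (k + 1)) (𝓡∂ (k + 2)) ∞ f) (x : S) :
    AEMeasurable (fun z : Coord k => ENNReal.ofReal (boundaryElement g f x (boundaryIncl k z)))
      (volume.restrict (boundaryIncl k ⁻¹' (extChartAt (𝓡∂ (k + 1)) x).target)) :=
  (((continuousOn_boundaryElement hf x).comp continuous_boundaryIncl.continuousOn
    (mapsTo_preimage _ _)).aemeasurable (measurableSet_boundaryTarget x)).ennreal_ofReal

theorem chartBoundaryVolume_eq (x : S) : chartBoundaryVolume k g f x =
    ((volume.restrict (boundaryIncl k ⁻¹' (extChartAt (𝓡∂ (k + 1)) x).target)).withDensity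
      fun z => ENNReal.ofReal (boundaryElement g f x (boundaryIncl k z))).map
      (fun z => (extChartAt (𝓡∂ (k + 1)) x).symm (boundaryIncl k z)) := rfl

/-- Every chart piece of the measure is carried by the image of the hyperplane `y 0 = 0`, that is,
by boundary points. -/
theorem ae_boundaryVolume {P : S → Prop} (h : ∀ p ∈ (𝓡∂ (k + 1)).boundary S, P p) :
    ∀ᵐ p ∂(boundaryVolume k g f), P p := by
  have : IsManifold (𝓡∂ (k + 1)) 1 S := IsManifold.of_le (n := ∞) (by simp)
  have hm : MeasurableSet ((𝓡∂ (k + 1)).boundary S) :=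
    (ModelWithCorners.isClosed_boundary (n := 1) one_ne_zero).measurableSet
  suffices h1 : ∀ᵐ p ∂(boundaryVolume k g f), p ∈ (𝓡∂ (k + 1)).boundary S from h1.mono h
  refine (Measure.ae_sum_iff' (p := (· ∈ (𝓡∂ (k + 1)).boundary S)) hm).2 fun x => ?_
  refine (withDensity_absolutelyContinuous _ _).ae_le ?_
  rw [chartBoundaryVolume_eq]
  refine (ae_map_iff (p := (· ∈ (𝓡∂ (k + 1)).boundary S)) ((aemeasurable_boundaryParam x).mono_ac
    (withDensity_absolutelyContinuous _ _)) hm).2 ?_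
  refine (withDensity_absolutelyContinuous _ _).ae_le ?_
  refine (ae_restrict_iff' (measurableSet_boundaryTarget x)).2 (Eventually.of_forall fun z hz => ?_)
  rw [mem_boundary_iff hz, boundaryIncl_zero]

theorem integrableOn_boundaryIncl {v : Coord (k + 1) → ℝ}
    (hv : ContinuousOn v (extChartAt (𝓡∂ (k + 1)) x).target) (hK : IsCompact K)
    (hKx : K ⊆ (chartAt (EuclideanHalfSpace (k + 1)) x).source)
    (h0 : ∀ y ∈ (extChartAt (𝓡∂ (k + 1)) x).target, (extChartAt (𝓡∂ (k + 1)) x).symm y ∉ K → v y = 0) :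
    IntegrableOn (fun z : Coord k => v (boundaryIncl k z))
      (boundaryIncl k ⁻¹' (extChartAt (𝓡∂ (k + 1)) x).target) := by
  have h1 := continuous_indicator_boundaryIncl hv hK hKx h0
  have h2 := hasCompactSupport_indicator_boundaryIncl hK hKx h0
  have h3 : Integrable _ (volume : Measure (Coord k)) := h1.integrable_of_hasCompactSupport h2
  exact (integrable_indicator_iff (measurableSet_boundaryTarget x)).1 h3

theorem integrableOn_boundaryElement_mul (hf : ContMDiff (𝓡∂ (k + 1)) (𝓡∂ (k + 2)) ∞ f) {v : S → ℝ}
    (hv : Continuous v) (hK : IsCompact K)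
    (hKx : K ⊆ (chartAt (EuclideanHalfSpace (k + 1)) x).source) (h0 : ∀ p ∉ K, v p = 0) :
    IntegrableOn (fun z : Coord k => boundaryElement g f x (boundaryIncl k z) *
      v ((extChartAt (𝓡∂ (k + 1)) x).symm (boundaryIncl k z)))
      (boundaryIncl k ⁻¹' (extChartAt (𝓡∂ (k + 1)) x).target) :=
  integrableOn_boundaryIncl
    (v := fun y => boundaryElement g f x y * v ((extChartAt (𝓡∂ (k + 1)) x).symm y))
    ((continuousOn_boundaryElement hf x).mul (hv.comp_continuousOn (continuousOn_extChartAt_symm x)))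
    hK hKx fun y _ hy => by rw [h0 _ hy, mul_zero]

theorem integral_map_withDensity_ofReal {α β : Type*} [MeasurableSpace α] [MeasurableSpace β]
    [TopologicalSpace β] [BorelSpace β] {μ : Measure α} {d : α → ℝ}
    {φ : α → β} (hd : AEMeasurable (fun z => ENNReal.ofReal (d z)) μ) (hd0 : ∀ z, 0 ≤ d z)
    (hφ : AEMeasurable φ μ) {v : β → ℝ} (hv : Continuous v)
    (hi : Integrable (fun z => d z * v (φ z)) μ) :
    Integrable v ((μ.withDensity fun z => ENNReal.ofReal (d z)).map φ) ∧
      ∫ p, v p ∂((μ.withDensity fun z => ENNReal.ofReal (d z)).map φ) = ∫ z, d z * v (φ z) ∂μ := by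
  have hm := hφ.mono_ac (withDensity_absolutelyContinuous μ fun z => ENNReal.ofReal (d z))
  have hlt : ∀ᵐ z ∂μ, ENNReal.ofReal (d z) < ⊤ := Eventually.of_forall fun _ => ENNReal.ofReal_lt_top
  constructor
  · rw [integrable_map_measure hv.aestronglyMeasurable hm,
      integrable_withDensity_iff_integrable_smul₀' hd hlt]
    simpa only [ENNReal.toReal_ofReal (hd0 _), smul_eq_mul, Function.comp_apply] using hi
  · rw [integral_map hm hv.aestronglyMeasurable,
      integral_withDensity_eq_integral_toReal_smul₀ hd hlt]
    simp only [ENNReal.toReal_ofReal (hd0 _), smul_eq_mul]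

theorem integral_chartBoundaryVolume (hf : ContMDiff (𝓡∂ (k + 1)) (𝓡∂ (k + 2)) ∞ f) {v : S → ℝ}
    (hv : Continuous v) (hK : IsCompact K)
    (hKx : K ⊆ (chartAt (EuclideanHalfSpace (k + 1)) x).source) (h0 : ∀ p ∉ K, v p = 0) :
    Integrable v (chartBoundaryVolume k g f x) ∧ ∫ p, v p ∂(chartBoundaryVolume k g f x) =
      ∫ z in boundaryIncl k ⁻¹' (extChartAt (𝓡∂ (k + 1)) x).target,
        boundaryElement g f x (boundaryIncl k z) *
          v ((extChartAt (𝓡∂ (k + 1)) x).symm (boundaryIncl k z)) := by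
  rw [chartBoundaryVolume_eq]
  exact integral_map_withDensity_ofReal (aemeasurable_boundaryElement hf x)
    (fun _ => Real.sqrt_nonneg _) (aemeasurable_boundaryParam x) hv
    (integrableOn_boundaryElement_mul hf hv hK hKx h0)

theorem integral_withDensity_chartPartition (hf : ContMDiff (𝓡∂ (k + 1)) (𝓡∂ (k + 2)) ∞ f) {u : S → ℝ}
    (hu : Continuous u) (hK : IsCompact K) (h0 : ∀ p ∉ K, u p = 0) (x : S) :
    Integrable u ((chartBoundaryVolume k g f x).withDensity
      fun p => ENNReal.ofReal (chartPartition k S x p)) ∧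
    ∫ p, u p ∂((chartBoundaryVolume k g f x).withDensity
        fun p => ENNReal.ofReal (chartPartition k S x p)) =
      ∫ z in boundaryIncl k ⁻¹' (extChartAt (𝓡∂ (k + 1)) x).target,
        boundaryElement g f x (boundaryIncl k z) *
          (chartPartition k S x ((extChartAt (𝓡∂ (k + 1)) x).symm (boundaryIncl k z)) *
            u ((extChartAt (𝓡∂ (k + 1)) x).symm (boundaryIncl k z))) := by
  have hlt : ∀ᵐ p ∂(chartBoundaryVolume k g f x), ENNReal.ofReal (chartPartition k S x p) < ⊤ :=
    Eventually.of_forall fun _ => ENNReal.ofReal_lt_top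
  rw [integrable_withDensity_iff_integrable_smul₀' (measurable_chartPartition x).aemeasurable hlt,
    integral_withDensity_eq_integral_toReal_smul₀ (measurable_chartPartition x).aemeasurable hlt]
  simp only [ENNReal.toReal_ofReal ((chartPartition k S).nonneg x _), smul_eq_mul]
  refine integral_chartBoundaryVolume hf (v := fun p => chartPartition k S x p * u p)
    ((chartPartition k S x).contMDiff.continuous.mul hu) (hK.inter_right (isClosed_tsupport _))
    (inter_subset_right.trans (chartPartition_subordinate x)) fun p hp => ?_
  by_cases hpK : p ∈ K
  · rw [image_eq_zero_of_notMem_tsupport fun h => hp ⟨hpK, h⟩, zero_mul]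
  · rw [h0 _ hpK, mul_zero]

/-- The boundary integral of a continuous function with compact support. -/
theorem integral_boundaryVolume (hf : ContMDiff (𝓡∂ (k + 1)) (𝓡∂ (k + 2)) ∞ f) {u : S → ℝ}
    (hu : Continuous u) (hK : IsCompact K) (h0 : ∀ p ∉ K, u p = 0) {s : Finset S}
    (hs : ∀ x ∉ s, ∀ p ∈ K, chartPartition k S x p = 0) :
    Integrable u (boundaryVolume k g f) ∧ ∫ p, u p ∂(boundaryVolume k g f) =
      ∑ x ∈ s, ∫ z in boundaryIncl k ⁻¹' (extChartAt (𝓡∂ (k + 1)) x).target,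
        boundaryElement g f x (boundaryIncl k z) *
          (chartPartition k S x ((extChartAt (𝓡∂ (k + 1)) x).symm (boundaryIncl k z)) *
            u ((extChartAt (𝓡∂ (k + 1)) x).symm (boundaryIncl k z))) := by
  have hbr : (boundaryVolume k g f).restrict K = ∑ x ∈ s, ((chartBoundaryVolume k g f x).withDensity
      fun p => ENNReal.ofReal (chartPartition k S x p)).restrict K :=
    measure_sum_restrict_eq _ hK.measurableSet s fun x hx =>
      withDensity_chartPartition_null _ hK.measurableSet (hs x hx)
  have hx := integral_withDensity_chartPartition (g := g) hf hu hK h0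
  have hint : Integrable u ((boundaryVolume k g f).restrict K) := by
    rw [hbr, integrable_finsetSum_measure]
    exact fun x _ => (hx x).1.restrict
  refine ⟨(integrableOn_iff_integrable_of_support_subset fun p hp => by_contra fun h => hp (h0 p h)).1 hint, ?_⟩
  rw [← setIntegral_eq_integral_of_forall_compl_eq_zero h0, hbr,
    integral_finsetSum_measure fun x _ => (hx x).1.restrict]
  refine Finset.sum_congr rfl fun x _ => ?_
  rw [setIntegral_eq_integral_of_forall_compl_eq_zero h0, (hx x).2]

end BoundaryMeasure

/-! ### Normal variations and the boundary term. -/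

section NormalVariation

variable {k : ℕ} {M : Type*} [TopologicalSpace M]
  [ChartedSpace (EuclideanHalfSpace (k + 2)) M] [IsManifold (𝓡∂ (k + 2)) ∞ M]
  {S : Type*} [TopologicalSpace S] [ChartedSpace (EuclideanHalfSpace (k + 1)) S]
  [IsManifold (𝓡∂ (k + 1)) ∞ S] {g : RMetric (k + 2) M} {f : S → M} {ε : ℝ}
  {F : ℝ → S → M} {ν : ∀ p, TangentSpace (𝓡∂ (k + 2)) (f p)} {φ : S → ℝ}

theorem variation_eq_zero (hF : IsSmoothFamily (k + 1) (k + 2) F (Ioo (-ε) ε)) (hε : 0 < ε)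
    (hF0 : ∀ p, F 0 p = f p) {p : S} (hp : ∀ t ∈ Ioo (-ε) ε, F t p = f p) :
    variationField (k + 2) f F p = 0 ∧ variationAcceleration g f F p = 0 := by
  obtain ⟨y, hy⟩ : ∃ y, y = extChartAt (𝓡∂ (k + 1)) p p := ⟨_, rfl⟩
  have hσ : (extChartAt (𝓡∂ (k + 1)) p).symm y = p := by
    rw [hy]; exact extChartAt_symm_extChartAt (mem_chart_source _ p)
  have hyD : y ∈ (extChartAt (𝓡∂ (k + 1)) p).target ∩ (fun y => f ((extChartAt (𝓡∂ (k + 1)) p).symm y)) ⁻¹'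
      (chartAt (EuclideanHalfSpace (k + 2)) (f p)).source :=
    ⟨hy ▸ mem_extChartAt_target p, by rw [mem_preimage, hσ]; exact mem_chart_source _ _⟩
  have hm := mem_timeDomain hε hF0 hyD
  have hv : ∀ t, (t, y) ∈ timeDomain (k + 2) (Ioo (-ε) ε) p (f p) F →
      timeVelocity (Ioo (-ε) ε) p (f p) F (t, y) = 0 := fun t ht => by
    refine (hasDerivAt_timeMap hF ht).unique ((hasDerivAt_const t
      (timeMap (m := k + 1) (n := k + 2) p (f p) F (0, y))).congr_of_eventuallyEq ?_)
    filter_upwards [isOpen_Ioo.mem_nhds ht.1.1] with s hs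
    simp only [timeMap, mapCoord, hσ, hp s hs, hF0]
  have ha := (hasDerivAt_timeVelocity hF hm).unique ((hasDerivAt_const 0
    (0 : Coord (k + 2))).congr_of_eventuallyEq ((eventually_mem_timeDomain hF hm).mono hv))
  have h1 := reading_variationField hF hε hF0 hyD
  have h2 := reading_variationAcceleration (g := g) hF hε hF0 hyD
  rw [hv 0 hm, hσ, reading_self] at h1
  rw [ha, hv 0 hm, Bil.zero_left, add_zero, hσ, reading_self] at h2
  exact ⟨h1, h2⟩

theorem covDerivAlong_zero_right (g : RMetric (k + 2) M) (f : S → M)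
    (V : ∀ p, TangentSpace (𝓡∂ (k + 2)) (f p)) (p : S) :
    covDerivAlong g (𝓡∂ (k + 1)) f V p 0 = 0 := by
  simp only [covDerivAlong, map_zero]
  have h1 : christoffelVec g (f p) 0 (V p) = (0 : Coord (k + 2)) :=
    (christoffelVec_eq g (f p) 0 (V p)).trans (Bil.zero_left _ _)
  exact (congrArg (fun v : Coord (k + 2) => 0 + v) h1).trans (add_zero (0 : Coord (k + 2)))

theorem IsHypersurface.tangentPart_smul_normal (h : IsHypersurface g f ν) (r : ℝ) (p : S) :
    tangentPart (k + 1) g f p (r • ν p) = 0 := by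
  simp only [tangentPart, map_smul, _root_.smul_apply, frameVec, h.normal, smul_zero, mul_zero,
    Finset.sum_const_zero, zero_smul]

/-- The density of the second variation for a normal variation field. -/
theorem IsHypersurface.secondVariationDensity_normal (h : IsHypersurface g f ν)
    {X Z : ∀ p, TangentSpace (𝓡∂ (k + 2)) (f p)} (hX : ∀ p, X p = φ p • ν p) {p : S}
    (hp : p ∉ (𝓡∂ (k + 1)).boundary S) :
    secondVariationDensity (k + 1) g f ν X Z p = gradNormSq (k + 1) g f φ p
      - (ricci g (f p) (ν p) (ν p) + secondFormNormSq (k + 1) g f ν p) * φ p ^ 2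
      + divAlong (k + 1) g f (tangentialField g f Z) p := by
  obtain rfl : X = fun p => φ p • ν p := funext hX
  have h1 : ∀ q, g.inner (f q) (φ q • ν q) (ν q) = φ q := fun q => by
    rw [map_smul, _root_.smul_apply, h.unit, smul_eq_mul, mul_one]
  have h2 : divAlong (k + 1) g f (fun q => (0 : TangentSpace (𝓡∂ (k + 2)) (f q))) p = 0 :=
    divAlong_of_eventuallyEq_zero h hp (Eventually.of_forall fun _ => rfl)
  simp only [secondVariationDensity, h1, h.tangentPart_smul_normal, map_zero, covDerivAlong_zero_right,
    smul_zero, sub_zero, h2]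
  change _ + divAlong (k + 1) g f (tangentialField g f Z) p - _ = _
  ring

/-- The left side is `-⟨Z, η⟩`, and the zeroth component of `Z` is that of `Γ(φν, φν)`. Where `φ` is
nonzero, `ν` is tangent to `∂M` and `boundaryForm_eq` applies; where `φ` vanishes both sides are
zero. -/
theorem variationAcceleration_boundary (hF : IsSmoothFamily (k + 1) (k + 2) F (Ioo (-ε) ε))
    (hε : 0 < ε) (hF0 : ∀ p, F 0 p = f p) (hFb : KeepsBoundary (k + 2) k F (Ioo (-ε) ε))
    (hX : ∀ p, variationField (k + 2) f F p = φ p • ν p) {p : S}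
    (hp : p ∈ (𝓡∂ (k + 1)).boundary S) :
    reading (n := k + 2) (f p) (f p) (variationAcceleration g f F p) 0 /
      √((metricMatrix g (f p) (extChartAt (𝓡∂ (k + 2)) (f p) (f p)))⁻¹ 0 0) =
    φ p ^ 2 * boundaryForm g (f p) (ν p) (ν p) := by
  obtain ⟨h1, h2⟩ := variation_boundary (g := g) hF hε hF0 hFb hp
  rw [hX, reading_smul (mem_chart_source _ _)] at h1 h2
  rw [h2, Bil.smul_left, Bil.smul_right, PiLp.smul_apply, PiLp.smul_apply]
  rcases eq_or_ne (φ p) 0 with h0 | h0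
  · simp [h0]
  · rw [boundaryForm_eq g (ν p) ((mul_eq_zero.1 h1).resolve_left h0), smul_eq_mul, smul_eq_mul]
    ring

end NormalVariation

section BoundaryTerm

variable {k : ℕ} {M : Type*} [TopologicalSpace M]
  [ChartedSpace (EuclideanHalfSpace (k + 2)) M] [IsManifold (𝓡∂ (k + 2)) ∞ M]
  {S : Type*} [TopologicalSpace S] [T2Space S] [SigmaCompactSpace S]
  [ChartedSpace (EuclideanHalfSpace (k + 1)) S] [IsManifold (𝓡∂ (k + 1)) ∞ S]
  [MeasurableSpace S] [BorelSpace S] {g : RMetric (k + 2) M} {f : S → M} {ε : ℝ}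
  {F : ℝ → S → M} {K : Set S} {ν : ∀ p, TangentSpace (𝓡∂ (k + 2)) (f p)} {φ ψ : S → ℝ}

omit [T2Space S] [SigmaCompactSpace S] [MeasurableSpace S] [BorelSpace S] in
theorem exists_boundaryIncl_eq {x p : S} (hp : p ∈ (𝓡∂ (k + 1)).boundary S)
    (hx : p ∈ (chartAt (EuclideanHalfSpace (k + 1)) x).source) :
    ∃ z, boundaryIncl k z = extChartAt (𝓡∂ (k + 1)) x p := by
  have hy := extChartAt_mem_target (n := k + 1) hx
  exact ⟨_, boundaryIncl_tail ((mem_boundary_iff hy).1 (by rwa [extChartAt_symm_extChartAt hx]))⟩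

/-- The divergence theorem for the tangential part of a field with compact support whose conormal
component along the boundary is `ψ`. -/
theorem IsHypersurface.integral_divAlong_eq_neg_boundary (h : IsHypersurface g f ν)
    (hmin : IsFreeBoundaryMinimal k g f)
    (hbd : ∀ p ∈ (𝓡∂ (k + 1)).boundary S, f p ∈ (𝓡∂ (k + 2)).boundary M)
    {Z : ∀ p, TangentSpace (𝓡∂ (k + 2)) (f p)} (hZ : SmoothField (k + 1) (k + 2) f Z)
    (hK : IsCompact K) (hZ0 : ∀ p ∉ K, Z p = 0)
    (hψ : ∀ p ∈ (𝓡∂ (k + 1)).boundary S, reading (n := k + 2) (f p) (f p) (Z p) 0 /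
      √((metricMatrix g (f p) (extChartAt (𝓡∂ (k + 2)) (f p) (f p)))⁻¹ 0 0) = ψ p)
    (hψ0 : ∀ p ∉ K, ψ p = 0) :
    Integrable (divAlong (k + 1) g f (tangentialField g f Z)) (inducedVolume k g f) ∧
    Integrable ψ (boundaryVolume k g f) ∧
    ∫ p, divAlong (k + 1) g f (tangentialField g f Z) p ∂(inducedVolume k g f) =
      - ∫ p, ψ p ∂(boundaryVolume k g f) := by
  obtain ⟨s, hs, hs1⟩ := exists_finset_chartPartition k hK
  set V : S → ∀ p, TangentSpace (𝓡∂ (k + 2)) (f p) := fun x p => chartPartition k S x p • Z p with hV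
  set C : S → Set S := fun x => K ∩ tsupport (chartPartition k S x) with hC
  have hCc : ∀ x, IsCompact (C x) := fun x => hK.inter_right (isClosed_tsupport _)
  have hCx : ∀ x, C x ⊆ (chartAt (EuclideanHalfSpace (k + 1)) x).source := fun x =>
    inter_subset_right.trans (chartPartition_subordinate x)
  have hVs : ∀ x, SmoothField (k + 1) (k + 2) f (V x) := fun x =>
    hZ.smul (chartPartition k S x).contMDiff
  have hVK : ∀ x, ∀ p ∉ K, V x p = 0 := fun x p hp => by simp only [hV, hZ0 p hp, smul_zero]
  have hV0 : ∀ x, ∀ p ∉ C x, V x p = 0 := fun x p hp => by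
    by_cases hpK : p ∈ K
    · simp only [hV, image_eq_zero_of_notMem_tsupport fun h => hp ⟨hpK, h⟩, zero_smul]
    · exact hVK x p hpK
  have hcomp0 : ∀ x p, V x p = 0 → tangentComp (k + 1) g f x (V x) 0 p = 0 := fun x p hp => by
    simp only [tangentComp, hp, map_zero, _root_.zero_apply, mul_zero, Finset.sum_const_zero]
  have hsum : (fun p => ∑ x ∈ s, V x p) = Z := funext fun p => by
    by_cases hpK : p ∈ K
    · simp only [hV, ← Finset.sum_smul, hs1 p hpK, one_smul]
    · rw [hZ0 p hpK]; exact Finset.sum_eq_zero fun x _ => hVK x p hpK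
  obtain ⟨-, hint, hdiv⟩ := h.integral_divAlong_sum hVs hCc hCx hV0 s
  rw [hsum] at hint hdiv
  have hkey : ∀ (x : S) (z : Coord k) (p : S), boundaryIncl k z ∈ (extChartAt (𝓡∂ (k + 1)) x).target →
      p = (extChartAt (𝓡∂ (k + 1)) x).symm (boundaryIncl k z) →
      volumeElement g f x (boundaryIncl k z) * tangentComp (k + 1) g f x (V x) 0 p =
        boundaryElement g f x (boundaryIncl k z) * (chartPartition k S x p * ψ p) := by
    intro x z p hz hp
    have hpb : p ∈ (𝓡∂ (k + 1)).boundary S := by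
      rw [hp, mem_boundary_iff hz, boundaryIncl_zero]
    rw [h.volumeElement_mul_tangentComp hmin hbd hz hp, ← hψ p hpb, boundaryElement, ← hp,
      hV, reading_smul (mem_chart_source _ _), PiLp.smul_apply, smul_eq_mul, mul_div_assoc]
  -- `ψ` is given as a bare function. The quotient of the conormal flux by the boundary element is
  -- continuous in the chart and equals the weight times `ψ` on the boundary, so summing over charts
  -- gives a continuous `u` that represents `ψ` for the boundary measure.
  set w : S → Coord (k + 1) → ℝ := fun x y => volumeElement g f x y *
    tangentComp (k + 1) g f x (V x) 0 ((extChartAt (𝓡∂ (k + 1)) x).symm y) / boundaryElement g f x y with hw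
  have hqc : ∀ x, Continuous ((chartAt (EuclideanHalfSpace (k + 1)) x).source.indicator
      fun p => w x (extChartAt (𝓡∂ (k + 1)) x p)) := fun x =>
    continuous_indicator_source (v := w x)
      (((h.contDiffOn_volumeElement x).continuousOn.mul (h.contDiffOn_tangentComp (hVs x) x 0).continuousOn).div
        (continuousOn_boundaryElement h.smooth x) fun y hy => (boundaryElement_pos h.immersion hy).ne')
      (hCc x) (hCx x) fun y _ hy => by simp only [hw, hcomp0 x _ (hV0 x _ hy), mul_zero, zero_div]
  set u : S → ℝ := fun p => ∑ x ∈ s, (chartAt (EuclideanHalfSpace (k + 1)) x).source.indicator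
      (fun p => w x (extChartAt (𝓡∂ (k + 1)) x p)) p with hu
  have huc : Continuous u := continuous_finsetSum s fun x _ => hqc x
  have hu0 : ∀ p ∉ K, u p = 0 := fun p hp => Finset.sum_eq_zero fun x _ =>
    indicator_apply_eq_zero.2 fun hpx => by
      simp only [hw, extChartAt_symm_extChartAt hpx, hcomp0 x _ (hVK x p hp), mul_zero, zero_div]
  have huψ : ∀ p ∈ (𝓡∂ (k + 1)).boundary S, u p = ψ p := fun p hp => by
    have h1 : u p = ∑ x ∈ s, chartPartition k S x p * ψ p := Finset.sum_congr rfl fun x _ => by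
      by_cases hpx : p ∈ (chartAt (EuclideanHalfSpace (k + 1)) x).source
      · obtain ⟨z, hz⟩ := exists_boundaryIncl_eq hp hpx
        have hzT : boundaryIncl k z ∈ (extChartAt (𝓡∂ (k + 1)) x).target := hz ▸ extChartAt_mem_target hpx
        have hzp : (extChartAt (𝓡∂ (k + 1)) x).symm (boundaryIncl k z) = p := by
          rw [hz, extChartAt_symm_extChartAt hpx]
        rw [indicator_of_mem hpx, ← hz]
        simp only [hw]
        rw [hzp, hkey x z p hzT hzp.symm, mul_div_cancel_left₀ _ (boundaryElement_pos h.immersion hzT).ne']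
      · rw [indicator_of_notMem hpx, image_eq_zero_of_notMem_tsupport fun h =>
          hpx (chartPartition_subordinate x h), zero_mul]
    rw [h1, ← Finset.sum_mul]
    by_cases hpK : p ∈ K
    · rw [hs1 p hpK, one_mul]
    · rw [hψ0 p hpK, mul_zero]
  have hae : u =ᵐ[boundaryVolume k g f] ψ := ae_boundaryVolume huψ
  obtain ⟨h1, h2⟩ := integral_boundaryVolume (g := g) h.smooth huc hK hu0 hs
  refine ⟨hint, h1.congr hae, ?_⟩
  rw [hdiv, ← integral_congr_ae hae, h2]
  refine congrArg Neg.neg (Finset.sum_congr rfl fun x _ =>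
    setIntegral_congr_fun (measurableSet_boundaryTarget x) fun z hz => ?_)
  rw [hkey x z _ hz rfl, huψ _ (by rw [mem_boundary_iff hz, boundaryIncl_zero])]

/-- The second variation of volume for a normal variation through surfaces with boundary on the
boundary of the ambient manifold. -/
theorem IsHypersurface.hasSecondDerivAtZero_normal (h : IsHypersurface g f ν)
    (hmin : IsFreeBoundaryMinimal k g f)
    (hbd : ∀ p ∈ (𝓡∂ (k + 1)).boundary S, f p ∈ (𝓡∂ (k + 2)).boundary M)
    (hF : IsVariation (k + 2) k f F (Ioo (-ε) ε) K) (hε : 0 < ε)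
    (hFb : KeepsBoundary (k + 2) k F (Ioo (-ε) ε))
    (hX : ∀ p, variationField (k + 2) f F p = φ p • ν p) :
    Integrable (fun p => gradNormSq (k + 1) g f φ p
      - (ricci g (f p) (ν p) (ν p) + secondFormNormSq (k + 1) g f ν p) * φ p ^ 2) (inducedVolume k g f) ∧
    Integrable (fun p => φ p ^ 2 * boundaryForm g (f p) (ν p) (ν p)) (boundaryVolume k g f) ∧
    HasSecondDerivAtZero (volumeFunction k g F K)
      ((∫ p, (gradNormSq (k + 1) g f φ p
        - (ricci g (f p) (ν p) (ν p) + secondFormNormSq (k + 1) g f ν p) * φ p ^ 2) ∂(inducedVolume k g f))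
      - ∫ p, φ p ^ 2 * boundaryForm g (f p) (ν p) (ν p) ∂(boundaryVolume k g f)) := by
  have hoff : ∀ p ∉ K, variationField (k + 2) f F p = 0 ∧ variationAcceleration g f F p = 0 := fun p hp =>
    variation_eq_zero hF.smooth hε hF.zero fun t ht => hF.eq_off t ht p hp
  -- Off `K` the field `φν` vanishes while `ν` has length one.
  have hφ0 : ∀ p ∉ K, φ p = 0 := fun p hp => by
    have h1 := h.unit p
    have h2 : φ p • ν p = 0 := (hX p).symm.trans (hoff p hp).1
    refine (smul_eq_zero.1 h2).resolve_right fun h3 => ?_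
    rw [h3, map_zero] at h1
    exact zero_ne_one h1
  obtain ⟨h1, h2, h3⟩ := h.integral_divAlong_eq_neg_boundary hmin hbd
    (smoothField_variationAcceleration (g := g) hF.smooth hε hF.zero) hF.isCompact
    (fun p hp => (hoff p hp).2)
    (fun p hp => variationAcceleration_boundary hF.smooth hε hF.zero hFb hX hp)
    fun p hp => by rw [hφ0 p hp]; ring
  obtain ⟨h4, h5⟩ := h.hasSecondDerivAtZero (fun x y hy => h.divAlong_normal_eq_zero hmin hbd x hy) hF hε
  -- For a normal field the density and the integrand of (b) differ by `div Ẑ`, whose integral is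
  -- the boundary term with `ψ = φ² A(ν, ν)`.
  have hae : (fun p => secondVariationDensity (k + 1) g f ν (variationField (k + 2) f F)
      (variationAcceleration g f F) p
      - divAlong (k + 1) g f (tangentialField g f (variationAcceleration g f F)) p)
      =ᵐ[inducedVolume k g f] fun p => gradNormSq (k + 1) g f φ p
        - (ricci g (f p) (ν p) (ν p) + secondFormNormSq (k + 1) g f ν p) * φ p ^ 2 :=
    ae_of_interior fun p hp => by
      simp only [h.secondVariationDensity_normal hX hp, add_sub_cancel_right]
  refine ⟨(h4.sub h1).congr hae, h2, ?_⟩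
  rw [← integral_congr_ae hae, integral_sub h4 h1, h3, sub_neg_eq_add, add_sub_cancel_right]
  exact h5

end BoundaryTerm

end FreeBoundary

theorem mainTheorem3 (k : ℕ)
    {M : Type*} [TopologicalSpace M] [T2Space M]
    [ChartedSpace (EuclideanHalfSpace (k + 2)) M] [IsManifold (𝓡∂ (k + 2)) ∞ M]
    (g : FreeBoundary.RMetric (k + 2) M)
    {S : Type*} [TopologicalSpace S] [T2Space S] [SigmaCompactSpace S]
    [ChartedSpace (EuclideanHalfSpace (k + 1)) S] [IsManifold (𝓡∂ (k + 1)) ∞ S]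
    [MeasurableSpace S] [BorelSpace S]
    -- an immersed hypersurface with boundary on the boundary of `M`
    (f : S → M) (hf : ContMDiff (𝓡∂ (k + 1)) (𝓡∂ (k + 2)) ∞ f)
    (himm : ∀ p, Function.Injective (mfderiv (𝓡∂ (k + 1)) (𝓡∂ (k + 2)) f p))
    (hbd : ∀ p ∈ (𝓡∂ (k + 1)).boundary S, f p ∈ (𝓡∂ (k + 2)).boundary M)
    -- with a smooth unit normal field
    (ν : ∀ p, TangentSpace (𝓡∂ (k + 2)) (f p))
    (hν : ContMDiff (𝓡∂ (k + 1)) (𝓡∂ (k + 2)).tangent ∞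
      (fun p => (⟨f p, ν p⟩ : TangentBundle (𝓡∂ (k + 2)) M)))
    (hν_unit : ∀ p, g.inner (f p) (ν p) (ν p) = 1)
    (hν_normal : ∀ p (u : TangentSpace (𝓡∂ (k + 1)) p),
      g.inner (f p) (ν p) (mfderiv (𝓡∂ (k + 1)) (𝓡∂ (k + 2)) f p u) = 0)
    (hmin : FreeBoundary.IsFreeBoundaryMinimal k g f)
    -- a variation of the hypersurface
    (ε : ℝ) (hε : 0 < ε) (F : ℝ → S → M) (K : Set S)
    (hF : FreeBoundary.IsVariation (k + 2) k f F (Ioo (-ε) ε) K) :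
    -- the second variation for a variation field tangent to the boundary along the boundary
    ((∀ p ∈ (𝓡∂ (k + 1)).boundary S,
        FreeBoundary.IsTangentToBoundary (FreeBoundary.variationField (k + 2) f F p)) →
      Integrable (FreeBoundary.secondVariationDensity (k + 1) g f ν (FreeBoundary.variationField (k + 2) f F)
          (FreeBoundary.variationAcceleration g f F)) (FreeBoundary.inducedVolume k g f) ∧
      FreeBoundary.HasSecondDerivAtZero (FreeBoundary.volumeFunction k g F K)
        (∫ p, FreeBoundary.secondVariationDensity (k + 1) g f ν (FreeBoundary.variationField (k + 2) f F)
          (FreeBoundary.variationAcceleration g f F) p ∂(FreeBoundary.inducedVolume k g f))) ∧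
    -- the second variation for normal variations through surfaces with boundary on `∂M`
    (FreeBoundary.KeepsBoundary (k + 2) k F (Ioo (-ε) ε) →
      ∀ φ : S → ℝ, (∀ p, FreeBoundary.variationField (k + 2) f F p = φ p • ν p) →
        Integrable (fun p => FreeBoundary.gradNormSq (k + 1) g f φ p
          - (FreeBoundary.ricci g (f p) (ν p) (ν p) + FreeBoundary.secondFormNormSq (k + 1) g f ν p)
            * φ p ^ 2) (FreeBoundary.inducedVolume k g f) ∧
        Integrable (fun p => φ p ^ 2 * FreeBoundary.boundaryForm g (f p) (ν p) (ν p))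
          (FreeBoundary.boundaryVolume k g f) ∧
        FreeBoundary.HasSecondDerivAtZero (FreeBoundary.volumeFunction k g F K)
          ((∫ p, (FreeBoundary.gradNormSq (k + 1) g f φ p
            - (FreeBoundary.ricci g (f p) (ν p) (ν p) + FreeBoundary.secondFormNormSq (k + 1) g f ν p)
              * φ p ^ 2) ∂(FreeBoundary.inducedVolume k g f))
          - ∫ p, φ p ^ 2 * FreeBoundary.boundaryForm g (f p) (ν p) (ν p)
              ∂(FreeBoundary.boundaryVolume k g f))) := by
  have h : FreeBoundary.IsHypersurface g f ν := ⟨hf, himm, hν, hν_unit, hν_normal⟩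
  exact ⟨fun _ => h.hasSecondDerivAtZero
      (fun x _ hy => h.divAlong_normal_eq_zero hmin hbd x hy) hF hε,
    fun hFb _ hX => h.hasSecondDerivAtZero_normal hmin hbd hF hε hFb hX⟩
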